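/- Let $N\ge 2$, let $\Omega\subset\mathbb R^N$ be a bounded open set, and let $1<p_1\le p_2\le\dots\le p_N$ be real exponents whose harmonic mean $p:=N/\sum_{j=1}^N\frac1{p_j}$ satisfies $p<N$. Put $p^*:=\frac{Np}{N-p}$, and $q':=\frac{q}{q-1}$ for $q>1$. Let $W_0^{1,\vec p}(\Omega)$ be the closure of $C_c^\infty(\Omega)$ with respect to the norm $\|u\|_{W_0^{1,\vec p}(\Omega)}=\sum_{j=1}^N\|\partial_ju\|_{L^{p_j}(\Omega)}$, and let $W^{-1,\vec p'}(\Omega)$ be its dual, with duality bracket $\langle\cdot,\cdot\rangle$. Let $A_1,\dots,A_N,\Phi:\Omega\times\mathbb R\times\mathbb R^N\to\mathbb R$ be Carathéodory functions, i.e. measurable in $x$ for every $(t,\xi)$ and continuous in $(t,\xi)$ for a.e. $x$. Suppose that there are constants $\nu_0,\nu,\tau,\gamma>0$, nonnegative functions $\eta_j\in L^{p_j'}(\Omega)$ ($1\le j\le N$) and $c\in L^1(\Omega)$, and a continuous nondecreasing function $\zeta:\mathbb R\to[0,\infty)$, such that for a.e. $x\in\Omega$, all $t\in\mathbb R$ and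 all $\xi,\hat\xi\in\mathbb R^N$: * $\sum_{j=1}^N A_j(x,t,\xi)\,\xi_j\ge\nu_0\sum_{j=1}^N|\xi_j|^{p_j}$; * $\sum_{j=1}^N\big(A_j(x,t,\xi)-A_j(x,t,\hat\xi)\big)(\xi_j-\hat\xi_j)>0$ if $\xi\ne\hat\xi$; * $\Phi(x,t,\xi)\,t\ge0$; * $|A_j(x,t,\xi)|\le\nu\Big[\eta_j(x)+|t|^{p^*/p_j'}+\big(\sum_{\ell=1}^N|\xi_\ell|^{p_\ell}\big)^{1/p_j'}\Big]$ for $1\le j\le N$; * $|\Phi(x,t,\xi)|\le\zeta(|t|)\big(\sum_{j=1}^N|\xi_j|^{p_j}+c(x)\big)$; * $|\Phi(x,t,\xi)|\ge\gamma\sum_{j=1}^N|\xi_j|^{p_j}$ whenever $|t|\ge\tau$. Let $\mathfrak B:W_0^{1,\vec p}(\Omega)\to W^{-1,\vec p'}(\Omega)$ be a (not necessarily linear) operator such that * $(P_1)$ there are constants $\mathfrak C>0$, $\mathfrak s\in[1,p^*)$, $\mathfrak a_0\ge0$ and $\mathfrak b$, with $\mathfrak b\in(0,p_1-1)$ if $\mathfrak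 a_0>0$ and $\mathfrak b\in(0,p_1/p')$ if $\mathfrak a_0=0$, such that for all $u,v\in W_0^{1,\vec p}(\Omega)$ $$|\langle\mathfrak Bu,v\rangle|\le\mathfrak C\big(1+\|u\|_{W_0^{1,\vec p}(\Omega)}^{\mathfrak b}\big)\big(\mathfrak a_0\|v\|_{W_0^{1,\vec p}(\Omega)}+\|v\|_{L^{\mathfrak s}(\Omega)}\big);$$ * $(P_2)$ if $u_\ell\rightharpoonup u$ and $v_\ell\rightharpoonup v$ weakly in $W_0^{1,\vec p}(\Omega)$, then $\langle\mathfrak Bu_\ell,v_\ell\rangle\to\langle\mathfrak Bu,v\rangle$. Then for every $f\in L^1(\Omega)$ there exists $u\in W_0^{1,\vec p}(\Omega)$ with $\Phi(x,u,\nabla u)\in L^1(\Omega)$ which is a weak solution of $-\sum_{j=1}^N\partial_j\big(A_j(x,u,\nabla u)\big)-\mathfrak Bu+\Phi(x,u,\nabla u)=f$, that is, for every $v\in W_0^{1,\vec p}(\Omega)\cap L^\infty(\Omega)$, $$\sum_{j=1}^N\int_\Omega A_j(x,u,\nabla u)\,\partial_jv\,dx+\int_\Omega\Phi(x,u,\nabla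 u)\,v\,dx=\langle\mathfrak Bu,v\rangle+\int_\Omega f\,v\,dx,$$ all integrals being absolutely convergent. -/

import Mathlib

open MeasureTheory Filter Topology
open scoped ENNReal ContDiff

noncomputable section

namespace AnisoElliptic

/-- The ambient Euclidean space `ℝ^N` (the space variable `x`). -/
abbrev Eu (N : ℕ) : Type := EuclideanSpace ℝ (Fin N)

/-- Lebesgue measure on `Ω`. -/
abbrev leb {N : ℕ} (Ω : Set (Eu N)) : Measure (Eu N) := volume.restrict Ω

/-- The classical partial derivative `∂_j φ`. -/
def pderiv {N : ℕ} (j : Fin N) (φ : Eu N → ℝ) (x : Eu N) : ℝ :=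
  fderiv ℝ φ x (EuclideanSpace.single j 1)

/-- `φ ∈ C_c^∞(Ω)`, as a function on `ℝ^N` vanishing outside `Ω`. -/
structure IsTest {N : ℕ} (Ω : Set (Eu N)) (φ : Eu N → ℝ) : Prop where
  smooth : ContDiff ℝ ∞ φ
  compact : HasCompactSupport φ
  supp : tsupport φ ⊆ Ω

instance factOneLe {N : ℕ} (p : Fin N → ℝ) [hp : Fact (∀ j, 1 < p j)] (j : Fin N) :
    Fact (1 ≤ ENNReal.ofReal (p j)) :=
  ⟨by simpa using (hp.out j).le⟩

/-- The space `L^1(Ω) × ∏_j L^{p_j}(Ω)` of candidates for the pairs `(u, ∇u)`. -/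
abbrev Pairs {N : ℕ} (Ω : Set (Eu N)) (p : Fin N → ℝ) : Type :=
  Lp ℝ 1 (leb Ω) × (∀ j : Fin N, Lp ℝ (ENNReal.ofReal (p j)) (leb Ω))

section Space

variable {N : ℕ} (Ω : Set (Eu N)) (p : Fin N → ℝ)

lemma pderiv_add (j : Fin N) {φ ψ : Eu N → ℝ} (hφ : ContDiff ℝ ∞ φ) (hψ : ContDiff ℝ ∞ ψ)
    (x : Eu N) : pderiv j (φ + ψ) x = pderiv j φ x + pderiv j ψ x := by
  unfold pderiv
  rw [fderiv_add (hφ.differentiable (by simp) x) (hψ.differentiable (by simp) x)]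
  rfl

lemma pderiv_smul (j : Fin N) (c : ℝ) {φ : Eu N → ℝ} (hφ : ContDiff ℝ ∞ φ)
    (x : Eu N) : pderiv j (c • φ) x = c * pderiv j φ x := by
  unfold pderiv
  rw [fderiv_const_smul (hφ.differentiable (by simp) x)]
  rfl

/-- The pairs `(φ, ∇φ)` with `φ ∈ C_c^∞(Ω)`. -/
def testPairs [Fact (∀ j, 1 < p j)] : Submodule ℝ (Pairs Ω p) where
  carrier := {w | ∃ φ : Eu N → ℝ, IsTest Ω φ ∧ w.1 =ᵐ[leb Ω] φ ∧
    ∀ j, w.2 j =ᵐ[leb Ω] pderiv j φ}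
  zero_mem' := by
    refine ⟨0, ⟨contDiff_const, HasCompactSupport.zero, by simp [tsupport]⟩,
      Lp.coeFn_zero _ _ _, fun j => ?_⟩
    have h0 : pderiv j (0 : Eu N → ℝ) = 0 := by
      funext x
      simp [pderiv]
    rw [h0]
    exact Lp.coeFn_zero _ _ _
  add_mem' := by
    rintro v w ⟨φ, hφ, h1, h2⟩ ⟨ψ, hψ, k1, k2⟩
    refine ⟨φ + ψ, ⟨hφ.smooth.add hψ.smooth, hφ.compact.add hψ.compact,
      (tsupport_add φ ψ).trans (Set.union_subset hφ.supp hψ.supp)⟩, ?_, fun j => ?_⟩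
    · filter_upwards [Lp.coeFn_add v.1 w.1, h1, k1] with x hx hx1 hx2
      exact hx.trans (congrArg₂ (· + ·) hx1 hx2)
    · filter_upwards [Lp.coeFn_add (v.2 j) (w.2 j), h2 j, k2 j] with x hx hx1 hx2
      rw [pderiv_add j hφ.smooth hψ.smooth]
      exact hx.trans (congrArg₂ (· + ·) hx1 hx2)
  smul_mem' := by
    rintro c w ⟨φ, hφ, h1, h2⟩
    refine ⟨c • φ, ⟨contDiff_const.smul hφ.smooth, hφ.compact.smul_left (f := fun _ => c),
      (closure_mono (Function.support_const_smul_subset c φ)).trans hφ.supp⟩, ?_, fun j => ?_⟩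
    · filter_upwards [Lp.coeFn_smul c w.1, h1] with x hx hx1
      simp [Prod.smul_fst, hx, hx1]
    · filter_upwards [Lp.coeFn_smul c (w.2 j), h2 j] with x hx hx1
      simp [Prod.smul_snd, hx, hx1, pderiv_smul j c hφ.smooth]

/-- The closure of the pairs `(φ, ∇φ)`, `φ ∈ C_c^∞(Ω)`, in `L^1(Ω) × ∏_j L^{p_j}(Ω)`. -/
def closedPairs [Fact (∀ j, 1 < p j)] : Submodule ℝ (Pairs Ω p) :=
  (testPairs Ω p).topologicalClosure

/-- The anisotropic Sobolev space `W_0^{1,p}(Ω)`: the closure of `C_c^∞(Ω)` with respect to the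
norm `∑_j ‖∂_j u‖_{L^{p_j}(Ω)}`. An element is a function `u` together with its weak
gradient. When `Ω` is bounded, the Poincaré inequality `‖φ‖_{L^1} ≤ C ∑_j ‖∂_j φ‖_{L^{p_j}}` shows
that taking the closure for this norm, or for it plus the `L^1` norm, gives the same space. -/
def W0 [Fact (∀ j, 1 < p j)] : Type := ↥(closedPairs Ω p)

end Space

namespace W0

variable {N : ℕ} {Ω : Set (Eu N)} {p : Fin N → ℝ} [hp : Fact (∀ j, 1 < p j)]

instance : AddCommGroup (W0 Ω p) := inferInstanceAs (AddCommGroup ↥(closedPairs Ω p))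

instance : Module ℝ (W0 Ω p) := inferInstanceAs (Module ℝ ↥(closedPairs Ω p))

/-- The function `u ∈ L^1(Ω)`. -/
def fn (u : W0 Ω p) : Lp ℝ 1 (leb Ω) := (Subtype.val (p := (· ∈ closedPairs Ω p)) u).1

/-- The weak partial derivative `∂_j u ∈ L^{p_j}(Ω)`. -/
def der (u : W0 Ω p) (j : Fin N) : Lp ℝ (ENNReal.ofReal (p j)) (leb Ω) :=
  (Subtype.val (p := (· ∈ closedPairs Ω p)) u).2 j

/-- The weak gradient `∇u(x) = (∂_1 u(x), …, ∂_N u(x))`. -/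
def grad (u : W0 Ω p) (x : Eu N) : Fin N → ℝ := fun j => u.der j x

/-- Integration by parts characterizes the weak gradient of an element of `W_0^{1,p}(Ω)`. -/
lemma weak_der (u : W0 Ω p) (j : Fin N) {ψ : Eu N → ℝ} (hψ : ContDiff ℝ ∞ ψ)
    (hc : HasCompactSupport ψ) :
    ∫ x, u.fn x * pderiv j ψ x ∂(leb Ω) = - ∫ x, u.der j x * ψ x ∂(leb Ω) := by
  have hdψ : Continuous (pderiv j ψ) :=
    (hψ.continuous_fderiv (by simp)).clm_apply continuous_const
  have hdc : HasCompactSupport (pderiv j ψ) := hc.fderiv_apply (𝕜 := ℝ) _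
  have hq : (p j).HolderConjugate (p j).conjExponent := Real.HolderConjugate.conjExponent (hp.out j)
  have : ENNReal.HolderConjugate (ENNReal.ofReal (p j)) (ENNReal.ofReal (p j).conjExponent) :=
    hq.ennrealOfReal
  have : Fact (1 ≤ ENNReal.ofReal (p j).conjExponent) := ⟨by simpa using hq.symm.lt.le⟩
  have m1 : MemLp (pderiv j ψ) ∞ (leb Ω) := (hdψ.memLp_of_hasCompactSupport hdc).restrict Ω
  have m2 : MemLp ψ (ENNReal.ofReal (p j).conjExponent) (leb Ω) :=
    (hψ.continuous.memLp_of_hasCompactSupport hc).restrict Ω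
  let L : Pairs Ω p → ℝ := fun w =>
    (ContinuousLinearMap.mul ℝ ℝ).lpPairing (leb Ω) 1 ∞ w.1 (m1.toLp _) +
    (ContinuousLinearMap.mul ℝ ℝ).lpPairing (leb Ω) (ENNReal.ofReal (p j))
      (ENNReal.ofReal (p j).conjExponent) (w.2 j) (m2.toLp _)
  have hL : Continuous L := by fun_prop
  have hLeq : ∀ w, L w = ∫ x, w.1 x * pderiv j ψ x ∂(leb Ω) + ∫ x, w.2 j x * ψ x ∂(leb Ω) := by
    intro w
    simp only [L, ContinuousLinearMap.lpPairing_eq_integral]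
    congr 1
    · refine integral_congr_ae ?_
      filter_upwards [m1.coeFn_toLp] with x hx
      simp [hx]
    · refine integral_congr_ae ?_
      filter_upwards [m2.coeFn_toLp] with x hx
      simp [hx]
  have hsub : (closure (testPairs Ω p : Set (Pairs Ω p))) ⊆ {w | L w = 0} := by
    refine closure_minimal ?_ (isClosed_eq hL continuous_const)
    rintro w ⟨φ, hφ, h1, h2⟩
    have hφd : Continuous (pderiv j φ) :=
      (hφ.smooth.continuous_fderiv (by simp)).clm_apply continuous_const
    have e1 : ∫ x, w.1 x * pderiv j ψ x ∂(leb Ω) = ∫ x, φ x * pderiv j ψ x := by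
      refine (integral_congr_ae (h1.mul (ae_eq_refl (pderiv j ψ)))).trans ?_
      refine setIntegral_eq_integral_of_forall_compl_eq_zero fun x hx => ?_
      simp [image_eq_zero_of_notMem_tsupport fun h => hx (hφ.supp h)]
    have e2 : ∫ x, w.2 j x * ψ x ∂(leb Ω) = ∫ x, pderiv j φ x * ψ x := by
      refine (integral_congr_ae ((h2 j).mul (ae_eq_refl ψ))).trans ?_
      refine setIntegral_eq_integral_of_forall_compl_eq_zero fun x hx => ?_
      have : x ∉ tsupport (fderiv ℝ φ) := fun h => hx (hφ.supp (tsupport_fderiv_subset ℝ h))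
      simp [pderiv, image_eq_zero_of_notMem_tsupport this]
    have key := integral_mul_fderiv_eq_neg_fderiv_mul_of_integrable (μ := (volume : Measure (Eu N)))
      (f := φ) (g := ψ) (v := EuclideanSpace.single j (1 : ℝ))
      ((hφd.mul hψ.continuous).integrable_of_hasCompactSupport (hc.mul_left))
      ((hφ.smooth.continuous.mul hdψ).integrable_of_hasCompactSupport (hdc.mul_left))
      ((hφ.smooth.continuous.mul hψ.continuous).integrable_of_hasCompactSupport (hc.mul_left))
      (fun x _ => hφ.smooth.differentiable (by simp) x) (fun x _ => hψ.differentiable (by simp) x)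
    show L w = 0
    rw [hLeq, e1, e2]
    simp only [pderiv] at key ⊢
    linarith
  have := hsub u.2
  have h := (hLeq _).symm.trans this
  exact eq_neg_of_add_eq_zero_left h

/-- A function of `W_0^{1,p}(Ω)` with zero gradient vanishes. -/
lemma eq_zero_of_der [NeZero N] (u : W0 Ω p) (h : ∀ j, u.der j = 0) : u = 0 := by
  let j : Fin N := 0
  let e : Eu N := EuclideanSpace.single j (1 : ℝ)
  have he : ‖e‖ = 1 := by simp [e]
  have hui : Integrable u.fn (leb Ω) := L1.integrable_coeFn u.fn
  have h0 : ∀ ψ : Eu N → ℝ, ContDiff ℝ ∞ ψ → HasCompactSupport ψ →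
      ∫ x, u.fn x * pderiv j ψ x ∂(leb Ω) = 0 := by
    intro ψ hψ hc
    rw [weak_der u j hψ hc, h j, neg_eq_zero]
    refine (integral_congr_ae (g := fun _ => 0) ?_).trans (by simp)
    filter_upwards [Lp.coeFn_zero ℝ (ENNReal.ofReal (p j)) (leb Ω)] with x hx
    exact (congrArg (· * ψ x) hx).trans (zero_mul _)
  have hz : u.fn = 0 := by
    refine Lp.eq_zero_iff_ae_eq_zero.2 ?_
    refine ae_eq_zero_of_integral_contDiff_smul_eq_zero hui.locallyIntegrable ?_
    intro ψ hψ hc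
    have hdψ : Continuous (pderiv j ψ) :=
      (hψ.continuous_fderiv (by simp)).clm_apply continuous_const
    have hdc : HasCompactSupport (pderiv j ψ) := hc.fderiv_apply (𝕜 := ℝ) _
    obtain ⟨C, hC⟩ := hψ.continuous.bounded_above_of_compact_support hc
    obtain ⟨D, hD⟩ := hdψ.bounded_above_of_compact_support hdc
    let F : ℝ → ℝ := fun s => ∫ x, u.fn x * ψ (x + s • e) ∂(leb Ω)
    have hcont : ∀ s : ℝ, Continuous fun x : Eu N => ψ (x + s • e) := fun s =>
      hψ.continuous.comp (by fun_prop)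
    have hF : ∀ s, HasDerivAt F 0 s := by
      intro s
      have hd := (hasDerivAt_integral_of_dominated_loc_of_deriv_le (μ := leb Ω)
        (F := fun s x => u.fn x * ψ (x + s • e))
        (F' := fun s x => u.fn x * pderiv j ψ (x + s • e)) (x₀ := s) (s := Set.univ)
        (bound := fun x => ‖u.fn x‖ * D) univ_mem
        (Eventually.of_forall fun s =>
          hui.aestronglyMeasurable.mul (hcont s).aestronglyMeasurable)
        (hui.mul_bdd (hcont s).aestronglyMeasurable (Eventually.of_forall fun x => hC _))
        (hui.aestronglyMeasurable.mul
          (hdψ.comp (by fun_prop : Continuous fun x : Eu N => x + s • e)).aestronglyMeasurable)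
        (Eventually.of_forall fun x s _ => by
          rw [norm_mul]
          exact mul_le_mul_of_nonneg_left (hD _) (norm_nonneg _))
        (hui.norm.mul_const D)
        (Eventually.of_forall fun x s _ => by
          have h1 : HasDerivAt (fun s : ℝ => x + s • e) e s := by
            simpa using ((hasDerivAt_id s).smul_const e).const_add x
          exact ((hψ.differentiable (by simp) _).hasFDerivAt.comp_hasDerivAt s h1).const_mul _)).2
      have hs := h0 (fun x => ψ (x + s • e)) (hψ.comp (by fun_prop))
        (hc.comp_homeomorph (Homeomorph.addRight (s • e)))
      have hs2 : ∀ x, pderiv j (fun x => ψ (x + s • e)) x = pderiv j ψ (x + s • e) := by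
        intro x
        simp [pderiv, fderiv_comp_add_right]
      simp only [hs2] at hs
      rw [hs] at hd
      exact hd
    have hconst : ∀ s, F s = F 0 := fun s =>
      is_const_of_deriv_eq_zero (fun s => (hF s).differentiableAt) (fun s => (hF s).deriv) s 0
    have hlim : Tendsto F atTop (𝓝 (∫ _x, (0 : ℝ) ∂(leb Ω))) := by
      refine tendsto_integral_filter_of_dominated_convergence (fun x => ‖u.fn x‖ * C)
        (Eventually.of_forall fun s =>
          hui.aestronglyMeasurable.mul (hcont s).aestronglyMeasurable)
        (Eventually.of_forall fun s => Eventually.of_forall fun x => by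
          rw [norm_mul]
          exact mul_le_mul_of_nonneg_left (hC _) (norm_nonneg _))
        (hui.norm.mul_const C) (Eventually.of_forall fun x => ?_)
      obtain ⟨R, hR⟩ := hc.isCompact.isBounded.exists_norm_le
      refine tendsto_const_nhds.congr' ?_
      filter_upwards [eventually_gt_atTop (R + ‖x‖), eventually_ge_atTop 0] with s hs hs0
      have : x + s • e ∉ tsupport ψ := by
        intro hx
        have h1 := hR _ hx
        have h2 : ‖s • e‖ = s := by rw [norm_smul, he, mul_one, Real.norm_of_nonneg hs0]
        have h3 : ‖s • e‖ ≤ ‖x + s • e‖ + ‖x‖ := by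
          simpa using norm_sub_le (x + s • e) x
        linarith
      rw [image_eq_zero_of_notMem_tsupport this, mul_zero]
    have hF0 : F 0 = 0 := by
      have h1 : Tendsto F atTop (𝓝 (F 0)) :=
        tendsto_const_nhds.congr fun s => (hconst s).symm
      simpa using tendsto_nhds_unique h1 hlim
    simpa [F, mul_comm] using hF0
  exact Subtype.ext (Prod.ext hz (funext h))

/-- The norm `‖u‖ = ∑_j ‖∂_j u‖_{L^{p_j}(Ω)}`. -/
instance : Norm (W0 Ω p) := ⟨fun u => ∑ j, ‖u.der j‖⟩

lemma norm_def (u : W0 Ω p) : ‖u‖ = ∑ j, ‖u.der j‖ := rfl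

lemma normCore [NeZero N] : NormedSpace.Core ℝ (W0 Ω p) where
  norm_nonneg u := Finset.sum_nonneg fun j _ => norm_nonneg (u.der j)
  norm_smul c u := by
    simp only [norm_def, Finset.mul_sum]
    exact Finset.sum_congr rfl fun j _ => norm_smul c (u.der j)
  norm_triangle u v := by
    simp only [norm_def, ← Finset.sum_add_distrib]
    exact Finset.sum_le_sum fun j _ => norm_add_le (u.der j) (v.der j)
  norm_eq_zero_iff u := by
    constructor
    · intro hu
      refine eq_zero_of_der u fun j => norm_eq_zero.1 ?_
      exact (Finset.sum_eq_zero_iff_of_nonneg fun j _ => norm_nonneg (u.der j)).1 hu j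
        (Finset.mem_univ j)
    · rintro rfl
      exact Finset.sum_eq_zero fun j _ => norm_zero (E := Lp ℝ (ENNReal.ofReal (p j)) (leb Ω))

instance [NeZero N] : NormedAddCommGroup (W0 Ω p) := NormedAddCommGroup.ofCore normCore

instance [NeZero N] : NormedSpace ℝ (W0 Ω p) := NormedSpace.ofCore normCore

end W0

section Problem

variable {N : ℕ}

/-- The harmonic mean `p = N / ∑_j (1 / p_j)` of the exponents. -/
def hmean (p : Fin N → ℝ) : ℝ := N / ∑ j, 1 / p j

/-- The anisotropic Sobolev exponent `p^* = N p / (N - p)`, for `p` the harmonic mean. -/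
def sobExp (p : Fin N → ℝ) : ℝ := N * hmean p / (N - hmean p)

/-- `F : Ω × ℝ × ℝ^N → ℝ` is a Carathéodory function (only the values at `x ∈ Ω` matter). -/
def IsCaratheodory (Ω : Set (Eu N)) (F : Eu N → ℝ → (Fin N → ℝ) → ℝ) : Prop :=
  (∀ t ξ, AEMeasurable (fun x => F x t ξ) (leb Ω)) ∧
  ∀ᵐ x ∂(leb Ω), Continuous fun z : ℝ × (Fin N → ℝ) => F x z.1 z.2

variable [NeZero N] {Ω : Set (Eu N)} {p : Fin N → ℝ} [Fact (∀ j, 1 < p j)]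

/-- Weak convergence of a sequence in `W_0^{1,p}(Ω)`. -/
def WeakConv (u : ℕ → W0 Ω p) (v : W0 Ω p) : Prop :=
  ∀ F : StrongDual ℝ (W0 Ω p), Tendsto (fun n => F (u n)) atTop (𝓝 (F v))

/-- The growth condition `(P_1)`: there are `C > 0`, `s ∈ [1, p^*)`, `a₀ ≥ 0` and `b`, with
`b ∈ (0, p_1 - 1)` if `a₀ > 0` and `b ∈ (0, p_1 / p')` if `a₀ = 0`, such that
`|⟨B u, v⟩| ≤ C (1 + ‖u‖^b) (a₀ ‖v‖ + ‖v‖_{L^s(Ω)})`. The inequality is written in `[0, ∞]`,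
where `‖v‖_{L^s(Ω)}` takes its values. -/
def CondP1 (B : W0 Ω p → StrongDual ℝ (W0 Ω p)) : Prop :=
  ∃ C s a₀ b : ℝ, 0 < C ∧ 1 ≤ s ∧ s < sobExp p ∧ 0 ≤ a₀ ∧ 0 < b ∧
    (0 < a₀ → b < p 0 - 1) ∧ (a₀ = 0 → b < p 0 / (hmean p).conjExponent) ∧
    ∀ u v : W0 Ω p, ENNReal.ofReal |B u v| ≤
      ENNReal.ofReal (C * (1 + ‖u‖ ^ b)) *
        (ENNReal.ofReal (a₀ * ‖v‖) + eLpNorm v.fn (ENNReal.ofReal s) (leb Ω))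

/-- The continuity condition `(P_2)`: if `u_n ⇀ u` and `v_n ⇀ v` weakly, then
`⟨B u_n, v_n⟩ → ⟨B u, v⟩`. -/
def CondP2 (B : W0 Ω p → StrongDual ℝ (W0 Ω p)) : Prop :=
  ∀ (u v : ℕ → W0 Ω p) (u' v' : W0 Ω p), WeakConv u u' → WeakConv v v' →
    Tendsto (fun n => B (u n) (v n)) atTop (𝓝 (B u' v'))

/-- `u ∈ W_0^{1,p}(Ω)` is a weak solution of `-div A(x,u,∇u) - B u + Φ(x,u,∇u) = f` with
`Φ(x,u,∇u) ∈ L^1(Ω)`: the identity holds for all `v ∈ W_0^{1,p}(Ω) ∩ L^∞(Ω)`, all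
integrals in it being convergent. -/
structure IsWeakSolution (A : Fin N → Eu N → ℝ → (Fin N → ℝ) → ℝ)
    (Φ : Eu N → ℝ → (Fin N → ℝ) → ℝ) (B : W0 Ω p → StrongDual ℝ (W0 Ω p)) (f : Eu N → ℝ)
    (u : W0 Ω p) : Prop where
  integrable_lower : IntegrableOn (fun x => Φ x (u.fn x) (u.grad x)) Ω
  integrable_flux : ∀ (v : W0 Ω p) (j : Fin N), MemLp v.fn ∞ (leb Ω) →
    IntegrableOn (fun x => A j x (u.fn x) (u.grad x) * v.der j x) Ω
  weak_form : ∀ v : W0 Ω p, MemLp v.fn ∞ (leb Ω) →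
    (∑ j, ∫ x in Ω, A j x (u.fn x) (u.grad x) * v.der j x)
        + ∫ x in Ω, Φ x (u.fn x) (u.grad x) * v.fn x
      = B u v + ∫ x in Ω, f x * v.fn x

end Problem

end AnisoElliptic

end

/-! Weak solutions are limits of solutions of regularized problems. With a bounded lower order term
the problem is solved by Galerkin's method (`exists_form_eq_zero`): Brouwer's theorem
(`exists_zero_of_inner_pos`) solves it in each finite-dimensional subspace, and the weak compactness
of the anisotropic Sobolev space provides a limit. Bounding `Φ` by `tame` and truncating `f` reduces
the general problem to this one in two stages.

Each stage needs a bound on the energy `∑_j ∫ |∂_j u|^{p_j}`. By Troisi's anisotropic Sobolev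
inequality (`troisi`), condition `(P_1)` says that `B` contributes a power less than one of the
energy, which coercivity absorbs (`exists_bound_of_condP1`). When `f` is only integrable, `u` is not
an admissible test function, and `arctan u` replaces it: where `|u| < τ` the flux controls the
energy, and where `|u| ≥ τ` the lower bound `|Φ| ≥ γ ∑ |ξ_j|^{p_j}` does. This is how `Φ`
regularizes the problem and keeps `u` in the energy space.

A weak limit can be inserted in nonlinear terms only if gradients converge almost everywhere.
Following Leray and Lions, the equation is tested with a function of `u_n - u'` of height at most `2
r`. The lower order terms, bounded in `L^1`, contribute `O(r)`, so the monotonicity gap between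
`∇u_n` and `∇u'` tends to zero in measure, and strict monotonicity forces `∇u_n → ∇u'` along a
subsequence (`exists_subseq_ae_grad`).

Finally, `Φ(x, u_n, ∇u_n)` grows like the energy density and has no evident compactness in `L^1`.
For `v ≥ 0` the equation is tested with `v E(u_n)`, where `E` decreases so fast that `ζ E ≤ -ν₀ E'`
on the positive axis. The coercivity of the flux then absorbs the growth of `Φ`, the remaining
integrand is bounded above by a fixed integrable function, and the reverse Fatou lemma gives a
one-sided inequality in the limit (`LimitData.defect_nonneg_of_weight`). Choosing `v` so as to
cancel the weight removes `E`; the symmetry `u ↦ -u` of the hypotheses gives the opposite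
inequality, hence the equation. -/

noncomputable section

namespace AnisoElliptic

/-! ### Brouwer's theorem, from the change of variables formula and polynomial dependence on a
parameter -/

section Brouwer

open Polynomial in
/-- If `q(x, ·)` is a polynomial of degree at most `n` and `∫ q(x, t) dx` does not depend on small
`t > 0`, then `t = 1` gives the same value. -/
lemma integral_eq_of_polynomial {X : Type*} [MeasurableSpace X] {μ : Measure X}
    (q : X → ℝ → ℝ) (n : ℕ) (hq : ∀ x, ∃ P : ℝ[X], P.natDegree ≤ n ∧ ∀ t, q x t = P.eval t)
    (hint : ∀ t, Integrable (fun x => q x t) μ) {δ c : ℝ} (hδ : 0 < δ)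
    (hc : ∀ t, 0 < t → t ≤ δ → ∫ x, q x t ∂μ = c) : ∫ x, q x 1 ∂μ = c := by
  -- A polynomial of degree at most `n` is determined by its values at the `n + 1` nodes `δ / (i +
  -- 1)`, all in `(0, δ]`. Lagrange interpolation expresses its value at `1` through them with
  -- coefficients that do not depend on `x`.
  let s : Finset ℕ := Finset.range (n + 1)
  let v : ℕ → ℝ := fun i => δ / (i + 1)
  have hv : Set.InjOn v s := by
    intro i _ j _ hij
    have h1 : (i : ℝ) + 1 ≠ 0 := by positivity
    have h2 : (j : ℝ) + 1 ≠ 0 := by positivity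
    have : δ / ((i : ℝ) + 1) = δ / ((j : ℝ) + 1) := hij
    rw [div_eq_div_iff h1 h2] at this
    have := mul_left_cancel₀ hδ.ne' this
    have : (i : ℝ) = j := by linarith
    exact_mod_cast this
  have hlag : ∀ P : ℝ[X], P.natDegree ≤ n →
      P.eval 1 = ∑ i ∈ s, P.eval (v i) * (Lagrange.basis s v i).eval 1 := by
    intro P hP
    have hd : P.degree < s.card := by
      refine (degree_le_of_natDegree_le hP).trans_lt ?_
      simp only [s, Finset.card_range]
      exact_mod_cast Nat.lt_succ_self n
    conv_lhs => rw [Lagrange.eq_interpolate hv hd]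
    simp [Lagrange.interpolate_apply, eval_finsetSum]
  have h1 : ∀ x, q x 1 = ∑ i ∈ s, q x (v i) * (Lagrange.basis s v i).eval 1 := by
    intro x
    obtain ⟨P, hP, he⟩ := hq x
    simp only [he]
    exact hlag P hP
  -- The constant polynomial `c` obeys the same interpolation formula, so constant node values give
  -- back `c`.
  have h2 := hlag (C c) (by simp)
  simp only [eval_C] at h2
  simp only [h1]
  rw [integral_finsetSum _ fun i _ => (hint _).mul_const _]
  rw [h2]
  refine Finset.sum_congr rfl fun i _ => ?_
  rw [integral_mul_const, hc]
  · positivity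
  · exact div_le_self hδ.le (by linarith [(Nat.cast_nonneg i : (0 : ℝ) ≤ i)])

variable {d : ℕ}

/-- A perturbation of the identity by a contraction supported in `B` maps `B` bijectively onto
itself. -/
lemma image_add_eq_of_lipschitz {E : Type*} [NormedAddCommGroup E] [CompleteSpace E]
    {g : E → E} {K : NNReal} (hK : K < 1) (hg : LipschitzWith K g) {s : Set E}
    (hs : ∀ x ∉ s, g x = 0) :
    Function.Injective (fun x => x + g x) ∧ (fun x => x + g x) '' s = s := by
  have hinj : Function.Injective (fun x => x + g x) := by
    intro x y hxy
    have h1 : x - y = g y - g x := by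
      have : x + g x = y + g y := hxy
      rw [sub_eq_sub_iff_add_eq_add, this, add_comm]
    have h2 : ‖x - y‖ ≤ K * ‖x - y‖ := by
      conv_lhs => rw [h1]
      simpa [norm_sub_rev] using hg.norm_sub_le y x
    have h3 : (K : ℝ) < 1 := by exact_mod_cast hK
    have : ‖x - y‖ = 0 := by nlinarith [norm_nonneg (x - y)]
    exact sub_eq_zero.1 (norm_eq_zero.1 this)
  refine ⟨hinj, Set.Subset.antisymm ?_ ?_⟩
  · rintro _ ⟨x, hx, rfl⟩
    by_contra hz
    -- Points outside `s` are fixed by the map. If the image of `x` were outside, it would be its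
    -- own image, and injectivity would identify it with `x`.
    have h0 : (fun x => x + g x) (x + g x) = x + g x := by simp [hs _ hz]
    have := hinj h0
    exact hz (by simpa [this] using hx)
  · intro y hy
    -- Solving `x + g x = y` amounts to finding a fixed point of the contraction `x ↦ y - g x`. The
    -- solution lies in `s`, since outside `s` it would equal `y`.
    have hc : ContractingWith K (fun x => y - g x) :=
      ⟨hK, LipschitzWith.of_dist_le_mul fun a b => by
        simpa [dist_eq_norm, norm_sub_rev] using hg.norm_sub_le b a⟩
    have hfix := hc.fixedPoint_isFixedPt
    set x := ContractingWith.fixedPoint _ hc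
    have hx : y - g x = x := hfix
    refine ⟨x, ?_, ?_⟩
    · by_contra hxs
      rw [hs x hxs, sub_zero] at hx
      exact hxs (hx ▸ hy)
    · show x + g x = y
      exact (sub_eq_iff_eq_add.1 hx).symm

-- Together with `bump_polynomial`, this bounds by `2 * k + d` the degree in `t` of the integrand in
-- the change of variables formula.
open Polynomial in
lemma det_one_add_smul_polynomial (M : Eu d →L[ℝ] Eu d) :
    ∃ P : ℝ[X], P.natDegree ≤ d ∧ ∀ t : ℝ,
      (ContinuousLinearMap.id ℝ (Eu d) + t • M).det = P.eval t := by
  let b := (EuclideanSpace.basisFun (Fin d) ℝ).toBasis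
  let m := LinearMap.toMatrix b b (M : Eu d →ₗ[ℝ] Eu d)
  refine ⟨(((X : ℝ[X]) • m.map C + (1 : Matrix (Fin d) (Fin d) ℝ).map C)).det, ?_, fun t => ?_⟩
  · simpa using natDegree_det_X_add_C_le m 1
  · have : (ContinuousLinearMap.id ℝ (Eu d) + t • M).det
        = LinearMap.det ((LinearMap.id : Eu d →ₗ[ℝ] Eu d) + t • (M : Eu d →ₗ[ℝ] Eu d)) := rfl
    rw [this, ← LinearMap.det_toMatrix b]
    rw [← Polynomial.coe_evalRingHom, RingHom.map_det]
    congr 1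
    rw [map_add, map_smul, LinearMap.toMatrix_id]
    ext i j
    by_cases hij : i = j
    · simp [m, hij]
      ring
    · simp [m, hij]
      exact mul_comm _ _

open Polynomial in
lemma bump_polynomial (x y : Eu d) (M : ℝ) (k : ℕ) :
    ∃ P : ℝ[X], P.natDegree ≤ 2 * k ∧ ∀ t : ℝ, (1 - ‖x + t • y‖ ^ 2 / M ^ 2) ^ k = P.eval t := by
  refine ⟨(C (1 - ‖x‖ ^ 2 / M ^ 2) - C (2 * inner ℝ x y / M ^ 2) * X
    - C (‖y‖ ^ 2 / M ^ 2) * X ^ 2) ^ k, ?_, fun t => ?_⟩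
  · refine natDegree_pow_le.trans ?_
    rw [mul_comm]
    gcongr
    compute_degree
  · rw [norm_add_sq_real, inner_smul_right, norm_smul, mul_pow, Real.norm_eq_abs, sq_abs]
    simp
    ring

/-- The change of variables formula for `x ↦ x + g x`, with `g` supported in the ball. -/
lemma integral_comp_add_mul_det {g : Eu d → Eu d} (hg : ContDiff ℝ 1 g)
    {L : ℝ} (hsupp : ∀ x ∉ Metric.closedBall (0 : Eu d) L, g x = 0) (M : ℝ) (k : ℕ) :
    ∫ x in Metric.closedBall (0 : Eu d) L, (1 - ‖x + (1 : ℝ) • g x‖ ^ 2 / M ^ 2) ^ k *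
      (ContinuousLinearMap.id ℝ (Eu d) + (1 : ℝ) • fderiv ℝ g x).det =
    ∫ x in Metric.closedBall (0 : Eu d) L, (1 - ‖x‖ ^ 2 / M ^ 2) ^ k := by
  set B := Metric.closedBall (0 : Eu d) L with hB
  have hBc : IsCompact B := isCompact_closedBall _ _
  have hgc : HasCompactSupport g := HasCompactSupport.intro hBc hsupp
  obtain ⟨D, hD⟩ := (hg.continuous_fderiv (by simp)).bounded_above_of_compact_support
    (hgc.fderiv ℝ)
  have hD0 : 0 ≤ D := (norm_nonneg _).trans (hD 0)
  have hfd : ∀ x, HasFDerivAt g (fderiv ℝ g x) x := fun x =>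
    (hg.differentiable (by simp) x).hasFDerivAt
  have hlip : LipschitzWith D.toNNReal g :=
    lipschitzWith_of_nnnorm_fderiv_le (hg.differentiable (by simp)) fun x => by
      rw [← NNReal.coe_le_coe, Real.coe_toNNReal _ hD0]; exact hD x
  obtain ⟨r, hr, hdet⟩ : ∃ r > 0, ∀ M : Eu d →L[ℝ] Eu d, ‖M‖ < r →
      0 < (ContinuousLinearMap.id ℝ (Eu d) + M).det := by
    have hcont : Continuous fun M : Eu d →L[ℝ] Eu d => (ContinuousLinearMap.id ℝ (Eu d) + M).det :=
      ContinuousLinearMap.continuous_det.comp (by fun_prop)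
    have h0 : 0 < (ContinuousLinearMap.id ℝ (Eu d) + (0 : Eu d →L[ℝ] Eu d)).det := by
      rw [add_zero]
      have : (ContinuousLinearMap.id ℝ (Eu d)).det = LinearMap.det (LinearMap.id) := rfl
      rw [this, LinearMap.det_id]
      exact one_pos
    have := hcont.continuousAt.eventually (lt_mem_nhds h0)
    rw [Metric.eventually_nhds_iff] at this
    obtain ⟨r, hr, h⟩ := this
    exact ⟨r, hr, fun M hM => h (by simpa using hM)⟩
  -- The first bound makes `t • g` a contraction. The second keeps `id + t • Dg` where the
  -- determinant is positive, so that the Jacobian carries no absolute value.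
  set δ := min (1 / (2 * (D + 1))) (r / (2 * (D + 1))) with hδ
  have hδ0 : 0 < δ := by positivity
  let ρ : Eu d → ℝ := fun y => (1 - ‖y‖ ^ 2 / M ^ 2) ^ k
  have hρc : Continuous ρ := by fun_prop
  let q : Eu d → ℝ → ℝ := fun x t =>
    ρ (x + t • g x) * (ContinuousLinearMap.id ℝ (Eu d) + t • fderiv ℝ g x).det
  have hqc : ∀ t, Continuous fun x => q x t := fun t => by
    refine (hρc.comp (continuous_id.add (hg.continuous.const_smul t))).mul
      (ContinuousLinearMap.continuous_det.comp
        (continuous_const.add ((hg.continuous_fderiv (by simp)).const_smul t)))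
  show ∫ x in B, q x 1 = ∫ x in B, ρ x
  -- For small `t` the map `x ↦ x + t g(x)` is a bijection of the ball and the integral equals that
  -- of `ρ`. Polynomial dependence on `t` carries the identity to `t = 1`, where the map need not be
  -- injective.
  refine integral_eq_of_polynomial q (2 * k + d) (fun x => ?_)
    (fun t => ((hqc t).continuousOn.integrableOn_compact hBc)) hδ0 fun t ht ht' => ?_
  · obtain ⟨P, hP, hP'⟩ := bump_polynomial x (g x) M k
    obtain ⟨Q, hQ, hQ'⟩ := det_one_add_smul_polynomial (fderiv ℝ g x)
    refine ⟨P * Q, Polynomial.natDegree_mul_le.trans (add_le_add hP hQ), fun t => ?_⟩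
    simp only [q, ρ, Polynomial.eval_mul, ← hP', ← hQ']
  · have htD : t * (D + 1) ≤ 1 / 2 := by
      have := ht'.trans (min_le_left _ _)
      rw [le_div_iff₀ (by positivity)] at this
      linarith
    have htr : t * (D + 1) ≤ r / 2 := by
      have := ht'.trans (min_le_right _ _)
      rw [le_div_iff₀ (by positivity)] at this
      linarith
    have hl : LipschitzWith (t.toNNReal * D.toNNReal) (fun x => t • g x) := by
      refine LipschitzWith.of_dist_le_mul fun a b => ?_
      rw [dist_smul₀, NNReal.coe_mul, Real.coe_toNNReal _ ht.le, Real.norm_of_nonneg ht.le,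
        mul_assoc]
      exact mul_le_mul_of_nonneg_left (hlip.dist_le_mul a b) ht.le
    have hK : t.toNNReal * D.toNNReal < 1 := by
      rw [← NNReal.coe_lt_coe, NNReal.coe_mul, Real.coe_toNNReal _ ht.le,
        Real.coe_toNNReal _ hD0, NNReal.coe_one]
      nlinarith
    obtain ⟨hinj, himg⟩ := image_add_eq_of_lipschitz hK hl (s := B)
      fun x hx => by simp [hsupp x hx]
    have hcv := integral_image_eq_integral_abs_det_fderiv_smul (volume : Measure (Eu d))
      (s := B) (f := fun x => x + t • g x)
      (f' := fun x => ContinuousLinearMap.id ℝ (Eu d) + t • fderiv ℝ g x)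
      measurableSet_closedBall
      (fun x _ => ((hasFDerivAt_id x).add ((hfd x).const_smul t)).hasFDerivWithinAt)
      hinj.injOn ρ
    rw [himg] at hcv
    rw [hcv]
    refine setIntegral_congr_fun measurableSet_closedBall fun x _ => ?_
    have hpos : 0 < (ContinuousLinearMap.id ℝ (Eu d) + t • fderiv ℝ g x).det := by
      refine hdet _ ?_
      rw [norm_smul, Real.norm_of_nonneg ht.le]
      have := mul_le_mul_of_nonneg_left (hD x) ht.le
      nlinarith
    simp only [q, abs_of_pos hpos, smul_eq_mul]
    ring

/-- **Brouwer**: a continuous compactly supported perturbation of the identity has a zero. -/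
lemma exists_zero_of_compact_perturbation {g : Eu d → Eu d} (hg : ContDiff ℝ 1 g)
    {L : ℝ} (hL : 0 < L) (hsupp : ∀ x ∉ Metric.closedBall (0 : Eu d) L, g x = 0) {c : ℝ}
    (hc : 0 < c) : ∃ x ∈ Metric.closedBall (0 : Eu d) L, ‖x + g x‖ < c := by
  by_contra hcon
  push Not at hcon
  obtain ⟨B, hB⟩ : ∃ B, B = Metric.closedBall (0 : Eu d) L := ⟨_, rfl⟩
  have hBc : IsCompact B := hB ▸ isCompact_closedBall _ _
  have hgc : HasCompactSupport g := HasCompactSupport.intro hBc (hB ▸ hsupp)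
  obtain ⟨G, hG⟩ := hg.continuous.bounded_above_of_compact_support hgc
  have hG0 : 0 ≤ G := (norm_nonneg _).trans (hG 0)
  -- For `x` in the ball, `M` exceeds `‖x‖` and `‖x + g x‖`, so the base of the power in `ρ` stays
  -- in `[0, 1]`. It also exceeds `c`, which makes `a` positive below.
  obtain ⟨M, hM⟩ : ∃ M, M = L + G + c + 1 := ⟨_, rfl⟩
  have hM0 : 0 < M := by rw [hM]; positivity
  let ρ : ℕ → Eu d → ℝ := fun k y => (1 - ‖y‖ ^ 2 / M ^ 2) ^ k
  have hρc : ∀ k, Continuous (ρ k) := fun k => by fun_prop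
  let q : ℕ → Eu d → ℝ := fun k x =>
    ρ k (x + (1 : ℝ) • g x) * (ContinuousLinearMap.id ℝ (Eu d) + (1 : ℝ) • fderiv ℝ g x).det
  have key : ∀ k, ∫ x in B, q k x = ∫ x in B, ρ k x := by
    rw [hB]
    exact integral_comp_add_mul_det hg hsupp M
  -- The bump `ρ k` concentrates at the origin as `k` grows. If `x + g x` never has norm below `c`,
  -- the left side of `key` is `O(a ^ k)`, while the right side is at least a multiple of `a' ^ k`
  -- with `a' > a`, already by the contribution of a small ball around the origin.
  obtain ⟨a, ha⟩ : ∃ a, a = 1 - c ^ 2 / M ^ 2 := ⟨_, rfl⟩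
  obtain ⟨a', ha'⟩ : ∃ a', a' = 1 - (c / 2) ^ 2 / M ^ 2 := ⟨_, rfl⟩
  have hcM : c < M := by linarith
  have ha0 : 0 < a := by
    rw [ha, sub_pos, div_lt_one (by positivity)]
    gcongr
  have haa' : a < a' := by
    rw [ha, ha']
    gcongr
    linarith
  obtain ⟨s, hs⟩ : ∃ s, s = Metric.closedBall (0 : Eu d) (min L (c / 2)) := ⟨_, rfl⟩
  have hsB : s ⊆ B := by
    rw [hs, hB]
    exact Metric.closedBall_subset_closedBall (min_le_left _ _)
  have hmin : 0 < min L (c / 2) := by positivity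
  have hvs : 0 < (volume : Measure (Eu d)).real s := by
    rw [hs]
    refine ENNReal.toReal_pos (Metric.measure_closedBall_pos _ _ hmin).ne' ?_
    exact (isCompact_closedBall _ _).measure_lt_top.ne
  have lower : ∀ k, (volume : Measure (Eu d)).real s * a' ^ k ≤ ∫ x in B, ρ k x := by
    intro k
    have hpos : ∀ x ∈ B, 0 ≤ ρ k x := by
      intro x hx
      have hx' : ‖x‖ ≤ L := by simpa [hB] using hx
      have : ‖x‖ ^ 2 / M ^ 2 ≤ 1 := by
        rw [div_le_one (by positivity)]
        have : ‖x‖ ≤ M := by linarith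
        gcongr
      exact pow_nonneg (by linarith) k
    have h1 : ∫ x in s, a' ^ k ≤ ∫ x in s, ρ k x := by
      rw [hs]
      refine setIntegral_mono_on (by
          refine integrableOn_const ?_
          exact (isCompact_closedBall _ _).measure_lt_top.ne)
        ((hρc k).continuousOn.integrableOn_compact (isCompact_closedBall _ _))
        measurableSet_closedBall fun x hx => ?_
      have hx' : ‖x‖ ≤ c / 2 := by
        have : ‖x‖ ≤ min L (c / 2) := by simpa using hx
        exact this.trans (min_le_right _ _)
      have : a' ≤ 1 - ‖x‖ ^ 2 / M ^ 2 := by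
        rw [ha']
        gcongr
      exact pow_le_pow_left₀ (ha0.le.trans haa'.le) this k
    have h2 : ∫ x in s, ρ k x ≤ ∫ x in B, ρ k x :=
      setIntegral_mono_set ((hρc k).continuousOn.integrableOn_compact hBc)
        ((ae_restrict_iff' hBc.measurableSet).2 (Eventually.of_forall hpos))
        (Eventually.of_forall hsB)
    simpa using h1.trans h2
  have hdc : Continuous fun x =>
      (ContinuousLinearMap.id ℝ (Eu d) + (1 : ℝ) • fderiv ℝ g x).det := by
    have h1 : Continuous fun x => ContinuousLinearMap.id ℝ (Eu d) + (1 : ℝ) • fderiv ℝ g x := by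
      have hf := hg.continuous_fderiv (by simp)
      fun_prop
    exact ContinuousLinearMap.continuous_det.comp h1
  obtain ⟨W, hW⟩ : ∃ W, ∀ x ∈ B,
      ‖(ContinuousLinearMap.id ℝ (Eu d) + (1 : ℝ) • fderiv ℝ g x).det‖ ≤ W :=
    hBc.exists_bound_of_continuousOn hdc.continuousOn
  have upper : ∀ k, ∫ x in B, q k x ≤ a ^ k * W * (volume : Measure (Eu d)).real B := by
    intro k
    refine (Real.le_norm_self _).trans ?_
    refine norm_setIntegral_le_of_norm_le_const (C := a ^ k * W) hBc.measure_lt_top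
      fun x hx => ?_
    simp only [q, ρ, norm_mul]
    refine mul_le_mul ?_ (hW x hx) (norm_nonneg _) (pow_nonneg ha0.le k)
    have h1 : c ≤ ‖x + (1 : ℝ) • g x‖ := by simpa using hcon x (hB ▸ hx)
    have h2 : ‖x + (1 : ℝ) • g x‖ ≤ M := by
      have hx' : ‖x‖ ≤ L := by simpa [hB] using hx
      have := norm_add_le x ((1 : ℝ) • g x)
      have := hG x
      simp only [one_smul] at *
      linarith
    have h3 : ‖x + (1 : ℝ) • g x‖ ^ 2 / M ^ 2 ≤ 1 := by
      rw [div_le_one (by positivity)]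
      gcongr
    have h4 : 0 ≤ 1 - ‖x + (1 : ℝ) • g x‖ ^ 2 / M ^ 2 := by linarith
    rw [Real.norm_of_nonneg (pow_nonneg h4 k)]
    refine pow_le_pow_left₀ h4 ?_ k
    rw [ha]
    gcongr
  have hfin : ∀ k : ℕ, (volume : Measure (Eu d)).real s
      ≤ (a / a') ^ k * (W * (volume : Measure (Eu d)).real B) := by
    intro k
    have h := (lower k).trans ((key k).symm.le.trans (upper k))
    have hp : 0 < a' ^ k := pow_pos (ha0.trans haa') k
    rw [div_pow, div_mul_eq_mul_div, le_div_iff₀ hp]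
    linarith
  have hlim : Tendsto (fun k : ℕ => (a / a') ^ k * (W * (volume : Measure (Eu d)).real B)) atTop
      (𝓝 (0 * (W * (volume : Measure (Eu d)).real B))) :=
    (tendsto_pow_atTop_nhds_zero_of_lt_one (div_nonneg ha0.le (ha0.trans haa').le)
      ((div_lt_one (ha0.trans haa')).2 haa')).mul_const _
  rw [zero_mul] at hlim
  exact absurd (ge_of_tendsto' hlim hfin) (not_le.2 hvs)

/-- A continuous vector field on `ℝ^d` pointing outwards far from the origin has a zero. -/
theorem exists_zero_of_inner_pos {F : Eu d → Eu d} (hF : Continuous F) {R : ℝ} (hR : 0 < R)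
    (h : ∀ x, R ≤ ‖x‖ → 0 < inner ℝ (F x) x) : ∃ x, F x = 0 := by
  by_contra hcon
  push Not at hcon
  -- The map `x + g₀ x = χ F + (1 - χ) x` is `F` inside the ball of radius `R` and the identity
  -- outside the ball of radius `2 R`. In between, its inner product with `x` is positive by
  -- hypothesis, so it has no zero.
  let χ : Eu d → ℝ := fun x => max 0 (min 1 (2 - ‖x‖ / R))
  have hχc : Continuous χ := by fun_prop
  let g₀ : Eu d → Eu d := fun x => χ x • (F x - x)
  have hg₀c : Continuous g₀ := hχc.smul (hF.sub continuous_id)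
  have hg₀s : ∀ x ∉ Metric.closedBall (0 : Eu d) (2 * R), g₀ x = 0 := by
    intro x hx
    have hx' : 2 * R < ‖x‖ := by simpa using hx
    have : χ x = 0 := by
      refine max_eq_left ((min_le_right _ _).trans ?_)
      rw [sub_nonpos, le_div_iff₀ hR]
      exact hx'.le
    simp [g₀, this]
  have hne : ∀ x, x + g₀ x ≠ 0 := by
    intro x hx
    have heq : x + g₀ x = χ x • F x + (1 - χ x) • x := by
      simp only [g₀, smul_sub, sub_smul, one_smul]
      abel
    rcases le_or_gt R ‖x‖ with hxR | hxR
    · have h1 : inner ℝ (x + g₀ x) x = χ x * inner ℝ (F x) x + (1 - χ x) * ‖x‖ ^ 2 := by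
        rw [heq, inner_add_left, inner_smul_left, inner_smul_left, real_inner_self_eq_norm_sq]
        simp
      rw [hx, inner_zero_left] at h1
      have h2 := h x hxR
      have h3 : 0 ≤ χ x := le_max_left _ _
      have h4 : χ x ≤ 1 := max_le zero_le_one (min_le_left _ _)
      have h5 : 0 < ‖x‖ ^ 2 := by have := hR.trans_le hxR; positivity
      rcases h3.eq_or_lt with h6 | h6
      · rw [← h6] at h1
        linarith
      · have := mul_pos h6 h2
        have := mul_nonneg (sub_nonneg.2 h4) h5.le
        linarith
    · have : χ x = 1 := by
        have h1 : 1 ≤ 2 - ‖x‖ / R := by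
          have : ‖x‖ / R ≤ 1 := (div_le_one hR).2 hxR.le
          linarith
        simp [χ, min_eq_left h1]
      rw [heq, this] at hx
      simp at hx
      exact hcon x hx
  -- The field `g₀` is only continuous. If `c` is the minimum of `‖x + g₀ x‖` on the ball, a `C^1`
  -- approximation within `c / 2` that vanishes wherever `g₀` does cannot bring the norm below `c /
  -- 2`.
  obtain ⟨x₀, -, hx₀⟩ := (isCompact_closedBall (0 : Eu d) (2 * R)).exists_isMinOn
    (Metric.nonempty_closedBall.2 (by positivity)) (f := fun x => ‖x + g₀ x‖)
    (by fun_prop)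
  set c := ‖x₀ + g₀ x₀‖ with hc
  have hc0 : 0 < c := norm_pos_iff.2 (hne x₀)
  obtain ⟨g, hg, hgd, hgs⟩ := hg₀c.exists_contDiff_approx 1 (ε := fun _ => c / 2) continuous_const
    (fun _ => by positivity)
  obtain ⟨x, hx, hxc⟩ := exists_zero_of_compact_perturbation (hg.of_le (by simp))
    (by positivity : 0 < 2 * R)
    (fun x hx => by
      by_contra h0
      exact (hgs h0) (hg₀s x hx)) (by positivity : 0 < c / 2)
  have h1 : c ≤ ‖x + g₀ x‖ := hx₀ hx
  have h2 := hgd x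
  rw [dist_eq_norm] at h2
  have h3 : ‖x + g₀ x‖ ≤ ‖x + g x‖ + ‖g x - g₀ x‖ := by
    have heq : x + g₀ x = (x + g x) - (g x - g₀ x) := by abel
    rw [heq]
    exact norm_sub_le _ _
  linarith

end Brouwer

end AnisoElliptic

end

/-! ### Riesz representation and weak sequential compactness in `L^p` -/

noncomputable section

namespace AnisoElliptic

section LpDuality

variable {X : Type*} [MeasurableSpace X] {μ : Measure X} {p q : ℝ}

lemma fact_one_le_of_holderConjugate (hpq : p.HolderConjugate q) :
    Fact (1 ≤ ENNReal.ofReal p) := ⟨by simpa using hpq.lt.le⟩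

/-- The functional `h ↦ ∫ g h` on `L^p` for `g ∈ L^q`. -/
lemma exists_dual_eq_integral (hpq : p.HolderConjugate q) [Fact (1 ≤ ENNReal.ofReal p)]
    {g : X → ℝ} (hg : MemLp g (ENNReal.ofReal q) μ) :
    ∃ G : StrongDual ℝ (Lp ℝ (ENNReal.ofReal p) μ), ∀ h, G h = ∫ x, g x * h x ∂μ := by
  have : ENNReal.HolderConjugate (ENNReal.ofReal q) (ENNReal.ofReal p) :=
    hpq.symm.ennrealOfReal
  have : Fact (1 ≤ ENNReal.ofReal q) := fact_one_le_of_holderConjugate hpq.symm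
  refine ⟨(ContinuousLinearMap.mul ℝ ℝ).lpPairing μ _ _ (hg.toLp g), fun h => ?_⟩
  rw [ContinuousLinearMap.lpPairing_eq_integral]
  refine integral_congr_ae ?_
  filter_upwards [hg.coeFn_toLp] with x hx
  simp [hx]

lemma integrable_abs_rpow {r : ℝ} (hr : 0 < r) {f : X → ℝ} (hf : MemLp f (ENNReal.ofReal r) μ) :
    Integrable (fun x => |f x| ^ r) μ := by
  have := hf.integrable_norm_rpow (by simpa using hr) (by simp)
  simpa [ENNReal.toReal_ofReal hr.le] using this

lemma Lp_norm_rpow_eq {r : ℝ} (hr : 0 < r) (f : Lp ℝ (ENNReal.ofReal r) μ) :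
    ‖f‖ ^ r = ∫ x, |f x| ^ r ∂μ := by
  have h0 : 0 ≤ ∫ x, |f x| ^ r ∂μ := integral_nonneg fun x => by positivity
  rw [Lp.norm_def, (Lp.memLp f).eLpNorm_eq_integral_rpow_norm (by simpa using hr) (by simp)]
  simp only [ENNReal.toReal_ofReal hr.le, Real.norm_eq_abs]
  rw [ENNReal.toReal_ofReal (by positivity), ← Real.rpow_mul h0, inv_mul_cancel₀ hr.ne',
    Real.rpow_one]

variable [IsFiniteMeasure μ]

/-- A continuous functional on `L^p` is countably additive on indicators. -/
lemma hasSum_apply_indicatorConstLp {r : ℝ≥0∞} [Fact (1 ≤ r)] (hr : r ≠ ⊤)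
    (F : StrongDual ℝ (Lp ℝ r μ)) {E : ℕ → Set X} (hE : ∀ i, MeasurableSet (E i))
    (hd : Pairwise (Function.onFun Disjoint E)) :
    HasSum (fun i => F (indicatorConstLp r (hE i) (measure_ne_top μ _) 1))
      (F (indicatorConstLp r (MeasurableSet.iUnion hE) (measure_ne_top μ _) 1)) := by
  have hm : ∀ s : Finset ℕ, MeasurableSet (⋃ i ∈ s, E i) := fun s =>
    s.measurableSet_biUnion fun i _ => hE i
  have hfin : ∀ s : Finset ℕ, ∑ i ∈ s, F (indicatorConstLp r (hE i) (measure_ne_top μ _) 1)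
      = F (indicatorConstLp r (hm s) (measure_ne_top μ _) 1) := by
    intro s
    rw [← map_sum]
    congr 1
    refine Lp.ext ?_
    have h1 : ∀ᵐ x ∂μ, ∀ i, indicatorConstLp r (hE i) (measure_ne_top μ (E i)) (1 : ℝ) x
        = (E i).indicator (fun _ => (1 : ℝ)) x :=
      ae_all_iff.2 fun i => indicatorConstLp_coeFn
    filter_upwards [h1, Lp.coeFn_finsetSum (s := s) (f := fun i =>
      indicatorConstLp r (hE i) (measure_ne_top μ (E i)) (1 : ℝ)),
      indicatorConstLp_coeFn (p := r) (hs := hm s) (hμs := measure_ne_top μ _) (c := (1 : ℝ))]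
      with x hx h2 h3
    rw [h2, h3, Finset.sum_apply, Finset.indicator_biUnion_apply]
    · exact Finset.sum_congr rfl fun i _ => hx i
    · exact fun i _ j _ hij => hd hij
  simp only [HasSum, SummationFilter.unconditional_filter]
  simp only [hfin]
  refine (F.continuous.tendsto _).comp (tendsto_indicatorConstLp_set hr ?_)
  have hs : Tendsto (fun s : Finset ℕ => ∑ i ∈ s, μ (E i)) atTop (𝓝 (μ (⋃ i, E i))) := by
    have := ENNReal.summable (f := fun i => μ (E i)) |>.hasSum
    rw [← measure_iUnion hd hE] at this
    simpa [HasSum] using this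
  have hs2 : Tendsto (fun s : Finset ℕ => μ (⋃ i, E i) - ∑ i ∈ s, μ (E i)) atTop (𝓝 0) := by
    have := ENNReal.Tendsto.sub (tendsto_const_nhds (x := μ (⋃ i, E i))) hs
      (Or.inl (measure_ne_top μ _))
    simpa using this
  refine hs2.congr fun s => ?_
  have hsub : (⋃ i ∈ s, E i) ⊆ ⋃ i, E i := Set.iUnion₂_subset fun i _ => Set.subset_iUnion E i
  rw [Set.symmDiff_def, Set.sdiff_eq_empty.2 hsub, Set.empty_union,
    measure_sdiff hsub (hm s).nullMeasurableSet (measure_ne_top μ _),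
    measure_biUnion_finset (fun i _ j _ hij => hd hij) fun i _ => hE i]

/-- Two functionals on `L^r` agreeing on indicators are equal. -/
lemma dual_ext_indicator {r : ℝ≥0∞} [Fact (1 ≤ r)] (hr : r ≠ ⊤) {F G : StrongDual ℝ (Lp ℝ r μ)}
    (h : ∀ (s : Set X) (hs : MeasurableSet s),
      F (indicatorConstLp r hs (measure_ne_top μ _) 1)
        = G (indicatorConstLp r hs (measure_ne_top μ _) 1)) : F = G := by
  ext f
  refine Lp.induction hr (motive := fun f => F f = G f) ?_ ?_ ?_ f
  · intro c s hs hμs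
    have h1 : ((Lp.simpleFunc.indicatorConst r hs hμs.ne c : Lp.simpleFunc ℝ r μ) : Lp ℝ r μ)
        = c • indicatorConstLp r hs (measure_ne_top μ s) 1 := by
      rw [Lp.simpleFunc.coe_indicatorConst]
      refine Lp.ext ?_
      filter_upwards [indicatorConstLp_coeFn (p := r) (hs := hs) (hμs := hμs.ne) (c := c),
        Lp.coeFn_smul c (indicatorConstLp r hs (measure_ne_top μ s) (1 : ℝ)),
        indicatorConstLp_coeFn (p := r) (hs := hs) (hμs := measure_ne_top μ s) (c := (1 : ℝ))]
        with x h1 h2 h3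
      rw [h1, h2, Pi.smul_apply, h3]
      by_cases hx : x ∈ s <;> simp [hx]
    rw [h1, map_smul, map_smul, h s hs]
  · intro f g hf hg _ h1 h2
    rw [map_add, map_add, h1, h2]
  · exact isClosed_eq F.continuous G.continuous

/-- **Riesz representation**: functionals on `L^p`, `1 < p < ⊤`, are given by functions in `L^q`. -/
theorem exists_eq_integral_of_dual (hpq : p.HolderConjugate q) [Fact (1 ≤ ENNReal.ofReal p)]
    (F : StrongDual ℝ (Lp ℝ (ENNReal.ofReal p) μ)) :
    ∃ g : X → ℝ, MemLp g (ENNReal.ofReal q) μ ∧ ∀ h, F h = ∫ x, g x * h x ∂μ := by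
  classical
  have hF : Fact (1 ≤ ENNReal.ofReal q) := fact_one_le_of_holderConjugate hpq.symm
  have hp0 := hpq.pos
  have hq0 := hpq.symm.pos
  have hpt : ENNReal.ofReal p ≠ ⊤ := ENNReal.ofReal_ne_top
  -- The map `E ↦ F(1_E)` is a signed measure, absolutely continuous with respect to `μ`. Its
  -- Radon–Nikodym density represents `F` on indicators, but is a priori only integrable.
  let s : SignedMeasure X :=
    { measureOf' := fun E => if hE : MeasurableSet E then
        F (indicatorConstLp _ hE (measure_ne_top μ _) 1) else 0
      empty' := by
        rw [dif_pos MeasurableSet.empty, indicatorConstLp_empty, map_zero]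
      not_measurable' := fun E hE => dif_neg hE
      m_iUnion' := fun E hE hd => by
        simp only [hE, MeasurableSet.iUnion hE, dif_pos]
        exact hasSum_apply_indicatorConstLp hpt F hE hd }
  have hs : ∀ E (hE : MeasurableSet E),
      s E = F (indicatorConstLp _ hE (measure_ne_top μ _) 1) := fun E hE => dif_pos hE
  have hac : VectorMeasure.AbsolutelyContinuous s μ.toENNRealVectorMeasure := by
    refine VectorMeasure.AbsolutelyContinuous.mk fun E hE h0 => ?_
    rw [Measure.toENNRealVectorMeasure_apply_measurable hE] at h0
    rw [hs E hE]
    have : indicatorConstLp (ENNReal.ofReal p) hE (measure_ne_top μ E) (1 : ℝ) = 0 := by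
      rw [← norm_eq_zero, norm_indicatorConstLp (by simpa using hp0) hpt]
      rw [Measure.real, h0]
      simp [hp0.ne', ENNReal.toReal_ofReal hp0.le]
    rw [this, map_zero]
  set g : X → ℝ := s.rnDeriv μ with hgdef
  have hgm : Measurable g := s.measurable_rnDeriv μ
  have hgi : Integrable g μ := s.integrable_rnDeriv μ
  have hFE : ∀ E (hE : MeasurableSet E),
      F (indicatorConstLp _ hE (measure_ne_top μ _) 1) = ∫ x in E, g x ∂μ := by
    intro E hE
    rw [← hs E hE, ← withDensityᵥ_apply hgi hE, s.withDensityᵥ_rnDeriv_eq μ hac]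
  have hind : ∀ (k : X → ℝ) (E : Set X) (hE : MeasurableSet E),
      ∫ x, k x * indicatorConstLp (ENNReal.ofReal p) hE (measure_ne_top μ _) (1 : ℝ) x ∂μ
        = ∫ x in E, k x ∂μ := by
    intro k E hE
    rw [← integral_indicator hE]
    refine integral_congr_ae ?_
    filter_upwards [indicatorConstLp_coeFn (p := ENNReal.ofReal p) (hs := hE)
      (hμs := measure_ne_top μ _) (c := (1 : ℝ))] with x hx
    rw [hx]
    by_cases h : x ∈ E <;> simp [h]
  -- On the set where `|g| ≤ k` the density is bounded and can be paired with all of `L^p`.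
  let E : ℕ → Set X := fun k => {x | |g x| ≤ k}
  have hE : ∀ k, MeasurableSet (E k) := fun k => measurableSet_le hgm.abs measurable_const
  let gk : ℕ → X → ℝ := fun k => (E k).indicator g
  have hgkm : ∀ k, Measurable (gk k) := fun k => hgm.indicator (hE k)
  have hgkb : ∀ k x, |gk k x| ≤ k := by
    intro k x
    by_cases h : x ∈ E k
    · simp only [gk, Set.indicator_of_mem h]
      exact h
    · simp [gk, Set.indicator_of_notMem h]
  have hgkL : ∀ (k : ℕ) (r : ℝ≥0∞), MemLp (gk k) r μ := fun k r =>
    MemLp.of_bound (hgkm k).aestronglyMeasurable k (Eventually.of_forall (hgkb k))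
  -- testing against functions supported in `E k`
  have htest : ∀ (k : ℕ) (h : Lp ℝ (ENNReal.ofReal p) μ), (∀ᵐ x ∂μ, x ∉ E k → h x = 0) →
      F h = ∫ x, gk k x * h x ∂μ := by
    intro k h hh
    let χ : Lp ℝ ⊤ μ := indicatorConstLp ⊤ (hE k) (measure_ne_top μ _) 1
    let I := (ContinuousLinearMap.mul ℝ ℝ).holderL μ ⊤ (ENNReal.ofReal p) (ENNReal.ofReal p) χ
    have hI : ∀ h : Lp ℝ (ENNReal.ofReal p) μ, I h =ᵐ[μ] (E k).indicator h := by
      intro h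
      have := (ContinuousLinearMap.mul ℝ ℝ).coeFn_holder (r := ENNReal.ofReal p) χ h
      filter_upwards [this, indicatorConstLp_coeFn (p := ⊤) (hs := hE k)
        (hμs := measure_ne_top μ _) (c := (1 : ℝ))] with x h1 h2
      refine h1.trans ?_
      simp only [χ, h2]
      by_cases hx : x ∈ E k <;> simp [hx]
    obtain ⟨G, hG⟩ := exists_dual_eq_integral hpq (hgkL k (ENNReal.ofReal q))
    have hFG : F.comp I = G := by
      refine dual_ext_indicator hpt fun A hA => ?_
      have h1 : I (indicatorConstLp _ hA (measure_ne_top μ _) 1)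
          = indicatorConstLp _ ((hE k).inter hA) (measure_ne_top μ _) 1 := by
        refine Lp.ext ?_
        filter_upwards [hI (indicatorConstLp _ hA (measure_ne_top μ _) 1),
          indicatorConstLp_coeFn (p := ENNReal.ofReal p) (hs := hA)
            (hμs := measure_ne_top μ _) (c := (1 : ℝ)),
          indicatorConstLp_coeFn (p := ENNReal.ofReal p) (hs := (hE k).inter hA)
            (hμs := measure_ne_top μ _) (c := (1 : ℝ))] with x h1 h2 h3
        rw [h1, h3]
        by_cases hx : x ∈ E k <;> by_cases hx' : x ∈ A <;> simp [hx, hx', h2]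
      rw [hG, hind, ContinuousLinearMap.comp_apply, h1, hFE, setIntegral_indicator (hE k),
        Set.inter_comm]
    have h2 : I h = h := by
      refine Lp.ext ?_
      filter_upwards [hI h, hh] with x h1 h2
      rw [h1]
      by_cases hx : x ∈ E k
      · simp [hx]
      · simp [hx, h2 hx]
    rw [← hG, ← hFG, ContinuousLinearMap.comp_apply, h2]
  have hbound : ∀ k, ∫ x, |gk k x| ^ q ∂μ ≤ ‖F‖ ^ q := by
    intro k
    set Y := ∫ x, |gk k x| ^ q ∂μ with hY
    have hY0 : 0 ≤ Y := integral_nonneg fun x => by positivity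
    -- The extremal function of Hölder's inequality: `F w = Y` and `‖w‖ ^ p = Y`, so `Y ≤ ‖F‖ ‖w‖`
    -- gives `Y ≤ ‖F‖ ^ q`, uniformly in `k`.
    let w : X → ℝ := fun x => |gk k x| ^ (q - 2) * gk k x
    have hwabs : ∀ x, |w x| = |gk k x| ^ (q - 1) := by
      intro x
      rcases eq_or_ne (gk k x) 0 with h | h
      · simp [w, h, Real.zero_rpow (sub_ne_zero.2 hpq.symm.lt.ne')]
      · have h' : 0 < |gk k x| := abs_pos.2 h
        simp only [w, abs_mul, abs_of_nonneg (Real.rpow_nonneg (abs_nonneg _) _)]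
        rw [← Real.rpow_add_one h'.ne']
        ring_nf
    have hwm : Measurable w := ((hgkm k).abs.pow_const _).mul (hgkm k)
    have hwL : MemLp w (ENNReal.ofReal p) μ := by
      refine MemLp.of_bound hwm.aestronglyMeasurable ((k : ℝ) ^ (q - 1))
        (Eventually.of_forall fun x => ?_)
      rw [Real.norm_eq_abs, hwabs]
      exact Real.rpow_le_rpow (abs_nonneg _) (hgkb k x) (sub_nonneg.2 hpq.symm.lt.le)
    have h1 : F (hwL.toLp w) = Y := by
      rw [htest k]
      · refine integral_congr_ae ?_
        filter_upwards [hwL.coeFn_toLp] with x hx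
        rw [hx]
        simp only [w]
        rcases eq_or_ne (gk k x) 0 with h | h
        · simp [h, Real.zero_rpow hq0.ne']
        · have h' : 0 < |gk k x| := abs_pos.2 h
          have h3 : |gk k x| ^ q = |gk k x| ^ (q - 2) * (|gk k x| * |gk k x|) := by
            rw [← mul_assoc, ← Real.rpow_add_one h'.ne', ← Real.rpow_add_one h'.ne']
            ring_nf
          rw [h3, abs_mul_abs_self]
          ring
      · filter_upwards [hwL.coeFn_toLp] with x hx hxE
        rw [hx]
        simp [w, gk, hxE]
    have h2 : ‖hwL.toLp w‖ ^ p = Y := by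
      rw [Lp_norm_rpow_eq hp0]
      refine integral_congr_ae ?_
      filter_upwards [hwL.coeFn_toLp] with x hx
      rw [hx, hwabs, ← Real.rpow_mul (abs_nonneg _), hpq.symm.sub_one_mul_conj]
    have h3 : Y ≤ ‖F‖ * ‖hwL.toLp w‖ := by
      rw [← h1]
      exact (le_abs_self _).trans (F.le_opNorm _)
    set n := ‖hwL.toLp w‖ with hn
    have hn0 : 0 ≤ n := norm_nonneg _
    rcases hn0.eq_or_lt with h | h
    · rw [← h2, ← h, Real.zero_rpow hp0.ne']
      positivity
    · have h4 : n ^ (p - 1) ≤ ‖F‖ := by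
        rw [← h2] at h3
        have : n ^ p = n ^ (p - 1) * n := by
          rw [← Real.rpow_add_one h.ne']
          ring_nf
        rw [this] at h3
        exact le_of_mul_le_mul_right h3 h
      calc Y = (n ^ (p - 1)) ^ q := by
            rw [← Real.rpow_mul hn0, hpq.sub_one_mul_conj, h2]
        _ ≤ ‖F‖ ^ q := Real.rpow_le_rpow (by positivity) h4 hq0.le
  have hgL : MemLp g (ENNReal.ofReal q) μ := by
    refine ⟨hgm.aestronglyMeasurable, ?_⟩
    rw [eLpNorm_lt_top_iff_lintegral_rpow_enorm_lt_top (by simpa using hq0) (by simp),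
      ENNReal.toReal_ofReal hq0.le]
    have hlim : ∀ x, Tendsto (fun k => ‖gk k x‖ₑ ^ q) atTop (𝓝 (‖g x‖ₑ ^ q)) := by
      intro x
      obtain ⟨n, hn⟩ := exists_nat_ge |g x|
      refine tendsto_const_nhds.congr' ?_
      filter_upwards [eventually_ge_atTop n] with k hk
      have : x ∈ E k := hn.trans (by exact_mod_cast hk)
      simp [gk, this]
    have h1 : ∫⁻ x, ‖g x‖ₑ ^ q ∂μ ≤ liminf (fun k => ∫⁻ x, ‖gk k x‖ₑ ^ q ∂μ) atTop := by
      have := lintegral_liminf_le (μ := μ) (u := atTop) (f := fun k x => ‖gk k x‖ₑ ^ q)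
        fun k => (hgkm k).enorm.pow_const q
      refine le_trans (lintegral_mono fun x => ?_) this
      rw [(hlim x).liminf_eq]
    refine (h1.trans ?_).trans_lt (ENNReal.ofReal_lt_top (r := ‖F‖ ^ q))
    refine liminf_le_of_le ⟨0, by simp⟩ fun b hb => ?_
    obtain ⟨k, hk⟩ := hb.exists
    refine hk.trans ?_
    have : ∫⁻ x, ‖gk k x‖ₑ ^ q ∂μ = ENNReal.ofReal (∫ x, |gk k x| ^ q ∂μ) := by
      rw [ofReal_integral_eq_lintegral_ofReal (integrable_abs_rpow hq0 (hgkL k _))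
        (Eventually.of_forall fun x => by positivity)]
      refine lintegral_congr fun x => ?_
      rw [Real.enorm_eq_ofReal_abs, ENNReal.ofReal_rpow_of_nonneg (abs_nonneg _) hq0.le]
    rw [this]
    exact ENNReal.ofReal_le_ofReal (hbound k)
  obtain ⟨G, hG⟩ := exists_dual_eq_integral hpq hgL
  have : F = G := dual_ext_indicator hpt fun A hA => by rw [hG, hind, hFE]
  exact ⟨g, hgL, fun h => by rw [this, hG]⟩

/-- Bounded sequences in `L^p`, `1 < p < ⊤`, have weakly convergent subsequences. -/
theorem Lp_exists_weak_subseq [MeasurableSpace.CountablyGenerated X]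
    (hp : 1 < p) [Fact (1 ≤ ENNReal.ofReal p)] {f : ℕ → Lp ℝ (ENNReal.ofReal p) μ} {R : ℝ}
    (hf : ∀ n, ‖f n‖ ≤ R) :
    ∃ (g : Lp ℝ (ENNReal.ofReal p) μ) (φ : ℕ → ℕ), StrictMono φ ∧
      ∀ F : StrongDual ℝ (Lp ℝ (ENNReal.ofReal p) μ),
        Tendsto (fun n => F (f (φ n))) atTop (𝓝 (F g)) := by
  have hpq := Real.HolderConjugate.conjExponent hp
  set q := p.conjExponent
  have : ENNReal.HolderConjugate (ENNReal.ofReal p) (ENNReal.ofReal q) := hpq.ennrealOfReal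
  have hq : Fact (1 ≤ ENNReal.ofReal q) := fact_one_le_of_holderConjugate hpq.symm
  have : Fact (ENNReal.ofReal q ≠ ⊤) := ⟨ENNReal.ofReal_ne_top⟩
  -- The pairing places `L^p` in the dual of the separable space `L^q`, where bounded sequences have
  -- weak-star convergent subsequences. Riesz representation brings the limit back to `L^p`.
  let Λ := (ContinuousLinearMap.mul ℝ ℝ).lpPairing μ (ENNReal.ofReal p) (ENNReal.ofReal q)
  have hΛ : ∀ f h, Λ f h = ∫ x, f x * h x ∂μ := fun f h => by
    simp only [Λ, ContinuousLinearMap.lpPairing_eq_integral, ContinuousLinearMap.mul_apply']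
  have hK := WeakDual.isSeqCompact_closedBall ℝ (Lp ℝ (ENNReal.ofReal q) μ) 0 (‖Λ‖ * R)
  obtain ⟨ℓ, -, φ, hφ, hlim⟩ := hK (x := fun n => StrongDual.toWeakDual (Λ (f n))) fun n => by
    simp only [Set.mem_preimage, Metric.mem_closedBall, dist_zero_right]
    exact (Λ.le_opNorm _).trans (mul_le_mul_of_nonneg_left (hf n) (norm_nonneg _))
  obtain ⟨g, hg, hgℓ⟩ := exists_eq_integral_of_dual hpq.symm (WeakDual.toStrongDual ℓ)
  refine ⟨hg.toLp g, φ, hφ, fun F => ?_⟩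
  obtain ⟨h, hh, hFh⟩ := exists_eq_integral_of_dual hpq F
  have hc : ∀ k : Lp ℝ (ENNReal.ofReal p) μ, F k = Λ k (hh.toLp h) := by
    intro k
    rw [hFh, hΛ]
    refine integral_congr_ae ?_
    filter_upwards [hh.coeFn_toLp] with x hx
    rw [hx, mul_comm]
  have h1 : F (hg.toLp g) = ℓ (hh.toLp h) := by
    have := hgℓ (hh.toLp h)
    rw [hc, hΛ]
    refine Eq.trans ?_ this.symm
    refine integral_congr_ae ?_
    filter_upwards [hg.coeFn_toLp] with x hx
    rw [hx]
  have h2 := ((WeakDual.eval_continuous (hh.toLp h)).tendsto ℓ).comp hlim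
  rw [h1]
  refine h2.congr fun n => ?_
  rw [hc]
  rfl

end LpDuality

end AnisoElliptic

end

/-! ### The anisotropic Sobolev inequality of Troisi for `C_c^1` functions -/

noncomputable section

namespace AnisoElliptic

section Sobolev

variable {N : ℕ}

lemma abs_rpow_sub_two_mul {t : ℝ} (ht : 1 < t) (v : ℝ) :
    |(|v| ^ (t - 2) * v)| = |v| ^ (t - 1) := by
  rcases eq_or_ne v 0 with h | h
  · simp [h, Real.zero_rpow (sub_ne_zero.2 ht.ne')]
  · have h' : 0 < |v| := abs_pos.2 h
    rw [abs_mul, abs_of_nonneg (Real.rpow_nonneg (abs_nonneg _) _), ← Real.rpow_add_one h'.ne']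
    ring_nf

/-- `|u|^t` is controlled by the integral of its partial derivative along a coordinate line. -/
lemma ofReal_abs_rpow_le_lintegral {u : (Fin N → ℝ) → ℝ} (hu : ContDiff ℝ 1 u)
    (h2u : HasCompactSupport u) {t : ℝ} (ht : 1 < t) (j : Fin N) (x : Fin N → ℝ) :
    ENNReal.ofReal (|u x| ^ t) ≤ ∫⁻ s, ENNReal.ofReal (t * |u (Function.update x j s)| ^ (t - 1) *
      |fderiv ℝ u (Function.update x j s) (Pi.single j 1)|) := by
  let φ : ℝ → ℝ := fun s => ‖u (Function.update x j s)‖ ^ t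
  have hv : ContDiff ℝ 1 fun s => u (Function.update x j s) :=
    hu.comp (by convert! contDiff_update 1 x j)
  have hφ : ContDiff ℝ 1 φ := (contDiff_norm_rpow ht).comp hv
  have hφc : HasCompactSupport φ := by
    have h1 : HasCompactSupport fun s => u (Function.update x j s) :=
      h2u.comp_isClosedEmbedding (isClosedEmbedding_update x j)
    exact h1.comp_left (g := fun y => ‖y‖ ^ t) (by simp [Real.zero_rpow (by linarith : t ≠ 0)])
  have h := HasCompactSupport.enorm_le_lintegral_Ici_deriv hφ hφc (x j)
  have h0 : ‖φ (x j)‖ₑ = ENNReal.ofReal (|u x| ^ t) := by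
    rw [Real.enorm_eq_ofReal (by positivity)]
    simp [φ]
  rw [h0] at h
  refine h.trans ((setLIntegral_le_lintegral _ _).trans (lintegral_mono fun s => ?_))
  have hd : HasDerivAt φ ((t * |u (Function.update x j s)| ^ (t - 2) * u (Function.update x j s)) *
      fderiv ℝ u (Function.update x j s) (Pi.single j 1)) s := by
    have h1 := (hu.differentiable one_ne_zero (Function.update x j s)).hasFDerivAt.comp_hasDerivAt s
      (hasDerivAt_update x j s)
    exact (hasDerivAt_abs_rpow _ ht).comp s h1
  rw [hd.deriv, Real.enorm_eq_ofReal_abs, abs_mul, mul_assoc t, abs_mul, abs_rpow_sub_two_mul ht,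
    abs_of_pos (by linarith : 0 < t)]

/-- A Loomis–Whitney inequality with a different function for each coordinate direction. -/
lemma lintegral_prod_le_prod_lintegral (hN : 2 ≤ N) {f : Fin N → (Fin N → ℝ) → ℝ≥0∞}
    (hf : ∀ j, Measurable (f j)) (h0 : ∀ j, ∫⁻ x, f j x ≠ 0) (ht : ∀ j, ∫⁻ x, f j x ≠ ⊤) :
    ∫⁻ x, ∏ j, (∫⁻ s, f j (Function.update x j s)) ^ (1 / ((N : ℝ) - 1))
      ≤ (∏ j, (∫⁻ x, f j x) ^ (1 / ((N : ℝ) - 1))) * (N : ℝ≥0∞) ^ ((N : ℝ) / (N - 1)) := by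
  set e : ℝ := 1 / ((N : ℝ) - 1) with he
  have hN' : (2 : ℝ) ≤ N := by exact_mod_cast hN
  have he0 : 0 ≤ e := one_div_nonneg.2 (by linarith)
  let I : Fin N → ℝ≥0∞ := fun j => ∫⁻ x, f j x
  -- The sum of the `f j`, each normalized to have integral one, is a single function of integral
  -- `N` that dominates every `f j / I j`. The grid-lines inequality for one function then applies,
  -- at the cost of the factor `N ^ (N / (N - 1))`.
  let F : (Fin N → ℝ) → ℝ≥0∞ := fun x => ∑ j, (I j)⁻¹ * f j x
  have hF : Measurable F := Finset.measurable_fun_sum _ fun j _ => (hf j).const_mul _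
  have hle : ∀ j x, f j x ≤ I j * F x := by
    intro j x
    have h1 : (I j)⁻¹ * f j x ≤ F x :=
      Finset.single_le_sum (f := fun j => (I j)⁻¹ * f j x) (fun _ _ => bot_le)
        (Finset.mem_univ j)
    calc f j x = I j * ((I j)⁻¹ * f j x) := by
          rw [← mul_assoc, ENNReal.mul_inv_cancel (h0 j) (ht j), one_mul]
      _ ≤ I j * F x := by gcongr
  have hint : ∫⁻ x, F x = N := by
    simp only [F]
    rw [lintegral_finsetSum _ fun j _ => (hf j).const_mul _]
    have : ∀ j ∈ Finset.univ, ∫⁻ x, (I j)⁻¹ * f j x = 1 := fun j _ => by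
      rw [lintegral_const_mul _ (hf j), ENNReal.inv_mul_cancel (h0 j) (ht j)]
    rw [Finset.sum_congr rfl this]
    simp
  have hconj : Real.HolderConjugate (Fintype.card (Fin N)) ((N : ℝ) / (N - 1)) := by
    rw [Fintype.card_fin]
    exact Real.HolderConjugate.conjExponent (by linarith)
  have hgrid := lintegral_prod_lintegral_pow_le (fun _ : Fin N => (volume : Measure ℝ)) hconj hF
  rw [← volume_pi, hint, Fintype.card_fin, ← he] at hgrid
  calc ∫⁻ x, ∏ j, (∫⁻ s, f j (Function.update x j s)) ^ e
      ≤ ∫⁻ x, (∏ j, I j ^ e) * ∏ j, (∫⁻ s, F (Function.update x j s)) ^ e := by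
        refine lintegral_mono fun x => ?_
        rw [← Finset.prod_mul_distrib]
        refine Finset.prod_le_prod' fun j _ => ?_
        rw [← ENNReal.mul_rpow_of_nonneg _ _ he0]
        refine ENNReal.rpow_le_rpow ?_ he0
        rw [← lintegral_const_mul' _ _ (ht j)]
        exact lintegral_mono fun s => hle j _
    _ = (∏ j, I j ^ e) * ∫⁻ x, ∏ j, (∫⁻ s, F (Function.update x j s)) ^ e := by
        refine lintegral_const_mul' _ _ ?_
        refine ENNReal.prod_ne_top fun j _ => ?_
        exact ENNReal.rpow_ne_top_of_nonneg he0 (ht j)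
    _ ≤ _ := by gcongr

/-- The condition `hmean p < N` in terms of `σ = ∑ 1 / p_j`, the parameter in which the exponents
below are computed. -/
lemma sum_inv_gt_one {p : Fin N → ℝ} (hp : ∀ j, 1 < p j) (hN : 2 ≤ N) (hpN : hmean p < N) :
    1 < ∑ j, 1 / p j := by
  have hN' : (2 : ℝ) ≤ N := by exact_mod_cast hN
  have hpos : 0 < ∑ j, 1 / p j := by
    have : NeZero N := ⟨by omega⟩
    exact Finset.sum_pos (fun j _ => one_div_pos.2 (by linarith [hp j])) Finset.univ_nonempty
  unfold hmean at hpN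
  rw [div_lt_iff₀ hpos] at hpN
  nlinarith

lemma sobExp_eq {p : Fin N → ℝ} (hN : 2 ≤ N) (hσ : 1 < ∑ j, 1 / p j) :
    sobExp p = N / (∑ j, 1 / p j - 1) := by
  have hN' : (2 : ℝ) ≤ N := by exact_mod_cast hN
  unfold sobExp hmean
  set σ := ∑ j, 1 / p j
  have h1 : σ - 1 ≠ 0 := by linarith
  have h2 : σ ≠ 0 := by linarith
  have h3 : (N : ℝ) ≠ 0 := by linarith
  have h4 : (N : ℝ) - N / σ = N * (σ - 1) / σ := by field_simp
  rw [h4]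
  field_simp

lemma sobExp_div_hmean {p : Fin N → ℝ} (hN : 2 ≤ N) (hσ : 1 < ∑ j, 1 / p j) :
    sobExp p / hmean p = (∑ j, 1 / p j) / (∑ j, 1 / p j - 1) := by
  have hN' : (2 : ℝ) ≤ N := by exact_mod_cast hN
  rw [sobExp_eq hN hσ]
  unfold hmean
  set σ := ∑ j, 1 / p j
  have h1 : σ - 1 ≠ 0 := by linarith
  have h2 : σ ≠ 0 := by linarith
  have h3 : (N : ℝ) ≠ 0 := by linarith
  field_simp

/-- Solving `Y ≤ C X^{eσ} Y^{e(N-σ)}`, with `e = 1/(N-1)`, for `Y`. -/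
lemma le_of_le_mul_rpow {Nr σ C X Y : ℝ} (hN : 2 ≤ Nr) (hσ : 1 < σ) (hC : 0 ≤ C) (hX : 0 ≤ X)
    (hY : 0 ≤ Y)
    (h : Y ≤ C * (X ^ (1 / (Nr - 1) * σ) * Y ^ (1 / (Nr - 1) * (Nr - σ)))) :
    Y ≤ C ^ ((Nr - 1) / (σ - 1)) * X ^ (σ / (σ - 1)) := by
  rcases hY.eq_or_lt with h0 | h0
  · rw [← h0]
    positivity
  have hN1 : Nr - 1 ≠ 0 := by linarith
  have hσ1 : σ - 1 ≠ 0 := by linarith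
  have h1 : Y ^ ((σ - 1) / (Nr - 1)) ≤ C * X ^ (1 / (Nr - 1) * σ) := by
    have h2 : Y ^ ((σ - 1) / (Nr - 1)) * Y ^ (1 / (Nr - 1) * (Nr - σ)) = Y := by
      rw [← Real.rpow_add h0]
      have : (σ - 1) / (Nr - 1) + 1 / (Nr - 1) * (Nr - σ) = 1 := by field_simp; ring
      rw [this, Real.rpow_one]
    have h3 : 0 < Y ^ (1 / (Nr - 1) * (Nr - σ)) := Real.rpow_pos_of_pos h0 _
    refine le_of_mul_le_mul_right ?_ h3
    rw [h2]
    linarith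
  have hexp : 0 ≤ (Nr - 1) / (σ - 1) := div_nonneg (by linarith) (by linarith)
  have h4 := Real.rpow_le_rpow (by positivity) h1 hexp
  rw [← Real.rpow_mul hY, Real.mul_rpow hC (by positivity), ← Real.rpow_mul hX] at h4
  have e1 : (σ - 1) / (Nr - 1) * ((Nr - 1) / (σ - 1)) = 1 := by field_simp
  have e2 : 1 / (Nr - 1) * σ * ((Nr - 1) / (σ - 1)) = σ / (σ - 1) := by field_simp
  rwa [e1, e2, Real.rpow_one] at h4

/-- The anisotropic Sobolev (Troisi) inequality on `Fin N → ℝ`. -/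
lemma troisi_pi (hN : 2 ≤ N) {p : Fin N → ℝ} (hp : ∀ j, 1 < p j) (hσ : 1 < ∑ j, 1 / p j) :
    ∃ C : ℝ, 0 < C ∧ ∀ u : (Fin N → ℝ) → ℝ, ContDiff ℝ 1 u → HasCompactSupport u →
      ∫ x, |u x| ^ sobExp p ≤ C * (∑ j, ∫ x, |fderiv ℝ u x (Pi.single j 1)| ^ p j) ^
        ((∑ j, 1 / p j) / (∑ j, 1 / p j - 1)) := by
  have hN' : (2 : ℝ) ≤ N := by exact_mod_cast hN
  obtain ⟨σ, hσd⟩ : ∃ σ, σ = ∑ j, 1 / p j := ⟨_, rfl⟩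
  obtain ⟨P, hPd⟩ : ∃ P, P = sobExp p := ⟨_, rfl⟩
  have hP : P = N / (σ - 1) := by rw [hPd, hσd, sobExp_eq hN hσ]
  rw [← hσd] at hσ
  rw [← hσd, ← hPd]
  have hP0 : 0 < P := by rw [hP]; exact div_pos (by linarith) (by linarith)
  obtain ⟨e, he⟩ : ∃ e : ℝ, e = 1 / ((N : ℝ) - 1) := ⟨_, rfl⟩
  have he0 : 0 < e := by rw [he]; exact one_div_pos.2 (by linarith)
  let a : Fin N → ℝ := fun j => (p j).conjExponent
  have hpa : ∀ j, (p j).HolderConjugate (a j) := fun j =>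
    Real.HolderConjugate.conjExponent (hp j)
  -- These exponents are forced: `(t j - 1) a j = P` in Hölder's inequality for `|u| ^ (t j - 1)
  -- |∂_j u|`, and `∑ t j e = P`, so that the product over `j` of the one-dimensional bounds is `|u|
  -- ^ P`.
  let t : Fin N → ℝ := fun j => 1 + P / a j
  have ht : ∀ j, 1 < t j := fun j => by
    have := div_pos hP0 (hpa j).symm.pos
    simp only [t]
    linarith
  have hsa : ∑ j, 1 / a j = N - σ := by
    have : ∀ j ∈ Finset.univ, 1 / a j = 1 - 1 / p j := fun j _ => by
      have := (hpa j).inv_add_inv_eq_one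
      simp only [one_div]
      linarith
    rw [Finset.sum_congr rfl this, Finset.sum_sub_distrib, ← hσd]
    simp
  have hst : ∑ j, t j * e = P := by
    have h1 : ∑ j, t j = N + P * (N - σ) := by
      simp only [t, Finset.sum_add_distrib, div_eq_mul_one_div P, ← Finset.mul_sum, hsa]
      simp
    rw [← Finset.sum_mul, h1, he, hP]
    have h2 : (N : ℝ) - 1 ≠ 0 := by linarith
    have h3 : σ - 1 ≠ 0 := by linarith
    field_simp
    ring
  let C₀ : ℝ := (∏ j, t j ^ e) * (N : ℝ) ^ ((N : ℝ) / (N - 1))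
  have hC₀ : 0 < C₀ := mul_pos (Finset.prod_pos fun j _ =>
    Real.rpow_pos_of_pos (by linarith [ht j]) _) (Real.rpow_pos_of_pos (by linarith) _)
  refine ⟨C₀ ^ (((N : ℝ) - 1) / (σ - 1)), Real.rpow_pos_of_pos hC₀ _, fun u hu hc => ?_⟩
  let D : Fin N → (Fin N → ℝ) → ℝ := fun j x => fderiv ℝ u x (Pi.single j 1)
  have hDc : ∀ j, Continuous (D j) := fun j =>
    (hu.continuous_fderiv (by simp)).clm_apply continuous_const
  have hDs : ∀ j, HasCompactSupport (D j) := fun j => hc.fderiv_apply (𝕜 := ℝ) _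
  let f : Fin N → (Fin N → ℝ) → ℝ := fun j x => t j * |u x| ^ (t j - 1) * |D j x|
  have hfc : ∀ j, Continuous (f j) := fun j =>
    (continuous_const.mul (hu.continuous.abs.rpow_const fun x => Or.inr (by linarith [ht j]))).mul
      (hDc j).abs
  have hf0 : ∀ j x, 0 ≤ f j x := fun j x => by
    have := ht j
    positivity
  have hfs : ∀ j, HasCompactSupport (f j) := fun j =>
    ((hDs j).comp_left (g := fun y => |y|) (by simp)).mul_left
  have hfi : ∀ j, Integrable (f j) := fun j => (hfc j).integrable_of_hasCompactSupport (hfs j)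
  have hIeq : ∀ j, ∫⁻ x, ENNReal.ofReal (f j x) = ENNReal.ofReal (∫ x, f j x) := fun j =>
    (ofReal_integral_eq_lintegral_ofReal (hfi j) (Eventually.of_forall (hf0 j))).symm
  have hpt : ∀ j x, ENNReal.ofReal (|u x| ^ t j)
      ≤ ∫⁻ s, ENNReal.ofReal (f j (Function.update x j s)) := fun j x =>
    ofReal_abs_rpow_le_lintegral hu hc (ht j) j x
  set Y := ∫ x, |u x| ^ P with hY
  have hY0 : 0 ≤ Y := integral_nonneg fun x => by positivity
  set Xj : Fin N → ℝ := fun j => ∫ x, |D j x| ^ p j with hXj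
  have hXj0 : ∀ j, 0 ≤ Xj j := fun j => integral_nonneg fun x => by positivity
  have hX0 : 0 ≤ ∑ j, Xj j := Finset.sum_nonneg fun j _ => hXj0 j
  -- The product inequality normalizes by the integrals and needs them nonzero. If one of them
  -- vanishes, the bound along coordinate lines shows that `u = 0`.
  by_cases hzero : ∃ j, ∫⁻ x, ENNReal.ofReal (f j x) = 0
  · obtain ⟨j, hj⟩ := hzero
    have h1 : ∀ x, f j x = 0 := by
      have h2 := (lintegral_eq_zero_iff (hfc j).measurable.ennreal_ofReal).1 hj
      have h3 : f j =ᵐ[volume] 0 := by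
        filter_upwards [h2] with x hx
        exact le_antisymm (ENNReal.ofReal_eq_zero.1 hx) (hf0 j x)
      exact fun x => congrFun (((hfc j).ae_eq_iff_eq volume continuous_const).1 h3) x
    have h2 : ∀ x, u x = 0 := by
      intro x
      have := hpt j x
      simp only [h1, ENNReal.ofReal_zero, lintegral_zero, nonpos_iff_eq_zero,
        ENNReal.ofReal_eq_zero] at this
      by_contra hne
      exact absurd (Real.rpow_pos_of_pos (abs_pos.2 hne) (t j)) (not_lt.2 this)
    have : Y = 0 := by
      rw [hY]
      simp [h2, Real.zero_rpow hP0.ne']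
    rw [this]
    positivity
  push Not at hzero
  have hmain := lintegral_prod_le_prod_lintegral hN
    (fun j => (hfc j).measurable.ennreal_ofReal) hzero
    (fun j => by rw [hIeq]; exact ENNReal.ofReal_ne_top)
  have hYi : Integrable fun x => |u x| ^ P :=
    (hu.continuous.abs.rpow_const fun x => Or.inr hP0.le).integrable_of_hasCompactSupport
      (hc.comp_left (g := fun y => |y| ^ P) (by simp [Real.zero_rpow hP0.ne']))
  have hL : ENNReal.ofReal Y ≤ ∫⁻ x, ∏ j, (∫⁻ s, ENNReal.ofReal (f j (Function.update x j s))) ^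
      (1 / ((N : ℝ) - 1)) := by
    rw [hY, ofReal_integral_eq_lintegral_ofReal hYi (Eventually.of_forall fun x => by positivity)]
    refine lintegral_mono fun x => ?_
    have : ENNReal.ofReal (|u x| ^ P) = ∏ j, ENNReal.ofReal (|u x| ^ t j) ^ e := by
      rw [← hst]
      rcases eq_or_ne (u x) 0 with h | h
      · have h1 : (0 : ℝ) < ∑ j, t j * e := by rw [hst]; exact hP0
        rw [h, abs_zero, Real.zero_rpow h1.ne', ENNReal.ofReal_zero]
        symm
        refine Finset.prod_eq_zero (Finset.mem_univ ⟨0, by omega⟩) ?_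
        rw [Real.zero_rpow (by linarith [ht ⟨0, by omega⟩]), ENNReal.ofReal_zero,
          ENNReal.zero_rpow_of_pos he0]
      · have h' : 0 < |u x| := abs_pos.2 h
        rw [Real.rpow_sum_of_pos h', ENNReal.ofReal_prod_of_nonneg fun j _ => by positivity]
        refine Finset.prod_congr rfl fun j _ => ?_
        rw [ENNReal.ofReal_rpow_of_nonneg (by positivity) he0.le, ← Real.rpow_mul (abs_nonneg _)]
    rw [this, he]
    refine Finset.prod_le_prod' fun j _ => ?_
    exact ENNReal.rpow_le_rpow (hpt j x) (he ▸ he0.le)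
  have hIle : ∀ j, ∫ x, f j x ≤ t j * (Xj j ^ (1 / p j) * Y ^ (1 / a j)) := by
    intro j
    have h1 : MemLp (fun x => |u x| ^ (t j - 1)) (ENNReal.ofReal (a j)) :=
      (hu.continuous.abs.rpow_const fun x =>
        Or.inr (by linarith [ht j])).memLp_of_hasCompactSupport
          (hc.comp_left (g := fun y => |y| ^ (t j - 1))
            (by simp [Real.zero_rpow (by linarith [ht j] : t j - 1 ≠ 0)]))
    have h2 : MemLp (fun x => |D j x|) (ENNReal.ofReal (p j)) :=
      (hDc j).abs.memLp_of_hasCompactSupport ((hDs j).comp_left (g := fun y => |y|) (by simp))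
    have h3 := integral_mul_le_Lp_mul_Lq_of_nonneg (μ := (volume : Measure (Fin N → ℝ))) (hpa j)
      (Eventually.of_forall fun x => abs_nonneg _) (Eventually.of_forall fun x => by positivity)
      h2 h1
    have h4 : ∀ x, (|u x| ^ (t j - 1)) ^ a j = |u x| ^ P := fun x => by
      rw [← Real.rpow_mul (abs_nonneg _)]
      congr 1
      have := (hpa j).symm.pos.ne'
      simp only [t]
      field_simp
      ring
    simp only [h4] at h3
    have h5 : ∫ x, f j x = t j * ∫ x, |D j x| * |u x| ^ (t j - 1) := by
      rw [← integral_const_mul]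
      refine integral_congr_ae (Eventually.of_forall fun x => ?_)
      simp only [f]
      ring
    rw [h5]
    exact mul_le_mul_of_nonneg_left h3 (by linarith [ht j])
  -- Hölder's inequality in each factor brings back a power of `Y` whose exponent `(N - σ) / (N -
  -- 1)` is less than one because `σ > 1`; it is absorbed into the left side.
  have hfin : Y ≤ C₀ * ((∑ j, Xj j) ^ (1 / ((N : ℝ) - 1) * σ) *
      Y ^ (1 / ((N : ℝ) - 1) * (N - σ))) := by
    have h1 := hL.trans hmain
    simp only [hIeq] at h1
    rw [← he] at h1
    have h2 : (∏ j, ENNReal.ofReal (∫ x, f j x) ^ e) * (N : ℝ≥0∞) ^ ((N : ℝ) / (N - 1))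
        ≤ ENNReal.ofReal (C₀ * ((∑ j, Xj j) ^ (e * σ) * Y ^ (e * (N - σ)))) := by
      have h3 : ∀ j ∈ Finset.univ, ENNReal.ofReal (∫ x, f j x) ^ e
          ≤ ENNReal.ofReal (t j ^ e * ((∑ j, Xj j) ^ (1 / p j * e) * Y ^ (1 / a j * e))) := by
        intro j _
        rw [ENNReal.ofReal_rpow_of_nonneg (integral_nonneg (hf0 j)) he0.le]
        refine ENNReal.ofReal_le_ofReal ?_
        have htj : 0 ≤ t j := by linarith [ht j]
        have hpj : 0 ≤ 1 / p j := one_div_nonneg.2 (hpa j).pos.le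
        rw [Real.rpow_mul hX0, Real.rpow_mul hY0, ← Real.mul_rpow (by positivity) (by positivity),
          ← Real.mul_rpow htj (by positivity)]
        refine Real.rpow_le_rpow (integral_nonneg (hf0 j)) ((hIle j).trans ?_) he0.le
        refine mul_le_mul_of_nonneg_left ?_ htj
        refine mul_le_mul_of_nonneg_right ?_ (by positivity)
        exact Real.rpow_le_rpow (hXj0 j)
          (Finset.single_le_sum (fun j _ => hXj0 j) (Finset.mem_univ j)) hpj
      refine (mul_le_mul_left (Finset.prod_le_prod' h3) _).trans (le_of_eq ?_)
      have hnn : ∀ j ∈ Finset.univ,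
          0 ≤ t j ^ e * ((∑ j, Xj j) ^ (1 / p j * e) * Y ^ (1 / a j * e)) := fun j _ => by
        have htj : 0 ≤ t j := by linarith [ht j]
        positivity
      rw [← ENNReal.ofReal_prod_of_nonneg hnn, ← ENNReal.ofReal_natCast,
        ENNReal.ofReal_rpow_of_nonneg (by linarith) (div_nonneg (by linarith) (by linarith)),
        ← ENNReal.ofReal_mul (Finset.prod_nonneg hnn)]
      congr 1
      rw [Finset.prod_mul_distrib, Finset.prod_mul_distrib]
      have e1 : ∏ j, (∑ j, Xj j) ^ (1 / p j * e) = (∑ j, Xj j) ^ (e * σ) := by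
        rw [hσd, mul_comm e, Finset.sum_mul]
        exact (Real.rpow_sum_of_nonneg hX0 fun j _ =>
          mul_nonneg (one_div_nonneg.2 (hpa j).pos.le) he0.le).symm
      have e2 : ∏ j, Y ^ (1 / a j * e) = Y ^ (e * (N - σ)) := by
        rw [← hsa, mul_comm e, Finset.sum_mul]
        exact (Real.rpow_sum_of_nonneg hY0 fun j _ =>
          mul_nonneg (one_div_nonneg.2 (hpa j).symm.pos.le) he0.le).symm
      rw [e1, e2]
      simp only [C₀]
      ring
    rw [← he]
    exact (ENNReal.ofReal_le_ofReal_iff (by positivity)).1 (h1.trans h2)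
  exact le_of_le_mul_rpow hN' hσ hC₀.le hX0 hY0 hfin

/-- The anisotropic Sobolev (Troisi) inequality. -/
theorem troisi (hN : 2 ≤ N) {p : Fin N → ℝ} (hp : ∀ j, 1 < p j) (hpN : hmean p < N) :
    ∃ C : ℝ, 0 < C ∧ ∀ φ : Eu N → ℝ, ContDiff ℝ 1 φ → HasCompactSupport φ →
      ∫ x, |φ x| ^ sobExp p ≤
        C * (∑ j, ∫ x, |pderiv j φ x| ^ p j) ^ (sobExp p / hmean p) := by
  have hσ := sum_inv_gt_one hp hN hpN
  obtain ⟨C, hC, h⟩ := troisi_pi hN hp hσ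
  refine ⟨C, hC, fun φ hφ hc => ?_⟩
  let L : (Fin N → ℝ) ≃L[ℝ] Eu N := (EuclideanSpace.equiv (Fin N) ℝ).symm
  have hmp : MeasurePreserving L volume volume := PiLp.volume_preserving_toLp (Fin N)
  have hme : MeasurableEmbedding L := L.toHomeomorph.measurableEmbedding
  have h1 := h (φ ∘ L) (hφ.comp L.contDiff) (hc.comp_homeomorph L.toHomeomorph)
  have hd : ∀ j x, fderiv ℝ (φ ∘ L) x (Pi.single j 1) = pderiv j φ (L x) := by
    intro j x
    rw [fderiv_comp x (hφ.differentiable one_ne_zero _) L.differentiableAt, L.fderiv]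
    rfl
  simp only [hd] at h1
  rw [sobExp_div_hmean hN hσ]
  have h2 : ∫ x, |(φ ∘ L) x| ^ sobExp p = ∫ x, |φ x| ^ sobExp p :=
    hmp.integral_comp hme fun y => |φ y| ^ sobExp p
  have h3 : ∀ j, ∫ x, |pderiv j φ (L x)| ^ p j = ∫ x, |pderiv j φ x| ^ p j := fun j =>
    hmp.integral_comp hme fun y => |pderiv j φ y| ^ p j
  simpa only [h2, h3] using h1

end Sobolev

end AnisoElliptic

end

/-! ### Sobolev and Poincaré inequalities, duality and weak compactness in the space `W0` -/

noncomputable section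

set_option linter.unusedSectionVars false

namespace AnisoElliptic

namespace W0

variable {N : ℕ} {Ω : Set (Eu N)} {p : Fin N → ℝ} [hp : Fact (∀ j, 1 < p j)]

lemma p_pos (p : Fin N → ℝ) [hp : Fact (∀ j, 1 < p j)] (j : Fin N) : 0 < p j :=
  zero_lt_one.trans (hp.out j)

lemma fn_add (u v : W0 Ω p) : (u + v).fn = u.fn + v.fn := rfl
lemma fn_sub (u v : W0 Ω p) : (u - v).fn = u.fn - v.fn := rfl
lemma fn_smul (c : ℝ) (u : W0 Ω p) : (c • u).fn = c • u.fn := rfl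
lemma der_add (u v : W0 Ω p) (j : Fin N) : (u + v).der j = u.der j + v.der j := rfl
lemma der_sub (u v : W0 Ω p) (j : Fin N) : (u - v).der j = u.der j - v.der j := rfl
lemma der_smul (c : ℝ) (u : W0 Ω p) (j : Fin N) : (c • u).der j = c • u.der j := rfl

/-- `w` is the element of `W_0^{1,p}(Ω)` given by the test function `φ`. -/
structure OfTest (w : W0 Ω p) (φ : Eu N → ℝ) : Prop where
  isTest : IsTest Ω φ
  fn_eq : w.fn =ᵐ[leb Ω] φ
  der_eq : ∀ j, w.der j =ᵐ[leb Ω] pderiv j φ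

lemma exists_seq_ofTest (u : W0 Ω p) : ∃ (w : ℕ → W0 Ω p) (φ : ℕ → Eu N → ℝ),
    (∀ k, OfTest (w k) (φ k)) ∧ Tendsto (fun k => (w k).fn) atTop (𝓝 u.fn) ∧
      ∀ j, Tendsto (fun k => (w k).der j) atTop (𝓝 (u.der j)) := by
  obtain ⟨x, hx, hlim⟩ := mem_closure_iff_seq_limit.1
    (show Subtype.val (p := (· ∈ closedPairs Ω p)) u ∈ closure (testPairs Ω p : Set (Pairs Ω p))
      from Subtype.property (p := (· ∈ closedPairs Ω p)) u)
  have hx2 := hx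
  choose φ h1 h2 h3 using hx2
  refine ⟨fun k => ⟨x k, subset_closure (hx k)⟩, φ, fun k => ⟨h1 k, h2 k, h3 k⟩,
    (continuous_fst.tendsto _).comp hlim, fun j => ?_⟩
  exact (((continuous_apply j).comp continuous_snd).tendsto _).comp hlim

lemma exists_of_tendsto_pair {w : ℕ → W0 Ω p} {f : Lp ℝ 1 (leb Ω)}
    {g : ∀ j, Lp ℝ (ENNReal.ofReal (p j)) (leb Ω)}
    (hf : Tendsto (fun k => (w k).fn) atTop (𝓝 f))
    (hg : ∀ j, Tendsto (fun k => (w k).der j) atTop (𝓝 (g j))) :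
    ∃ u : W0 Ω p, u.fn = f ∧ ∀ j, u.der j = g j := by
  have hc : IsClosed (closedPairs Ω p : Set (Pairs Ω p)) :=
    Submodule.isClosed_topologicalClosure _
  have hm : ((f, g) : Pairs Ω p) ∈ (closedPairs Ω p : Set (Pairs Ω p)) := by
    refine hc.mem_of_tendsto (f := fun k => ((w k : W0 Ω p) : ↥(closedPairs Ω p)).1) (b := atTop)
      ?_ (Eventually.of_forall fun k => Subtype.property (p := (· ∈ closedPairs Ω p)) (w k))
    exact (Prod.tendsto_iff _ _).2 ⟨hf, tendsto_pi_nhds.2 hg⟩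
  exact ⟨⟨(f, g), hm⟩, rfl, fun _ => rfl⟩

/-- The energy `∑_j ∫ |∂_j u|^{p_j}`. -/
def energy (u : W0 Ω p) : ℝ := ∑ j, ∫ x in Ω, |u.der j x| ^ p j

lemma energy_eq (u : W0 Ω p) : u.energy = ∑ j, ‖u.der j‖ ^ p j :=
  Finset.sum_congr rfl fun j _ => (Lp_norm_rpow_eq (p_pos p j) (u.der j)).symm

lemma energy_nonneg (u : W0 Ω p) : 0 ≤ u.energy := by
  rw [energy_eq]
  exact Finset.sum_nonneg fun j _ => by positivity

lemma norm_der_le (u : W0 Ω p) (j : Fin N) : ‖u.der j‖ ≤ ‖u‖ :=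
  Finset.single_le_sum (f := fun j => ‖u.der j‖) (fun j _ => norm_nonneg (u.der j))
    (Finset.mem_univ j)

lemma norm_nonneg' (u : W0 Ω p) : 0 ≤ ‖u‖ := Finset.sum_nonneg fun j _ => norm_nonneg (u.der j)

lemma energy_le {u : W0 Ω p} {R : ℝ} (h : ‖u‖ ≤ R) : u.energy ≤ ∑ j, R ^ p j := by
  rw [energy_eq]
  exact Finset.sum_le_sum fun j _ =>
    Real.rpow_le_rpow (norm_nonneg _) ((norm_der_le u j).trans h) (p_pos p j).le

/-- If `m` is a lower bound of the exponents, then `‖u‖ ≤ N (1 + X)^{1/m}` where `X` is the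
energy. -/
lemma norm_le_energy (u : W0 Ω p) {m : ℝ} (hm : 0 < m) (hmp : ∀ j, m ≤ p j) :
    ‖u‖ ≤ N * (1 + u.energy) ^ (1 / m) := by
  have : ∀ j ∈ Finset.univ, ‖u.der j‖ ≤ (1 + u.energy) ^ (1 / m) := by
    intro j _
    have h1 : ‖u.der j‖ ^ p j ≤ 1 + u.energy := by
      have := Finset.single_le_sum (f := fun j => ‖u.der j‖ ^ p j) (fun j _ => by positivity)
        (Finset.mem_univ j)
      rw [energy_eq]
      linarith
    -- The summand `1` makes powers increase with the exponent, so that `1 / p j` can be replaced by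
    -- the larger `1 / m`.
    have h2 : (1 : ℝ) ≤ 1 + u.energy := by linarith [u.energy_nonneg]
    calc ‖u.der j‖ = (‖u.der j‖ ^ p j) ^ (1 / p j) := by
          rw [← Real.rpow_mul (norm_nonneg _), mul_one_div_cancel (p_pos p j).ne', Real.rpow_one]
      _ ≤ (1 + u.energy) ^ (1 / p j) :=
          Real.rpow_le_rpow (by positivity) h1 (one_div_nonneg.2 (p_pos p j).le)
      _ ≤ (1 + u.energy) ^ (1 / m) :=
          Real.rpow_le_rpow_of_exponent_le h2 (one_div_le_one_div_of_le hm (hmp j))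
  rw [norm_def]
  refine (Finset.sum_le_sum this).trans ?_
  simp

lemma continuous_energy_of_der {w : ℕ → W0 Ω p} {u : W0 Ω p}
    (h : ∀ j, Tendsto (fun k => (w k).der j) atTop (𝓝 (u.der j))) :
    Tendsto (fun k => (w k).energy) atTop (𝓝 u.energy) := by
  simp only [energy_eq]
  exact tendsto_finsetSum _ fun j _ => ((h j).norm).rpow_const (Or.inr (p_pos p j).le)

lemma setIntegral_of_isTest {φ : Eu N → ℝ} (hφ : IsTest Ω φ) {F : ℝ → ℝ} (hF : F 0 = 0) :
    ∫ x in Ω, F (φ x) = ∫ x, F (φ x) := by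
  refine setIntegral_eq_integral_of_forall_compl_eq_zero fun x hx => ?_
  rw [image_eq_zero_of_notMem_tsupport fun h => hx (hφ.supp h), hF]

lemma pderiv_eq_zero {φ : Eu N → ℝ} (hφ : tsupport φ ⊆ Ω) {x : Eu N} (hx : x ∉ Ω) (j : Fin N) :
    pderiv j φ x = 0 := by
  have : x ∉ tsupport (fderiv ℝ φ) := fun h => hx (hφ (tsupport_fderiv_subset ℝ h))
  simp [pderiv, image_eq_zero_of_notMem_tsupport this]

lemma setIntegral_pderiv_of_isTest {φ : Eu N → ℝ} (hφ : IsTest Ω φ) (j : Fin N) {F : ℝ → ℝ}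
    (hF : F 0 = 0) : ∫ x in Ω, F (pderiv j φ x) = ∫ x, F (pderiv j φ x) := by
  refine setIntegral_eq_integral_of_forall_compl_eq_zero fun x hx => ?_
  rw [pderiv_eq_zero hφ.supp hx, hF]

section Sobolev

variable [hN : Fact (2 ≤ N)] [hpN : Fact (hmean p < N)]

variable (p) in
lemma hmean_gt_one :
    1 < hmean p := by
  have : NeZero N := ⟨by have := hN.out; omega⟩
  have hpos : 0 < ∑ j, 1 / p j :=
    Finset.sum_pos (fun j _ => one_div_pos.2 (p_pos p j)) Finset.univ_nonempty
  unfold hmean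
  rw [lt_div_iff₀ hpos, one_mul]
  have h : ∑ j, 1 / p j < ∑ _j : Fin N, (1 : ℝ) :=
    Finset.sum_lt_sum_of_nonempty Finset.univ_nonempty fun j _ =>
      (div_lt_one (p_pos p j)).2 (hp.out j)
  simpa using h

variable (p) in
lemma sobExp_gt_one : 1 < sobExp p := by
  have h1 := hmean_gt_one p
  have h2 := hpN.out
  have h3 : (2 : ℝ) ≤ N := by exact_mod_cast hN.out
  unfold sobExp
  rw [lt_div_iff₀ (by linarith)]
  nlinarith

variable (Ω p) in
/-- The anisotropic Sobolev inequality in `W_0^{1,p}(Ω)`. -/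
theorem sobolev : ∃ C : ℝ, 0 < C ∧ ∀ u : W0 Ω p,
      MemLp u.fn (ENNReal.ofReal (sobExp p)) (leb Ω) ∧
      ∫ x in Ω, |u.fn x| ^ sobExp p ≤ C * u.energy ^ (sobExp p / hmean p) := by
  obtain ⟨C, hC, hT⟩ := troisi hN.out hp.out hpN.out
  have hP : 0 < sobExp p := zero_lt_one.trans (sobExp_gt_one p)
  have hh : 0 < hmean p := zero_lt_one.trans (hmean_gt_one p)
  refine ⟨C, hC, fun u => ?_⟩
  obtain ⟨w, φ, hw, hfn, hder⟩ := exists_seq_ofTest u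
  have htest : ∀ k, ∫⁻ x in Ω, ENNReal.ofReal (|(w k).fn x| ^ sobExp p)
      ≤ ENNReal.ofReal (C * (w k).energy ^ (sobExp p / hmean p)) := by
    intro k
    have h1 := hT (φ k) ((hw k).isTest.smooth.of_le (by simp)) (hw k).isTest.compact
    have h2 : ∀ j, ∫ x, |pderiv j (φ k) x| ^ p j = ∫ x in Ω, |(w k).der j x| ^ p j := by
      intro j
      rw [← setIntegral_pderiv_of_isTest (hw k).isTest j (F := fun y => |y| ^ p j)
        (by simp [Real.zero_rpow (p_pos p j).ne'])]
      refine integral_congr_ae ?_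
      filter_upwards [(hw k).der_eq j] with x hx
      rw [hx]
    simp only [h2] at h1
    rw [← setIntegral_of_isTest (hw k).isTest (F := fun y => |y| ^ sobExp p)
      (by simp [Real.zero_rpow hP.ne'])] at h1
    have hint : Integrable (fun x => |φ k x| ^ sobExp p) (leb Ω) :=
      (((hw k).isTest.smooth.continuous.abs.rpow_const fun x =>
        Or.inr hP.le).integrable_of_hasCompactSupport
        ((hw k).isTest.compact.comp_left (g := fun y => |y| ^ sobExp p)
          (by simp [Real.zero_rpow hP.ne']))).restrict
    have h3 : ∫⁻ x in Ω, ENNReal.ofReal (|(w k).fn x| ^ sobExp p)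
        = ENNReal.ofReal (∫ x in Ω, |φ k x| ^ sobExp p) := by
      rw [ofReal_integral_eq_lintegral_ofReal hint (Eventually.of_forall fun x => by positivity)]
      refine lintegral_congr_ae ?_
      filter_upwards [(hw k).fn_eq] with x hx
      rw [hx]
    rw [h3]
    exact ENNReal.ofReal_le_ofReal h1
  -- The approximating test functions converge only in `L^1`, but their energies converge. Fatou's
  -- lemma along an almost everywhere convergent subsequence transfers the inequality to `u`.
  obtain ⟨ns, hns, hae⟩ := (tendstoInMeasure_of_tendsto_Lp hfn).exists_seq_tendsto_ae
  have hfatou : ∫⁻ x in Ω, ENNReal.ofReal (|u.fn x| ^ sobExp p)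
      ≤ ENNReal.ofReal (C * u.energy ^ (sobExp p / hmean p)) := by
    have h1 : ∫⁻ x in Ω, ENNReal.ofReal (|u.fn x| ^ sobExp p)
        ≤ ∫⁻ x in Ω, liminf (fun k => ENNReal.ofReal (|(w (ns k)).fn x| ^ sobExp p)) atTop := by
      refine lintegral_mono_ae ?_
      filter_upwards [hae] with x hx
      have : Tendsto (fun k => ENNReal.ofReal (|(w (ns k)).fn x| ^ sobExp p)) atTop
          (𝓝 (ENNReal.ofReal (|u.fn x| ^ sobExp p))) :=
        (ENNReal.continuous_ofReal.tendsto _).comp ((hx.abs).rpow_const (Or.inr hP.le))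
      rw [this.liminf_eq]
    refine h1.trans ((lintegral_liminf_le' (u := atTop) fun k => ?_).trans ?_)
    · exact ((Lp.aestronglyMeasurable _).aemeasurable.abs.pow_const _).ennreal_ofReal
    · have h2 : Tendsto (fun k => ENNReal.ofReal (C * (w (ns k)).energy ^ (sobExp p / hmean p)))
          atTop (𝓝 (ENNReal.ofReal (C * u.energy ^ (sobExp p / hmean p)))) := by
        refine (ENNReal.continuous_ofReal.tendsto _).comp (Tendsto.const_mul _ ?_)
        exact (((continuous_energy_of_der hder).comp hns.tendsto_atTop).rpow_const
          (Or.inr (by positivity)))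
      rw [← h2.liminf_eq]
      exact liminf_le_liminf (Eventually.of_forall fun k => htest (ns k))
  have hmeas := Lp.aestronglyMeasurable u.fn
  have hint : Integrable (fun x => |u.fn x| ^ sobExp p) (leb Ω) := by
    refine ⟨(hmeas.aemeasurable.abs.pow_const _).aestronglyMeasurable, ?_⟩
    rw [hasFiniteIntegral_iff_ofReal (Eventually.of_forall fun x => by positivity)]
    exact hfatou.trans_lt ENNReal.ofReal_lt_top
  refine ⟨?_, ?_⟩
  · refine (integrable_norm_rpow_iff hmeas (by simpa using hP) (by simp)).1 ?_
    simpa [ENNReal.toReal_ofReal hP.le] using hint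
  · rw [← ofReal_integral_eq_lintegral_ofReal hint (Eventually.of_forall fun x => by positivity)]
      at hfatou
    have h0 := u.energy_nonneg
    exact (ENNReal.ofReal_le_ofReal_iff (by positivity)).1 hfatou

variable [NeZero N] [hfin : IsFiniteMeasure (leb Ω)]

lemma abs_le_one_add_rpow (x : ℝ) {r : ℝ} (hr : 1 ≤ r) : |x| ≤ 1 + |x| ^ r := by
  rcases le_total |x| 1 with h | h
  · have : 0 ≤ |x| ^ r := by positivity
    linarith
  · have := Real.rpow_le_rpow_of_exponent_le h hr
    rw [Real.rpow_one] at this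
    linarith

variable (Ω p) in
/-- The Poincaré inequality. -/
theorem poincare :
    ∃ C : ℝ, 0 ≤ C ∧ ∀ u : W0 Ω p, ‖u.fn‖ ≤ C * ‖u‖ := by
  obtain ⟨C, hC, hT⟩ := sobolev Ω p
  have hP := sobExp_gt_one p
  have hh : 0 < hmean p := zero_lt_one.trans (hmean_gt_one p)
  set K := (leb Ω).real Set.univ + C * (N : ℝ) ^ (sobExp p / hmean p) with hK
  -- The energy is not homogeneous in `u`, so the estimate is first obtained on the unit ball and
  -- then scaled.
  have hunit : ∀ u : W0 Ω p, ‖u‖ ≤ 1 → ‖u.fn‖ ≤ K := by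
    intro u hu
    have hE : u.energy ≤ N := by simpa using energy_le hu
    obtain ⟨hL, hI⟩ := hT u
    have hint : Integrable (fun x => |u.fn x| ^ sobExp p) (leb Ω) :=
      integrable_abs_rpow (zero_lt_one.trans hP) hL
    have h1 : ‖u.fn‖ ≤ ∫ x in Ω, (1 + |u.fn x| ^ sobExp p) := by
      rw [L1.norm_eq_integral_norm]
      exact integral_mono (L1.integrable_coeFn _).norm ((integrable_const _).add hint)
        fun x => abs_le_one_add_rpow _ hP.le
    rw [integral_add (integrable_const _) hint] at h1
    refine h1.trans ?_
    rw [hK]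
    refine add_le_add (by simp) (hI.trans ?_)
    refine mul_le_mul_of_nonneg_left ?_ hC.le
    exact Real.rpow_le_rpow u.energy_nonneg hE (by positivity)
  refine ⟨K, by positivity, fun u => ?_⟩
  rcases eq_or_ne u 0 with rfl | h
  · have : (0 : W0 Ω p).fn = 0 := rfl
    rw [this, norm_zero]
    positivity
  · have h0 : 0 < ‖u‖ := norm_pos_iff.2 h
    have := hunit (‖u‖⁻¹ • u) (by rw [norm_smul]; simp [h0.ne'])
    rw [fn_smul, norm_smul, norm_inv, norm_norm, inv_mul_le_iff₀ h0] at this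
    linarith

variable (Ω p) in
/-- `u ↦ u` as a continuous map `W_0^{1,p}(Ω) → L^1(Ω)`. -/
def fnL :
    W0 Ω p →L[ℝ] Lp ℝ 1 (leb Ω) :=
  LinearMap.mkContinuous
    { toFun := fn
      map_add' := fn_add
      map_smul' := fn_smul } (poincare Ω p).choose (poincare Ω p).choose_spec.2

lemma fnL_apply (u : W0 Ω p) : fnL Ω p u = u.fn := rfl

variable (Ω p) in
/-- `u ↦ ∂_j u` as a continuous map `W_0^{1,p}(Ω) → L^{p_j}(Ω)`. -/
def derL (j : Fin N) :
    W0 Ω p →L[ℝ] Lp ℝ (ENNReal.ofReal (p j)) (leb Ω) :=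
  LinearMap.mkContinuous
    { toFun := fun u => u.der j
      map_add' := fun u v => der_add u v j
      map_smul' := fun c u => der_smul c u j } 1 fun u => by
        rw [one_mul]
        exact norm_der_le u j

lemma derL_apply (u : W0 Ω p) (j : Fin N) : derL Ω p j u = u.der j := rfl

/-- The gradients of elements of `W_0^{1,p}(Ω)` form a closed set. -/
theorem exists_of_tendsto_der {w : ℕ → W0 Ω p} {g : ∀ j, Lp ℝ (ENNReal.ofReal (p j)) (leb Ω)}
    (hg : ∀ j, Tendsto (fun k => (w k).der j) atTop (𝓝 (g j))) :
    ∃ u : W0 Ω p, (∀ j, u.der j = g j) ∧ Tendsto w atTop (𝓝 u) := by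
  have hcauchy : CauchySeq w := by
    rw [cauchySeq_iff_tendsto_dist_atTop_0]
    have : ∀ n : ℕ × ℕ, dist (w n.1) (w n.2) = ∑ j, dist ((w n.1).der j) ((w n.2).der j) := by
      intro n
      simp only [dist_eq_norm]
      rfl
    simp only [this]
    rw [← Finset.sum_const_zero (s := (Finset.univ : Finset (Fin N)))]
    exact tendsto_finsetSum _ fun j _ =>
      cauchySeq_iff_tendsto_dist_atTop_0.1 (hg j).cauchySeq
  -- By the Poincaré inequality, convergence of the gradients forces convergence of the functions in
  -- `L^1`, so the limits belong to an element of the space.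
  have hcf : CauchySeq fun k => (w k).fn :=
    (fnL Ω p).uniformContinuous.comp_cauchySeq hcauchy
  obtain ⟨f, hf⟩ := cauchySeq_tendsto_of_complete hcf
  obtain ⟨u, -, hu⟩ := exists_of_tendsto_pair (f := f) hf hg
  refine ⟨u, hu, ?_⟩
  rw [tendsto_iff_norm_sub_tendsto_zero]
  have : ∀ k, ‖w k - u‖ = ∑ j, ‖(w k).der j - g j‖ := fun k => by
    simp only [← hu]
    rfl
  simp only [this]
  rw [← Finset.sum_const_zero (s := (Finset.univ : Finset (Fin N)))]
  exact tendsto_finsetSum _ fun j _ => tendsto_iff_norm_sub_tendsto_zero.1 (hg j)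

lemma tendsto_of_tendsto_der {w : ℕ → W0 Ω p} {u : W0 Ω p}
    (hg : ∀ j, Tendsto (fun k => (w k).der j) atTop (𝓝 (u.der j))) : Tendsto w atTop (𝓝 u) := by
  rw [tendsto_iff_norm_sub_tendsto_zero]
  have : ∀ k, ‖w k - u‖ = ∑ j, ‖(w k).der j - u.der j‖ := fun k => rfl
  simp only [this]
  rw [← Finset.sum_const_zero (s := (Finset.univ : Finset (Fin N)))]
  exact tendsto_finsetSum _ fun j _ => tendsto_iff_norm_sub_tendsto_zero.1 (hg j)

/-- Functionals on `W_0^{1,p}(Ω)` are sums of functionals of the partial derivatives. -/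
theorem exists_dual_repr (F : StrongDual ℝ (W0 Ω p)) :
    ∃ G : ∀ j, StrongDual ℝ (Lp ℝ (ENNReal.ofReal (p j)) (leb Ω)),
      ∀ u, F u = ∑ j, G j (u.der j) := by
  let D : W0 Ω p →ₗ[ℝ] (∀ j, Lp ℝ (ENNReal.ofReal (p j)) (leb Ω)) :=
    { toFun := fun u j => u.der j
      map_add' := fun _ _ => rfl
      map_smul' := fun _ _ => rfl }
  have hD : Function.Injective D := by
    rw [injective_iff_map_eq_zero]
    exact fun u hu => eq_zero_of_der u fun j => congrFun hu j
  let e := LinearEquiv.ofInjective D hD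
  have he : ∀ s, D (e.symm s) = s := fun s => by
    have := congrArg Subtype.val (e.apply_symm_apply s)
    exact this
  -- The gradient embeds the space in the product of the `L^{p_j}`. The functional, transported to
  -- the range, extends by Hahn–Banach and then splits into its components.
  let f : StrongDual ℝ (LinearMap.range D) :=
    LinearMap.mkContinuous ((F : W0 Ω p →ₗ[ℝ] ℝ) ∘ₗ e.symm.toLinearMap) (‖F‖ * N) fun s => by
      refine (F.le_opNorm _).trans ?_
      rw [mul_assoc]
      refine mul_le_mul_of_nonneg_left ?_ (norm_nonneg _)
      have h1 : ‖e.symm s‖ = ∑ j, ‖D (e.symm s) j‖ := rfl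
      refine h1.trans_le ?_
      rw [he]
      refine (Finset.sum_le_sum (g := fun _ => ‖s‖) fun j _ => ?_).trans (by simp)
      exact norm_le_pi_norm (s : ∀ j, Lp ℝ (ENNReal.ofReal (p j)) (leb Ω)) j
  obtain ⟨g, hg, -⟩ := exists_extension_norm_eq _ f
  refine ⟨fun j => g.comp (ContinuousLinearMap.single ℝ
        (fun j => Lp ℝ (ENNReal.ofReal (p j)) (leb Ω)) j), fun u => ?_⟩
  have h1 : F u = g (D u) := by
    have h2 := hg (e u)
    have h3 : f (e u) = F (e.symm (e u)) := rfl
    rw [h3, e.symm_apply_apply] at h2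
    exact h2.symm
  rw [h1]
  conv_lhs => rw [← Finset.univ_sum_single (D u)]
  rw [map_sum]
  rfl

lemma weakConv_of_der {u : ℕ → W0 Ω p} {v : W0 Ω p}
    (h : ∀ j (G : StrongDual ℝ (Lp ℝ (ENNReal.ofReal (p j)) (leb Ω))),
      Tendsto (fun n => G ((u n).der j)) atTop (𝓝 (G (v.der j)))) : WeakConv u v := by
  intro F
  obtain ⟨G, hG⟩ := exists_dual_repr F
  simp only [hG]
  exact tendsto_finsetSum _ fun j _ => h j (G j)

/-- Subsequences are extracted one coordinate at a time. That the limits form a gradient is a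
separate matter, settled in `exists_weakConv_subseq`. -/
lemma exists_weak_subseq_der {u : ℕ → W0 Ω p} {R : ℝ} (hu : ∀ n, ‖u n‖ ≤ R)
    (s : Finset (Fin N)) :
    ∃ (g : ∀ j, Lp ℝ (ENNReal.ofReal (p j)) (leb Ω)) (φ : ℕ → ℕ), StrictMono φ ∧
      ∀ j ∈ s, ∀ G : StrongDual ℝ (Lp ℝ (ENNReal.ofReal (p j)) (leb Ω)),
        Tendsto (fun n => G ((u (φ n)).der j)) atTop (𝓝 (G (g j))) := by
  classical
  induction s using Finset.induction_on with
  | empty => exact ⟨fun _ => 0, id, strictMono_id, by simp⟩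
  | insert i s hi ih =>
    obtain ⟨g, φ, hφ, h⟩ := ih
    obtain ⟨g', ψ, hψ, h'⟩ := Lp_exists_weak_subseq (hp.out i)
      (f := fun n => (u (φ n)).der i) (R := R) fun n => (norm_der_le _ i).trans (hu _)
    refine ⟨Function.update g i g', φ ∘ ψ, hφ.comp hψ, fun j hj G => ?_⟩
    rcases eq_or_ne j i with rfl | hji
    · rw [Function.update_self]
      exact h' G
    · rw [Function.update_of_ne hji]
      have hjs : j ∈ s := (Finset.mem_insert.1 hj).resolve_left hji
      exact (h j hjs G).comp hψ.tendsto_atTop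

/-- Bounded sequences in `W_0^{1,p}(Ω)` have weakly convergent subsequences. -/
theorem exists_weakConv_subseq {u : ℕ → W0 Ω p} {R : ℝ} (hu : ∀ n, ‖u n‖ ≤ R) :
    ∃ (v : W0 Ω p) (φ : ℕ → ℕ), StrictMono φ ∧ WeakConv (fun n => u (φ n)) v := by
  obtain ⟨g, φ, hφ, h⟩ := exists_weak_subseq_der hu Finset.univ
  let S : Submodule ℝ (∀ j, Lp ℝ (ENNReal.ofReal (p j)) (leb Ω)) :=
    LinearMap.range
      ({ toFun := fun u j => u.der j
         map_add' := fun _ _ => rfl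
         map_smul' := fun _ _ => rfl } : W0 Ω p →ₗ[ℝ] _)
  have hS : IsClosed (S : Set (∀ j, Lp ℝ (ENNReal.ofReal (p j)) (leb Ω))) := by
    refine IsSeqClosed.isClosed fun x y hx hxy => ?_
    choose w hw using hx
    obtain ⟨v, hv, -⟩ := exists_of_tendsto_der (w := w) (g := y) fun j => by
      have := ((continuous_apply j).tendsto y).comp hxy
      refine this.congr fun n => ?_
      rw [Function.comp, ← hw n]
      rfl
    exact ⟨v, funext hv⟩
  -- The gradients form a closed subspace. A limit outside it would be strictly separated from it by
  -- a continuous functional, against weak convergence of the components.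
  have hg : g ∈ S := by
    by_contra hgS
    obtain ⟨f, c, h1, h2⟩ := geometric_hahn_banach_closed_point S.convex hS hgS
    have h3 : Tendsto (fun n => f (fun j => (u (φ n)).der j)) atTop (𝓝 (f g)) := by
      have h4 : ∀ x, f x = ∑ j, (f.comp (ContinuousLinearMap.single ℝ
        (fun j => Lp ℝ (ENNReal.ofReal (p j)) (leb Ω)) j)) (x j) := by
        intro x
        conv_lhs => rw [← Finset.univ_sum_single x]
        rw [map_sum]
        rfl
      rw [h4 g]
      refine (tendsto_finsetSum _ fun j _ => h j (Finset.mem_univ j)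
        (f.comp (ContinuousLinearMap.single ℝ
        (fun j => Lp ℝ (ENNReal.ofReal (p j)) (leb Ω)) j))).congr fun n => ?_
      rw [h4]
    exact absurd (le_of_tendsto' h3 fun n => (h1 _ ⟨u (φ n), rfl⟩).le) (not_le.2 h2)
  obtain ⟨v, hv⟩ := hg
  refine ⟨v, φ, hφ, weakConv_of_der fun j G => ?_⟩
  have : v.der j = g j := congrFun hv j
  rw [this]
  exact h j (Finset.mem_univ j) G

/-- An element of `W_0^{1,p}(Ω)` is determined by its function. -/
theorem eq_of_fn_eq {u v : W0 Ω p} (h : u.fn = v.fn) : u = v := by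
  rw [← sub_eq_zero]
  refine eq_zero_of_der _ fun j => Lp.eq_zero_iff_ae_eq_zero.2 ?_
  have hz : (u - v).fn = 0 := by rw [fn_sub, h, sub_self]
  have hint : Integrable ((u - v).der j) (leb Ω) :=
    (Lp.memLp ((u - v).der j)).integrable (by simpa using (hp.out j).le)
  refine ae_eq_zero_of_integral_contDiff_smul_eq_zero hint.locallyIntegrable ?_
  intro ψ hψ hc
  have h1 := weak_der (u - v) j hψ hc
  have h2 : ∫ x, (u - v).fn x * pderiv j ψ x ∂(leb Ω) = 0 := by
    refine (integral_congr_ae (g := fun _ => 0) ?_).trans (by simp)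
    filter_upwards [Lp.eq_zero_iff_ae_eq_zero.1 hz] with x hx
    rw [hx]
    simp
  rw [h2] at h1
  simpa [mul_comm] using h1.symm

end Sobolev

end W0

end AnisoElliptic

end

/-! ### Rellich compactness in `L^1`, by translations and local averages -/

noncomputable section

set_option linter.unusedSectionVars false

namespace AnisoElliptic

section Translation

variable {N : ℕ}

lemma abs_fderiv_apply_le (φ : Eu N → ℝ) (x h : Eu N) :
    |fderiv ℝ φ x h| ≤ ‖h‖ * ∑ j, |pderiv j φ x| := by
  have hh : h = ∑ j, h j • (EuclideanSpace.single j (1 : ℝ) : Eu N) := by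
    conv_lhs => rw [← (EuclideanSpace.basisFun (Fin N) ℝ).sum_repr h]
    simp
  conv_lhs => rw [hh]
  rw [map_sum, Finset.mul_sum]
  refine (Finset.abs_sum_le_sum_abs _ _).trans (Finset.sum_le_sum fun j _ => ?_)
  rw [map_smul, smul_eq_mul, abs_mul]
  exact mul_le_mul_of_nonneg_right (PiLp.norm_apply_le h j) (abs_nonneg _)

/-- Translations of `C_c^1` functions are controlled by the gradient. -/
lemma lintegral_translate_le {φ : Eu N → ℝ} (hφ : ContDiff ℝ 1 φ) (h : Eu N) :
    ∫⁻ x, ENNReal.ofReal |φ (x + h) - φ x|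
      ≤ ENNReal.ofReal ‖h‖ * ∫⁻ x, ENNReal.ofReal (∑ j, |pderiv j φ x|) := by
  have hpc : ∀ j, Continuous (pderiv j φ) := fun j =>
    (hφ.continuous_fderiv (by simp)).clm_apply continuous_const
  let S : Eu N → ℝ := fun x => ∑ j, |pderiv j φ x|
  have hS : Continuous S := continuous_finsetSum _ fun j _ => (hpc j).abs
  have hpt : ∀ x, ENNReal.ofReal |φ (x + h) - φ x|
      ≤ ENNReal.ofReal ‖h‖ * ∫⁻ s in Set.Ioc (0 : ℝ) 1, ENNReal.ofReal (S (x + s • h)) := by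
    intro x
    have hd : ∀ s : ℝ, HasDerivAt (fun s : ℝ => φ (x + s • h)) (fderiv ℝ φ (x + s • h) h) s := by
      intro s
      have h1 : HasDerivAt (fun s : ℝ => x + s • h) h s := by
        simpa using ((hasDerivAt_id s).smul_const h).const_add x
      exact (hφ.differentiable (by simp) _).hasFDerivAt.comp_hasDerivAt s h1
    have hlin : Continuous fun s : ℝ => x + s • h := by fun_prop
    have hc : Continuous fun s : ℝ => fderiv ℝ φ (x + s • h) h :=
      ((hφ.continuous_fderiv (by simp)).comp hlin).clm_apply continuous_const
    have h1 := intervalIntegral.integral_eq_sub_of_hasDerivAt (a := 0) (b := 1)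
      (fun s _ => hd s) (hc.intervalIntegrable _ _)
    have h2 : |φ (x + h) - φ x| ≤ ∫ s in Set.Ioc (0 : ℝ) 1, ‖h‖ * S (x + s • h) := by
      have h3 : φ (x + h) - φ x = ∫ s in Set.Ioc (0 : ℝ) 1, fderiv ℝ φ (x + s • h) h := by
        rw [← intervalIntegral.integral_of_le zero_le_one, h1]
        simp
      rw [h3]
      refine (abs_integral_le_integral_abs).trans ?_
      refine integral_mono (hc.abs.integrableOn_Ioc)
        ((continuous_const.mul (hS.comp hlin)).integrableOn_Ioc) fun s => ?_
      exact abs_fderiv_apply_le φ _ h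
    refine (ENNReal.ofReal_le_ofReal h2).trans (le_of_eq ?_)
    have hi : IntegrableOn (fun s : ℝ => S (x + s • h)) (Set.Ioc 0 1) :=
      (hS.comp hlin).integrableOn_Ioc
    rw [integral_const_mul, ENNReal.ofReal_mul (norm_nonneg _),
      ofReal_integral_eq_lintegral_ofReal hi
        (Eventually.of_forall fun s => Finset.sum_nonneg fun j _ => abs_nonneg _)]
  calc ∫⁻ x, ENNReal.ofReal |φ (x + h) - φ x|
      ≤ ∫⁻ x, ENNReal.ofReal ‖h‖ * ∫⁻ s in Set.Ioc (0 : ℝ) 1, ENNReal.ofReal (S (x + s • h)) :=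
        lintegral_mono hpt
    _ = ENNReal.ofReal ‖h‖ * ∫⁻ x, ∫⁻ s in Set.Ioc (0 : ℝ) 1, ENNReal.ofReal (S (x + s • h)) :=
        lintegral_const_mul' _ _ ENNReal.ofReal_ne_top
    _ = ENNReal.ofReal ‖h‖ * ∫⁻ s in Set.Ioc (0 : ℝ) 1, ∫⁻ x, ENNReal.ofReal (S (x + s • h)) := by
        congr 1
        refine lintegral_lintegral_swap ?_
        have : Continuous fun z : Eu N × ℝ => S (z.1 + z.2 • h) := hS.comp (by fun_prop)
        exact this.measurable.ennreal_ofReal.aemeasurable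
    _ = ENNReal.ofReal ‖h‖ * ∫⁻ s in Set.Ioc (0 : ℝ) 1, ∫⁻ x, ENNReal.ofReal (S x) := by
        congr 1
        refine lintegral_congr fun s => ?_
        exact lintegral_add_right_eq_self (fun x => ENNReal.ofReal (S x)) (s • h)
    _ = _ := by simp [S]

/-- `|B_r| ∫_Ω |φ| ≤ ∫_Ω |∫_{B_r} φ(x + y) dy| dx + |B_r| r ∫ |∇φ|`. -/
lemma measure_mul_lintegral_le {φ : Eu N → ℝ} (hφ : ContDiff ℝ 1 φ) {r : ℝ} (Ω : Set (Eu N)) :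
    volume (Metric.closedBall (0 : Eu N) r) * ∫⁻ x in Ω, ENNReal.ofReal |φ x|
      ≤ (∫⁻ x in Ω, ENNReal.ofReal |∫ y in Metric.closedBall (0 : Eu N) r, φ (x + y)|) +
        volume (Metric.closedBall (0 : Eu N) r) * (ENNReal.ofReal r *
          ∫⁻ x, ENNReal.ofReal (∑ j, |pderiv j φ x|)) := by
  set B := Metric.closedBall (0 : Eu N) r with hB
  have hBt : volume B ≠ ⊤ := (isCompact_closedBall _ _).measure_lt_top.ne
  have hc2 : Continuous fun z : Eu N × Eu N => φ (z.1 + z.2) := hφ.continuous.comp (by fun_prop)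
  have hpt : ∀ x, volume B * ENNReal.ofReal |φ x| ≤ ENNReal.ofReal |∫ y in B, φ (x + y)| +
      ∫⁻ y in B, ENNReal.ofReal |φ (x + y) - φ x| := by
    intro x
    have hcx : Continuous fun y => φ (x + y) := hφ.continuous.comp (by fun_prop)
    have hi1 : IntegrableOn (fun y => φ (x + y)) B :=
      hcx.continuousOn.integrableOn_compact (isCompact_closedBall _ _)
    have hi2 : IntegrableOn (fun y => φ (x + y) - φ x) B :=
      (hcx.sub continuous_const).continuousOn.integrableOn_compact (isCompact_closedBall _ _)
    have h1 : (volume.real B) * |φ x| ≤ |∫ y in B, φ (x + y)| + ∫ y in B, |φ (x + y) - φ x| := by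
      have h2 : ∫ y in B, (φ (x + y) - φ x) = (∫ y in B, φ (x + y)) - volume.real B * φ x := by
        rw [integral_sub hi1 (by exact integrableOn_const hBt)]
        simp
      have h3 : |∫ y in B, (φ (x + y) - φ x)| ≤ ∫ y in B, |φ (x + y) - φ x| :=
        abs_integral_le_integral_abs
      have h4 : volume.real B * |φ x| = |volume.real B * φ x| := by
        rw [abs_mul, abs_of_nonneg measureReal_nonneg]
      rw [h4]
      rw [h2] at h3
      have := abs_sub_abs_le_abs_sub (volume.real B * φ x) (∫ y in B, φ (x + y))
      rw [abs_sub_comm] at this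
      linarith
    have h5 := ENNReal.ofReal_le_ofReal h1
    rwa [ENNReal.ofReal_mul measureReal_nonneg, Measure.real, ENNReal.ofReal_toReal hBt,
      ENNReal.ofReal_add (abs_nonneg _) (integral_nonneg fun y => abs_nonneg _),
      ofReal_integral_eq_lintegral_ofReal hi2.abs (Eventually.of_forall fun y => abs_nonneg _)]
      at h5
  have hmeas : AEMeasurable (Function.uncurry fun (x y : Eu N) =>
      ENNReal.ofReal |φ (x + y) - φ x|) ((volume.restrict Ω).prod (volume.restrict B)) := by
    have : Continuous fun z : Eu N × Eu N => |φ (z.1 + z.2) - φ z.1| :=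
      (hc2.sub (hφ.continuous.comp continuous_fst)).abs
    exact this.measurable.ennreal_ofReal.aemeasurable
  have hm2 : Measurable fun x => ENNReal.ofReal |∫ y in B, φ (x + y)| :=
    (hc2.stronglyMeasurable.integral_prod_right'
      (ν := volume.restrict B)).measurable.abs.ennreal_ofReal
  calc volume B * ∫⁻ x in Ω, ENNReal.ofReal |φ x|
      = ∫⁻ x in Ω, volume B * ENNReal.ofReal |φ x| := (lintegral_const_mul' _ _ hBt).symm
    _ ≤ ∫⁻ x in Ω, (ENNReal.ofReal |∫ y in B, φ (x + y)| +
          ∫⁻ y in B, ENNReal.ofReal |φ (x + y) - φ x|) := lintegral_mono hpt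
    _ = (∫⁻ x in Ω, ENNReal.ofReal |∫ y in B, φ (x + y)|) +
          ∫⁻ x in Ω, ∫⁻ y in B, ENNReal.ofReal |φ (x + y) - φ x| := lintegral_add_left hm2 _
    _ = (∫⁻ x in Ω, ENNReal.ofReal |∫ y in B, φ (x + y)|) +
          ∫⁻ y in B, ∫⁻ x in Ω, ENNReal.ofReal |φ (x + y) - φ x| := by
        rw [lintegral_lintegral_swap hmeas]
    _ ≤ _ := by
        gcongr
        have : ∀ y ∈ B, ∫⁻ x in Ω, ENNReal.ofReal |φ (x + y) - φ x|
            ≤ ENNReal.ofReal r * ∫⁻ x, ENNReal.ofReal (∑ j, |pderiv j φ x|) := by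
          intro y hy
          refine (setLIntegral_le_lintegral _ _).trans ((lintegral_translate_le hφ y).trans ?_)
          gcongr
          simpa [hB] using hy
        refine (setLIntegral_mono' measurableSet_closedBall this).trans ?_
        rw [setLIntegral_const, mul_comm]

end Translation

namespace W0

variable {N : ℕ} {Ω : Set (Eu N)} {p : Fin N → ℝ} [hp : Fact (∀ j, 1 < p j)]
  [hN : Fact (2 ≤ N)] [hpN : Fact (hmean p < N)] [NeZero N] [hfin : IsFiniteMeasure (leb Ω)]

lemma integral_abs_der_le (u : W0 Ω p) (j : Fin N) :
    ∫ x in Ω, |u.der j x| ≤ (leb Ω).real Set.univ + u.energy := by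
  have hL := Lp.memLp (u.der j)
  have hint : Integrable (fun x => |u.der j x| ^ p j) (leb Ω) :=
    integrable_abs_rpow (p_pos p j) hL
  have h1 : ∫ x in Ω, |u.der j x| ≤ ∫ x in Ω, (1 + |u.der j x| ^ p j) :=
    integral_mono (hL.integrable (by simpa using (hp.out j).le)).abs
      ((integrable_const _).add hint) fun x => abs_le_one_add_rpow _ (hp.out j).le
  rw [integral_add (integrable_const _) hint] at h1
  refine h1.trans (add_le_add (by simp) ?_)
  exact Finset.single_le_sum (f := fun j => ∫ x in Ω, |u.der j x| ^ p j)
    (fun j _ => integral_nonneg fun x => by positivity) (Finset.mem_univ j)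

/-- **Rellich**: weakly null bounded sequences of test functions converge to zero in `L^1`. -/
lemma tendsto_fn_zero_of_ofTest {w : ℕ → W0 Ω p} {φ : ℕ → Eu N → ℝ}
    (hw : ∀ n, OfTest (w n) (φ n)) {R : ℝ} (hR : ∀ n, ‖w n‖ ≤ R) (hweak : WeakConv w 0) :
    Tendsto (fun n => (w n).fn) atTop (𝓝 0) := by
  -- the total gradients are bounded
  obtain ⟨K, hK0, hK⟩ : ∃ K : ℝ, 0 ≤ K ∧ ∀ n,
      ∫⁻ x, ENNReal.ofReal (∑ j, |pderiv j (φ n) x|) ≤ ENNReal.ofReal K := by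
    have hE0 : 0 ≤ ∑ j, R ^ p j := (w 0).energy_nonneg.trans (energy_le (hR 0))
    refine ⟨∑ _j : Fin N, ((leb Ω).real Set.univ + ∑ j, R ^ p j),
      Finset.sum_nonneg fun _ _ => add_nonneg measureReal_nonneg hE0, fun n => ?_⟩
    have hpc : ∀ j, Continuous (pderiv j (φ n)) := fun j =>
      ((hw n).isTest.smooth.continuous_fderiv (by simp)).clm_apply continuous_const
    have hpi : ∀ j, Integrable (fun x => |pderiv j (φ n) x|) := fun j =>
      ((hpc j).integrable_of_hasCompactSupport ((hw n).isTest.compact.fderiv_apply (𝕜 := ℝ) _)).abs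
    rw [← ofReal_integral_eq_lintegral_ofReal (integrable_finsetSum _ fun j _ => hpi j)
      (Eventually.of_forall fun x => Finset.sum_nonneg fun j _ => abs_nonneg _),
      integral_finsetSum _ fun j _ => hpi j]
    refine ENNReal.ofReal_le_ofReal (Finset.sum_le_sum fun j _ => ?_)
    have h1 : ∫ x, |pderiv j (φ n) x| = ∫ x in Ω, |(w n).der j x| := by
      rw [← setIntegral_pderiv_of_isTest (hw n).isTest j (F := fun y => |y|) (by simp)]
      refine integral_congr_ae ?_
      filter_upwards [(hw n).der_eq j] with x hx
      rw [hx]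
    rw [h1]
    exact (integral_abs_der_le (w n) j).trans (add_le_add le_rfl (energy_le (hR n)))
  obtain ⟨C, hC0, hC⟩ := poincare Ω p
  have hfn : ∀ n, ∫ x in Ω, |φ n x| = ‖(w n).fn‖ := fun n => by
    rw [L1.norm_eq_integral_norm]
    refine integral_congr_ae ?_
    filter_upwards [(hw n).fn_eq] with x hx
    rw [hx, Real.norm_eq_abs]
  have hφint : ∀ n, Integrable (φ n) := fun n =>
    (hw n).isTest.smooth.continuous.integrable_of_hasCompactSupport (hw n).isTest.compact
  -- local averages converge to zero
  have havg : ∀ r : ℝ, Tendsto (fun n => ∫⁻ x in Ω, ENNReal.ofReal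
      |∫ y in Metric.closedBall (0 : Eu N) r, φ n (x + y)|) atTop (𝓝 0) := by
    intro r
    have hpt : ∀ x, Tendsto (fun n => ∫ y in Metric.closedBall (0 : Eu N) r, φ n (x + y)) atTop
        (𝓝 0) := by
      intro x
      -- Integration over the ball around `x` is a continuous functional, so the local integrals
      -- tend to zero at every point. The `L^1` bound dominates them by a constant, which is
      -- integrable on `Ω`.
      let T : StrongDual ℝ (W0 Ω p) :=
        ((ContinuousLinearMap.mul ℝ ℝ).lpPairing (leb Ω) ⊤ 1
          (indicatorConstLp ⊤ (measurableSet_closedBall (x := x) (ε := r))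
            (measure_ne_top (leb Ω) _) 1)).comp (fnL Ω p)
      have h0 := hweak T
      rw [map_zero] at h0
      refine h0.congr fun n => ?_
      have h1 : T (w n) = ∫ y in Ω, (Metric.closedBall x r).indicator (φ n) y := by
        simp only [T, ContinuousLinearMap.comp_apply, ContinuousLinearMap.lpPairing_eq_integral,
          fnL_apply]
        refine integral_congr_ae ?_
        filter_upwards [(hw n).fn_eq, indicatorConstLp_coeFn (p := ⊤) (μ := leb Ω)
          (hs := measurableSet_closedBall (x := x) (ε := r))
          (hμs := measure_ne_top (leb Ω) _) (c := (1 : ℝ))] with y h1 h2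
        rw [h1, h2]
        by_cases hy : y ∈ Metric.closedBall x r
        · simp only [Set.indicator_of_mem hy, ContinuousLinearMap.mul_apply', one_mul]
        · simp only [Set.indicator_of_notMem hy, ContinuousLinearMap.mul_apply', zero_mul]
      rw [h1, setIntegral_eq_integral_of_forall_compl_eq_zero,
        ← integral_indicator measurableSet_closedBall]
      · rw [← integral_add_left_eq_self _ x]
        refine integral_congr_ae (Eventually.of_forall fun y => ?_)
        by_cases hy : y ∈ Metric.closedBall (0 : Eu N) r
        · have : x + y ∈ Metric.closedBall x r := by simpa using hy
          simp only [Set.indicator_of_mem hy, Set.indicator_of_mem this]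
        · have : x + y ∉ Metric.closedBall x r := by simpa using hy
          simp only [Set.indicator_of_notMem hy, Set.indicator_of_notMem this]
      · intro y hy
        have : φ n y = 0 :=
          image_eq_zero_of_notMem_tsupport fun h => hy ((hw n).isTest.supp h)
        simp [Set.indicator, this]
    have h0 : (0 : ℝ≥0∞) = ∫⁻ _x in Ω, 0 := by simp
    rw [h0]
    refine tendsto_lintegral_of_dominated_convergence (fun _ => ENNReal.ofReal (C * R))
      (fun n => ?_) (fun n => Eventually.of_forall fun x => ?_) ?_
      (Eventually.of_forall fun x => ?_)
    · have hc2 : Continuous fun z : Eu N × Eu N => φ n (z.1 + z.2) :=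
        (hw n).isTest.smooth.continuous.comp (by fun_prop)
      exact (hc2.stronglyMeasurable.integral_prod_right'
        (ν := volume.restrict _)).measurable.abs.ennreal_ofReal
    · refine ENNReal.ofReal_le_ofReal ?_
      have hix : Integrable fun y => |φ n (x + y)| := ((hφint n).comp_add_left x).abs
      calc |∫ y in Metric.closedBall (0 : Eu N) r, φ n (x + y)|
          ≤ ∫ y in Metric.closedBall (0 : Eu N) r, |φ n (x + y)| := abs_integral_le_integral_abs
        _ ≤ ∫ y, |φ n (x + y)| :=
            setIntegral_le_integral hix (Eventually.of_forall fun y => abs_nonneg _)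
        _ = ∫ y, |φ n y| := integral_add_left_eq_self (fun y => |φ n y|) x
        _ = ‖(w n).fn‖ := by
            rw [← hfn, setIntegral_of_isTest (hw n).isTest (F := fun y => |y|) (by simp)]
        _ ≤ C * R := (hC _).trans (mul_le_mul_of_nonneg_left (hR n) hC0)
    · rw [lintegral_const]
      exact ENNReal.mul_ne_top ENNReal.ofReal_ne_top (measure_ne_top _ _)
    · have := (ENNReal.continuous_ofReal.tendsto _).comp (hpt x).abs
      rw [abs_zero, ENNReal.ofReal_zero] at this
      exact this
  have hnorm : ∀ n, ENNReal.ofReal ‖(w n).fn‖ = ∫⁻ x in Ω, ENNReal.ofReal |φ n x| := fun n => by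
    rw [← hfn, ofReal_integral_eq_lintegral_ofReal (hφint n).abs.restrict
      (Eventually.of_forall fun x => abs_nonneg _)]
  rw [tendsto_zero_iff_norm_tendsto_zero]
  have hgoal : Tendsto (fun n => ENNReal.ofReal ‖(w n).fn‖) atTop (𝓝 0) := by
    rw [ENNReal.tendsto_nhds_zero]
    intro ε hε
    -- The radius is fixed first, so that the translation error is at most `ε / 2` for all `n`. Then
    -- `n` is taken large for the averages at this radius.
    obtain ⟨r, hr, hrε⟩ : ∃ r : ℝ, 0 < r ∧ ENNReal.ofReal r * ENNReal.ofReal K ≤ ε / 2 := by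
      rcases eq_or_ne ε ⊤ with rfl | hεt
      · exact ⟨1, one_pos, by simp [ENNReal.top_div]⟩
      · have hε2 : 0 < (ε / 2).toReal :=
          ENNReal.toReal_pos (ENNReal.half_pos hε.ne').ne' (ENNReal.div_ne_top hεt (by simp))
        refine ⟨(ε / 2).toReal / (K + 1), by positivity, ?_⟩
        rw [← ENNReal.ofReal_mul (by positivity)]
        refine ENNReal.ofReal_le_of_le_toReal ?_
        rw [div_mul_eq_mul_div, div_le_iff₀ (by positivity)]
        nlinarith
    set V := volume (Metric.closedBall (0 : Eu N) r) with hV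
    have hV0 : V ≠ 0 := (Metric.measure_closedBall_pos _ _ hr).ne'
    have hVt : V ≠ ⊤ := (isCompact_closedBall _ _).measure_lt_top.ne
    have hev := (ENNReal.tendsto_nhds_zero.1 (havg r)) (V * (ε / 2))
      (pos_iff_ne_zero.2 (mul_ne_zero hV0 (ENNReal.half_pos hε.ne').ne'))
    filter_upwards [hev] with n hn
    rw [hnorm]
    have h1 := measure_mul_lintegral_le ((hw n).isTest.smooth.of_le (by simp)) (r := r) Ω
    rw [← hV] at h1
    have h2 : V * ∫⁻ x in Ω, ENNReal.ofReal |φ n x| ≤ V * ε := by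
      refine h1.trans ?_
      calc _ ≤ V * (ε / 2) + V * (ε / 2) := by
            refine add_le_add hn ?_
            gcongr
            exact (mul_le_mul_right (hK n) _).trans hrε
        _ = V * ε := by rw [← mul_add, ENNReal.add_halves]
    exact (ENNReal.mul_le_mul_iff_right hV0 hVt).1 h2
  have := (ENNReal.tendsto_toReal (by simp : (0 : ℝ≥0∞) ≠ ⊤)).comp hgoal
  refine (this.congr fun n => ?_)
  simp

/-- **Rellich**: bounded weakly convergent sequences in `W_0^{1,p}(Ω)` converge in `L^1(Ω)`. -/
theorem tendsto_fn_of_weakConv {u : ℕ → W0 Ω p} {v : W0 Ω p} {R : ℝ}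
    (hR : ∀ n, ‖u n‖ ≤ R) (hweak : WeakConv u v) :
    Tendsto (fun n => (u n).fn) atTop (𝓝 v.fn) := by
  -- The translation argument is available for test functions only, so `u n - v` is replaced by one
  -- at distance less than `1 / (n + 1)`; this changes neither boundedness nor the weak limit.
  have happ : ∀ n, ∃ (w : W0 Ω p) (φ : Eu N → ℝ), OfTest w φ ∧
      ‖u n - v - w‖ < 1 / ((n : ℝ) + 1) := by
    intro n
    obtain ⟨w, φ, hw, -, hder⟩ := exists_seq_ofTest (u n - v)
    have h1 := tendsto_of_tendsto_der hder
    have h2 := (tendsto_iff_norm_sub_tendsto_zero.1 h1).eventually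
      (gt_mem_nhds (by positivity : (0 : ℝ) < 1 / ((n : ℝ) + 1)))
    obtain ⟨k, hk⟩ := h2.exists
    exact ⟨w k, φ k, hw k, by rwa [norm_sub_rev]⟩
  choose w φ hw hd using happ
  have hdlim : Tendsto (fun n => u n - v - w n) atTop (𝓝 0) := by
    rw [tendsto_zero_iff_norm_tendsto_zero]
    exact squeeze_zero (fun n => norm_nonneg _) (fun n => (hd n).le)
      tendsto_one_div_add_atTop_nhds_zero_nat
  have hwR : ∀ n, ‖w n‖ ≤ R + ‖v‖ + 1 := by
    intro n
    have h1 : w n = u n - v - (u n - v - w n) := by abel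
    have h2 : 1 / ((n : ℝ) + 1) ≤ 1 := by
      rw [div_le_one (by positivity)]
      linarith [(Nat.cast_nonneg n : (0 : ℝ) ≤ n)]
    rw [h1]
    refine (norm_sub_le _ _).trans ?_
    have h3 := norm_sub_le (u n) v
    linarith [hR n, hd n]
  have hww : WeakConv w 0 := by
    intro F
    have h1 : Tendsto (fun n => F (u n) - F v - F (u n - v - w n)) atTop (𝓝 (F v - F v - F 0)) :=
      ((hweak F).sub tendsto_const_nhds).sub ((F.continuous.tendsto _).comp hdlim)
    rw [sub_self, map_zero, sub_zero] at h1
    rw [map_zero]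
    refine h1.congr fun n => ?_
    simp only [map_sub]
    ring
  have hwfn := tendsto_fn_zero_of_ofTest hw hwR hww
  have hdfn : Tendsto (fun n => (u n - v - w n).fn) atTop (𝓝 0) := by
    have := ((fnL Ω p).continuous.tendsto _).comp hdlim
    rw [map_zero] at this
    exact this
  have hsum := (hwfn.add hdfn).add (tendsto_const_nhds (x := v.fn))
  rw [add_zero, zero_add] at hsum
  refine hsum.congr fun n => ?_
  simp only [fn_sub]
  abel

/-- A bounded sequence in `W_0^{1,p}(Ω)` which converges in `L^1(Ω)` converges weakly. -/
theorem weakConv_of_tendsto_fn {u : ℕ → W0 Ω p} {v : W0 Ω p} {R : ℝ}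
    (hR : ∀ n, ‖u n‖ ≤ R) (hfn : Tendsto (fun n => (u n).fn) atTop (𝓝 v.fn)) : WeakConv u v := by
  intro F
  -- Every subsequence has a weakly convergent further subsequence, and Rellich's theorem together
  -- with the given `L^1` limit identifies its limit as `v`.
  refine tendsto_of_subseq_tendsto fun ns hns => ?_
  obtain ⟨v', φ, hφ, hv'⟩ := exists_weakConv_subseq (u := fun n => u (ns n)) fun n => hR _
  have h1 := tendsto_fn_of_weakConv (fun n => hR (ns (φ n))) hv'
  have h2 : Tendsto (fun n => (u (ns (φ n))).fn) atTop (𝓝 v.fn) :=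
    hfn.comp (hns.comp hφ.tendsto_atTop)
  have : v' = v := eq_of_fn_eq (tendsto_nhds_unique h1 h2)
  exact ⟨φ, this ▸ hv' F⟩

end W0

end AnisoElliptic

end

/-! ### Limits of integrals of products, and measurability of superposition operators -/

noncomputable section

set_option linter.unusedSectionVars false

namespace AnisoElliptic

section Convergence

variable {α : Type*} [MeasurableSpace α] {μ : Measure α} [IsFiniteMeasure μ]

/-- Dominated convergence in `L^r`. -/
lemma tendsto_eLpNorm_sub_of_dominated {r : ℝ≥0∞} (hr : 1 ≤ r) (hr' : r ≠ ⊤) {F : ℕ → α → ℝ}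
    {f g : α → ℝ} (hF : ∀ n, AEStronglyMeasurable (F n) μ) (hg : MemLp g r μ)
    (hb : ∀ n, ∀ᵐ x ∂μ, |F n x| ≤ |g x|)
    (hlim : ∀ᵐ x ∂μ, Tendsto (fun n => F n x) atTop (𝓝 (f x))) :
    MemLp f r μ ∧ Tendsto (fun n => eLpNorm (F n - f) r μ) atTop (𝓝 0) := by
  have hf : MemLp f r μ := by
    refine hg.mono (aestronglyMeasurable_of_tendsto_ae _ hF hlim) ?_
    filter_upwards [ae_all_iff.2 hb, hlim] with x hx hl
    exact le_of_tendsto hl.abs (Eventually.of_forall hx)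
  refine ⟨hf, tendsto_Lp_finite_of_tendsto_ae hr hr' hF hf (fun ε hε => ?_) hlim⟩
  obtain ⟨δ, hδ, h⟩ := hg.eLpNorm_indicator_le hr hr' hε
  refine ⟨δ, hδ, fun n s hs hμ => (eLpNorm_mono_ae ?_).trans (h s hs hμ)⟩
  filter_upwards [hb n] with x hx
  by_cases hxs : x ∈ s
  · simpa [hxs] using hx
  · simp [hxs]

lemma memLp_of_ae_tendsto {q : ℝ≥0∞} {a : ℕ → α → ℝ} {b : α → ℝ} {K : ℝ≥0∞} (hK : K ≠ ⊤)
    (ha : ∀ n, AEStronglyMeasurable (a n) μ) (hb : ∀ n, eLpNorm (a n) q μ ≤ K)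
    (hlim : ∀ᵐ x ∂μ, Tendsto (fun n => a n x) atTop (𝓝 (b x))) :
    MemLp b q μ ∧ eLpNorm b q μ ≤ K := by
  have h := Lp.eLpNorm_lim_le_liminf_eLpNorm (p := q) ha b hlim
  have h2 : eLpNorm b q μ ≤ K := h.trans <| by
    refine liminf_le_of_frequently_le' (Frequently.of_forall hb)
  exact ⟨⟨aestronglyMeasurable_of_tendsto_ae _ ha hlim, h2.trans_lt hK.lt_top⟩, h2⟩

lemma eLpNorm_mul_le {p q : ℝ} (hpq : p.HolderConjugate q) {a b : α → ℝ}
    (ha : AEStronglyMeasurable a μ) (hb : AEStronglyMeasurable b μ) :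
    eLpNorm (fun x => a x * b x) 1 μ ≤
      eLpNorm a (ENNReal.ofReal q) μ * eLpNorm b (ENNReal.ofReal p) μ := by
  have := hpq.symm.ennrealOfReal
  have h : eLpNorm (a • b) 1 μ ≤ eLpNorm a (ENNReal.ofReal q) μ * eLpNorm b (ENNReal.ofReal p) μ :=
    eLpNorm_smul_le_mul_eLpNorm hb ha
  have e : (fun x => a x * b x) = a • b := by
    funext x
    simp
  rwa [e]

lemma integrable_mul_of_conj {p q : ℝ} (hpq : p.HolderConjugate q) {a b : α → ℝ}
    (ha : MemLp a (ENNReal.ofReal q) μ) (hb : MemLp b (ENNReal.ofReal p) μ) :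
    Integrable (fun x => a x * b x) μ := by
  have := hpq.symm.ennrealOfReal
  exact memLp_one_iff_integrable.1 (hb.mul ha)

lemma abs_integral_mul_le {p q : ℝ} (hpq : p.HolderConjugate q) {a b : α → ℝ}
    (ha : MemLp a (ENNReal.ofReal q) μ) (hb : MemLp b (ENNReal.ofReal p) μ) :
    |∫ x, a x * b x ∂μ| ≤ (eLpNorm a (ENNReal.ofReal q) μ).toReal *
      (eLpNorm b (ENNReal.ofReal p) μ).toReal := by
  rw [← ENNReal.toReal_mul]
  have h1 : ‖∫ x, a x * b x ∂μ‖ₑ ≤ eLpNorm (fun x => a x * b x) 1 μ := by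
    rw [eLpNorm_one_eq_lintegral_enorm]
    exact enorm_integral_le_lintegral_enorm _
  have h2 := h1.trans (eLpNorm_mul_le hpq ha.1 hb.1)
  have h3 := ENNReal.toReal_mono (ENNReal.mul_ne_top ha.2.ne hb.2.ne) h2
  simpa using h3

/-- A bounded sequence in `L^q` that converges almost everywhere converges against functions
of the dual space. -/
lemma tendsto_integral_mul_of_ae {p q : ℝ} (hpq : p.HolderConjugate q) {a : ℕ → α → ℝ}
    {a' b : α → ℝ} {K : ℝ≥0∞} (hK : K ≠ ⊤) (ha : ∀ n, AEStronglyMeasurable (a n) μ)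
    (hbd : ∀ n, eLpNorm (a n) (ENNReal.ofReal q) μ ≤ K)
    (hlim : ∀ᵐ x ∂μ, Tendsto (fun n => a n x) atTop (𝓝 (a' x)))
    (hb : MemLp b (ENNReal.ofReal p) μ) :
    Tendsto (fun n => ∫ x, a n x * b x ∂μ) atTop (𝓝 (∫ x, a' x * b x ∂μ)) := by
  have ha' := (memLp_of_ae_tendsto hK ha hbd hlim).1
  have hint := integrable_mul_of_conj hpq ha' hb
  have hp1 : (1 : ℝ≥0∞) ≤ ENNReal.ofReal p := by simpa using hpq.lt.le
  refine tendsto_integral_of_L1' _ hint.1 (Eventually.of_forall fun n =>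
    integrable_mul_of_conj hpq ⟨ha n, (hbd n).trans_lt hK.lt_top⟩ hb) ?_
  -- Vitali's theorem: the products are uniformly integrable because the `a n` are bounded in `L^q`
  -- and the `L^p` norm of `b` on small sets is small.
  refine tendsto_Lp_finite_of_tendsto_ae (f := fun n x => a n x * b x) le_rfl ENNReal.one_ne_top
    (fun n => (ha n).mul hb.1) (memLp_one_iff_integrable.2 hint) (fun ε hε => ?_) ?_
  · obtain ⟨δ, hδ, h⟩ := hb.eLpNorm_indicator_le hp1 ENNReal.ofReal_ne_top
      (ε := ε / (K.toReal + 1)) (by positivity)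
    refine ⟨δ, hδ, fun n s hs hμ => ?_⟩
    have e : s.indicator (fun x => a n x * b x) = fun x => a n x * s.indicator b x := by
      funext x
      by_cases hxs : x ∈ s <;> simp [hxs]
    rw [e]
    refine (eLpNorm_mul_le hpq (ha n) (hb.1.indicator hs)).trans ?_
    refine (mul_le_mul' (hbd n) (h s hs hμ)).trans ?_
    rw [← ENNReal.ofReal_toReal hK, ← ENNReal.ofReal_mul ENNReal.toReal_nonneg,
      ENNReal.toReal_ofReal ENNReal.toReal_nonneg]
    refine ENNReal.ofReal_le_ofReal ?_
    have : 0 ≤ K.toReal := ENNReal.toReal_nonneg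
    rw [mul_div_assoc', div_le_iff₀ (by positivity)]
    nlinarith
  · filter_upwards [hlim] with x hx
    exact hx.mul_const _

lemma tendsto_integral_mul_of_ae_of_tendsto {p q : ℝ} (hpq : p.HolderConjugate q)
    {a b : ℕ → α → ℝ} {a' b' : α → ℝ} {K : ℝ≥0∞} (hK : K ≠ ⊤)
    (ha : ∀ n, AEStronglyMeasurable (a n) μ)
    (hbd : ∀ n, eLpNorm (a n) (ENNReal.ofReal q) μ ≤ K)
    (hlim : ∀ᵐ x ∂μ, Tendsto (fun n => a n x) atTop (𝓝 (a' x)))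
    (hb : ∀ n, MemLp (b n) (ENNReal.ofReal p) μ) (hb' : MemLp b' (ENNReal.ofReal p) μ)
    (hbl : Tendsto (fun n => eLpNorm (b n - b') (ENNReal.ofReal p) μ) atTop (𝓝 0)) :
    Tendsto (fun n => ∫ x, a n x * b n x ∂μ) atTop (𝓝 (∫ x, a' x * b' x ∂μ)) := by
  have h1 := tendsto_integral_mul_of_ae hpq hK ha hbd hlim hb'
  have hm : ∀ n, MemLp (a n) (ENNReal.ofReal q) μ := fun n =>
    ⟨ha n, (hbd n).trans_lt hK.lt_top⟩
  have h2 : Tendsto (fun n => ∫ x, a n x * (b n - b') x ∂μ) atTop (𝓝 0) := by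
    have h3 : Tendsto (fun n => K.toReal * (eLpNorm (b n - b') (ENNReal.ofReal p) μ).toReal)
        atTop (𝓝 0) := by
      simpa using ((ENNReal.tendsto_toReal ENNReal.zero_ne_top).comp hbl).const_mul K.toReal
    refine squeeze_zero_norm (fun n => ?_) h3
    refine (abs_integral_mul_le hpq (hm n) ((hb n).sub hb')).trans ?_
    gcongr
    exact hbd n
  have h4 := h1.add h2
  rw [add_zero] at h4
  refine h4.congr fun n => ?_
  rw [← integral_add (integrable_mul_of_conj hpq (hm n) hb')
    (integrable_mul_of_conj hpq (hm n) ((hb n).sub hb'))]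
  exact integral_congr_ae (Eventually.of_forall fun x => by simp; ring)

/-- Products of strongly and weakly convergent sequences. -/
lemma tendsto_integral_mul_of_strong_weak {p q : ℝ} (hpq : p.HolderConjugate q)
    {a b : ℕ → α → ℝ} {a' b' : α → ℝ} {K : ℝ≥0∞} (hK : K ≠ ⊤)
    (ha : ∀ n, MemLp (a n) (ENNReal.ofReal q) μ) (ha' : MemLp a' (ENNReal.ofReal q) μ)
    (hal : Tendsto (fun n => eLpNorm (a n - a') (ENNReal.ofReal q) μ) atTop (𝓝 0))
    (hb : ∀ n, MemLp (b n) (ENNReal.ofReal p) μ)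
    (hbd : ∀ n, eLpNorm (b n) (ENNReal.ofReal p) μ ≤ K)
    (hbl : Tendsto (fun n => ∫ x, a' x * b n x ∂μ) atTop (𝓝 (∫ x, a' x * b' x ∂μ))) :
    Tendsto (fun n => ∫ x, a n x * b n x ∂μ) atTop (𝓝 (∫ x, a' x * b' x ∂μ)) := by
  have h2 : Tendsto (fun n => ∫ x, (a n - a') x * b n x ∂μ) atTop (𝓝 0) := by
    have h3 : Tendsto (fun n => (eLpNorm (a n - a') (ENNReal.ofReal q) μ).toReal * K.toReal)
        atTop (𝓝 0) := by
      simpa using ((ENNReal.tendsto_toReal ENNReal.zero_ne_top).comp hal).mul_const K.toReal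
    refine squeeze_zero_norm (fun n => ?_) h3
    refine (abs_integral_mul_le hpq ((ha n).sub ha') (hb n)).trans ?_
    gcongr
    exact hbd n
  have h4 := hbl.add h2
  rw [add_zero] at h4
  refine h4.congr fun n => ?_
  rw [← integral_add (integrable_mul_of_conj hpq ha' (hb n))
    (integrable_mul_of_conj hpq ((ha n).sub ha') (hb n))]
  exact integral_congr_ae (Eventually.of_forall fun x => by simp; ring)

end Convergence

section Caratheodory

variable {N : ℕ} {Ω : Set (Eu N)}

/-- Superposition operators preserve measurability. -/
lemma IsCaratheodory.aestronglyMeasurable {F : Eu N → ℝ → (Fin N → ℝ) → ℝ}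
    (hF : IsCaratheodory Ω F) {u : Eu N → ℝ} {ξ : Eu N → Fin N → ℝ}
    (hu : AEStronglyMeasurable u (leb Ω)) (hξ : ∀ j, AEStronglyMeasurable (fun x => ξ x j) (leb Ω)) :
    AEStronglyMeasurable (fun x => F x (u x) (ξ x)) (leb Ω) := by
  have hz : AEMeasurable (fun x => (u x, ξ x)) (leb Ω) :=
    hu.aemeasurable.prodMk (aemeasurable_pi_lambda _ fun j => (hξ j).aemeasurable)
  have hz' : AEStronglyMeasurable (fun x => (u x, ξ x)) (leb Ω) := hz.aestronglyMeasurable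
  obtain ⟨z, hzm, hze⟩ := hz'
  -- Along a simple function the superposition is a finite sum of the measurable functions `F(·, y)`
  -- restricted to fibres. Continuity in the remaining variables passes to limits of simple
  -- functions.
  have key : ∀ s : SimpleFunc (Eu N) (ℝ × (Fin N → ℝ)),
      AEMeasurable (fun x => F x (s x).1 (s x).2) (leb Ω) := by
    intro s
    have : (fun x => F x (s x).1 (s x).2) =
        fun x => ∑ y ∈ s.range, (s ⁻¹' {y}).indicator (fun x => F x y.1 y.2) x := by
      funext x
      rw [Finset.sum_eq_single (s x)]
      · simp
      · intro y _ hy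
        exact Set.indicator_of_notMem (fun h => hy (by simpa using Eq.symm h)) _
      · intro h
        exact absurd (SimpleFunc.mem_range_self s x) h
    rw [this]
    exact Finset.aemeasurable_fun_sum _ fun y _ =>
      (hF.1 y.1 y.2).indicator (s.measurableSet_fiber y)
  refine (aemeasurable_of_tendsto_metrizable_ae (u := atTop) (fun n => key (hzm.approx n))
    ?_).aestronglyMeasurable
  filter_upwards [hze, hF.2] with x hx hc
  have h1 := (hc.tendsto (z x)).comp (hzm.tendsto_approx x)
  have h2 : F x (u x) (ξ x) = F x (z x).1 (z x).2 := by rw [← hx]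
  rw [h2]
  exact h1

end Caratheodory

end AnisoElliptic

end

/-! ### Chain rule and products in `W0` -/

noncomputable section

set_option linter.unusedSectionVars false

namespace AnisoElliptic

/-- To be applied to Weierstrass approximations of `G'`; vanishing at `0` keeps compositions with
test functions supported in `Ω`. -/
lemma exists_polynomial_antideriv (P : Polynomial ℝ) :
    ∃ Q : Polynomial ℝ, Q.derivative = P ∧ Q.eval 0 = 0 := by
  induction P using Polynomial.induction_on' with
  | add P₁ P₂ h₁ h₂ =>
    obtain ⟨Q₁, h₁, h₁'⟩ := h₁
    obtain ⟨Q₂, h₂, h₂'⟩ := h₂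
    exact ⟨Q₁ + Q₂, by simp [h₁, h₂], by simp [h₁', h₂']⟩
  | monomial n a =>
    refine ⟨Polynomial.monomial (n + 1) (a / (n + 1)), ?_, by simp⟩
    have : (n : ℝ) + 1 ≠ 0 := by positivity
    rw [Polynomial.derivative_monomial]
    simp [div_mul_cancel₀ _ this]

lemma abs_sub_le_of_hasDerivAt {G G' : ℝ → ℝ} {L : ℝ} (hG : ∀ t, HasDerivAt G (G' t) t)
    (hL : ∀ t, |G' t| ≤ L) (a b : ℝ) : |G a - G b| ≤ L * |a - b| := by
  have := Convex.norm_image_sub_le_of_norm_hasDerivWithin_le (f := G) (f' := G') (s := Set.univ)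
    (x := b) (y := a) (C := L) (fun x _ => (hG x).hasDerivWithinAt) (fun x _ => hL x) convex_univ
    trivial trivial
  simpa using this

namespace W0

variable {N : ℕ} {Ω : Set (Eu N)} {p : Fin N → ℝ} [hp : Fact (∀ j, 1 < p j)]

lemma exists_ofTest {φ : Eu N → ℝ} (hφ : IsTest Ω φ) : ∃ w : W0 Ω p, OfTest w φ := by
  have hd : ∀ j, Continuous (pderiv j φ) := fun j =>
    (hφ.smooth.continuous_fderiv (by simp)).clm_apply continuous_const
  have hdc : ∀ j, HasCompactSupport (pderiv j φ) := fun j => hφ.compact.fderiv_apply (𝕜 := ℝ) _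
  have m1 : MemLp φ 1 (leb Ω) :=
    (hφ.smooth.continuous.memLp_of_hasCompactSupport hφ.compact).restrict Ω
  have m2 : ∀ j, MemLp (pderiv j φ) (ENNReal.ofReal (p j)) (leb Ω) := fun j =>
    ((hd j).memLp_of_hasCompactSupport (hdc j)).restrict Ω
  have hm : ((m1.toLp φ, fun j => (m2 j).toLp (pderiv j φ)) : Pairs Ω p) ∈ testPairs Ω p :=
    ⟨φ, hφ, m1.coeFn_toLp, fun j => (m2 j).coeFn_toLp⟩
  exact ⟨⟨_, subset_closure hm⟩, hφ, m1.coeFn_toLp, fun j => (m2 j).coeFn_toLp⟩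

/-- Completeness of `W_0^{1,p}(Ω)`, for functions and gradients converging in the Lebesgue
spaces. -/
lemma exists_of_tendsto_eLpNorm {w : ℕ → W0 Ω p} {f : Eu N → ℝ} {g : Fin N → Eu N → ℝ}
    (hf : MemLp f 1 (leb Ω)) (hg : ∀ j, MemLp (g j) (ENNReal.ofReal (p j)) (leb Ω))
    (hwf : Tendsto (fun k => eLpNorm (⇑(w k).fn - f) 1 (leb Ω)) atTop (𝓝 0))
    (hwg : ∀ j, Tendsto (fun k => eLpNorm (⇑((w k).der j) - g j) (ENNReal.ofReal (p j)) (leb Ω))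
      atTop (𝓝 0)) :
    ∃ u : W0 Ω p, u.fn =ᵐ[leb Ω] f ∧ ∀ j, u.der j =ᵐ[leb Ω] g j := by
  have h1 : Tendsto (fun k => (w k).fn) atTop (𝓝 (hf.toLp f)) :=
    (Lp.tendsto_Lp_iff_tendsto_eLpNorm _ f hf).2 hwf
  have h2 : ∀ j, Tendsto (fun k => (w k).der j) atTop (𝓝 ((hg j).toLp (g j))) := fun j =>
    (Lp.tendsto_Lp_iff_tendsto_eLpNorm _ (g j) (hg j)).2 (hwg j)
  obtain ⟨u, hu, hu'⟩ := exists_of_tendsto_pair h1 h2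
  exact ⟨u, by rw [hu]; exact hf.coeFn_toLp, fun j => by rw [hu' j]; exact (hg j).coeFn_toLp⟩

variable [hfin : IsFiniteMeasure (leb Ω)]

/-- As `G` is only of class `C^1`, its composition with `φ` need not be a test function. Polynomials
vanishing at `0`, with derivatives uniformly close to `G'` on an interval containing the values of
`φ`, do give test functions, and these converge with their gradients by dominated convergence. -/
lemma exists_comp_of_test {φ : Eu N → ℝ} (hφ : IsTest Ω φ) {G G' : ℝ → ℝ}
    (hG : ∀ t, HasDerivAt G (G' t) t) (hG' : Continuous G') (h0 : G 0 = 0) :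
    ∃ w : W0 Ω p, w.fn =ᵐ[leb Ω] (fun x => G (φ x)) ∧
      ∀ j, w.der j =ᵐ[leb Ω] fun x => G' (φ x) * pderiv j φ x := by
  obtain ⟨M₀, hM₀⟩ := hφ.smooth.continuous.bounded_above_of_compact_support hφ.compact
  obtain ⟨M, hMdef⟩ : ∃ M, M = max M₀ 0 := ⟨_, rfl⟩
  have hM0 : 0 ≤ M := hMdef ▸ le_max_right _ _
  have hM : ∀ x, φ x ∈ Set.Icc (-M) M := fun x =>
    abs_le.1 ((hM₀ x).trans (hMdef ▸ le_max_left _ _))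
  obtain ⟨K, hK⟩ := (isCompact_Icc (a := -M) (b := M)).exists_bound_of_continuousOn
    hG'.continuousOn
  have hex : ∀ k : ℕ, ∃ Q : Polynomial ℝ, Q.eval 0 = 0 ∧
      ∀ t ∈ Set.Icc (-M) M, |Q.derivative.eval t - G' t| ≤ 1 / ((k : ℝ) + 1) := by
    intro k
    obtain ⟨P, hP⟩ := exists_polynomial_near_of_continuousOn (-M) M G' hG'.continuousOn
      (1 / ((k : ℝ) + 1)) (by positivity)
    obtain ⟨Q, hQ, hQ0⟩ := exists_polynomial_antideriv P
    exact ⟨Q, hQ0, fun t ht => hQ ▸ (hP t ht).le⟩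
  choose Q hQ0 hQ using hex
  have hone : ∀ k : ℕ, 1 / ((k : ℝ) + 1) ≤ 1 := fun k =>
    div_le_one_of_le₀ (by linarith [k.cast_nonneg (α := ℝ)]) (by positivity)
  have hQG : ∀ k, ∀ t ∈ Set.Icc (-M) M, |(Q k).eval t - G t| ≤ 1 / ((k : ℝ) + 1) * M := by
    intro k t ht
    have h := Convex.norm_image_sub_le_of_norm_hasDerivWithin_le
      (f := fun t => (Q k).eval t - G t) (f' := fun t => (Q k).derivative.eval t - G' t)
      (s := Set.Icc (-M) M) (x := 0) (y := t) (C := 1 / ((k : ℝ) + 1))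
      (fun x _ => (((Q k).hasDerivAt x).sub (hG x)).hasDerivWithinAt) (fun x hx => hQ k x hx)
      (convex_Icc _ _) ⟨by linarith, hM0⟩ ht
    simp only [hQ0, h0, sub_zero, Real.norm_eq_abs] at h
    exact h.trans (mul_le_mul_of_nonneg_left (abs_le.2 ht) (by positivity))
  have htest : ∀ k, IsTest Ω (fun x => (Q k).eval (φ x)) := fun k =>
    { smooth := by
        have h := ((Q k).contDiff_aeval (𝕜 := ℝ) ∞).comp hφ.smooth
        simp only [Polynomial.coe_aeval_eq_eval] at h
        exact h
      compact := hφ.compact.comp_left (g := fun t => (Q k).eval t) (hQ0 k)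
      supp := (closure_mono (Function.support_comp_subset (g := fun t => (Q k).eval t)
        (hQ0 k) φ)).trans hφ.supp }
  have hpd : ∀ k j x, pderiv j (fun x => (Q k).eval (φ x)) x =
      (Q k).derivative.eval (φ x) * pderiv j φ x := by
    intro k j x
    have h := ((Q k).hasDerivAt (φ x)).comp_hasFDerivAt x
      (hφ.smooth.differentiable (by simp) x).hasFDerivAt
    have h' : fderiv ℝ (fun x => (Q k).eval (φ x)) x =
      (Q k).derivative.eval (φ x) • fderiv ℝ φ x := h.fderiv
    simp [pderiv, h']
  choose w hw using fun k => exists_ofTest (p := p) (htest k)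
  have hd : ∀ j, Continuous (pderiv j φ) := fun j =>
    (hφ.smooth.continuous_fderiv (by simp)).clm_apply continuous_const
  have hdc : ∀ j, HasCompactSupport (pderiv j φ) := fun j => hφ.compact.fderiv_apply (𝕜 := ℝ) _
  have m2 : ∀ j, MemLp (fun x => (K + 1) * pderiv j φ x) (ENNReal.ofReal (p j)) (leb Ω) :=
    fun j => (((hd j).memLp_of_hasCompactSupport (hdc j)).restrict Ω).const_mul _
  have hinv : Tendsto (fun k : ℕ => 1 / ((k : ℝ) + 1)) atTop (𝓝 0) :=
    tendsto_one_div_add_atTop_nhds_zero_nat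
  obtain ⟨K₂, hK₂⟩ := (isCompact_Icc (a := -M) (b := M)).exists_bound_of_continuousOn
    (continuous_iff_continuousAt.2 fun t => (hG t).continuousAt).continuousOn
  have c1 := tendsto_eLpNorm_sub_of_dominated (μ := leb Ω) (r := 1) le_rfl ENNReal.one_ne_top
    (F := fun k => ((w k).fn : Eu N → ℝ)) (f := fun x => G (φ x)) (g := fun _ => K₂ + M)
    (fun k => Lp.aestronglyMeasurable _) (memLp_const _)
    (fun k => by
      filter_upwards [(hw k).fn_eq] with x hx
      rw [hx]
      have h1 := hQG k _ (hM x)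
      have h2 := hK₂ _ (hM x)
      rw [Real.norm_eq_abs] at h2
      have h3 : 1 / ((k : ℝ) + 1) * M ≤ 1 * M := mul_le_mul_of_nonneg_right (hone k) hM0
      have h4 := abs_sub_abs_le_abs_sub ((Q k).eval (φ x)) (G (φ x))
      exact le_trans (by linarith) (le_abs_self _))
    (by
      filter_upwards [ae_all_iff.2 fun k => (hw k).fn_eq] with x hx
      simp only [hx]
      rw [tendsto_iff_norm_sub_tendsto_zero]
      refine squeeze_zero (fun _ => norm_nonneg _) (fun k => hQG k _ (hM x)) ?_
      simpa using hinv.mul_const M)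
  have c2 : ∀ j, _ := fun j => tendsto_eLpNorm_sub_of_dominated (μ := leb Ω)
    (r := ENNReal.ofReal (p j)) (by simpa using (hp.out j).le) ENNReal.ofReal_ne_top
    (F := fun k => ((w k).der j : Eu N → ℝ)) (f := fun x => G' (φ x) * pderiv j φ x)
    (g := fun x => (K + 1) * pderiv j φ x)
    (fun k => Lp.aestronglyMeasurable _) (m2 j)
    (fun k => by
      filter_upwards [(hw k).der_eq j] with x hx
      rw [hx, hpd, abs_mul, abs_mul]
      have h1 := (hQ k _ (hM x)).trans (hone k)
      have h2 := hK _ (hM x)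
      rw [Real.norm_eq_abs] at h2
      have h4 := abs_sub_abs_le_abs_sub ((Q k).derivative.eval (φ x)) (G' (φ x))
      refine mul_le_mul_of_nonneg_right ?_ (abs_nonneg _)
      exact le_trans (by linarith) (le_abs_self _))
    (by
      filter_upwards [ae_all_iff.2 fun k => (hw k).der_eq j] with x hx
      simp only [hx, hpd]
      refine Tendsto.mul_const _ ?_
      rw [tendsto_iff_norm_sub_tendsto_zero]
      exact squeeze_zero (fun _ => norm_nonneg _) (fun k => hQ k _ (hM x)) hinv)
  exact exists_of_tendsto_eLpNorm c1.1 (fun j => (c2 j).1) c1.2 (fun j => (c2 j).2)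

/-- The chain rule: `G(u) ∈ W_0^{1,p}(Ω)` for `G` of class `C^1` with bounded derivative and
`G(0) = 0`. -/
lemma exists_comp (u : W0 Ω p) {G G' : ℝ → ℝ} {L : ℝ} (hG : ∀ t, HasDerivAt G (G' t) t)
    (hG' : Continuous G') (hL : ∀ t, |G' t| ≤ L) (h0 : G 0 = 0) :
    ∃ w : W0 Ω p, w.fn =ᵐ[leb Ω] (fun x => G (u.fn x)) ∧
      ∀ j, w.der j =ᵐ[leb Ω] fun x => G' (u.fn x) * u.der j x := by
  have hL0 : 0 ≤ L := (abs_nonneg _).trans (hL 0)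
  have hGc : Continuous G := continuous_iff_continuousAt.2 fun t => (hG t).continuousAt
  obtain ⟨v₀, φ₀, hv₀, hfn₀, hder₀⟩ := exists_seq_ofTest u
  obtain ⟨σ, hσ, hae⟩ := (tendstoInMeasure_of_tendsto_Lp hfn₀).exists_seq_tendsto_ae
  have hfn := hfn₀.comp hσ.tendsto_atTop
  have hder := fun j => (hder₀ j).comp hσ.tendsto_atTop
  choose w hwf hwd using fun k => exists_comp_of_test (p := p) (hv₀ (σ k)).isTest hG hG' h0
  have hwf' : ∀ k, (w k).fn =ᵐ[leb Ω] fun x => G ((v₀ (σ k)).fn x) := fun k => by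
    filter_upwards [hwf k, (hv₀ (σ k)).fn_eq] with x h1 h2
    rw [h1, h2]
  have hwd' : ∀ k j, (w k).der j =ᵐ[leb Ω]
      fun x => G' ((v₀ (σ k)).fn x) * (v₀ (σ k)).der j x := fun k j => by
    filter_upwards [hwd k j, (hv₀ (σ k)).fn_eq, (hv₀ (σ k)).der_eq j] with x h1 h2 h3
    rw [h1, h2, h3]
  have hGb : ∀ t, |G t| ≤ L * |t| := fun t => by
    simpa [h0] using abs_sub_le_of_hasDerivAt hG hL t 0
  have mf : MemLp (fun x => G (u.fn x)) 1 (leb Ω) := by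
    refine ((Lp.memLp u.fn).const_mul L).mono
      (hGc.comp_aestronglyMeasurable (Lp.aestronglyMeasurable _)) (Eventually.of_forall fun x => ?_)
    rw [Real.norm_eq_abs, norm_mul, Real.norm_of_nonneg hL0]
    exact hGb _
  have mg : ∀ j, MemLp (fun x => G' (u.fn x) * u.der j x) (ENNReal.ofReal (p j)) (leb Ω) := by
    intro j
    refine ((Lp.memLp (u.der j)).const_mul L).mono
      ((hG'.comp_aestronglyMeasurable (Lp.aestronglyMeasurable _)).mul
        (Lp.aestronglyMeasurable _)) (Eventually.of_forall fun x => ?_)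
    rw [norm_mul, norm_mul, Real.norm_of_nonneg hL0]
    exact mul_le_mul_of_nonneg_right (hL _) (norm_nonneg _)
  refine exists_of_tendsto_eLpNorm (w := w) mf mg ?_ fun j => ?_
  · have h1 := (Lp.tendsto_Lp_iff_tendsto_eLpNorm' _ _).1 hfn
    have h2 : Tendsto (fun k => ENNReal.ofReal L * eLpNorm (⇑(v₀ (σ k)).fn - ⇑u.fn) 1 (leb Ω))
        atTop (𝓝 0) := by
      simpa using ENNReal.Tendsto.const_mul h1 (Or.inr ENNReal.ofReal_ne_top)
    refine tendsto_of_tendsto_of_tendsto_of_le_of_le tendsto_const_nhds h2 (fun _ => bot_le)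
      fun k => ?_
    refine eLpNorm_le_mul_eLpNorm_of_ae_le_mul ?_ 1
    filter_upwards [hwf' k] with x hx
    simp only [Pi.sub_apply, hx, Real.norm_eq_abs]
    exact abs_sub_le_of_hasDerivAt hG hL _ _
  · have h1 := (Lp.tendsto_Lp_iff_tendsto_eLpNorm' _ _).1 (hder j)
    have h2 : Tendsto (fun k => ENNReal.ofReal L *
        eLpNorm (⇑((v₀ (σ k)).der j) - ⇑(u.der j)) (ENNReal.ofReal (p j)) (leb Ω)) atTop (𝓝 0) := by
      simpa using ENNReal.Tendsto.const_mul h1 (Or.inr ENNReal.ofReal_ne_top)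
    -- The difference of gradients is `G'(v_k) (∂_j v_k - ∂_j u) + (G'(v_k) - G'(u)) ∂_j u`. The
    -- first term is small because `G'` is bounded; the second tends to zero by dominated
    -- convergence.
    have h3 := (tendsto_eLpNorm_sub_of_dominated (μ := leb Ω) (r := ENNReal.ofReal (p j))
      (by simpa using (hp.out j).le) ENNReal.ofReal_ne_top
      (F := fun k x => G' ((v₀ (σ k)).fn x) * u.der j x) (f := fun x => G' (u.fn x) * u.der j x)
      (g := fun x => L * u.der j x)
      (fun k => (hG'.comp_aestronglyMeasurable (Lp.aestronglyMeasurable _)).mul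
        (Lp.aestronglyMeasurable _)) ((Lp.memLp _).const_mul L)
      (fun k => Eventually.of_forall fun x => by
        rw [abs_mul, abs_mul, abs_of_nonneg hL0]
        exact mul_le_mul_of_nonneg_right (hL _) (abs_nonneg _))
      (by
        filter_upwards [hae] with x hx
        exact ((hG'.tendsto _).comp hx).mul_const _)).2
    have h4 := h2.add h3
    rw [add_zero] at h4
    refine tendsto_of_tendsto_of_tendsto_of_le_of_le tendsto_const_nhds h4 (fun _ => bot_le)
      fun k => ?_
    have h5 : ((w k).der j - fun x => G' (u.fn x) * u.der j x : Eu N → ℝ) =ᵐ[leb Ω]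
        (fun x => G' ((v₀ (σ k)).fn x) * ((v₀ (σ k)).der j x - u.der j x)) +
        ((fun x => G' ((v₀ (σ k)).fn x) * u.der j x) - fun x => G' (u.fn x) * u.der j x) := by
      filter_upwards [hwd' k j] with x hx
      simp only [Pi.sub_apply, Pi.add_apply, hx]
      ring
    have hm1 : AEStronglyMeasurable (fun x => G' ((v₀ (σ k)).fn x)) (leb Ω) :=
      hG'.comp_aestronglyMeasurable (Lp.aestronglyMeasurable _)
    rw [eLpNorm_congr_ae h5]
    refine (eLpNorm_add_le (hm1.mul ((Lp.aestronglyMeasurable _).sub (Lp.aestronglyMeasurable _)))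
      ((hm1.mul (Lp.aestronglyMeasurable _)).sub (mg j).1)
      (by simpa using (hp.out j).le)).trans ?_
    refine add_le_add (eLpNorm_le_mul_eLpNorm_of_ae_le_mul ?_ _) le_rfl
    refine Eventually.of_forall fun x => ?_
    rw [Pi.mul_apply, norm_mul]
    exact mul_le_mul_of_nonneg_right (hL _) (norm_nonneg _)

variable [NeZero N]

lemma norm_le_of_der_le {w u v : W0 Ω p} {a b : ℝ} (ha : 0 ≤ a) (hb : 0 ≤ b)
    (h : ∀ j, ∀ᵐ x ∂(leb Ω), |w.der j x| ≤ a * |u.der j x| + b * |v.der j x|) :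
    ‖w‖ ≤ a * ‖u‖ + b * ‖v‖ := by
  simp only [norm_def, Finset.mul_sum, ← Finset.sum_add_distrib]
  refine Finset.sum_le_sum fun j _ => ?_
  have h1 : ‖w.der j‖ ≤ ‖a • |u.der j| + b • |v.der j|‖ := by
    refine Lp.norm_le_norm_of_ae_le ?_
    filter_upwards [h j, Lp.coeFn_add (a • |u.der j|) (b • |v.der j|),
      Lp.coeFn_smul a |u.der j|, Lp.coeFn_smul b |v.der j|, Lp.coeFn_abs (u.der j),
      Lp.coeFn_abs (v.der j)] with x hx h1 h2 h3 h4 h5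
    rw [h1, Pi.add_apply, h2, h3, Pi.smul_apply, Pi.smul_apply, h4, h5]
    exact hx.trans (le_abs_self _)
  refine h1.trans ((norm_add_le _ _).trans ?_)
  rw [norm_smul, norm_smul, norm_abs_eq_norm, norm_abs_eq_norm, Real.norm_of_nonneg ha,
    Real.norm_of_nonneg hb]

end W0

/-- The primitive of a continuous function. -/
lemma hasDerivAt_primitive {g : ℝ → ℝ} (hg : Continuous g) (t : ℝ) :
    HasDerivAt (fun t => ∫ s in (0 : ℝ)..t, g s) (g t) t :=
  (hg.integral_hasStrictDerivAt 0 t).hasDerivAt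

/-- A function with bounded derivative which coincides with `t ^ 2` on a given interval. -/
lemma exists_sq_truncation (M : ℝ) (hM : 0 ≤ M) : ∃ G G' : ℝ → ℝ, (∀ t, HasDerivAt G (G' t) t) ∧
    Continuous G' ∧ (∀ t, |G' t| ≤ 2 * M) ∧ ∀ t, |t| ≤ M → G t = t ^ 2 ∧ G' t = 2 * t := by
  have hc : Continuous fun t : ℝ => 2 * max (-M) (min t M) := by fun_prop
  refine ⟨_, _, hasDerivAt_primitive hc, hc, fun t => ?_, fun t ht => ⟨?_, ?_⟩⟩
  · rw [abs_mul, abs_two]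
    refine mul_le_mul_of_nonneg_left (abs_le.2 ⟨le_max_left _ _, ?_⟩) zero_le_two
    exact max_le (by linarith) (min_le_right _ _)
  · have h : ∫ s in (0 : ℝ)..t, 2 * max (-M) (min s M) = ∫ s in (0 : ℝ)..t, 2 * s := by
      refine intervalIntegral.integral_congr fun s hs => ?_
      have hs' : |s| ≤ M := by
        have := Set.abs_sub_left_of_mem_uIcc hs
        rw [sub_zero, sub_zero] at this
        exact this.trans ht
      obtain ⟨h1, h2⟩ := abs_le.1 hs'
      simp [h1, h2]
    rw [h, intervalIntegral.integral_const_mul, integral_id]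
    ring
  · obtain ⟨h1, h2⟩ := abs_le.1 ht
    show 2 * max (-M) (min t M) = 2 * t
    rw [min_eq_left h2, max_eq_right h1]

namespace W0

variable {N : ℕ} {Ω : Set (Eu N)} {p : Fin N → ℝ} [hp : Fact (∀ j, 1 < p j)]
  [hfin : IsFiniteMeasure (leb Ω)]

/-- The product of two bounded elements of `W_0^{1,p}(Ω)`. -/
lemma exists_mul (u v : W0 Ω p) {M : ℝ} (hu : ∀ᵐ x ∂(leb Ω), |u.fn x| ≤ M)
    (hv : ∀ᵐ x ∂(leb Ω), |v.fn x| ≤ M) :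
    ∃ w : W0 Ω p, w.fn =ᵐ[leb Ω] (fun x => u.fn x * v.fn x) ∧
      ∀ j, w.der j =ᵐ[leb Ω] fun x => v.fn x * u.der j x + u.fn x * v.der j x := by
  -- Polarization: `4 u v = (u + v)^2 - (u - v)^2`. The square is made linear beyond `2 |M|`, a
  -- bound for `|u + v|` and `|u - v|`, so that the chain rule applies to it.
  obtain ⟨G, G', hG, hG', hL, hsq⟩ := exists_sq_truncation (2 * |M|) (by positivity)
  have h0 : G 0 = 0 := by simpa using (hsq 0 (by simp)).1
  obtain ⟨w₁, h1, h1'⟩ := exists_comp (u + v) hG hG' hL h0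
  obtain ⟨w₂, h2, h2'⟩ := exists_comp (u - v) hG hG' hL h0
  have hp' : ∀ᵐ x ∂(leb Ω), (u + v).fn x = u.fn x + v.fn x := by
    rw [fn_add]
    exact Lp.coeFn_add _ _
  have hm' : ∀ᵐ x ∂(leb Ω), (u - v).fn x = u.fn x - v.fn x := by
    rw [fn_sub]
    exact Lp.coeFn_sub _ _
  have hb : ∀ᵐ x ∂(leb Ω), |u.fn x + v.fn x| ≤ 2 * |M| ∧ |u.fn x - v.fn x| ≤ 2 * |M| := by
    filter_upwards [hu, hv] with x hx hy
    have := le_abs_self M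
    exact ⟨(abs_add_le _ _).trans (by linarith), (abs_sub _ _).trans (by linarith)⟩
  refine ⟨(1 / 4 : ℝ) • (w₁ - w₂), ?_, fun j => ?_⟩
  · rw [fn_smul, fn_sub]
    filter_upwards [Lp.coeFn_smul (1 / 4 : ℝ) (w₁.fn - w₂.fn), Lp.coeFn_sub w₁.fn w₂.fn, h1, h2,
      hp', hm', hb] with x e1 e2 e3 e4 e5 e6 e7
    rw [e1, Pi.smul_apply, e2, Pi.sub_apply, e3, e4, e5, e6, (hsq _ e7.1).1, (hsq _ e7.2).1,
      smul_eq_mul]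
    ring
  · have hd1 : ∀ᵐ x ∂(leb Ω), (u + v).der j x = u.der j x + v.der j x := by
      rw [der_add]
      exact Lp.coeFn_add _ _
    have hd2 : ∀ᵐ x ∂(leb Ω), (u - v).der j x = u.der j x - v.der j x := by
      rw [der_sub]
      exact Lp.coeFn_sub _ _
    rw [der_smul, der_sub]
    filter_upwards [Lp.coeFn_smul (1 / 4 : ℝ) (w₁.der j - w₂.der j),
      Lp.coeFn_sub (w₁.der j) (w₂.der j), h1' j, h2' j, hp', hm', hb, hd1, hd2]
      with x e1 e2 e3 e4 e5 e6 e7 e8 e9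
    rw [e1, Pi.smul_apply, e2, Pi.sub_apply, e3, e4, e5, e6, e8, e9, (hsq _ e7.1).2,
      (hsq _ e7.2).2, smul_eq_mul]
    ring

/-- The product of a bounded element of `W_0^{1,p}(Ω)` with a bounded `C^1` function of another
element. -/
lemma exists_mul_comp (v u : W0 Ω p) {M K L : ℝ} (hv : ∀ᵐ x ∂(leb Ω), |v.fn x| ≤ M)
    {F F' : ℝ → ℝ} (hF : ∀ t, HasDerivAt F (F' t) t) (hF' : Continuous F')
    (hL : ∀ t, |F' t| ≤ L) (hK : ∀ t, |F t| ≤ K) :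
    ∃ w : W0 Ω p, w.fn =ᵐ[leb Ω] (fun x => v.fn x * F (u.fn x)) ∧
      ∀ j, w.der j =ᵐ[leb Ω]
        fun x => F (u.fn x) * v.der j x + v.fn x * (F' (u.fn x) * u.der j x) := by
  -- Since `F 0` may be nonzero, `F(u)` need not belong to the space. The product is assembled as
  -- `F(0) v + v (F(u) - F(0))`.
  obtain ⟨z, hz, hz'⟩ := exists_comp u (G := fun t => F t - F 0) (fun t => (hF t).sub_const _) hF'
    hL (sub_self _)
  have hzb : ∀ᵐ x ∂(leb Ω), |z.fn x| ≤ max M (2 * K) := by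
    filter_upwards [hz] with x hx
    rw [hx]
    refine (abs_sub _ _).trans (le_max_of_le_right ?_)
    linarith [hK (u.fn x), hK 0]
  obtain ⟨y, hy, hy'⟩ := exists_mul v z (hv.mono fun x hx => hx.trans (le_max_left _ _)) hzb
  refine ⟨F 0 • v + y, ?_, fun j => ?_⟩
  · rw [fn_add, fn_smul]
    filter_upwards [Lp.coeFn_add (F 0 • v.fn) y.fn, Lp.coeFn_smul (F 0) v.fn, hy, hz]
      with x e1 e2 e3 e4
    rw [e1, Pi.add_apply, e2, e3, e4, Pi.smul_apply, smul_eq_mul]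
    ring
  · rw [der_add, der_smul]
    filter_upwards [Lp.coeFn_add (F 0 • v.der j) (y.der j), Lp.coeFn_smul (F 0) (v.der j), hy' j,
      hz, hz' j] with x e1 e2 e3 e4 e5
    rw [e1, Pi.add_apply, e2, e3, e4, e5, Pi.smul_apply, smul_eq_mul]
    ring

end W0

end AnisoElliptic

end

/-! ### Bounds on the flux and the a priori estimate -/

noncomputable section

set_option linter.unusedSectionVars false

namespace AnisoElliptic

/-- Both nonlinear terms of the growth condition have the form `h ^ (1 / q)` with `q = p_j'` and `h`
integrable. -/
lemma memLp_rpow_inv {α : Type*} [MeasurableSpace α] {μ : Measure α} {q : ℝ} (hq : 0 < q)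
    {h : α → ℝ} (h0 : ∀ x, 0 ≤ h x) (hint : Integrable h μ) :
    MemLp (fun x => h x ^ (1 / q)) (ENNReal.ofReal q) μ ∧
      eLpNorm (fun x => h x ^ (1 / q)) (ENNReal.ofReal q) μ =
        ENNReal.ofReal ((∫ x, h x ∂μ) ^ (1 / q)) := by
  have hm : AEStronglyMeasurable (fun x => h x ^ (1 / q)) μ :=
    (hint.1.aemeasurable.pow_const _).aestronglyMeasurable
  have he : eLpNorm (fun x => h x ^ (1 / q)) (ENNReal.ofReal q) μ =
      ENNReal.ofReal ((∫ x, h x ∂μ) ^ (1 / q)) := by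
    rw [eLpNorm_eq_lintegral_rpow_enorm_toReal (by simpa using hq) ENNReal.ofReal_ne_top,
      ENNReal.toReal_ofReal hq.le,
      ← ENNReal.ofReal_rpow_of_nonneg (integral_nonneg h0) (by positivity),
      ofReal_integral_eq_lintegral_ofReal hint (Eventually.of_forall h0)]
    congr 1
    refine lintegral_congr fun x => ?_
    rw [Real.enorm_of_nonneg (Real.rpow_nonneg (h0 x) _),
      ENNReal.ofReal_rpow_of_nonneg (Real.rpow_nonneg (h0 x) _) hq.le, ← Real.rpow_mul (h0 x),
      one_div_mul_cancel hq.ne', Real.rpow_one]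
  exact ⟨⟨hm, he ▸ ENNReal.ofReal_lt_top⟩, he⟩

/-- The structural conditions on the principal part. -/
structure FluxCond {N : ℕ} (Ω : Set (Eu N)) (p : Fin N → ℝ)
    (A : Fin N → Eu N → ℝ → (Fin N → ℝ) → ℝ) (ν₀ ν : ℝ) (η : Fin N → Eu N → ℝ) : Prop where
  cara : ∀ j, IsCaratheodory Ω (A j)
  pos : 0 < ν₀
  pos' : 0 < ν
  coer : ∀ᵐ x ∂(leb Ω), ∀ (t : ℝ) (ξ : Fin N → ℝ),
    ν₀ * ∑ j, |ξ j| ^ p j ≤ ∑ j, A j x t ξ * ξ j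
  monot : ∀ᵐ x ∂(leb Ω), ∀ (t : ℝ) (ξ ξ' : Fin N → ℝ), ξ ≠ ξ' →
    0 < ∑ j, (A j x t ξ - A j x t ξ') * (ξ j - ξ' j)
  memLp : ∀ j, MemLp (η j) (ENNReal.ofReal (p j).conjExponent) (leb Ω)
  growth : ∀ᵐ x ∂(leb Ω), ∀ (t : ℝ) (ξ : Fin N → ℝ) (j : Fin N),
    |A j x t ξ| ≤ ν * (η j x + |t| ^ (sobExp p / (p j).conjExponent)
      + (∑ l, |ξ l| ^ p l) ^ (1 / (p j).conjExponent))

namespace W0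

variable {N : ℕ} {Ω : Set (Eu N)} {p : Fin N → ℝ} [hp : Fact (∀ j, 1 < p j)]

variable (p) in
lemma conj (j : Fin N) : (p j).HolderConjugate (p j).conjExponent :=
  Real.HolderConjugate.conjExponent (hp.out j)

lemma integrable_sum_der (u : W0 Ω p) :
    Integrable (fun x => ∑ l, |u.grad x l| ^ p l) (leb Ω) :=
  integrable_finsetSum _ fun l _ => integrable_abs_rpow (p_pos p l) (Lp.memLp (u.der l))

lemma integral_sum_der (u : W0 Ω p) :
    ∫ x in Ω, ∑ l, |u.grad x l| ^ p l = u.energy :=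
  integral_finsetSum _ fun l _ => integrable_abs_rpow (p_pos p l) (Lp.memLp (u.der l))

lemma sum_abs_rpow_nonneg (p : Fin N → ℝ) (ξ : Fin N → ℝ) : 0 ≤ ∑ l, |ξ l| ^ p l :=
  Finset.sum_nonneg fun _ _ => by positivity

lemma aestronglyMeasurable_comp {F : Eu N → ℝ → (Fin N → ℝ) → ℝ} (hF : IsCaratheodory Ω F)
    {w : Eu N → ℝ} (hw : AEStronglyMeasurable w (leb Ω)) (v : W0 Ω p) :
    AEStronglyMeasurable (fun x => F x (w x) (v.grad x)) (leb Ω) :=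
  hF.aestronglyMeasurable hw fun j => Lp.aestronglyMeasurable (v.der j)

variable [hN : Fact (2 ≤ N)] [hpN : Fact (hmean p < N)] [NeZero N]
  [hfin : IsFiniteMeasure (leb Ω)] {A : Fin N → Eu N → ℝ → (Fin N → ℝ) → ℝ} {ν₀ ν : ℝ}
  {η : Fin N → Eu N → ℝ}

/-- The first argument is any function of `L^{p^*}`, not only an element of the space, because the
majorant `|u'| + r` of `tendsto_flux_of_ae` is inserted there. -/
lemma memLp_growth (hA : FluxCond Ω p A ν₀ ν η) {w : Eu N → ℝ}
    (hw : MemLp w (ENNReal.ofReal (sobExp p)) (leb Ω)) (v : W0 Ω p) (j : Fin N) :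
    MemLp (fun x => ν * (η j x + |w x| ^ (sobExp p / (p j).conjExponent)
      + (∑ l, |v.grad x l| ^ p l) ^ (1 / (p j).conjExponent)))
      (ENNReal.ofReal (p j).conjExponent) (leb Ω) ∧
    eLpNorm (fun x => ν * (η j x + |w x| ^ (sobExp p / (p j).conjExponent)
      + (∑ l, |v.grad x l| ^ p l) ^ (1 / (p j).conjExponent)))
      (ENNReal.ofReal (p j).conjExponent) (leb Ω) ≤
    ENNReal.ofReal ν * (eLpNorm (η j) (ENNReal.ofReal (p j).conjExponent) (leb Ω) +
      ENNReal.ofReal ((∫ x in Ω, |w x| ^ sobExp p) ^ (1 / (p j).conjExponent)) +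
      ENNReal.ofReal (v.energy ^ (1 / (p j).conjExponent))) := by
  have hq := (conj p j).symm.pos
  have hP : 0 < sobExp p := zero_lt_one.trans (sobExp_gt_one p)
  obtain ⟨m1, e1⟩ := memLp_rpow_inv hq (fun x => by positivity) (integrable_abs_rpow hP hw)
  obtain ⟨m2, e2⟩ := memLp_rpow_inv hq (fun x => sum_abs_rpow_nonneg p _) (integrable_sum_der v)
  rw [integral_sum_der] at e2
  have hpow : ∀ x, (|w x| ^ sobExp p) ^ (1 / (p j).conjExponent) =
      |w x| ^ (sobExp p / (p j).conjExponent) := fun x => by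
    rw [← Real.rpow_mul (abs_nonneg _), mul_one_div]
  simp only [hpow] at m1 e1
  have h1 : 1 ≤ ENNReal.ofReal (p j).conjExponent := by simpa using (conj p j).symm.lt.le
  refine ⟨(((hA.memLp j).add m1).add m2).const_mul ν, ?_⟩
  have h2 : eLpNorm (fun x => ν * (η j x + |w x| ^ (sobExp p / (p j).conjExponent)
      + (∑ l, |v.grad x l| ^ p l) ^ (1 / (p j).conjExponent)))
      (ENNReal.ofReal (p j).conjExponent) (leb Ω) ≤ ENNReal.ofReal ν * eLpNorm ((η j +
      fun x => |w x| ^ (sobExp p / (p j).conjExponent))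
      + fun x => (∑ l, |v.grad x l| ^ p l) ^ (1 / (p j).conjExponent))
      (ENNReal.ofReal (p j).conjExponent) (leb Ω) := by
    refine eLpNorm_le_mul_eLpNorm_of_ae_le_mul (Eventually.of_forall fun x => ?_) _
    rw [norm_mul, Real.norm_of_nonneg hA.pos'.le]
    rfl
  refine h2.trans (mul_le_mul' le_rfl ?_)
  refine (eLpNorm_add_le ((hA.memLp j).add m1).1 m2.1 h1).trans ?_
  rw [e2]
  refine add_le_add ?_ le_rfl
  refine (eLpNorm_add_le (hA.memLp j).1 m1.1 h1).trans ?_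
  rw [e1]

lemma memLp_flux (hA : FluxCond Ω p A ν₀ ν η) (u v : W0 Ω p) (j : Fin N) :
    MemLp (fun x => A j x (u.fn x) (v.grad x)) (ENNReal.ofReal (p j).conjExponent) (leb Ω) := by
  obtain ⟨C, -, hC⟩ := sobolev Ω p
  refine (memLp_growth hA (hC u).1 v j).1.mono
    (aestronglyMeasurable_comp (hA.cara j) (Lp.aestronglyMeasurable _) v) ?_
  filter_upwards [hA.growth] with x hx
  exact (hx _ _ j).trans (le_abs_self _)

/-- The flux is bounded in the dual Lebesgue space on bounded sets. -/
lemma exists_eLpNorm_flux_le (hA : FluxCond Ω p A ν₀ ν η) (R : ℝ) (j : Fin N) :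
    ∃ K : ℝ≥0∞, K ≠ ⊤ ∧ ∀ u v : W0 Ω p, ‖u‖ ≤ R → ‖v‖ ≤ R →
      eLpNorm (fun x => A j x (u.fn x) (v.grad x)) (ENNReal.ofReal (p j).conjExponent) (leb Ω)
        ≤ K := by
  obtain ⟨C, hC0, hC⟩ := sobolev Ω p
  have hP : 0 < sobExp p := zero_lt_one.trans (sobExp_gt_one p)
  have hh : 0 < hmean p := zero_lt_one.trans (hmean_gt_one p)
  have hq := (conj p j).symm.pos
  refine ⟨ENNReal.ofReal ν * (eLpNorm (η j) (ENNReal.ofReal (p j).conjExponent) (leb Ω) +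
      ENNReal.ofReal ((C * (∑ j, R ^ p j) ^ (sobExp p / hmean p)) ^ (1 / (p j).conjExponent)) +
      ENNReal.ofReal ((∑ j, R ^ p j) ^ (1 / (p j).conjExponent))), ?_, fun u v hu hv => ?_⟩
  · exact ENNReal.mul_ne_top ENNReal.ofReal_ne_top (ENNReal.add_ne_top.2
      ⟨ENNReal.add_ne_top.2 ⟨(hA.memLp j).2.ne, ENNReal.ofReal_ne_top⟩, ENNReal.ofReal_ne_top⟩)
  · refine (eLpNorm_mono_ae (f := fun x => A j x (u.fn x) (v.grad x)) (g := fun x =>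
        ν * (η j x + |u.fn x| ^ (sobExp p / (p j).conjExponent)
        + (∑ l, |v.grad x l| ^ p l) ^ (1 / (p j).conjExponent))) (hA.growth.mono fun x hx =>
        (hx _ _ j).trans (le_abs_self _))).trans ((memLp_growth hA (hC u).1 v j).2.trans ?_)
    have hXu := u.energy_nonneg
    have hXv := v.energy_nonneg
    have hu' := energy_le hu
    have hv' := energy_le hv
    have i1 : (∫ x in Ω, |u.fn x| ^ sobExp p) ^ (1 / (p j).conjExponent) ≤
        (C * (∑ j, R ^ p j) ^ (sobExp p / hmean p)) ^ (1 / (p j).conjExponent) := by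
      refine Real.rpow_le_rpow (integral_nonneg fun x => by positivity) ?_ (by positivity)
      refine (hC u).2.trans ?_
      gcongr
    have i2 : v.energy ^ (1 / (p j).conjExponent) ≤
        (∑ j, R ^ p j) ^ (1 / (p j).conjExponent) := by
      gcongr
    gcongr

/-- Strong convergence of fluxes with a frozen gradient, localized where the functions are
uniformly close to the limit. -/
lemma tendsto_flux_of_ae (hA : FluxCond Ω p A ν₀ ν η) {u : ℕ → W0 Ω p} {u' v : W0 Ω p}
    (hae : ∀ᵐ x ∂(leb Ω), Tendsto (fun n => (u n).fn x) atTop (𝓝 (u'.fn x)))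
    {χ : ℝ → ℝ} (hχc : Continuous χ) (hχ : ∀ s, 0 ≤ χ s ∧ χ s ≤ 1) {r : ℝ}
    (hχ0 : ∀ s, r ≤ |s| → χ s = 0) (j : Fin N) :
    Tendsto (fun n => eLpNorm ((fun x => A j x ((u n).fn x) (v.grad x) *
      χ ((u n).fn x - u'.fn x)) - fun x => A j x (u'.fn x) (v.grad x) * χ 0)
      (ENNReal.ofReal (p j).conjExponent) (leb Ω)) atTop (𝓝 0) := by
  obtain ⟨C, -, hC⟩ := sobolev Ω p
  have hq := (conj p j).symm.pos
  have hP : 0 < sobExp p := zero_lt_one.trans (sobExp_gt_one p)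
  -- The flux has critical growth `p^*` in `u`, and the embedding in `L^{p^*}` is not compact. The
  -- factor `χ` confines attention to `|u_n - u'| < r`, where `|u'| + r` is a majorant independent
  -- of `n`.
  have mw : MemLp (fun x => |u'.fn x| + r) (ENNReal.ofReal (sobExp p)) (leb Ω) :=
    (hC u').1.abs.add (memLp_const r)
  refine (tendsto_eLpNorm_sub_of_dominated (by simpa using (conj p j).symm.lt.le)
    ENNReal.ofReal_ne_top (fun n => (aestronglyMeasurable_comp (hA.cara j)
    (Lp.aestronglyMeasurable _) v).mul (hχc.comp_aestronglyMeasurable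
    ((Lp.aestronglyMeasurable _).sub (Lp.aestronglyMeasurable _))))
    (memLp_growth hA mw v j).1 (fun n => ?_) ?_).2
  · filter_upwards [hA.growth] with x hx
    have h1 := hx ((u n).fn x) (v.grad x) j
    obtain ⟨k0, k1⟩ := hχ ((u n).fn x - u'.fn x)
    rw [Pi.mul_apply, abs_mul, Pi.sub_apply, abs_of_nonneg k0]
    rcases le_or_gt r |(u n).fn x - u'.fn x| with h | h
    · rw [hχ0 _ h, mul_zero]
      exact abs_nonneg _
    · have h2 : |(u n).fn x| ≤ |(|u'.fn x| + r)| := by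
        refine le_trans ?_ (le_abs_self _)
        have := abs_sub_abs_le_abs_sub ((u n).fn x) (u'.fn x)
        linarith
      have h3 : |(u n).fn x| ^ (sobExp p / (p j).conjExponent) ≤
          |(|u'.fn x| + r)| ^ (sobExp p / (p j).conjExponent) :=
        Real.rpow_le_rpow (abs_nonneg _) h2 (by positivity)
      refine (mul_le_of_le_one_right (abs_nonneg _) k1).trans ((h1.trans ?_).trans (le_abs_self _))
      have := hA.pos'
      gcongr
  · filter_upwards [hae, (hA.cara j).2] with x hx hc
    have h1 : Tendsto (fun n => ((u n).fn x, v.grad x)) atTop (𝓝 (u'.fn x, v.grad x)) :=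
      hx.prodMk_nhds tendsto_const_nhds
    have h2 : Tendsto (fun n => (u n).fn x - u'.fn x) atTop (𝓝 0) := by
      simpa using hx.sub_const (u'.fn x)
    exact ((hc.tendsto _).comp h1).mul ((hχc.tendsto 0).comp h2)

lemma tendsto_integral_mul_der {u : ℕ → W0 Ω p} {v : W0 Ω p} (h : WeakConv u v) (j : Fin N)
    {g : Eu N → ℝ} (hg : MemLp g (ENNReal.ofReal (p j).conjExponent) (leb Ω)) :
    Tendsto (fun n => ∫ x in Ω, g x * (u n).der j x) atTop (𝓝 (∫ x in Ω, g x * v.der j x)) := by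
  obtain ⟨G, hG⟩ := exists_dual_eq_integral (conj p j) hg
  have := h (G.comp (derL Ω p j))
  simpa [hG, derL_apply] using this

lemma eLpNorm_der_le (u : W0 Ω p) (j : Fin N) {R : ℝ} (hu : ‖u‖ ≤ R) :
    eLpNorm (u.der j) (ENNReal.ofReal (p j)) (leb Ω) ≤ ENNReal.ofReal R := by
  rw [← ENNReal.ofReal_toReal (Lp.eLpNorm_ne_top (u.der j))]
  exact ENNReal.ofReal_le_ofReal ((norm_der_le u j).trans hu)

/-- The power `1 / hmean p` of the energy, which comes from Troisi's inequality, is for large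
energies better than the `1 / p 0` of `norm_le_energy`. It is what permits the range `b < p_1 / p'`
in `(P_1)` when `a₀ = 0`. -/
lemma eLpNorm_fn_le_energy {s : ℝ} (hs1 : 1 ≤ s) (hs : s < sobExp p) :
    ∃ K : ℝ, 0 ≤ K ∧ ∀ u : W0 Ω p, eLpNorm u.fn (ENNReal.ofReal s) (leb Ω) ≤
      ENNReal.ofReal (K * u.energy ^ (1 / hmean p)) := by
  obtain ⟨C, hC0, hC⟩ := sobolev Ω p
  have hP : 0 < sobExp p := zero_lt_one.trans (sobExp_gt_one p)
  have hh : 0 < hmean p := zero_lt_one.trans (hmean_gt_one p)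
  obtain ⟨V, hV⟩ : ∃ V, V = leb Ω Set.univ ^ (1 / (ENNReal.ofReal s).toReal -
    1 / (ENNReal.ofReal (sobExp p)).toReal) := ⟨_, rfl⟩
  have hVt : V ≠ ⊤ := by
    rw [hV]
    refine ENNReal.rpow_ne_top_of_nonneg ?_ (measure_ne_top _ _)
    rw [ENNReal.toReal_ofReal (by linarith), ENNReal.toReal_ofReal hP.le, sub_nonneg]
    exact one_div_le_one_div_of_le (by linarith) hs.le
  refine ⟨C ^ (1 / sobExp p) * V.toReal, by positivity, fun u => ?_⟩
  have h1 := eLpNorm_le_eLpNorm_mul_rpow_measure_univ (μ := leb Ω)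
    (ENNReal.ofReal_le_ofReal hs.le) (Lp.aestronglyMeasurable u.fn)
  rw [← hV] at h1
  refine h1.trans ?_
  have hX := u.energy_nonneg
  have h2 : eLpNorm u.fn (ENNReal.ofReal (sobExp p)) (leb Ω) ≤
      ENNReal.ofReal (C ^ (1 / sobExp p) * u.energy ^ (1 / hmean p)) := by
    rw [(hC u).1.eLpNorm_eq_integral_rpow_norm (by simpa using hP) ENNReal.ofReal_ne_top,
      ENNReal.toReal_ofReal hP.le]
    refine ENNReal.ofReal_le_ofReal ?_
    have h3 := Real.rpow_le_rpow (integral_nonneg fun x => by positivity) (hC u).2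
      (inv_nonneg.2 hP.le)
    refine h3.trans (le_of_eq ?_)
    rw [Real.mul_rpow hC0.le (by positivity), ← Real.rpow_mul hX, one_div]
    congr 2
    field_simp
  refine (mul_le_mul' h2 le_rfl).trans (le_of_eq ?_)
  rw [← ENNReal.ofReal_toReal hVt, ← ENNReal.ofReal_mul (by positivity),
    ENNReal.toReal_ofReal ENNReal.toReal_nonneg]
  ring_nf

omit [NeZero N] hN hpN hfin in
lemma le_hmean [NeZero N] (hmono : Monotone p) : p 0 ≤ hmean p := by
  have hpos : 0 < ∑ j, 1 / p j :=
    Finset.sum_pos (fun j _ => one_div_pos.2 (p_pos p j)) Finset.univ_nonempty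
  unfold hmean
  rw [le_div_iff₀ hpos, Finset.mul_sum]
  have : ∀ j ∈ Finset.univ, p 0 * (1 / p j) ≤ 1 := fun j _ => by
    rw [mul_one_div]
    exact (div_le_one (p_pos p j)).2 (hmono (Fin.zero_le j))
  simpa using Finset.sum_le_sum this

omit hp hN hpN hfin [NeZero N] in
lemma le_of_le_rpow {κ K Y θ : ℝ} (hκ : 0 < κ) (hY : 1 ≤ Y) (hθ : θ < 1)
    (h : κ * Y ≤ K * Y ^ θ) : Y ≤ (K / κ) ^ (1 / (1 - θ)) := by
  have hY0 : 0 < Y := by linarith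
  have h1 : Y ^ (1 - θ) ≤ K / κ := by
    rw [le_div_iff₀ hκ, Real.rpow_sub hY0, Real.rpow_one, div_mul_eq_mul_div,
      div_le_iff₀ (by positivity)]
    linarith
  calc Y = (Y ^ (1 - θ)) ^ (1 / (1 - θ)) := by
        rw [← Real.rpow_mul hY0.le, mul_one_div_cancel (by linarith), Real.rpow_one]
    _ ≤ _ := Real.rpow_le_rpow (by positivity) h1 (one_div_nonneg.2 (by linarith))

/-- The a priori estimate behind all existence statements. -/
theorem exists_bound_of_condP1 {B : W0 Ω p → StrongDual ℝ (W0 Ω p)} (hB : CondP1 B)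
    (hmono : Monotone p) {κ M : ℝ} (hκ : 0 < κ) (hM : 0 ≤ M) :
    ∃ R, 0 < R ∧ ∀ u v : W0 Ω p, v.energy ≤ u.energy →
      κ * u.energy ≤ B u v + M * (1 + ‖v‖) → ‖u‖ ≤ R := by
  obtain ⟨C, s, a₀, b, hC, hs1, hs, ha₀, hb, hb1, hb2, hBle⟩ := hB
  obtain ⟨K, hK, hKle⟩ := eLpNorm_fn_le_energy (Ω := Ω) (p := p) hs1 hs
  have hh1 := hmean_gt_one p
  have hh : 0 < hmean p := zero_lt_one.trans hh1
  have hm : 0 < p 0 := p_pos p 0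
  have hmh := le_hmean hmono
  have hreal : ∀ u v : W0 Ω p, |B u v| ≤
      C * (1 + ‖u‖ ^ b) * (a₀ * ‖v‖ + K * v.energy ^ (1 / hmean p)) := by
    intro u v
    have hv := v.energy_nonneg
    have hn := norm_nonneg' v
    have hn' := norm_nonneg' u
    have h1 : 0 ≤ C * (1 + ‖u‖ ^ b) := by positivity
    have h2 := (hBle u v).trans (mul_le_mul' le_rfl (add_le_add le_rfl (hKle v)))
    rw [← ENNReal.ofReal_add (by positivity) (by positivity), ← ENNReal.ofReal_mul h1] at h2
    exact (ENNReal.ofReal_le_ofReal_iff (by positivity)).1 h2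
  -- The factor `‖u‖ ^ b` costs the power `b / p_1` of the energy, and the factor in `v` costs `1 /
  -- p` if `a₀ = 0` and `1 / p_1` otherwise. The restrictions on `b` in `(P_1)` say exactly that the
  -- sum is less than one.
  obtain ⟨θ₁, hθ₁, K₁, hK₁, hmain⟩ : ∃ θ₁ : ℝ, θ₁ < 1 ∧ ∃ K₁ : ℝ, 0 ≤ K₁ ∧
      ∀ u v : W0 Ω p, v.energy ≤ u.energy → B u v ≤ K₁ * (1 + u.energy) ^ θ₁ := by
    have hstep : ∀ u v : W0 Ω p, v.energy ≤ u.energy →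
        C * (1 + ‖u‖ ^ b) ≤ C * (1 + (N : ℝ) ^ b) * (1 + u.energy) ^ (b / p 0) ∧
        ‖v‖ ≤ N * (1 + u.energy) ^ (1 / p 0) ∧
        v.energy ^ (1 / hmean p) ≤ (1 + u.energy) ^ (1 / hmean p) := by
      intro u v huv
      have hX := u.energy_nonneg
      have hXv := v.energy_nonneg
      have hY : 1 ≤ 1 + u.energy := by linarith
      have hu := norm_le_energy u hm fun j => hmono (Fin.zero_le j)
      have hv := norm_le_energy v hm fun j => hmono (Fin.zero_le j)
      refine ⟨?_, hv.trans ?_, Real.rpow_le_rpow hXv (by linarith) (by positivity)⟩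
      · have h1 : ‖u‖ ^ b ≤ (N : ℝ) ^ b * (1 + u.energy) ^ (b / p 0) := by
          refine (Real.rpow_le_rpow (norm_nonneg' u) hu hb.le).trans (le_of_eq ?_)
          rw [Real.mul_rpow (by positivity) (by positivity), ← Real.rpow_mul (by linarith)]
          congr 2
          ring
        have h2 : 1 ≤ (1 + u.energy) ^ (b / p 0) := Real.one_le_rpow hY (by positivity)
        rw [mul_assoc]
        refine mul_le_mul_of_nonneg_left ?_ hC.le
        rw [add_mul, one_mul]
        exact add_le_add h2 h1
      · gcongr
    rcases ha₀.eq_or_lt with h0 | h0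
    · refine ⟨b / p 0 + 1 / hmean p, ?_, C * (1 + (N : ℝ) ^ b) * K, by positivity,
        fun u v huv => ?_⟩
      · have h1 := hb2 h0.symm
        have h2 : (hmean p).conjExponent = hmean p / (hmean p - 1) := rfl
        rw [h2, div_div_eq_mul_div, lt_div_iff₀ hh] at h1
        rw [div_add_div _ _ hm.ne' hh.ne', div_lt_one (by positivity)]
        nlinarith
      · obtain ⟨h1, h2, h3⟩ := hstep u v huv
        have hX := u.energy_nonneg
        have hXv := v.energy_nonneg
        refine ((le_abs_self _).trans (hreal u v)).trans ?_
        rw [← h0, zero_mul, zero_add, Real.rpow_add (by linarith)]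
        calc _ ≤ (C * (1 + (N : ℝ) ^ b) * (1 + u.energy) ^ (b / p 0)) *
            (K * (1 + u.energy) ^ (1 / hmean p)) := by
              have h4 : 0 ≤ (1 + u.energy) ^ (b / p 0) := by positivity
              gcongr
          _ = _ := by ring
    · refine ⟨b / p 0 + 1 / p 0, ?_, C * (1 + (N : ℝ) ^ b) * (a₀ * N + K), by positivity,
        fun u v huv => ?_⟩
      · have h1 := hb1 h0
        rw [← add_div, div_lt_one hm]
        linarith
      · obtain ⟨h1, h2, h3⟩ := hstep u v huv
        have hX := u.energy_nonneg
        have hXv := v.energy_nonneg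
        have h5 : (1 + u.energy) ^ (1 / hmean p) ≤ (1 + u.energy) ^ (1 / p 0) :=
          Real.rpow_le_rpow_of_exponent_le (by linarith) (one_div_le_one_div_of_le hm hmh)
        have h6 := h3.trans h5
        refine ((le_abs_self _).trans (hreal u v)).trans ?_
        rw [Real.rpow_add (by linarith)]
        have hn := norm_nonneg' v
        calc _ ≤ (C * (1 + (N : ℝ) ^ b) * (1 + u.energy) ^ (b / p 0)) *
            (a₀ * (N * (1 + u.energy) ^ (1 / p 0)) + K * (1 + u.energy) ^ (1 / p 0)) := by
              have h4 : 0 ≤ (1 + u.energy) ^ (b / p 0) := by positivity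
              gcongr
          _ = _ := by ring
  -- The term `M (1 + ‖v‖)` grows like the power `1 / p 0 < 1` of the energy; the maximum treats it
  -- together with `B`.
  obtain ⟨θ, hθ⟩ : ∃ θ, θ = max θ₁ (1 / p 0) := ⟨_, rfl⟩
  have hθ1 : θ < 1 := by
    rw [hθ]
    exact max_lt hθ₁ ((div_lt_one hm).2 (hp.out 0))
  have hθ0 : 0 ≤ θ := by
    rw [hθ]
    exact le_max_of_le_right (by positivity)
  obtain ⟨Z, hZ⟩ : ∃ Z, Z = ((κ + K₁ + M * (1 + N)) / κ) ^ (1 / (1 - θ)) := ⟨_, rfl⟩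
  have hZ0 : 0 ≤ Z := by rw [hZ]; positivity
  refine ⟨N * Z ^ (1 / p 0) + 1, by positivity, fun u v huv h => ?_⟩
  have hX := u.energy_nonneg
  have hY : 1 ≤ 1 + u.energy := by linarith
  have hYZ : 1 + u.energy ≤ Z := by
    rw [hZ]
    refine le_of_le_rpow hκ hY hθ1 ?_
    have h1 := hmain u v huv
    have h2 : (1 + u.energy) ^ θ₁ ≤ (1 + u.energy) ^ θ :=
      Real.rpow_le_rpow_of_exponent_le hY (hθ ▸ le_max_left _ _)
    have h3 : (1 + u.energy) ^ (1 / p 0) ≤ (1 + u.energy) ^ θ :=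
      Real.rpow_le_rpow_of_exponent_le hY (hθ ▸ le_max_right _ _)
    have h4 : 1 ≤ (1 + u.energy) ^ θ := Real.one_le_rpow hY hθ0
    have h5 : ‖v‖ ≤ N * (1 + u.energy) ^ θ := by
      refine (norm_le_energy v hm fun j => hmono (Fin.zero_le j)).trans ?_
      have h6 : (1 + v.energy) ^ (1 / p 0) ≤ (1 + u.energy) ^ (1 / p 0) := by
        have := v.energy_nonneg
        gcongr
      gcongr
      exact h6.trans h3
    have h7 : K₁ * (1 + u.energy) ^ θ₁ ≤ K₁ * (1 + u.energy) ^ θ :=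
      mul_le_mul_of_nonneg_left h2 hK₁
    have h8 : M * (1 + ‖v‖) ≤ M * ((1 + u.energy) ^ θ + N * (1 + u.energy) ^ θ) :=
      mul_le_mul_of_nonneg_left (add_le_add h4 h5) hM
    have h9 : κ * 1 ≤ κ * (1 + u.energy) ^ θ := mul_le_mul_of_nonneg_left h4 hκ.le
    linarith
  refine ((norm_le_energy u hm fun j => hmono (Fin.zero_le j)).trans ?_).trans
    (le_add_of_nonneg_right zero_le_one)
  gcongr

end W0

end AnisoElliptic

end

/-! ### Almost everywhere convergence of gradients, after Leray and Lions -/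

noncomputable section

set_option linter.unusedSectionVars false

namespace AnisoElliptic

/-- If `a(t, ·)` is strictly monotone and `a` is continuous, then
`(a(t_n, ξ_n) - a(t_n, ξ)) · (ξ_n - ξ) → 0` forces `ξ_n → ξ`. -/
lemma tendsto_of_monotone_pairing {N : ℕ} {a : Fin N → ℝ → (Fin N → ℝ) → ℝ}
    (hc : ∀ j, Continuous fun z : ℝ × (Fin N → ℝ) => a j z.1 z.2)
    (hmon : ∀ (t : ℝ) (ξ ξ' : Fin N → ℝ), ξ ≠ ξ' →
      0 < ∑ j, (a j t ξ - a j t ξ') * (ξ j - ξ' j))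
    {t : ℕ → ℝ} {t' : ℝ} (ht : Tendsto t atTop (𝓝 t')) {ξ : ℕ → Fin N → ℝ} {ξ' : Fin N → ℝ}
    (hD : Tendsto (fun n => ∑ j, (a j (t n) (ξ n) - a j (t n) ξ') * (ξ n j - ξ' j)) atTop (𝓝 0)) :
    Tendsto ξ atTop (𝓝 ξ') := by
  have hmon' : ∀ (t : ℝ) (ξ ξ' : Fin N → ℝ),
      0 ≤ ∑ j, (a j t ξ - a j t ξ') * (ξ j - ξ' j) := by
    intro t ξ ξ'
    rcases eq_or_ne ξ ξ' with h | h
    · simp [h]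
    · exact (hmon t ξ ξ' h).le
  rw [Metric.tendsto_atTop']
  by_contra! hcon
  obtain ⟨ε, hε, hcon⟩ := hcon
  have hcc : Continuous fun z : ℝ × (Fin N → ℝ) =>
      ∑ j, (a j z.1 (ξ' + ε • z.2) - a j z.1 ξ') * z.2 j := by
    refine continuous_finsetSum _ fun j _ => ?_
    have h1 : Continuous fun z : ℝ × (Fin N → ℝ) => a j z.1 (ξ' + ε • z.2) :=
      (hc j).comp (by fun_prop : Continuous fun z : ℝ × (Fin N → ℝ) => (z.1, ξ' + ε • z.2))
    have h2 : Continuous fun z : ℝ × (Fin N → ℝ) => a j z.1 ξ' :=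
      (hc j).comp (by fun_prop : Continuous fun z : ℝ × (Fin N → ℝ) => (z.1, ξ'))
    have h3 : Continuous fun z : ℝ × (Fin N → ℝ) => z.2 j := by fun_prop
    exact (h1.sub h2).mul h3
  -- By compactness, strict monotonicity is quantitative at distance `ε` from `ξ'`: the pairing in
  -- direction `e` is at least `c > 0`, for all unit `e` and all first arguments within `1` of `t'`.
  obtain ⟨c, hc0, hcK⟩ := ((isCompact_closedBall t' 1).prod
    (isCompact_sphere (0 : Fin N → ℝ) 1)).exists_forall_le' hcc.continuousOn (a := 0) (by
      rintro ⟨s, e⟩ ⟨-, he⟩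
      have he' : e ≠ 0 := by
        rintro rfl
        simp at he
      have h1 := hmon s (ξ' + ε • e) ξ' (by simp [hε.ne', he'])
      have h2 : ∑ j, (a j s (ξ' + ε • e) - a j s ξ') * ((ξ' + ε • e) j - ξ' j) =
          ε * ∑ j, (a j s (ξ' + ε • e) - a j s ξ') * e j := by
        rw [Finset.mul_sum]
        refine Finset.sum_congr rfl fun j _ => ?_
        simp only [Pi.add_apply, Pi.smul_apply, smul_eq_mul]
        ring
      rw [h2] at h1
      exact (mul_pos_iff_of_pos_left hε).1 h1)
  have hev : ∀ᶠ n in atTop, t n ∈ Metric.closedBall t' 1 ∧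
      ∑ j, (a j (t n) (ξ n) - a j (t n) ξ') * (ξ n j - ξ' j) < ε * c := by
    exact (ht.eventually (Metric.closedBall_mem_nhds t' one_pos)).and
      (hD.eventually (gt_mem_nhds (mul_pos hε hc0)))
  obtain ⟨n₀, hn₀⟩ := eventually_atTop.1 hev
  obtain ⟨n, hn, hdist⟩ := hcon n₀
  obtain ⟨h1, h2⟩ := hn₀ n hn.le
  obtain ⟨s, hs⟩ : ∃ s, s = ‖ξ n - ξ'‖ := ⟨_, rfl⟩
  rw [dist_eq_norm, ← hs] at hdist
  have hs0 : 0 < s := hε.trans_le hdist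
  obtain ⟨e, he⟩ : ∃ e, e = s⁻¹ • (ξ n - ξ') := ⟨_, rfl⟩
  have hen : e ∈ Metric.sphere (0 : Fin N → ℝ) 1 := by
    rw [mem_sphere_zero_iff_norm, he, norm_smul, ← hs, norm_inv, Real.norm_of_nonneg hs0.le,
      inv_mul_cancel₀ hs0.ne']
  have hse : s • e = ξ n - ξ' := by rw [he, smul_inv_smul₀ hs0.ne']
  have h3 := hcK (t n, e) ⟨h1, hen⟩
  have hξ : ξ n = ξ' + s • e := by rw [hse]; abel
  have h4 := hmon' (t n) (ξ n) (ξ' + ε • e)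
  have hcoord : ∀ j, ξ n j = ξ' j + s * e j := fun j => by rw [hξ]; simp
  have h5 : ∑ j, (a j (t n) (ξ n) - a j (t n) (ξ' + ε • e)) * (ξ n j - (ξ' + ε • e) j) =
      (s - ε) * ∑ j, (a j (t n) (ξ n) - a j (t n) (ξ' + ε • e)) * e j := by
    rw [Finset.mul_sum]
    refine Finset.sum_congr rfl fun j _ => ?_
    rw [hcoord j]
    simp only [Pi.add_apply, Pi.smul_apply, smul_eq_mul]
    ring
  have h6 : ∑ j, (a j (t n) (ξ n) - a j (t n) ξ') * (ξ n j - ξ' j) =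
      s * ∑ j, (a j (t n) (ξ n) - a j (t n) ξ') * e j := by
    rw [Finset.mul_sum]
    refine Finset.sum_congr rfl fun j _ => ?_
    rw [hcoord j]
    ring
  have h7 : ∑ j, (a j (t n) (ξ n) - a j (t n) ξ') * e j =
      ∑ j, (a j (t n) (ξ n) - a j (t n) (ξ' + ε • e)) * e j +
      ∑ j, (a j (t n) (ξ' + ε • e) - a j (t n) ξ') * e j := by
    rw [← Finset.sum_add_distrib]
    exact Finset.sum_congr rfl fun j _ => by ring
  -- Monotonicity between the points at distances `ε` and `s` on the ray shows that the directional
  -- pairing does not decrease, so the lower bound at distance `ε` persists at `ξ n`, however far it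
  -- is.
  have h8 : c ≤ ∑ j, (a j (t n) (ξ n) - a j (t n) ξ') * e j := by
    rcases hdist.eq_or_lt with heq | hlt
    · have : ξ' + ε • e = ξ n := by rw [hξ, heq]
      rw [← this]
      exact h3
    · rw [h5] at h4
      have := nonneg_of_mul_nonneg_right h4 (by linarith)
      rw [h7]
      linarith
  rw [h6] at h2
  have h9 : ε * c ≤ s * c := mul_le_mul_of_nonneg_right hdist hc0.le
  have h10 := mul_le_mul_of_nonneg_left h8 hs0.le
  linarith

/-- A Lipschitz cutoff function, equal to `1` on `[-1, 1]` and to `0` outside of `[-2, 2]`. -/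
def cutoff (s : ℝ) : ℝ := max 0 (min 1 (2 - |s|))

lemma continuous_cutoff : Continuous cutoff := by
  unfold cutoff
  fun_prop

lemma cutoff_mem (s : ℝ) : 0 ≤ cutoff s ∧ cutoff s ≤ 1 :=
  ⟨le_max_left _ _, max_le zero_le_one (min_le_left _ _)⟩

lemma cutoff_eq_one {s : ℝ} (h : |s| ≤ 1) : cutoff s = 1 := by
  unfold cutoff
  rw [min_eq_left (by linarith), max_eq_right zero_le_one]

lemma cutoff_eq_zero {s : ℝ} (h : 2 ≤ |s|) : cutoff s = 0 := by
  unfold cutoff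
  rw [max_eq_left ((min_le_right _ _).trans (by linarith))]

namespace W0

variable {N : ℕ} {Ω : Set (Eu N)} {p : Fin N → ℝ} [hp : Fact (∀ j, 1 < p j)]
  [hN : Fact (2 ≤ N)] [hpN : Fact (hmean p < N)] [NeZero N]
  [hfin : IsFiniteMeasure (leb Ω)] {A : Fin N → Eu N → ℝ → (Fin N → ℝ) → ℝ} {ν₀ ν : ℝ}
  {η : Fin N → Eu N → ℝ}

lemma integrable_flux_mul_der (hA : FluxCond Ω p A ν₀ ν η) (u v z : W0 Ω p) (j : Fin N) :
    Integrable (fun x => A j x (u.fn x) (v.grad x) * z.der j x) (leb Ω) :=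
  integrable_mul_of_conj (conj p j) (memLp_flux hA u v j) (Lp.memLp _)

lemma integrable_flux_mul_der_mul (hA : FluxCond Ω p A ν₀ ν η) (u v z : W0 Ω p) (j : Fin N)
    {h : Eu N → ℝ} {K : ℝ} (hm : AEStronglyMeasurable h (leb Ω))
    (hK : ∀ᵐ x ∂(leb Ω), |h x| ≤ K) :
    Integrable (fun x => A j x (u.fn x) (v.grad x) * z.der j x * h x) (leb Ω) :=
  (integrable_flux_mul_der hA u v z j).mul_bdd hm hK

lemma exists_subseq_ae_fn {u : ℕ → W0 Ω p} {u' : W0 Ω p} {R : ℝ} (hR : ∀ n, ‖u n‖ ≤ R)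
    (hweak : WeakConv u u') : ∃ σ : ℕ → ℕ, StrictMono σ ∧
      ∀ᵐ x ∂(leb Ω), Tendsto (fun n => (u (σ n)).fn x) atTop (𝓝 (u'.fn x)) :=
  (tendstoInMeasure_of_tendsto_Lp (tendsto_fn_of_weakConv hR hweak)).exists_seq_tendsto_ae

lemma WeakConv.comp {u : ℕ → W0 Ω p} {u' : W0 Ω p} (h : WeakConv u u') {σ : ℕ → ℕ}
    (hσ : StrictMono σ) : WeakConv (fun n => u (σ n)) u' :=
  fun F => (h F).comp hσ.tendsto_atTop

/-- The integrals `∫ A(x, u_n, ∇u) · ∇(u_n - u) χ(u_n - u)` tend to zero. -/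
lemma tendsto_integral_flux_frozen (hA : FluxCond Ω p A ν₀ ν η) {u : ℕ → W0 Ω p} {u' : W0 Ω p}
    {R : ℝ} (hR : ∀ n, ‖u n‖ ≤ R) (hweak : WeakConv u u')
    (hae : ∀ᵐ x ∂(leb Ω), Tendsto (fun n => (u n).fn x) atTop (𝓝 (u'.fn x)))
    {r : ℝ} (hr : 0 < r) :
    Tendsto (fun n => ∫ x in Ω, ∑ j, A j x ((u n).fn x) (u'.grad x) *
      ((u n).der j x - u'.der j x) * cutoff (((u n).fn x - u'.fn x) / r)) atTop (𝓝 0) := by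
  have hcc : Continuous fun s => cutoff (s / r) := continuous_cutoff.comp (by fun_prop)
  have hcm : ∀ n, AEStronglyMeasurable (fun x => cutoff (((u n).fn x - u'.fn x) / r)) (leb Ω) :=
    fun n => hcc.comp_aestronglyMeasurable
      ((Lp.aestronglyMeasurable _).sub (Lp.aestronglyMeasurable _))
  have hcb : ∀ n, ∀ᵐ x ∂(leb Ω), |cutoff (((u n).fn x - u'.fn x) / r)| ≤ 1 := fun n =>
    Eventually.of_forall fun x => by
      rw [abs_of_nonneg (cutoff_mem _).1]
      exact (cutoff_mem _).2
  have hint : ∀ n j (z : W0 Ω p), Integrable (fun x => A j x ((u n).fn x) (u'.grad x) *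
      z.der j x * cutoff (((u n).fn x - u'.fn x) / r)) (leb Ω) := fun n j z =>
    integrable_flux_mul_der_mul hA (u n) u' z j (hcm n) (hcb n)
  have key : ∀ j, Tendsto (fun n => ∫ x in Ω, A j x ((u n).fn x) (u'.grad x) *
      ((u n).der j x - u'.der j x) * cutoff (((u n).fn x - u'.fn x) / r)) atTop (𝓝 0) := by
    intro j
    -- With the gradient frozen at that of `u'`, the cut-off flux converges strongly in the dual
    -- exponent and can be paired with the weakly convergent `∂_j u_n`.
    have hstr := tendsto_flux_of_ae hA (v := u') hae hcc (fun s => cutoff_mem _)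
      (r := 2 * r) (fun s hs => cutoff_eq_zero (by
        rwa [abs_div, abs_of_pos hr, le_div_iff₀ hr])) j
    simp only [zero_div, cutoff_eq_one (s := 0) (by simp), mul_one] at hstr
    have hmem : ∀ n, MemLp (fun x => A j x ((u n).fn x) (u'.grad x) *
        cutoff (((u n).fn x - u'.fn x) / r)) (ENNReal.ofReal (p j).conjExponent) (leb Ω) :=
      fun n => by
        refine (memLp_flux hA (u n) u' j).mono ((memLp_flux hA (u n) u' j).1.mul (hcm n)) ?_
        filter_upwards [hcb n] with x hx
        rw [norm_mul]
        exact mul_le_of_le_one_right (norm_nonneg _) hx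
    have t1 := tendsto_integral_mul_of_strong_weak (conj p j) ENNReal.ofReal_ne_top hmem
      (memLp_flux hA u' u' j) hstr (fun n => Lp.memLp ((u n).der j))
      (fun n => eLpNorm_der_le (u n) j (hR n))
      (tendsto_integral_mul_der hweak j (memLp_flux hA u' u' j))
    have t2 := tendsto_integral_mul_of_strong_weak (conj p j)
      (Lp.eLpNorm_ne_top (u'.der j)) hmem (memLp_flux hA u' u' j) hstr
      (fun n => Lp.memLp (u'.der j)) (fun n => le_rfl) tendsto_const_nhds
    have t3 := t1.sub t2
    rw [sub_self] at t3
    refine t3.congr fun n => ?_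
    rw [← integral_sub]
    · exact integral_congr_ae (Eventually.of_forall fun x => by ring)
    · exact (hint n j (u n)).congr (Eventually.of_forall fun x => by ring)
    · exact (hint n j u').congr (Eventually.of_forall fun x => by ring)
  have := tendsto_finsetSum Finset.univ fun j _ => key j
  simp only [Finset.sum_const_zero] at this
  refine this.congr fun n => ?_
  rw [integral_finsetSum]
  intro j _
  have := (hint n j (u n)).sub (hint n j u')
  exact this.congr (Eventually.of_forall fun x => by simp only [Pi.sub_apply]; ring)

/-- The almost everywhere convergence of gradients. -/
theorem exists_subseq_ae_grad (hA : FluxCond Ω p A ν₀ ν η) {u : ℕ → W0 Ω p} {u' : W0 Ω p} {R : ℝ}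
    (hR : ∀ n, ‖u n‖ ≤ R) (hweak : WeakConv u u')
    (hcrit : ∀ δ > 0, ∃ r > 0, ∀ᶠ n in atTop, ∫ x in Ω, ∑ j, A j x ((u n).fn x) ((u n).grad x) *
      ((u n).der j x - u'.der j x) * cutoff (((u n).fn x - u'.fn x) / r) ≤ δ) :
    ∃ σ : ℕ → ℕ, StrictMono σ ∧
      ∀ᵐ x ∂(leb Ω), Tendsto (fun n => (u (σ n)).fn x) atTop (𝓝 (u'.fn x)) ∧
        Tendsto (fun n => (u (σ n)).grad x) atTop (𝓝 (u'.grad x)) := by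
  obtain ⟨σ₁, hσ₁, hae⟩ := exists_subseq_ae_fn hR hweak
  obtain ⟨v, hv⟩ : ∃ v : ℕ → W0 Ω p, v = fun n => u (σ₁ n) := ⟨_, rfl⟩
  have hvw : WeakConv v u' := hv ▸ WeakConv.comp hweak hσ₁
  have hvR : ∀ n, ‖v n‖ ≤ R := fun n => by rw [hv]; exact hR _
  have hvae : ∀ᵐ x ∂(leb Ω), Tendsto (fun n => (v n).fn x) atTop (𝓝 (u'.fn x)) := by
    rw [hv]
    exact hae
  have hvc : ∀ δ > 0, ∃ r > 0, ∀ᶠ n in atTop, ∫ x in Ω,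
      ∑ j, A j x ((v n).fn x) ((v n).grad x) *
      ((v n).der j x - u'.der j x) * cutoff (((v n).fn x - u'.fn x) / r) ≤ δ := by
    intro δ hδ
    obtain ⟨r, hr, h⟩ := hcrit δ hδ
    refine ⟨r, hr, ?_⟩
    rw [hv]
    exact hσ₁.tendsto_atTop.eventually h
  -- `D n` is the monotonicity gap between the gradients of `v n` and `u'`. Being nonnegative, it
  -- needs only an upper bound on its integral, so the one-sided criterion `hcrit` suffices.
  obtain ⟨D, hD⟩ : ∃ D : ℕ → Eu N → ℝ, D = fun n x => ∑ j, (A j x ((v n).fn x) ((v n).grad x) -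
      A j x ((v n).fn x) (u'.grad x)) * ((v n).der j x - u'.der j x) := ⟨_, rfl⟩
  have hD0 : ∀ n, ∀ᵐ x ∂(leb Ω), 0 ≤ D n x := by
    intro n
    filter_upwards [hA.monot] with x hx
    rw [hD]
    rcases eq_or_ne ((v n).grad x) (u'.grad x) with h | h
    · simp [h]
    · exact (hx _ _ _ h).le
  have hmeas : TendstoInMeasure (leb Ω) D atTop (fun _ => 0) := by
    rw [tendstoInMeasure_iff_measureReal_dist]
    intro ε hε
    rw [Metric.tendsto_atTop']
    intro δ hδ
    -- Where `|v_n - u'| < r` the cutoff equals one, and Markov's inequality bounds the measure of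
    -- `{ε ≤ D n}` by `δ / 2`. The remaining set has measure below `δ / 4` by convergence of `v_n`
    -- in measure.
    obtain ⟨r, hr, hev⟩ := hvc (ε * δ / 4) (by positivity)
    have hfrozen := (tendsto_integral_flux_frozen hA hvR hvw hvae hr).eventually
      (lt_mem_nhds (show -(ε * δ / 4) < 0 by have := mul_pos hε hδ; linarith))
    have hfnm := (tendstoInMeasure_iff_measureReal_dist.1
      (tendstoInMeasure_of_tendsto_Lp (tendsto_fn_of_weakConv hvR hvw)) r hr).eventually
      (gt_mem_nhds (show (0 : ℝ) < δ / 4 by positivity))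
    obtain ⟨n₀, hn₀⟩ := eventually_atTop.1 (hev.and (hfrozen.and hfnm))
    refine ⟨n₀, fun n hn => ?_⟩
    obtain ⟨e1, e2, e3⟩ := hn₀ n (le_of_lt hn)
    have hcc : Continuous fun s => cutoff (s / r) := continuous_cutoff.comp (by fun_prop)
    have hcm : AEStronglyMeasurable (fun x => cutoff (((v n).fn x - u'.fn x) / r)) (leb Ω) :=
      hcc.comp_aestronglyMeasurable ((Lp.aestronglyMeasurable _).sub (Lp.aestronglyMeasurable _))
    have hcb : ∀ᵐ x ∂(leb Ω), |cutoff (((v n).fn x - u'.fn x) / r)| ≤ 1 :=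
      Eventually.of_forall fun x => by
        rw [abs_of_nonneg (cutoff_mem _).1]
        exact (cutoff_mem _).2
    have hint : ∀ w : W0 Ω p, Integrable (fun x => ∑ j, A j x ((v n).fn x) (w.grad x) *
        ((v n).der j x - u'.der j x) * cutoff (((v n).fn x - u'.fn x) / r)) (leb Ω) := fun w =>
      integrable_finsetSum _ fun j _ => by
        have := (integrable_flux_mul_der_mul hA (v n) w (v n) j hcm hcb).sub
          (integrable_flux_mul_der_mul hA (v n) w u' j hcm hcb)
        exact this.congr (Eventually.of_forall fun x => by simp only [Pi.sub_apply]; ring)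
    have hDeq : (fun x => D n x * cutoff (((v n).fn x - u'.fn x) / r)) = fun x =>
        (∑ j, A j x ((v n).fn x) ((v n).grad x) * ((v n).der j x - u'.der j x) *
          cutoff (((v n).fn x - u'.fn x) / r)) -
        ∑ j, A j x ((v n).fn x) (u'.grad x) * ((v n).der j x - u'.der j x) *
          cutoff (((v n).fn x - u'.fn x) / r) := by
      funext x
      rw [hD, ← Finset.sum_sub_distrib, Finset.sum_mul]
      exact Finset.sum_congr rfl fun j _ => by ring
    have hDint : Integrable (fun x => D n x * cutoff (((v n).fn x - u'.fn x) / r)) (leb Ω) := by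
      rw [hDeq]
      exact (hint (v n)).sub (hint u')
    have hDle : ∫ x in Ω, D n x * cutoff (((v n).fn x - u'.fn x) / r) ≤ ε * δ / 2 := by
      rw [hDeq, integral_sub (hint (v n)) (hint u')]
      linarith
    have hmark := mul_meas_ge_le_integral_of_nonneg (μ := leb Ω)
      (f := fun x => D n x * cutoff (((v n).fn x - u'.fn x) / r)) (by
        filter_upwards [hD0 n] with x hx
        exact mul_nonneg hx (cutoff_mem _).1) hDint ε
    have hsub : (leb Ω).real {x | ε ≤ dist (D n x) 0} ≤
        (leb Ω).real {x | ε ≤ D n x * cutoff (((v n).fn x - u'.fn x) / r)} +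
        (leb Ω).real {x | r ≤ dist ((v n).fn x) (u'.fn x)} := by
      refine le_trans ?_ (measureReal_union_le _ _)
      refine ENNReal.toReal_mono (measure_ne_top _ _) (measure_mono_ae ?_)
      filter_upwards [hD0 n] with x hx hx2
      change ε ≤ dist (D n x) 0 at hx2
      rw [Real.dist_eq, sub_zero, abs_of_nonneg hx] at hx2
      by_cases hxr : r ≤ dist ((v n).fn x) (u'.fn x)
      · exact Or.inr hxr
      · left
        show ε ≤ D n x * cutoff (((v n).fn x - u'.fn x) / r)
        rw [cutoff_eq_one, mul_one]
        · exact hx2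
        · rw [abs_div, abs_of_pos hr, div_le_one hr]
          rw [Real.dist_eq] at hxr
          exact (not_le.1 hxr).le
    rw [Real.dist_eq, sub_zero, abs_of_nonneg measureReal_nonneg]
    have h1 : (leb Ω).real {x | ε ≤ D n x * cutoff (((v n).fn x - u'.fn x) / r)} ≤ δ / 2 := by
      have := hmark.trans hDle
      rw [show ε * δ / 2 = ε * (δ / 2) by ring] at this
      exact le_of_mul_le_mul_left this hε
    linarith
  obtain ⟨σ₂, hσ₂, hDae⟩ := hmeas.exists_seq_tendsto_ae
  refine ⟨σ₁ ∘ σ₂, hσ₁.comp hσ₂, ?_⟩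
  filter_upwards [hDae, hvae, hA.monot, ae_all_iff.2 fun j => (hA.cara j).2] with x h1 h2 h3 h4
  have h5 := h2.comp hσ₂.tendsto_atTop
  rw [hD] at h1
  have h6 := tendsto_of_monotone_pairing (a := fun j => A j x) h4 h3 h5
    (ξ := fun n => (v (σ₂ n)).grad x) (ξ' := u'.grad x) h1
  rw [hv] at h5 h6
  exact ⟨h5, h6⟩

end W0

end AnisoElliptic

end

/-! ### Tools for Galerkin's method -/

noncomputable section

set_option linter.unusedSectionVars false

namespace AnisoElliptic

section Convergence

variable {α : Type*} [MeasurableSpace α] {μ : Measure α} [IsFiniteMeasure μ]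

lemma tendsto_integral_mul_zero {p q : ℝ} (hpq : p.HolderConjugate q) {a b : ℕ → α → ℝ}
    {K : ℝ≥0∞} (hK : K ≠ ⊤) (ha : ∀ n, MemLp (a n) (ENNReal.ofReal q) μ)
    (hbd : ∀ n, eLpNorm (a n) (ENNReal.ofReal q) μ ≤ K)
    (hb : ∀ n, MemLp (b n) (ENNReal.ofReal p) μ)
    (hbl : Tendsto (fun n => eLpNorm (b n) (ENNReal.ofReal p) μ) atTop (𝓝 0)) :
    Tendsto (fun n => ∫ x, a n x * b n x ∂μ) atTop (𝓝 0) := by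
  have h3 : Tendsto (fun n => K.toReal * (eLpNorm (b n) (ENNReal.ofReal p) μ).toReal)
      atTop (𝓝 0) := by
    simpa using ((ENNReal.tendsto_toReal ENNReal.zero_ne_top).comp hbl).const_mul K.toReal
  refine squeeze_zero_norm (fun n => ?_) h3
  refine (abs_integral_mul_le hpq (ha n) (hb n)).trans ?_
  gcongr
  exact hbd n

/-- Products of bounded, almost everywhere convergent functions and functions converging
in `L^1`. -/
lemma tendsto_integral_bdd_mul {a : ℕ → α → ℝ} {a' : α → ℝ} {K : ℝ}
    (ha : ∀ n, AEStronglyMeasurable (a n) μ) (hK : ∀ n, ∀ᵐ x ∂μ, |a n x| ≤ K)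
    (hlim : ∀ᵐ x ∂μ, Tendsto (fun n => a n x) atTop (𝓝 (a' x))) {b : ℕ → α → ℝ} {b' : α → ℝ}
    (hb : ∀ n, Integrable (b n) μ) (hb' : Integrable b' μ)
    (hbl : Tendsto (fun n => eLpNorm (b n - b') 1 μ) atTop (𝓝 0)) :
    Tendsto (fun n => ∫ x, a n x * b n x ∂μ) atTop (𝓝 (∫ x, a' x * b' x ∂μ)) := by
  have h1 : Tendsto (fun n => ∫ x, a n x * b' x ∂μ) atTop (𝓝 (∫ x, a' x * b' x ∂μ)) := by
    refine tendsto_integral_of_dominated_convergence (fun x => K * |b' x|)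
      (fun n => (ha n).mul hb'.1) (hb'.abs.const_mul K) (fun n => ?_) ?_
    · filter_upwards [hK n] with x hx
      rw [norm_mul]
      exact mul_le_mul_of_nonneg_right hx (abs_nonneg _)
    · filter_upwards [hlim] with x hx
      exact hx.mul_const _
  have h2 : Tendsto (fun n => ∫ x, a n x * (b n - b') x ∂μ) atTop (𝓝 0) := by
    have h3 : Tendsto (fun n => K * (eLpNorm (b n - b') 1 μ).toReal) atTop (𝓝 0) := by
      simpa using ((ENNReal.tendsto_toReal ENNReal.zero_ne_top).comp hbl).const_mul K
    refine squeeze_zero_norm (fun n => ?_) h3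
    have hi : Integrable (b n - b') μ := (hb n).sub hb'
    refine (norm_integral_le_integral_norm _).trans ?_
    have e : (eLpNorm (b n - b') 1 μ).toReal = ∫ x, ‖(b n - b') x‖ ∂μ := by
      rw [eLpNorm_one_eq_lintegral_enorm, integral_norm_eq_lintegral_enorm hi.1]
    rw [e, ← integral_const_mul]
    refine integral_mono_ae (hi.bdd_mul (ha n) (hK n)).norm (hi.norm.const_mul K) ?_
    filter_upwards [hK n] with x hx
    show ‖a n x * (b n - b') x‖ ≤ K * ‖(b n - b') x‖
    rw [norm_mul]
    exact mul_le_mul_of_nonneg_right hx (norm_nonneg _)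
  have h4 := h1.add h2
  rw [add_zero] at h4
  refine h4.congr fun n => ?_
  rw [← integral_add (hb'.bdd_mul (ha n) (hK n)) (((hb n).sub hb').bdd_mul (ha n) (hK n))]
  exact integral_congr_ae (Eventually.of_forall fun x => by simp; ring)

end Convergence

section Galerkin

variable {E : Type*} [NormedAddCommGroup E] [NormedSpace ℝ E]

/-- Solvability of coercive equations on finite-dimensional subspaces. -/
lemma exists_galerkin (V : Submodule ℝ E) [FiniteDimensional ℝ V] {T : E → E → ℝ}
    (hadd : ∀ u v w, T u (v + w) = T u v + T u w) (hsmul : ∀ u (c : ℝ) v, T u (c • v) = c * T u v)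
    (hcont : ∀ v, Continuous fun u => T u v) {R : ℝ} (hpos : ∀ u, R ≤ ‖u‖ → 0 < T u u) :
    ∃ u ∈ V, ∀ v ∈ V, T u v = 0 := by
  obtain ⟨e⟩ : Nonempty (Eu (Module.finrank ℝ V) ≃L[ℝ] V) :=
    ⟨ContinuousLinearEquiv.ofFinrankEq finrank_euclideanSpace_fin⟩
  have hlin : ∀ u, ∃ l : E →ₗ[ℝ] ℝ, ∀ v, l v = T u v := fun u =>
    ⟨{ toFun := T u, map_add' := hadd u, map_smul' := fun c v => hsmul u c v }, fun _ => rfl⟩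
  have hexp : ∀ u (c : Eu (Module.finrank ℝ V)), T u (e c) =
      ∑ i, T u (e (EuclideanSpace.single i 1)) * c i := by
    intro u c
    obtain ⟨l, hl⟩ := hlin u
    have hc : c = ∑ i, c i • EuclideanSpace.single i (1 : ℝ) := by
      ext k
      simp [Finset.sum_apply, Pi.single_apply]
    conv_lhs => rw [hc]
    simp only [← hl, map_sum, map_smul, Submodule.coe_sum, Submodule.coe_smul, smul_eq_mul]
    exact Finset.sum_congr rfl fun i _ => mul_comm _ _
  -- In coordinates the equation on `V` reads `F c = 0`, and `⟨F c, c⟩ = T (e c) (e c)`: coercivity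
  -- of `T` means that the vector field points outwards far from the origin.
  let F : Eu (Module.finrank ℝ V) → Eu (Module.finrank ℝ V) := fun c =>
    WithLp.toLp 2 fun i => T (e c) (e (EuclideanSpace.single i 1))
  have hF : Continuous F := by
    refine (PiLp.continuous_toLp 2 _).comp (continuous_pi fun i => ?_)
    exact (hcont _).comp (continuous_subtype_val.comp e.continuous)
  have hinner : ∀ c, inner ℝ (F c) c = T (e c) (e c) := by
    intro c
    rw [hexp]
    simp [F, PiLp.inner_apply, mul_comm]
  obtain ⟨K, hK⟩ : ∃ K : NNReal, AntilipschitzWith K e := ⟨_, e.antilipschitz⟩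
  have hbound : ∀ c : Eu (Module.finrank ℝ V), ‖c‖ ≤ K * ‖(e c : E)‖ := by
    intro c
    have := hK.le_mul_dist c 0
    simpa [dist_eq_norm] using this
  obtain ⟨c, hc⟩ := exists_zero_of_inner_pos hF (R := K * |R| + 1) (by positivity) fun c hc => by
    rw [hinner]
    refine hpos _ ?_
    by_contra! hlt
    have h1 := hbound c
    have h2 : (K : ℝ) * ‖(e c : E)‖ ≤ K * |R| :=
      mul_le_mul_of_nonneg_left (hlt.le.trans (le_abs_self R)) K.coe_nonneg
    linarith
  refine ⟨e c, (e c).2, fun v hv => ?_⟩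
  have hv' : v = e (e.symm ⟨v, hv⟩) := by simp
  rw [hv', hexp]
  refine Finset.sum_eq_zero fun i _ => ?_
  have : F c i = 0 := by rw [hc]; rfl
  have h2 : T (e c) (e (EuclideanSpace.single i 1)) = 0 := this
  rw [h2, zero_mul]

/-- In a separable space, there is an increasing sequence of finite-dimensional subspaces in which
every vector can be approximated. -/
lemma exists_exhaustion [TopologicalSpace.SeparableSpace E] :
    ∃ V : ℕ → Submodule ℝ E, (∀ m, FiniteDimensional ℝ (V m)) ∧ Monotone V ∧
      ∀ v, ∃ z : ℕ → E, (∀ m, z m ∈ V m) ∧ Tendsto z atTop (𝓝 v) := by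
  let e := TopologicalSpace.denseSeq E
  have hmono : Monotone fun m : ℕ => Submodule.span ℝ (e '' Set.Iio m) := fun a b hab =>
    Submodule.span_mono (Set.image_mono (Set.Iio_subset_Iio hab))
  refine ⟨fun m => Submodule.span ℝ (e '' Set.Iio m), fun m =>
    FiniteDimensional.span_of_finite ℝ ((Set.finite_Iio m).image e), hmono, fun v => ?_⟩
  -- Almost best approximations of `v` in each subspace. The distances tend to zero because a member
  -- `e k` of the dense sequence close to `v` lies in all subspaces of index larger than `k`.
  have hex : ∀ m : ℕ, ∃ z ∈ Submodule.span ℝ (e '' Set.Iio m), dist v z <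
      Metric.infDist v (Submodule.span ℝ (e '' Set.Iio m) : Set E) + 1 / ((m : ℝ) + 1) := by
    intro m
    exact (Metric.infDist_lt_iff ⟨0, Submodule.zero_mem _⟩).1
      (lt_add_of_pos_right _ (by positivity))
  choose z hz hzd using hex
  refine ⟨z, hz, ?_⟩
  rw [tendsto_iff_dist_tendsto_zero]
  have h0 : Tendsto (fun m : ℕ => Metric.infDist v (Submodule.span ℝ (e '' Set.Iio m) : Set E))
      atTop (𝓝 0) := by
    rw [Metric.tendsto_atTop]
    intro ε hε
    obtain ⟨k, hk⟩ := (TopologicalSpace.denseRange_denseSeq E).exists_dist_lt v hε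
    refine ⟨k + 1, fun m hm => ?_⟩
    rw [Real.dist_eq, sub_zero, abs_of_nonneg Metric.infDist_nonneg]
    have hmem : e k ∈ (Submodule.span ℝ (e '' Set.Iio m) : Set E) :=
      Submodule.subset_span ⟨k, Set.mem_Iio.2 (by omega), rfl⟩
    exact (Metric.infDist_le_dist_of_mem hmem).trans_lt hk
  have h1 := h0.add (tendsto_one_div_add_atTop_nhds_zero_nat (𝕜 := ℝ))
  rw [add_zero] at h1
  exact squeeze_zero (fun _ => dist_nonneg) (fun m => by rw [dist_comm]; exact (hzd m).le) h1

end Galerkin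

namespace W0

variable {N : ℕ} {Ω : Set (Eu N)} {p : Fin N → ℝ} [hp : Fact (∀ j, 1 < p j)] [NeZero N]

/-- The topology is induced by the gradient map into a second countable product; separability
provides the Galerkin subspaces. -/
instance : TopologicalSpace.SeparableSpace (W0 Ω p) := by
  have : ∀ j, Fact (ENNReal.ofReal (p j) ≠ ⊤) := fun j => ⟨ENNReal.ofReal_ne_top⟩
  have hind : IsInducing fun u : W0 Ω p => fun j => u.der j := by
    refine isInducing_iff_nhds.2 fun u => ?_
    refine le_antisymm ?_ ?_
    · refine Tendsto.le_comap (tendsto_pi_nhds.2 fun j => ?_)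
      rw [tendsto_iff_norm_sub_tendsto_zero]
      have h1 : Tendsto (fun v : W0 Ω p => ‖v - u‖) (𝓝 u) (𝓝 0) :=
        tendsto_iff_norm_sub_tendsto_zero.1 tendsto_id
      exact squeeze_zero (fun _ => norm_nonneg _) (fun v => norm_der_le (v - u) j) h1
    · have h2 : Tendsto id (comap (fun (u : W0 Ω p) j => u.der j) (𝓝 fun j => u.der j)) (𝓝 u) := by
        rw [tendsto_iff_norm_sub_tendsto_zero]
        have h3 : ∀ v : W0 Ω p, ‖id v - u‖ = ∑ j, ‖v.der j - u.der j‖ := fun v => rfl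
        simp only [h3]
        rw [← Finset.sum_const_zero (s := (Finset.univ : Finset (Fin N)))]
        refine tendsto_finsetSum _ fun j _ => ?_
        have h4 : Tendsto (fun v : W0 Ω p => v.der j)
            (comap (fun (u : W0 Ω p) j => u.der j) (𝓝 fun j => u.der j)) (𝓝 (u.der j)) :=
          ((continuous_apply j).tendsto _).comp tendsto_comap
        exact tendsto_iff_norm_sub_tendsto_zero.1 h4
      exact h2
  have := hind.secondCountableTopology
  infer_instance

end W0

end AnisoElliptic

end

/-! ### Existence for bounded lower order terms -/

noncomputable section

set_option linter.unusedSectionVars false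

namespace AnisoElliptic

namespace W0

variable {N : ℕ} {Ω : Set (Eu N)} {p : Fin N → ℝ} [hp : Fact (∀ j, 1 < p j)]
  [hN : Fact (2 ≤ N)] [hpN : Fact (hmean p < N)] [NeZero N]
  [hfin : IsFiniteMeasure (leb Ω)] {A : Fin N → Eu N → ℝ → (Fin N → ℝ) → ℝ} {ν₀ ν : ℝ}
  {η : Fin N → Eu N → ℝ} {Ψ : Eu N → ℝ → (Fin N → ℝ) → ℝ}
  {B : W0 Ω p → StrongDual ℝ (W0 Ω p)}

lemma tendsto_comp_of_ae (hΨ : IsCaratheodory Ω Ψ) {u : ℕ → W0 Ω p} {u' : W0 Ω p}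
    (hae : ∀ᵐ x ∂(leb Ω), Tendsto (fun n => (u n).fn x) atTop (𝓝 (u'.fn x)) ∧
      Tendsto (fun n => (u n).grad x) atTop (𝓝 (u'.grad x))) :
    ∀ᵐ x ∂(leb Ω), Tendsto (fun n => Ψ x ((u n).fn x) ((u n).grad x)) atTop
      (𝓝 (Ψ x (u'.fn x) (u'.grad x))) := by
  filter_upwards [hae, hΨ.2] with x hx hc
  exact (hc.tendsto (u'.fn x, u'.grad x)).comp (hx.1.prodMk_nhds hx.2)

lemma tendsto_der_of_tendsto {z : ℕ → W0 Ω p} {z' : W0 Ω p} (hz : Tendsto z atTop (𝓝 z'))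
    (j : Fin N) : Tendsto (fun n => eLpNorm (⇑((z n).der j) - ⇑(z'.der j))
      (ENNReal.ofReal (p j)) (leb Ω)) atTop (𝓝 0) :=
  (Lp.tendsto_Lp_iff_tendsto_eLpNorm' _ _).1 (((derL Ω p j).continuous.tendsto z').comp hz)

lemma tendsto_fn_of_tendsto {z : ℕ → W0 Ω p} {z' : W0 Ω p} (hz : Tendsto z atTop (𝓝 z')) :
    Tendsto (fun n => (z n).fn) atTop (𝓝 z'.fn) :=
  ((fnL Ω p).continuous.tendsto z').comp hz

lemma weakConv_of_tendsto {z : ℕ → W0 Ω p} {z' : W0 Ω p} (hz : Tendsto z atTop (𝓝 z')) :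
    WeakConv z z' := fun F => (F.continuous.tendsto z').comp hz

lemma tendsto_integral_flux (hA : FluxCond Ω p A ν₀ ν η) {u : ℕ → W0 Ω p} {u' : W0 Ω p} {R : ℝ}
    (hR : ∀ n, ‖u n‖ ≤ R)
    (hae : ∀ᵐ x ∂(leb Ω), Tendsto (fun n => (u n).fn x) atTop (𝓝 (u'.fn x)) ∧
      Tendsto (fun n => (u n).grad x) atTop (𝓝 (u'.grad x)))
    {z : ℕ → W0 Ω p} {z' : W0 Ω p} (hz : Tendsto z atTop (𝓝 z')) (j : Fin N) :
    Tendsto (fun n => ∫ x in Ω, A j x ((u n).fn x) ((u n).grad x) * (z n).der j x) atTop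
      (𝓝 (∫ x in Ω, A j x (u'.fn x) (u'.grad x) * z'.der j x)) := by
  obtain ⟨K, hK, hKle⟩ := exists_eLpNorm_flux_le hA R j
  exact tendsto_integral_mul_of_ae_of_tendsto (conj p j) hK
    (fun n => (memLp_flux hA (u n) (u n) j).1) (fun n => hKle _ _ (hR n) (hR n))
    (tendsto_comp_of_ae (hA.cara j) hae) (fun n => Lp.memLp _) (Lp.memLp _)
    (tendsto_der_of_tendsto hz j)

lemma integrable_lower_mul (hΨ : IsCaratheodory Ω Ψ) {K : ℝ}
    (hK : ∀ᵐ x ∂(leb Ω), ∀ t ξ, |Ψ x t ξ| ≤ K) (u v : W0 Ω p) :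
    Integrable (fun x => Ψ x (u.fn x) (u.grad x) * v.fn x) (leb Ω) :=
  (L1.integrable_coeFn v.fn).bdd_mul (aestronglyMeasurable_comp hΨ (Lp.aestronglyMeasurable _) u)
    (hK.mono fun _ hx => hx _ _)

lemma tendsto_integral_lower (hΨ : IsCaratheodory Ω Ψ) {K : ℝ}
    (hK : ∀ᵐ x ∂(leb Ω), ∀ t ξ, |Ψ x t ξ| ≤ K) {u : ℕ → W0 Ω p} {u' : W0 Ω p}
    (hae : ∀ᵐ x ∂(leb Ω), Tendsto (fun n => (u n).fn x) atTop (𝓝 (u'.fn x)) ∧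
      Tendsto (fun n => (u n).grad x) atTop (𝓝 (u'.grad x)))
    {z : ℕ → W0 Ω p} {z' : W0 Ω p} (hz : Tendsto (fun n => (z n).fn) atTop (𝓝 z'.fn)) :
    Tendsto (fun n => ∫ x in Ω, Ψ x ((u n).fn x) ((u n).grad x) * (z n).fn x) atTop
      (𝓝 (∫ x in Ω, Ψ x (u'.fn x) (u'.grad x) * z'.fn x)) :=
  tendsto_integral_bdd_mul
    (fun n => aestronglyMeasurable_comp hΨ (Lp.aestronglyMeasurable _) (u n))
    (fun _ => hK.mono fun _ hx => hx _ _) (tendsto_comp_of_ae hΨ hae)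
    (fun _ => L1.integrable_coeFn _) (L1.integrable_coeFn _)
    ((Lp.tendsto_Lp_iff_tendsto_eLpNorm' _ _).1 hz)

/-- The form associated with the equation `-div A(x,u,∇u) + Ψ(x,u,∇u) - B u = 0`. -/
def form (A : Fin N → Eu N → ℝ → (Fin N → ℝ) → ℝ) (Ψ : Eu N → ℝ → (Fin N → ℝ) → ℝ)
    (B : W0 Ω p → StrongDual ℝ (W0 Ω p)) (u v : W0 Ω p) : ℝ :=
  (∑ j, ∫ x in Ω, A j x (u.fn x) (u.grad x) * v.der j x) +
    (∫ x in Ω, Ψ x (u.fn x) (u.grad x) * v.fn x) - B u v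

lemma fn_add_ae (u v : W0 Ω p) : ∀ᵐ x ∂(leb Ω), (u + v).fn x = u.fn x + v.fn x :=
  Lp.coeFn_add u.fn v.fn

lemma fn_sub_ae (u v : W0 Ω p) : ∀ᵐ x ∂(leb Ω), (u - v).fn x = u.fn x - v.fn x :=
  Lp.coeFn_sub u.fn v.fn

lemma fn_smul_ae (c : ℝ) (u : W0 Ω p) : ∀ᵐ x ∂(leb Ω), (c • u).fn x = c * u.fn x :=
  Lp.coeFn_smul c u.fn

lemma der_add_ae (u v : W0 Ω p) (j : Fin N) :
    ∀ᵐ x ∂(leb Ω), (u + v).der j x = u.der j x + v.der j x :=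
  Lp.coeFn_add (u.der j) (v.der j)

lemma der_sub_ae (u v : W0 Ω p) (j : Fin N) :
    ∀ᵐ x ∂(leb Ω), (u - v).der j x = u.der j x - v.der j x :=
  Lp.coeFn_sub (u.der j) (v.der j)

lemma der_smul_ae (c : ℝ) (u : W0 Ω p) (j : Fin N) :
    ∀ᵐ x ∂(leb Ω), (c • u).der j x = c * u.der j x :=
  Lp.coeFn_smul c (u.der j)

lemma form_add (hA : FluxCond Ω p A ν₀ ν η) (hΨ : IsCaratheodory Ω Ψ) {K : ℝ}
    (hK : ∀ᵐ x ∂(leb Ω), ∀ t ξ, |Ψ x t ξ| ≤ K) (u v w : W0 Ω p) :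
    form A Ψ B u (v + w) = form A Ψ B u v + form A Ψ B u w := by
  have h1 : ∀ j, ∫ x in Ω, A j x (u.fn x) (u.grad x) * (v + w).der j x =
      (∫ x in Ω, A j x (u.fn x) (u.grad x) * v.der j x) +
      ∫ x in Ω, A j x (u.fn x) (u.grad x) * w.der j x := by
    intro j
    rw [← integral_add (integrable_flux_mul_der hA u u v j) (integrable_flux_mul_der hA u u w j)]
    refine integral_congr_ae ?_
    filter_upwards [der_add_ae v w j] with x hx
    rw [hx]
    ring
  have h2 : ∫ x in Ω, Ψ x (u.fn x) (u.grad x) * (v + w).fn x =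
      (∫ x in Ω, Ψ x (u.fn x) (u.grad x) * v.fn x) + ∫ x in Ω, Ψ x (u.fn x) (u.grad x) * w.fn x := by
    rw [← integral_add (integrable_lower_mul hΨ hK u v) (integrable_lower_mul hΨ hK u w)]
    refine integral_congr_ae ?_
    filter_upwards [fn_add_ae v w] with x hx
    rw [hx]
    ring
  unfold form
  simp only [h1, h2, Finset.sum_add_distrib, map_add]
  ring

lemma form_smul (u : W0 Ω p) (c : ℝ) (v : W0 Ω p) :
    form A Ψ B u (c • v) = c * form A Ψ B u v := by
  have h1 : ∀ j, ∫ x in Ω, A j x (u.fn x) (u.grad x) * (c • v).der j x =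
      c * ∫ x in Ω, A j x (u.fn x) (u.grad x) * v.der j x := by
    intro j
    rw [← integral_const_mul]
    refine integral_congr_ae ?_
    filter_upwards [der_smul_ae c v j] with x hx
    rw [hx]
    ring
  have h2 : ∫ x in Ω, Ψ x (u.fn x) (u.grad x) * (c • v).fn x =
      c * ∫ x in Ω, Ψ x (u.fn x) (u.grad x) * v.fn x := by
    rw [← integral_const_mul]
    refine integral_congr_ae ?_
    filter_upwards [fn_smul_ae c v] with x hx
    rw [hx]
    ring
  unfold form
  simp only [h1, h2, ← Finset.mul_sum, map_smul, smul_eq_mul]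
  ring

lemma tendsto_form (hA : FluxCond Ω p A ν₀ ν η) (hΨ : IsCaratheodory Ω Ψ) {K : ℝ}
    (hK : ∀ᵐ x ∂(leb Ω), ∀ t ξ, |Ψ x t ξ| ≤ K) (hB : CondP2 B) {u : ℕ → W0 Ω p} {u' : W0 Ω p}
    {R : ℝ} (hR : ∀ n, ‖u n‖ ≤ R) (hweak : WeakConv u u')
    (hae : ∀ᵐ x ∂(leb Ω), Tendsto (fun n => (u n).fn x) atTop (𝓝 (u'.fn x)) ∧
      Tendsto (fun n => (u n).grad x) atTop (𝓝 (u'.grad x)))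
    {z : ℕ → W0 Ω p} {z' : W0 Ω p} (hz : Tendsto z atTop (𝓝 z')) :
    Tendsto (fun n => form A Ψ B (u n) (z n)) atTop (𝓝 (form A Ψ B u' z')) :=
  ((tendsto_finsetSum _ fun j _ => tendsto_integral_flux hA hR hae hz j).add
    (tendsto_integral_lower hΨ hK hae (tendsto_fn_of_tendsto hz))).sub
    (hB _ _ _ _ hweak (weakConv_of_tendsto hz))

lemma exists_subseq_ae_of_tendsto {u : ℕ → W0 Ω p} {u' : W0 Ω p} (hu : Tendsto u atTop (𝓝 u')) :
    ∃ σ : ℕ → ℕ, StrictMono σ ∧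
      ∀ᵐ x ∂(leb Ω), Tendsto (fun n => (u (σ n)).fn x) atTop (𝓝 (u'.fn x)) ∧
        Tendsto (fun n => (u (σ n)).grad x) atTop (𝓝 (u'.grad x)) := by
  have hsub : ∀ s : Finset (Fin N), ∃ σ : ℕ → ℕ, StrictMono σ ∧
      ∀ᵐ x ∂(leb Ω), Tendsto (fun n => (u (σ n)).fn x) atTop (𝓝 (u'.fn x)) ∧
        ∀ j ∈ s, Tendsto (fun n => (u (σ n)).der j x) atTop (𝓝 (u'.der j x)) := by
    intro s
    induction s using Finset.induction_on with
    | empty =>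
      obtain ⟨σ, hσ, h⟩ :=
        (tendstoInMeasure_of_tendsto_Lp (tendsto_fn_of_tendsto hu)).exists_seq_tendsto_ae
      exact ⟨σ, hσ, h.mono fun x hx => ⟨hx, by simp⟩⟩
    | insert j s _ ih =>
      obtain ⟨σ, hσ, h⟩ := ih
      have : Tendsto (fun n => (u (σ n)).der j) atTop (𝓝 (u'.der j)) :=
        ((derL Ω p j).continuous.tendsto u').comp (hu.comp hσ.tendsto_atTop)
      obtain ⟨τ, hτ, h'⟩ := (tendstoInMeasure_of_tendsto_Lp this).exists_seq_tendsto_ae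
      refine ⟨σ ∘ τ, hσ.comp hτ, ?_⟩
      filter_upwards [h, h'] with x h1 h2
      refine ⟨h1.1.comp hτ.tendsto_atTop, fun k hk => ?_⟩
      rcases Finset.mem_insert.1 hk with rfl | hk
      · exact h2
      · exact (h1.2 k hk).comp hτ.tendsto_atTop
  obtain ⟨σ, hσ, h⟩ := hsub Finset.univ
  exact ⟨σ, hσ, h.mono fun x hx => ⟨hx.1, tendsto_pi_nhds.2 fun j => hx.2 j (Finset.mem_univ j)⟩⟩

/-- From every subsequence one extracts almost everywhere convergent functions and gradients, along
which `tendsto_form` applies. -/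
lemma continuous_form (hA : FluxCond Ω p A ν₀ ν η) (hΨ : IsCaratheodory Ω Ψ) {K : ℝ}
    (hK : ∀ᵐ x ∂(leb Ω), ∀ t ξ, |Ψ x t ξ| ≤ K) (hB : CondP2 B) (v : W0 Ω p) :
    Continuous fun u => form A Ψ B u v := by
  refine continuous_iff_seqContinuous.2 fun u u' hu => ?_
  refine tendsto_of_subseq_tendsto fun ns hns => ?_
  obtain ⟨σ, hσ, hae⟩ := exists_subseq_ae_of_tendsto (hu.comp hns)
  have hlim : Tendsto (fun n => u (ns (σ n))) atTop (𝓝 u') :=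
    hu.comp (hns.comp hσ.tendsto_atTop)
  obtain ⟨R, hR⟩ := (Metric.isBounded_range_of_tendsto _ hlim).exists_norm_le
  exact ⟨σ, tendsto_form hA hΨ hK hB (fun n => hR _ ⟨n, rfl⟩) (weakConv_of_tendsto hlim) hae
    tendsto_const_nhds⟩

lemma energy_le_integral_flux (hA : FluxCond Ω p A ν₀ ν η) (u : W0 Ω p) :
    ν₀ * u.energy ≤ ∑ j, ∫ x in Ω, A j x (u.fn x) (u.grad x) * u.der j x := by
  rw [← integral_sum_der, ← integral_const_mul, ← integral_finsetSum _ fun j _ =>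
    integrable_flux_mul_der hA u u u j]
  refine integral_mono_ae ((integrable_sum_der u).const_mul _)
    (integrable_finsetSum _ fun j _ => integrable_flux_mul_der hA u u u j) ?_
  filter_upwards [hA.coer] with x hx
  exact hx _ _

lemma norm_fn_eq (u : W0 Ω p) : ‖u.fn‖ = ∫ x in Ω, |u.fn x| := L1.norm_eq_integral_norm u.fn

lemma abs_integral_mul_fn_le {g : Eu N → ℝ} {K : ℝ} (hK : ∀ᵐ x ∂(leb Ω), |g x| ≤ K)
    (v : W0 Ω p) : |∫ x in Ω, g x * v.fn x| ≤ K * ‖v.fn‖ := by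
  rw [norm_fn_eq, ← integral_const_mul]
  refine norm_integral_le_of_norm_le (f := fun x => g x * v.fn x) (g := fun x => K * |v.fn x|)
    ((L1.integrable_coeFn v.fn).abs.const_mul K) ?_
  filter_upwards [hK] with x hx
  rw [norm_mul]
  exact mul_le_mul_of_nonneg_right hx (abs_nonneg _)

/-- Existence for bounded lower order terms, by the Galerkin method. -/
theorem exists_form_eq_zero (hA : FluxCond Ω p A ν₀ ν η) (hmono : Monotone p)
    (hΨ : IsCaratheodory Ω Ψ) {K : ℝ} (hK : ∀ᵐ x ∂(leb Ω), ∀ t ξ, |Ψ x t ξ| ≤ K)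
    (hB1 : CondP1 B) (hB2 : CondP2 B) : ∃ u : W0 Ω p, ∀ v, form A Ψ B u v = 0 := by
  obtain ⟨C, hC, hCle⟩ := poincare Ω p
  obtain ⟨R, hR0, hR⟩ := exists_bound_of_condP1 hB1 hmono hA.pos (M := |K| * C) (by positivity)
  have hΨb : ∀ u v : W0 Ω p, |∫ x in Ω, Ψ x (u.fn x) (u.grad x) * v.fn x| ≤ |K| * C * ‖v‖ := by
    intro u v
    refine (abs_integral_mul_fn_le (hK.mono fun x hx => (hx _ _).trans (le_abs_self K)) v).trans ?_
    rw [mul_assoc]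
    exact mul_le_mul_of_nonneg_left (hCle v) (abs_nonneg _)
  -- Stated for `form ≤ 0`, the bound serves twice: its contrapositive is the coercivity required in
  -- finite dimension, and it bounds the Galerkin solutions independently of `m`.
  have hbd : ∀ u : W0 Ω p, form A Ψ B u u ≤ 0 → ‖u‖ ≤ R := by
    intro u hu
    refine hR u u le_rfl ?_
    have h1 := energy_le_integral_flux hA u
    have h2 := (abs_le.1 (hΨb u u)).1
    have h3 : 0 ≤ |K| * C := by positivity
    unfold form at hu
    linarith
  obtain ⟨V, hVfin, hVmono, hVapp⟩ := exists_exhaustion (E := W0 Ω p)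
  have hgal : ∀ m, ∃ u ∈ V m, ∀ v ∈ V m, form A Ψ B u v = 0 := fun m => by
    have := hVfin m
    refine exists_galerkin (V m) (form_add hA hΨ hK) form_smul (continuous_form hA hΨ hK hB2)
      (R := R + 1) fun u hu => ?_
    by_contra! h
    linarith [hbd u h]
  choose u₀ hu₀ hu₀V using hgal
  have hu₀R : ∀ m, ‖u₀ m‖ ≤ R := fun m => hbd _ (hu₀V m _ (hu₀ m)).le
  obtain ⟨u', σ₁, hσ₁, hweak₁⟩ := exists_weakConv_subseq hu₀R
  obtain ⟨σ₂, hσ₂, hae⟩ := exists_subseq_ae_fn (fun n => hu₀R (σ₁ n)) hweak₁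
  obtain ⟨σ, hσdef⟩ : ∃ σ, σ = σ₁ ∘ σ₂ := ⟨_, rfl⟩
  have hσ : StrictMono σ := hσdef ▸ hσ₁.comp hσ₂
  obtain ⟨w, hw⟩ : ∃ w, w = fun n => u₀ (σ n) := ⟨_, rfl⟩
  have hwR : ∀ n, ‖w n‖ ≤ R := fun n => by rw [hw]; exact hu₀R _
  have hwV : ∀ n, w n ∈ V (σ n) := fun n => by rw [hw]; exact hu₀ _
  have hw0 : ∀ n, ∀ v ∈ V (σ n), form A Ψ B (w n) v = 0 := fun n => by rw [hw]; exact hu₀V _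
  have hweak : WeakConv w u' := by
    rw [hw, hσdef]
    exact WeakConv.comp hweak₁ hσ₂
  have hwae : ∀ᵐ x ∂(leb Ω), Tendsto (fun n => (w n).fn x) atTop (𝓝 (u'.fn x)) := by
    rw [hw, hσdef]
    exact hae
  -- The limit `u'` need not lie in the Galerkin subspaces. Its approximations `z n` in the same
  -- subspaces as `w n` do, so the equation is tested with `w n - z n`.
  obtain ⟨z₀, hz₀V, hz₀⟩ := hVapp u'
  obtain ⟨z, hz⟩ : ∃ z, z = fun n => z₀ (σ n) := ⟨_, rfl⟩
  have hzV : ∀ n, z n ∈ V (σ n) := fun n => by rw [hz]; exact hz₀V _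
  have hzlim : Tendsto z atTop (𝓝 u') := by
    rw [hz]
    exact hz₀.comp hσ.tendsto_atTop
  have hwzweak : WeakConv (fun n => w n - z n) 0 := fun F => by
    have := (hweak F).sub (weakConv_of_tendsto hzlim F)
    simpa using this
  have hwzfn : Tendsto (fun n => ‖(w n - z n).fn‖) atTop (𝓝 0) := by
    have := ((tendsto_fn_of_weakConv hwR hweak).sub (tendsto_fn_of_tendsto hzlim)).norm
    simpa [fn_sub] using this
  -- The `B` term vanishes in the limit by `(P_2)`, as `w n - z n` converges weakly to zero, and the
  -- bounded lower order term does by Rellich's theorem.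
  have hflux0 : Tendsto (fun n => ∑ j, ∫ x in Ω, A j x ((w n).fn x) ((w n).grad x) *
      (w n - z n).der j x) atTop (𝓝 0) := by
    have h1 := hB2 w (fun n => w n - z n) u' 0 hweak hwzweak
    rw [map_zero] at h1
    have h2 : Tendsto (fun n => ∫ x in Ω, Ψ x ((w n).fn x) ((w n).grad x) * (w n - z n).fn x)
        atTop (𝓝 0) := by
      refine squeeze_zero_norm (fun n => abs_integral_mul_fn_le
        (hK.mono fun x hx => hx _ _) (w n - z n)) ?_
      simpa using hwzfn.const_mul K
    have h3 := h1.sub h2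
    rw [sub_zero] at h3
    refine h3.congr fun n => ?_
    have := hw0 n (w n - z n) (Submodule.sub_mem _ (hwV n) (hzV n))
    unfold form at this
    linarith
  have hflux1 : Tendsto (fun n => ∑ j, ∫ x in Ω, A j x ((w n).fn x) ((w n).grad x) *
      (z n - u').der j x) atTop (𝓝 0) := by
    rw [← Finset.sum_const_zero (s := (Finset.univ : Finset (Fin N)))]
    refine tendsto_finsetSum _ fun j _ => ?_
    obtain ⟨K', hK', hKle⟩ := exists_eLpNorm_flux_le hA R j
    refine tendsto_integral_mul_zero (conj p j) hK' (fun n => memLp_flux hA (w n) (w n) j)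
      (fun n => hKle _ _ (hwR n) (hwR n)) (fun n => Lp.memLp _) ?_
    refine (tendsto_der_of_tendsto hzlim j).congr fun n => ?_
    exact eLpNorm_congr_ae (Lp.coeFn_sub _ _).symm
  -- The gradient criterion carries a cutoff. The part of the pairing with `∇u'` removed by it tends
  -- to zero by dominated convergence, while the part with `∇w_n` is nonnegative by coercivity and
  -- is dropped in the comparison below.
  have hcut : Tendsto (fun n => ∑ j, ∫ x in Ω, A j x ((w n).fn x) ((w n).grad x) *
      ((1 - cutoff (((w n).fn x - u'.fn x) / 1)) * u'.der j x)) atTop (𝓝 0) := by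
    rw [← Finset.sum_const_zero (s := (Finset.univ : Finset (Fin N)))]
    refine tendsto_finsetSum _ fun j _ => ?_
    obtain ⟨K', hK', hKle⟩ := exists_eLpNorm_flux_le hA R j
    have hm : ∀ n, AEStronglyMeasurable
        (fun x => (1 - cutoff (((w n).fn x - u'.fn x) / 1)) * u'.der j x) (leb Ω) := fun n => by
      have hcc : Continuous fun s => 1 - cutoff (s / 1) :=
        continuous_const.sub (continuous_cutoff.comp (by fun_prop))
      exact (hcc.comp_aestronglyMeasurable
        ((Lp.aestronglyMeasurable (w n).fn).sub (Lp.aestronglyMeasurable u'.fn))).mul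
        (Lp.aestronglyMeasurable _)
    have hb : ∀ n x, |(1 - cutoff (((w n).fn x - u'.fn x) / 1)) * u'.der j x| ≤ |u'.der j x| := by
      intro n x
      obtain ⟨c0, c1⟩ := cutoff_mem (((w n).fn x - u'.fn x) / 1)
      rw [abs_mul]
      exact mul_le_of_le_one_left (abs_nonneg _) (abs_le.2 ⟨by linarith, by linarith⟩)
    have hd := tendsto_eLpNorm_sub_of_dominated (r := ENNReal.ofReal (p j)) (f := fun _ => 0)
      (by simpa using (hp.out j).le)
      ENNReal.ofReal_ne_top hm (Lp.memLp (u'.der j)) (fun n => Eventually.of_forall (hb n)) (by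
        filter_upwards [hwae] with x hx
        have h1 : Tendsto (fun n => (w n).fn x - u'.fn x) atTop (𝓝 0) := by
          simpa using hx.sub_const (u'.fn x)
        have hcc : Continuous fun s => 1 - cutoff (s / 1) :=
          continuous_const.sub (continuous_cutoff.comp (by fun_prop))
        have h2 := ((hcc.tendsto 0).comp h1).mul_const (u'.der j x)
        rw [zero_div, cutoff_eq_one (s := 0) (by simp), sub_self, zero_mul] at h2
        exact h2)
    refine tendsto_integral_mul_zero (conj p j) hK' (fun n => memLp_flux hA (w n) (w n) j)
      (fun n => hKle _ _ (hwR n) (hwR n))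
      (fun n => (Lp.memLp (u'.der j)).mono (hm n) (Eventually.of_forall (hb n))) ?_
    refine hd.2.congr fun n => ?_
    congr 1
    funext x
    simp
  obtain ⟨τ, hτ, hτae⟩ := exists_subseq_ae_grad hA hwR hweak (by
    intro δ hδ
    refine ⟨1, one_pos, ?_⟩
    have h3 := (hflux0.add hflux1).add hcut
    simp only [add_zero] at h3
    filter_upwards [h3.eventually (gt_mem_nhds hδ)] with n hn
    refine le_trans ?_ hn.le
    rw [← Finset.sum_add_distrib, ← Finset.sum_add_distrib]
    have hcm : AEStronglyMeasurable (fun x => cutoff (((w n).fn x - u'.fn x) / 1)) (leb Ω) := by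
      have hcc : Continuous fun s => cutoff (s / 1) := continuous_cutoff.comp (by fun_prop)
      exact hcc.comp_aestronglyMeasurable
        ((Lp.aestronglyMeasurable (w n).fn).sub (Lp.aestronglyMeasurable u'.fn))
    have hcb : ∀ᵐ x ∂(leb Ω), |cutoff (((w n).fn x - u'.fn x) / 1)| ≤ 1 :=
      Eventually.of_forall fun x => by
        rw [abs_of_nonneg (cutoff_mem _).1]
        exact (cutoff_mem _).2
    have hi := fun (v : W0 Ω p) j => integrable_flux_mul_der hA (w n) (w n) v j
    have hic := fun (v : W0 Ω p) j => integrable_flux_mul_der_mul hA (w n) (w n) v j hcm hcb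
    have hi3 : ∀ j, Integrable (fun x => A j x ((w n).fn x) ((w n).grad x) *
        ((1 - cutoff (((w n).fn x - u'.fn x) / 1)) * u'.der j x)) (leb Ω) := fun j =>
      ((hi u' j).sub (hic u' j)).congr (Eventually.of_forall fun x => by
        simp only [Pi.sub_apply]
        ring)
    have hsum : ∀ j, (∫ x in Ω, A j x ((w n).fn x) ((w n).grad x) * (w n - z n).der j x) +
        (∫ x in Ω, A j x ((w n).fn x) ((w n).grad x) * (z n - u').der j x) +
        ∫ x in Ω, A j x ((w n).fn x) ((w n).grad x) *
          ((1 - cutoff (((w n).fn x - u'.fn x) / 1)) * u'.der j x) =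
        ∫ x in Ω, (A j x ((w n).fn x) ((w n).grad x) * (w n - z n).der j x +
          A j x ((w n).fn x) ((w n).grad x) * (z n - u').der j x) +
          A j x ((w n).fn x) ((w n).grad x) *
          ((1 - cutoff (((w n).fn x - u'.fn x) / 1)) * u'.der j x) := fun j => by
      rw [← integral_add (hi (w n - z n) j) (hi (z n - u') j)]
      exact (integral_add ((hi (w n - z n) j).add (hi (z n - u') j)) (hi3 j)).symm
    simp only [hsum]
    have hi4 : ∀ j ∈ Finset.univ, Integrable (fun x =>
        A j x ((w n).fn x) ((w n).grad x) * (w n - z n).der j x +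
        A j x ((w n).fn x) ((w n).grad x) * (z n - u').der j x +
        A j x ((w n).fn x) ((w n).grad x) *
          ((1 - cutoff (((w n).fn x - u'.fn x) / 1)) * u'.der j x)) (leb Ω) := fun j _ =>
      ((hi (w n - z n) j).add (hi (z n - u') j)).add (hi3 j)
    rw [← integral_finsetSum _ hi4]
    refine integral_mono_ae (integrable_finsetSum _ fun j _ => ?_)
      (integrable_finsetSum _ hi4) ?_
    · exact ((hic (w n) j).sub (hic u' j)).congr (Eventually.of_forall fun x => by
        simp only [Pi.sub_apply]
        ring)
    · filter_upwards [hA.coer, ae_all_iff.2 fun j => der_sub_ae (w n) (z n) j,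
        ae_all_iff.2 fun j => der_sub_ae (z n) u' j] with x hx h1 h2
      obtain ⟨c0, c1⟩ := cutoff_mem (((w n).fn x - u'.fn x) / 1)
      have h5 : 0 ≤ ∑ j, A j x ((w n).fn x) ((w n).grad x) * (w n).der j x :=
        (mul_nonneg hA.pos.le (sum_abs_rpow_nonneg p _)).trans (hx _ _)
      have h6 := mul_nonneg (sub_nonneg.2 c1) h5
      rw [Finset.mul_sum] at h6
      rw [← sub_nonneg, ← Finset.sum_sub_distrib]
      refine h6.trans (le_of_eq (Finset.sum_congr rfl fun j _ => ?_))
      simp only [h1, h2]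
      ring)
  -- An arbitrary `v` is the limit of elements of the subspaces of index `σ (τ n)`, where the form
  -- vanishes exactly.
  refine ⟨u', fun v => ?_⟩
  obtain ⟨y, hyV, hy⟩ := hVapp v
  have hlim := tendsto_form hA hΨ hK hB2 (fun n => hwR (τ n)) (WeakConv.comp hweak hτ) hτae
    (hy.comp (hσ.comp hτ).tendsto_atTop)
  refine tendsto_nhds_unique hlim (tendsto_const_nhds.congr fun n => ?_)
  exact (hw0 (τ n) _ (hyV _)).symm

end W0

end AnisoElliptic

end

/-! ### Passage to the limit: a one-sided inequality for weighted test functions -/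

noncomputable section

set_option linter.unusedSectionVars false

namespace AnisoElliptic

/-- The reverse Fatou lemma for integrals converging to a known limit. -/
lemma le_integral_of_tendsto {α : Type*} [MeasurableSpace α] {μ : Measure α} {q : ℕ → α → ℝ}
    {q' β : α → ℝ} {L : ℝ} (hq : ∀ n, Integrable (q n) μ) (hq' : Integrable q' μ)
    (hβ : Integrable β μ) (hle : ∀ n, ∀ᵐ x ∂μ, q n x ≤ β x)
    (hlim : ∀ᵐ x ∂μ, Tendsto (fun n => q n x) atTop (𝓝 (q' x)))
    (hL : Tendsto (fun n => ∫ x, q n x ∂μ) atTop (𝓝 L)) : L ≤ ∫ x, q' x ∂μ := by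
  have hle' : ∀ᵐ x ∂μ, q' x ≤ β x := by
    filter_upwards [ae_all_iff.2 hle, hlim] with x hx hl
    exact le_of_tendsto' hl hx
  -- Fatou's lemma, applied to the nonnegative functions `β - q n`.
  have h1 : ∫⁻ x, ENNReal.ofReal (β x - q' x) ∂μ ≤
      liminf (fun n => ∫⁻ x, ENNReal.ofReal (β x - q n x) ∂μ) atTop := by
    have hcongr : ∫⁻ x, ENNReal.ofReal (β x - q' x) ∂μ =
        ∫⁻ x, liminf (fun n => ENNReal.ofReal (β x - q n x)) atTop ∂μ := by
      refine lintegral_congr_ae ?_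
      filter_upwards [hlim] with x hx
      exact ((ENNReal.continuous_ofReal.tendsto _).comp (hx.const_sub (β x))).liminf_eq.symm
    rw [hcongr]
    exact lintegral_liminf_le' fun n =>
      (hβ.1.aemeasurable.sub (hq n).1.aemeasurable).ennreal_ofReal
  have hi : ∀ n, Integrable (fun x => β x - q n x) μ := fun n => hβ.sub (hq n)
  have hi' : Integrable (fun x => β x - q' x) μ := hβ.sub hq'
  have h2 : Tendsto (fun n => ∫⁻ x, ENNReal.ofReal (β x - q n x) ∂μ) atTop
      (𝓝 (ENNReal.ofReal (∫ x, β x ∂μ - L))) := by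
    refine ((ENNReal.continuous_ofReal.tendsto _).comp (hL.const_sub (∫ x, β x ∂μ))).congr
      fun n => ?_
    rw [Function.comp_apply, ← integral_sub hβ (hq n),
      ofReal_integral_eq_lintegral_ofReal (hi n)]
    filter_upwards [hle n] with x hx
    exact sub_nonneg.2 hx
  rw [h2.liminf_eq] at h1
  have h0 : 0 ≤ ∫ x, β x ∂μ - L :=
    sub_nonneg.2 (le_of_tendsto' hL fun n => integral_mono_ae (hq n) hβ (hle n))
  rw [← ofReal_integral_eq_lintegral_ofReal hi'
    (hle'.mono fun x hx => sub_nonneg.2 hx), ENNReal.ofReal_le_ofReal_iff h0] at h1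
  have h3 : ∫ x, (β x - q' x) ∂μ = ∫ x, β x ∂μ - ∫ x, q' x ∂μ := integral_sub hβ hq'
  linarith

/-- A `C^1` function decreasing from `1` on `(-∞, 0]` to `0` on `[1, ∞)`. -/
lemma exists_descent : ∃ (K K' : ℝ → ℝ) (L : ℝ), (∀ t, HasDerivAt K (K' t) t) ∧ Continuous K' ∧
    (∀ t, |K' t| ≤ L) ∧ (∀ t, K' t ≤ 0) ∧ (∀ t, 0 ≤ K t ∧ K t ≤ 1) ∧ (∀ t ≤ 0, K t = 1) ∧
    (∀ t, 1 ≤ t → K t = 0) ∧ ∀ t, 1 < t → K' t = 0 := by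
  have hd : ContDiff ℝ 1 fun t => 1 - Real.smoothTransition t :=
    contDiff_const.sub Real.smoothTransition.contDiff
  have hK' : Continuous (deriv fun t => 1 - Real.smoothTransition t) := hd.continuous_deriv le_rfl
  have hanti : Antitone fun t => 1 - Real.smoothTransition t := fun a b hab =>
    sub_le_sub_left (Real.smoothTransition.monotone hab) _
  have h0 : ∀ t : ℝ, t < 0 → deriv (fun t => 1 - Real.smoothTransition t) t = 0 := by
    intro t ht
    have : (fun t => 1 - Real.smoothTransition t) =ᶠ[𝓝 t] fun _ => (1 : ℝ) := by
      filter_upwards [gt_mem_nhds ht] with s hs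
      rw [Real.smoothTransition.zero_of_nonpos hs.le, sub_zero]
    rw [this.deriv_eq, deriv_const]
  have h1 : ∀ t : ℝ, 1 < t → deriv (fun t => 1 - Real.smoothTransition t) t = 0 := by
    intro t ht
    have : (fun t => 1 - Real.smoothTransition t) =ᶠ[𝓝 t] fun _ => (0 : ℝ) := by
      filter_upwards [lt_mem_nhds ht] with s hs
      rw [Real.smoothTransition.one_of_one_le hs.le, sub_self]
    rw [this.deriv_eq, deriv_const]
  obtain ⟨L, hL⟩ := (isCompact_Icc (a := (0 : ℝ)) (b := 1)).exists_bound_of_continuousOn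
    hK'.continuousOn
  have hL0 : 0 ≤ L := (norm_nonneg _).trans (hL 0 (by simp))
  refine ⟨_, _, L, fun t => (hd.differentiable one_ne_zero t).hasDerivAt, hK', fun t => ?_,
    fun t => hanti.deriv_nonpos, fun t => ⟨?_, ?_⟩, fun t ht => ?_, fun t ht => ?_, h1⟩
  · rcases lt_or_ge t 0 with ht | ht
    · rw [h0 t ht, abs_zero]
      exact hL0
    rcases lt_or_ge 1 t with ht' | ht'
    · rw [h1 t ht', abs_zero]
      exact hL0
    exact hL t ⟨ht, ht'⟩
  · exact sub_nonneg.2 (Real.smoothTransition.le_one t)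
  · exact sub_le_self _ (Real.smoothTransition.nonneg t)
  · rw [Real.smoothTransition.zero_of_nonpos ht, sub_zero]
  · rw [Real.smoothTransition.one_of_one_le ht, sub_self]

lemma mul_exp_neg_le_one (x : ℝ) : x * Real.exp (-x) ≤ 1 := by
  rw [Real.exp_neg, ← div_eq_mul_inv, div_le_one (Real.exp_pos x)]
  linarith [Real.add_one_le_exp x]

/-- A decreasing weight `E` with `Z E ≤ -E'` on `[0, ∞)`, vanishing for large arguments, such that
a given cutoff is a multiple of `E`. -/
lemma exists_weight {H H' : ℝ → ℝ} {L k Z : ℝ} (hH : ∀ t, HasDerivAt H (H' t) t)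
    (hH' : Continuous H') (hL : ∀ t, |H' t| ≤ L) (hH01 : ∀ t, 0 ≤ H t ∧ H t ≤ 1)
    (hz : ∀ t, k < t → H t = 0 ∧ H' t = 0) (hZ : 0 ≤ Z) :
    ∃ (E E' P P' : ℝ → ℝ) (M : ℝ),
      (∀ t, HasDerivAt E (E' t) t) ∧ Continuous E' ∧ (∀ t, |E' t| ≤ M) ∧ (∀ t, E' t ≤ 0) ∧
      (∀ t, 0 ≤ E t ∧ E t ≤ M) ∧ (∀ t, 0 ≤ t → Z * E t ≤ - E' t) ∧ (∀ t, k + 1 ≤ t → E t = 0) ∧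
      (∀ t, HasDerivAt P (P' t) t) ∧ Continuous P' ∧ (∀ t, |P' t| ≤ M) ∧
      (∀ t, 0 ≤ P t ∧ P t ≤ M) ∧ ∀ t, P t * E t = H t := by
  obtain ⟨K, K', C, hK, hK', hC, hKneg, hK01, hK1, hK0, -⟩ := exists_descent
  have hC0 : 0 ≤ C := (abs_nonneg _).trans (hC 0)
  have hL0 : 0 ≤ L := (abs_nonneg _).trans (hL 0)
  have hKc : Continuous K := continuous_iff_continuousAt.2 fun t => (hK t).continuousAt
  have hHc : Continuous H := continuous_iff_continuousAt.2 fun t => (hH t).continuousAt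
  obtain ⟨S, hS⟩ : ∃ S, S = Z * Real.exp k := ⟨_, rfl⟩
  have hS0 : 0 ≤ S := by rw [hS]; positivity
  obtain ⟨M, hM⟩ : ∃ M, M = 1 + C + Real.exp S * (1 + S + L) := ⟨_, rfl⟩
  have hM0 : 0 ≤ Real.exp S * (1 + S + L) := by positivity
  have hexp : ∀ t, HasDerivAt (fun t => Z * Real.exp t) (Z * Real.exp t) t := fun t =>
    (Real.hasDerivAt_exp t).const_mul Z
  have hx0 : ∀ t, 0 ≤ Z * Real.exp t := fun t => by positivity
  have hxS : ∀ t, t ≤ k → Z * Real.exp t ≤ S := fun t ht => by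
    rw [hS]
    exact mul_le_mul_of_nonneg_left (Real.exp_le_exp.2 ht) hZ
  -- The weight is `exp (-Z e^t)` cut off after `k`: on `[0, ∞)` its logarithmic derivative is at
  -- most `-Z e^t ≤ -Z`, and unlike `exp (-Z t)` it stays bounded as `t → -∞`. The multiplier `P =
  -- exp (Z e^t) H` undoes it, since the cutoff is one on `t ≤ k`, outside of which `H` vanishes.
  refine ⟨fun t => Real.exp (-(Z * Real.exp t)) * K (t - k),
    fun t => Real.exp (-(Z * Real.exp t)) * (-(Z * Real.exp t)) * K (t - k) +
      Real.exp (-(Z * Real.exp t)) * K' (t - k),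
    fun t => Real.exp (Z * Real.exp t) * H t,
    fun t => Real.exp (Z * Real.exp t) * (Z * Real.exp t) * H t +
      Real.exp (Z * Real.exp t) * H' t, M, fun t => ?_, by fun_prop, fun t => ?_, fun t => ?_,
      fun t => ⟨?_, ?_⟩, fun t ht => ?_, fun t ht => ?_, fun t => ?_, by fun_prop, fun t => ?_,
      fun t => ⟨?_, ?_⟩, fun t => ?_⟩
  · have h1 := (hexp t).neg.exp
    have h2 : HasDerivAt (fun t => K (t - k)) (K' (t - k)) t := by
      simpa using (hK (t - k)).comp_sub_const t k
    exact h1.mul h2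
  · have e1 : Real.exp (-(Z * Real.exp t)) ≤ 1 := Real.exp_le_one_iff.2 (neg_nonpos.2 (hx0 t))
    have e2 := mul_exp_neg_le_one (Z * Real.exp t)
    have e3 : 0 ≤ Z * Real.exp t * Real.exp (-(Z * Real.exp t)) := by
      have := hx0 t
      positivity
    obtain ⟨k0, k1⟩ := hK01 (t - k)
    refine (abs_add_le _ _).trans ?_
    have t1 : |Real.exp (-(Z * Real.exp t)) * (-(Z * Real.exp t)) * K (t - k)| ≤ 1 := by
      rw [show Real.exp (-(Z * Real.exp t)) * (-(Z * Real.exp t)) * K (t - k) =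
        -(Z * Real.exp t * Real.exp (-(Z * Real.exp t)) * K (t - k)) by ring, abs_neg,
        abs_of_nonneg (mul_nonneg e3 k0)]
      exact mul_le_one₀ e2 k0 k1
    have t2 : |Real.exp (-(Z * Real.exp t)) * K' (t - k)| ≤ C := by
      rw [abs_mul, abs_of_pos (Real.exp_pos _)]
      exact (mul_le_of_le_one_left (abs_nonneg _) e1).trans (hC _)
    rw [hM]
    linarith
  · obtain ⟨k0, k1⟩ := hK01 (t - k)
    have h1 : 0 ≤ Real.exp (-(Z * Real.exp t)) * (Z * Real.exp t) * K (t - k) := by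
      have := hx0 t
      positivity
    have h2 := mul_nonpos_of_nonneg_of_nonpos (Real.exp_pos (-(Z * Real.exp t))).le (hKneg (t - k))
    linarith
  · exact mul_nonneg (Real.exp_pos _).le (hK01 _).1
  · have e1 : Real.exp (-(Z * Real.exp t)) ≤ 1 := Real.exp_le_one_iff.2 (neg_nonpos.2 (hx0 t))
    have := mul_le_one₀ e1 (hK01 (t - k)).1 (hK01 (t - k)).2
    rw [hM]
    linarith
  · have h1 : 1 ≤ Real.exp t := Real.one_le_exp ht
    have h2 : Z ≤ Z * Real.exp t := le_mul_of_one_le_right hZ h1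
    have h3 : 0 ≤ Real.exp (-(Z * Real.exp t)) * K (t - k) :=
      mul_nonneg (Real.exp_pos _).le (hK01 _).1
    have h4 := mul_le_mul_of_nonneg_right h2 h3
    have h5 := mul_nonpos_of_nonneg_of_nonpos (Real.exp_pos (-(Z * Real.exp t))).le (hKneg (t - k))
    linarith
  · show Real.exp (-(Z * Real.exp t)) * K (t - k) = 0
    rw [hK0 (t - k) (by linarith), mul_zero]
  · exact (hexp t).exp.mul (hH t)
  · beta_reduce
    rcases lt_or_ge k t with h | h
    · obtain ⟨h1, h2⟩ := hz t h
      rw [h1, h2, mul_zero, mul_zero, add_zero, abs_zero, hM]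
      linarith
    · have e1 : Real.exp (Z * Real.exp t) ≤ Real.exp S := Real.exp_le_exp.2 (hxS t h)
      have t1 : |Real.exp (Z * Real.exp t) * (Z * Real.exp t) * H t| ≤ Real.exp S * S := by
        rw [abs_of_nonneg (mul_nonneg (mul_nonneg (Real.exp_pos _).le (hx0 t)) (hH01 t).1)]
        refine (mul_le_of_le_one_right (mul_nonneg (Real.exp_pos _).le (hx0 t)) (hH01 t).2).trans ?_
        exact mul_le_mul e1 (hxS t h) (hx0 t) (Real.exp_pos _).le
      have t2 : |Real.exp (Z * Real.exp t) * H' t| ≤ Real.exp S * L := by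
        rw [abs_mul, abs_of_pos (Real.exp_pos _)]
        exact mul_le_mul e1 (hL t) (abs_nonneg _) (Real.exp_pos _).le
      refine (abs_add_le _ _).trans ?_
      have := Real.exp_pos S
      rw [hM]
      nlinarith
  · exact mul_nonneg (Real.exp_pos _).le (hH01 t).1
  · beta_reduce
    rcases lt_or_ge k t with h | h
    · obtain ⟨h1, h2⟩ := hz t h
      rw [h1, mul_zero, hM]
      linarith
    · have e1 : Real.exp (Z * Real.exp t) ≤ Real.exp S := Real.exp_le_exp.2 (hxS t h)
      have := mul_le_mul e1 (hH01 t).2 (hH01 t).1 (Real.exp_pos _).le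
      have h5 : 0 ≤ Real.exp S * (S + L) := by positivity
      rw [hM]
      linarith
  · show Real.exp (Z * Real.exp t) * H t * (Real.exp (-(Z * Real.exp t)) * K (t - k)) = H t
    rcases lt_or_ge k t with h | h
    · rw [(hz t h).1, mul_zero, zero_mul]
    · rw [hK1 (t - k) (by linarith), Real.exp_neg]
      field_simp

namespace W0

variable {N : ℕ} {Ω : Set (Eu N)} {p : Fin N → ℝ} [hp : Fact (∀ j, 1 < p j)]
  [hN : Fact (2 ≤ N)] [hpN : Fact (hmean p < N)] [NeZero N]
  [hfin : IsFiniteMeasure (leb Ω)]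

/-- A sequence of solutions `u n` of approximate equations, with fluxes `a n`, lower order terms
`φ n`, functionals `ℓ n` and right hand sides `f n`, together with the limits of all these. -/
structure LimitData (ν₀ : ℝ) (ζ : ℝ → ℝ) (c : Eu N → ℝ) (u : ℕ → W0 Ω p) (u' : W0 Ω p)
    (a : ℕ → Fin N → Eu N → ℝ) (a' : Fin N → Eu N → ℝ) (φ : ℕ → Eu N → ℝ) (φ' : Eu N → ℝ)
    (ℓ : ℕ → StrongDual ℝ (W0 Ω p)) (ℓ' : StrongDual ℝ (W0 Ω p))
    (f : ℕ → Eu N → ℝ) (f' : Eu N → ℝ) : Prop where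
  pos : 0 < ν₀
  mono : Monotone ζ
  nonneg : ∀ t, 0 ≤ ζ t
  int_c : Integrable c (leb Ω)
  nonneg_c : ∀ᵐ x ∂(leb Ω), 0 ≤ c x
  norm_le : ∃ R, ∀ n, ‖u n‖ ≤ R
  ae : ∀ᵐ x ∂(leb Ω), Tendsto (fun n => (u n).fn x) atTop (𝓝 (u'.fn x)) ∧
    ∀ j, Tendsto (fun n => (u n).der j x) atTop (𝓝 (u'.der j x))
  aesm : ∀ n j, AEStronglyMeasurable (a n j) (leb Ω)
  bdd : ∀ j, ∃ K : ℝ≥0∞, K ≠ ⊤ ∧ ∀ n, eLpNorm (a n j) (ENNReal.ofReal (p j).conjExponent) (leb Ω) ≤ K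
  ae_flux : ∀ᵐ x ∂(leb Ω), ∀ j, Tendsto (fun n => a n j x) atTop (𝓝 (a' j x))
  coer : ∀ n, ∀ᵐ x ∂(leb Ω), ν₀ * ∑ j, |(u n).der j x| ^ p j ≤ ∑ j, a n j x * (u n).der j x
  int_lower : ∀ n, Integrable (φ n) (leb Ω)
  int_lower' : Integrable φ' (leb Ω)
  ae_lower : ∀ᵐ x ∂(leb Ω), Tendsto (fun n => φ n x) atTop (𝓝 (φ' x))
  sign : ∀ n, ∀ᵐ x ∂(leb Ω), 0 ≤ φ n x * (u n).fn x
  growth : ∀ n, ∀ᵐ x ∂(leb Ω), |φ n x| ≤ ζ |(u n).fn x| * (∑ j, |(u n).der j x| ^ p j + c x)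
  lim : ∀ (w : ℕ → W0 Ω p) (w' : W0 Ω p), WeakConv w w' →
    Tendsto (fun n => ℓ n (w n)) atTop (𝓝 (ℓ' w'))
  int_f : ∀ n, Integrable (f n) (leb Ω)
  int_f' : Integrable f' (leb Ω)
  lim_f : Tendsto (fun n => eLpNorm (f n - f') 1 (leb Ω)) atTop (𝓝 0)
  eq : ∀ n (v : W0 Ω p), MemLp v.fn ⊤ (leb Ω) →
    (∑ j, ∫ x in Ω, a n j x * v.der j x) + ∫ x in Ω, φ n x * v.fn x =
      ℓ n v + ∫ x in Ω, f n x * v.fn x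

variable {ν₀ : ℝ} {ζ : ℝ → ℝ} {c : Eu N → ℝ} {u : ℕ → W0 Ω p} {u' : W0 Ω p}
    {a : ℕ → Fin N → Eu N → ℝ} {a' : Fin N → Eu N → ℝ} {φ : ℕ → Eu N → ℝ} {φ' : Eu N → ℝ}
    {ℓ : ℕ → StrongDual ℝ (W0 Ω p)} {ℓ' : StrongDual ℝ (W0 Ω p)}
    {f : ℕ → Eu N → ℝ} {f' : Eu N → ℝ}

lemma fn_neg_ae (u : W0 Ω p) : ∀ᵐ x ∂(leb Ω), (-u).fn x = - u.fn x := Lp.coeFn_neg u.fn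

lemma der_neg_ae (u : W0 Ω p) : ∀ᵐ x ∂(leb Ω), ∀ j, (-u).der j x = - u.der j x :=
  ae_all_iff.2 fun j => Lp.coeFn_neg (u.der j)

/-- All the conditions are invariant under a simultaneous change of sign. Each inequality for the
limit equation therefore yields the opposite one. -/
lemma LimitData.neg (h : LimitData ν₀ ζ c u u' a a' φ φ' ℓ ℓ' f f') :
    LimitData ν₀ ζ c (fun n => - u n) (-u') (fun n j x => - a n j x) (fun j x => - a' j x)
      (fun n x => - φ n x) (fun x => - φ' x) (fun n => - ℓ n) (-ℓ') (fun n x => - f n x)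
      (fun x => - f' x) where
  pos := h.pos
  mono := h.mono
  nonneg := h.nonneg
  int_c := h.int_c
  nonneg_c := h.nonneg_c
  norm_le := by
    obtain ⟨R, hR⟩ := h.norm_le
    exact ⟨R, fun n => (norm_neg (u n)).trans_le (hR n)⟩
  ae := by
    filter_upwards [h.ae, ae_all_iff.2 fun n => fn_neg_ae (u n),
      ae_all_iff.2 fun n => der_neg_ae (u n), fn_neg_ae u', der_neg_ae u'] with x h1 h2 h3 h4 h5
    simp only [h2, h3, h4, h5]
    exact ⟨h1.1.neg, fun j => (h1.2 j).neg⟩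
  aesm n j := (h.aesm n j).neg
  bdd j := by
    obtain ⟨K, hK, hle⟩ := h.bdd j
    exact ⟨K, hK, fun n => (eLpNorm_neg (a n j) _ _).trans_le (hle n)⟩
  ae_flux := h.ae_flux.mono fun x hx j => (hx j).neg
  coer n := by
    filter_upwards [h.coer n, der_neg_ae (u n)] with x h1 h2
    simpa [h2] using h1
  int_lower n := (h.int_lower n).neg
  int_lower' := h.int_lower'.neg
  ae_lower := h.ae_lower.mono fun x hx => hx.neg
  sign n := by
    filter_upwards [h.sign n, fn_neg_ae (u n)] with x h1 h2
    simpa [h2] using h1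
  growth n := by
    filter_upwards [h.growth n, fn_neg_ae (u n), der_neg_ae (u n)] with x h1 h2 h3
    simpa [h2, h3] using h1
  lim w w' hw := by
    simpa using (h.lim w w' hw).neg
  int_f n := (h.int_f n).neg
  int_f' := h.int_f'.neg
  lim_f := by
    refine h.lim_f.congr fun n => ?_
    rw [← eLpNorm_neg]
    congr 1
    funext x
    simp
    ring
  eq n v hv := by
    have := h.eq n v hv
    simp only [neg_mul, integral_neg, Finset.sum_neg_distrib, neg_apply]
    linarith

lemma LimitData.memLp_flux (h : LimitData ν₀ ζ c u u' a a' φ φ' ℓ ℓ' f f') (j : Fin N) :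
    (∀ n, MemLp (a n j) (ENNReal.ofReal (p j).conjExponent) (leb Ω)) ∧
      MemLp (a' j) (ENNReal.ofReal (p j).conjExponent) (leb Ω) := by
  obtain ⟨K, hK, hle⟩ := h.bdd j
  exact ⟨fun n => ⟨h.aesm n j, (hle n).trans_lt hK.lt_top⟩,
    (memLp_of_ae_tendsto hK (fun n => h.aesm n j) hle (h.ae_flux.mono fun x hx => hx j)).1⟩

lemma memLp_top_of_abs_le {v : W0 Ω p} {M : ℝ} (hv : ∀ᵐ x ∂(leb Ω), |v.fn x| ≤ M) :
    MemLp v.fn ⊤ (leb Ω) :=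
  memLp_top_of_bound (Lp.aestronglyMeasurable _) M hv

lemma abs_le_of_memLp_top {v : W0 Ω p} (hv : MemLp v.fn ⊤ (leb Ω)) :
    ∃ M, 0 ≤ M ∧ ∀ᵐ x ∂(leb Ω), |v.fn x| ≤ M := by
  refine ⟨(eLpNorm v.fn ⊤ (leb Ω)).toReal, ENNReal.toReal_nonneg, ?_⟩
  have h1 := ae_le_eLpNormEssSup (f := (v.fn : Eu N → ℝ)) (μ := leb Ω)
  rw [← eLpNorm_exponent_top] at h1
  filter_upwards [h1] with x hx
  have h2 := ENNReal.toReal_mono hv.2.ne hx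
  simpa using h2

/-- The defect in the limit equation. -/
def defect (a' : Fin N → Eu N → ℝ) (φ' : Eu N → ℝ) (ℓ' : StrongDual ℝ (W0 Ω p)) (f' : Eu N → ℝ)
    (v : W0 Ω p) : ℝ :=
  (∑ j, ∫ x in Ω, a' j x * v.der j x) + (∫ x in Ω, φ' x * v.fn x) - ℓ' v - ∫ x in Ω, f' x * v.fn x

/-- The limit inequality for test functions weighted by a decreasing function of the solution. -/
lemma LimitData.defect_nonneg_of_weight (h : LimitData ν₀ ζ c u u' a a' φ φ' ℓ ℓ' f f')
    {v : W0 Ω p} {M : ℝ} (hv0 : ∀ᵐ x ∂(leb Ω), 0 ≤ v.fn x) (hvM : ∀ᵐ x ∂(leb Ω), |v.fn x| ≤ M)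
    {E E' : ℝ → ℝ} {K : ℝ} (hE : ∀ t, HasDerivAt E (E' t) t) (hE' : Continuous E')
    (hEK' : ∀ t, |E' t| ≤ K) (hEneg : ∀ t, E' t ≤ 0) (hE0 : ∀ t, 0 ≤ E t ∧ E t ≤ K)
    (hζE : ∀ t, 0 ≤ t → ζ t * E t ≤ - (ν₀ * E' t)) {Q : ℝ} (hQ : ∀ t, 0 ≤ t → ζ t * E t ≤ Q)
    {z : W0 Ω p} (hz : z.fn =ᵐ[leb Ω] fun x => v.fn x * E (u'.fn x)) :
    0 ≤ defect a' φ' ℓ' f' z := by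
  have hEc : Continuous E := continuous_iff_continuousAt.2 fun t => (hE t).continuousAt
  have hK0 : 0 ≤ K := (abs_nonneg _).trans (hEK' 0)
  have hEabs : ∀ t, |E t| ≤ K := fun t => by rw [abs_of_nonneg (hE0 t).1]; exact (hE0 t).2
  have hQ0 : 0 ≤ Q := (mul_nonneg (h.nonneg 0) (hE0 0).1).trans (hQ 0 le_rfl)
  have hM0 : 0 ≤ |M| := abs_nonneg M
  have hvM' : ∀ᵐ x ∂(leb Ω), |v.fn x| ≤ |M| := hvM.mono fun x hx => hx.trans (le_abs_self M)
  obtain ⟨R, hR⟩ := h.norm_le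
  -- The functions `v E(u_n)` are bounded both in the space and uniformly, so they converge weakly
  -- to `v E(u')`.
  choose w hwf hwd using fun n => exists_mul_comp v (u n) hvM hE hE' hEK' hEabs
  obtain ⟨z', hzf, hzd⟩ := exists_mul_comp v u' hvM hE hE' hEK' hEabs
  obtain rfl : z' = z := eq_of_fn_eq (Lp.ext (hzf.trans hz.symm))
  have hwR : ∀ n, ‖w n‖ ≤ K * ‖v‖ + |M| * K * R := by
    intro n
    refine (norm_le_of_der_le (u := v) (v := u n) hK0 (mul_nonneg hM0 hK0) fun j => ?_).trans ?_
    · filter_upwards [hwd n j, hvM'] with x hx hxM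
      rw [hx]
      refine (abs_add_le _ _).trans ?_
      rw [abs_mul, abs_mul, abs_mul, mul_assoc]
      gcongr
      · exact hEabs _
      · exact hEK' _
    · have := hR n
      gcongr
  have hwM : ∀ n, ∀ᵐ x ∂(leb Ω), |(w n).fn x| ≤ |M| * K := fun n => by
    filter_upwards [hwf n, hvM'] with x hx hxM
    rw [hx, abs_mul]
    exact mul_le_mul hxM (hEabs _) (abs_nonneg _) hM0
  have hwae : ∀ᵐ x ∂(leb Ω), Tendsto (fun n => (w n).fn x) atTop (𝓝 (z'.fn x)) := by
    filter_upwards [ae_all_iff.2 hwf, hzf, h.ae] with x h1 h2 h3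
    simp only [h1, h2]
    exact ((hEc.tendsto _).comp h3.1).const_mul _
  have hwfn : Tendsto (fun n => (w n).fn) atTop (𝓝 z'.fn) := by
    rw [Lp.tendsto_Lp_iff_tendsto_eLpNorm']
    refine (tendsto_eLpNorm_sub_of_dominated le_rfl ENNReal.one_ne_top
      (fun n => Lp.aestronglyMeasurable _) (memLp_const (|M| * K)) (fun n => ?_) hwae).2
    filter_upwards [hwM n] with x hx
    exact hx.trans (le_abs_self _)
  have hweak : WeakConv w z' := weakConv_of_tendsto_fn hwR hwfn
  have hEm : ∀ w : W0 Ω p, AEStronglyMeasurable (fun x => E (w.fn x)) (leb Ω) := fun w =>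
    hEc.comp_aestronglyMeasurable (Lp.aestronglyMeasurable _)
  have hE'm : ∀ w : W0 Ω p, AEStronglyMeasurable (fun x => E' (w.fn x)) (leb Ω) := fun w =>
    hE'.comp_aestronglyMeasurable (Lp.aestronglyMeasurable _)
  have hint1 : ∀ (b : Eu N → ℝ) j (w y : W0 Ω p),
      MemLp b (ENNReal.ofReal (p j).conjExponent) (leb Ω) →
      Integrable (fun x => b x * y.der j x * E (w.fn x)) (leb Ω) := fun b j w y hb =>
    (integrable_mul_of_conj (conj p j) hb (Lp.memLp _)).mul_bdd (hEm w)
      (Eventually.of_forall fun x => hEabs _)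
  have hint2 : ∀ (b : Eu N → ℝ) j (w : W0 Ω p),
      MemLp b (ENNReal.ofReal (p j).conjExponent) (leb Ω) →
      Integrable (fun x => b x * w.der j x * (v.fn x * E' (w.fn x))) (leb Ω) := fun b j w hb => by
    refine (integrable_mul_of_conj (conj p j) hb (Lp.memLp _)).mul_bdd (c := |M| * K)
      ((Lp.aestronglyMeasurable _).mul (hE'm w)) ?_
    filter_upwards [hvM'] with x hx
    rw [norm_mul]
    exact mul_le_mul hx (hEK' _) (abs_nonneg _) hM0
  have hint3 : ∀ (g : Eu N → ℝ) (w : W0 Ω p), Integrable g (leb Ω) →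
      Integrable (fun x => g x * (v.fn x * E (w.fn x))) (leb Ω) := fun g w hg => by
    refine hg.mul_bdd (c := |M| * K) ((Lp.aestronglyMeasurable _).mul (hEm w)) ?_
    filter_upwards [hvM'] with x hx
    rw [norm_mul]
    exact mul_le_mul hx (hEabs _) (abs_nonneg _) hM0
  -- The terms with `∇v` pass to the limit. Those with `∇u_n` and `φ_n`, for which only an upper
  -- bound is available, are kept together in a single integrand.
  have hsplit : ∀ (b : Fin N → Eu N → ℝ) (g : Eu N → ℝ) (w y : W0 Ω p),
      (∀ j, MemLp (b j) (ENNReal.ofReal (p j).conjExponent) (leb Ω)) → Integrable g (leb Ω) →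
      (y.fn =ᵐ[leb Ω] fun x => v.fn x * E (w.fn x)) →
      (∀ j, y.der j =ᵐ[leb Ω]
        fun x => E (w.fn x) * v.der j x + v.fn x * (E' (w.fn x) * w.der j x)) →
      (∑ j, ∫ x in Ω, b j x * y.der j x) + (∫ x in Ω, g x * y.fn x) =
      (∑ j, ∫ x in Ω, b j x * v.der j x * E (w.fn x)) +
        ∫ x in Ω, ((∑ j, b j x * w.der j x * (v.fn x * E' (w.fn x))) +
          g x * (v.fn x * E (w.fn x))) := by
    intro b g w y hb hg hy hyd
    have e1 : ∀ j, ∫ x in Ω, b j x * y.der j x = (∫ x in Ω, b j x * v.der j x * E (w.fn x)) +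
        ∫ x in Ω, b j x * w.der j x * (v.fn x * E' (w.fn x)) := fun j => by
      rw [← integral_add (hint1 _ j w v (hb j)) (hint2 _ j w (hb j))]
      refine integral_congr_ae ?_
      filter_upwards [hyd j] with x hx
      rw [hx]
      ring
    have e2 : ∫ x in Ω, g x * y.fn x = ∫ x in Ω, g x * (v.fn x * E (w.fn x)) := by
      refine integral_congr_ae ?_
      filter_upwards [hy] with x hx
      rw [hx]
    rw [integral_add (integrable_finsetSum _ fun j _ => hint2 _ j w (hb j)) (hint3 g w hg),
      integral_finsetSum _ fun j _ => hint2 _ j w (hb j), e2]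
    simp only [e1, Finset.sum_add_distrib]
    ring
  have hP : Tendsto (fun n => ∑ j, ∫ x in Ω, a n j x * v.der j x * E ((u n).fn x)) atTop
      (𝓝 (∑ j, ∫ x in Ω, a' j x * v.der j x * E (u'.fn x))) := by
    refine tendsto_finsetSum _ fun j _ => ?_
    obtain ⟨K₁, hK₁, hle⟩ := h.bdd j
    have t := tendsto_integral_mul_of_ae (conj p j) (a := fun n x => a n j x * E ((u n).fn x))
      (a' := fun x => a' j x * E (u'.fn x)) (K := ENNReal.ofReal K * K₁)
      (ENNReal.mul_ne_top ENNReal.ofReal_ne_top hK₁) (fun n => (h.aesm n j).mul (hEm (u n)))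
      (fun n => by
        refine (eLpNorm_le_mul_eLpNorm_of_ae_le_mul (f := fun x => a n j x * E ((u n).fn x))
          (g := a n j) (c := K) (Eventually.of_forall fun x => ?_) _).trans
          (mul_le_mul' le_rfl (hle n))
        rw [norm_mul, mul_comm]
        exact mul_le_mul_of_nonneg_right (hEabs _) (norm_nonneg _))
      (by
        filter_upwards [h.ae, h.ae_flux] with x h1 h2
        exact (h2 j).mul ((hEc.tendsto _).comp h1.1)) (Lp.memLp (v.der j))
    refine (t.congr fun n => ?_).trans_eq ?_
    · exact integral_congr_ae (Eventually.of_forall fun x => by ring)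
    · congr 1
      exact integral_congr_ae (Eventually.of_forall fun x => by ring)
  have hrhs : Tendsto (fun n => ℓ n (w n) + ∫ x in Ω, f n x * (w n).fn x) atTop
      (𝓝 (ℓ' z' + ∫ x in Ω, f' x * z'.fn x)) := by
    refine (h.lim w z' hweak).add ?_
    have := tendsto_integral_bdd_mul (fun n => Lp.aestronglyMeasurable (w n).fn) hwM hwae h.int_f
      h.int_f' h.lim_f
    simpa only [mul_comm] using this
  -- The equation expresses the integral of this integrand by convergent quantities, so its limit is
  -- known. The reverse Fatou lemma then compares it with the integral of the pointwise limit.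
  have hQn : Tendsto (fun n => ∫ x in Ω,
      ((∑ j, a n j x * (u n).der j x * (v.fn x * E' ((u n).fn x))) +
        φ n x * (v.fn x * E ((u n).fn x)))) atTop
      (𝓝 ((ℓ' z' + ∫ x in Ω, f' x * z'.fn x) -
        ∑ j, ∫ x in Ω, a' j x * v.der j x * E (u'.fn x))) := by
    refine (hrhs.sub hP).congr fun n => ?_
    have e1 := h.eq n (w n) (memLp_top_of_abs_le (hwM n))
    rw [hsplit (a n) (φ n) (u n) (w n) (fun j => (h.memLp_flux j).1 n) (h.int_lower n) (hwf n)
      (hwd n)] at e1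
    linarith
  have hfatou := le_integral_of_tendsto (μ := leb Ω) (q := fun n x =>
      (∑ j, a n j x * (u n).der j x * (v.fn x * E' ((u n).fn x))) +
        φ n x * (v.fn x * E ((u n).fn x)))
    (q' := fun x => (∑ j, a' j x * u'.der j x * (v.fn x * E' (u'.fn x))) +
        φ' x * (v.fn x * E (u'.fn x))) (β := fun x => |M| * Q * c x)
    (fun n => (integrable_finsetSum _ fun j _ => hint2 _ j (u n) ((h.memLp_flux j).1 n)).add
      (hint3 _ (u n) (h.int_lower n)))
    ((integrable_finsetSum _ fun j _ => hint2 _ j u' (h.memLp_flux j).2).add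
      (hint3 _ u' h.int_lower'))
    (h.int_c.const_mul _)
    (fun n => by
      filter_upwards [h.coer n, h.sign n, h.growth n, hv0, hvM', h.nonneg_c]
        with x h1 h2 h3 h4 h5 h6
      obtain ⟨t, ht⟩ : ∃ t, t = (u n).fn x := ⟨_, rfl⟩
      obtain ⟨S, hS⟩ : ∃ S, S = ∑ j, a n j x * (u n).der j x := ⟨_, rfl⟩
      obtain ⟨X, hX⟩ : ∃ X, X = ∑ j, |(u n).der j x| ^ p j := ⟨_, rfl⟩
      have hX0 : 0 ≤ X := hX ▸ sum_abs_rpow_nonneg p _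
      rw [← hS, ← hX] at h1
      rw [← ht] at h2 h3 ⊢
      rw [← hX] at h3
      rw [← Finset.sum_mul, ← hS]
      have hqc : 0 ≤ Q * c x := mul_nonneg hQ0 h6
      -- For `t ≥ 0` the growth of `φ` costs `ζ(t) E(t) X`, which the coercive part `ν₀ X E'(t)`
      -- absorbs; only `ζ(t) E(t) c` remains. For `t < 0` the sign condition makes `φ ≤ 0`, and both
      -- terms are nonpositive.
      have key : S * E' t + φ n x * E t ≤ Q * c x := by
        have hSE : S * E' t ≤ ν₀ * X * E' t := mul_le_mul_of_nonpos_right h1 (hEneg t)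
        rcases le_or_gt 0 t with h0 | h0
        · rw [abs_of_nonneg h0] at h3
          have e1 := mul_le_mul_of_nonneg_right ((le_abs_self _).trans h3) (hE0 t).1
          have e2 := mul_le_mul_of_nonneg_right (hζE t h0) hX0
          have e3 := mul_le_mul_of_nonneg_right (hQ t h0) h6
          linarith
        · have e1 : φ n x ≤ 0 := by
            by_contra! hpos
            linarith [mul_neg_of_pos_of_neg hpos h0]
          have e2 := mul_nonpos_of_nonpos_of_nonneg e1 (hE0 t).1
          have e3 := mul_nonpos_of_nonneg_of_nonpos (mul_nonneg h.pos.le hX0) (hEneg t)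
          linarith
      have e4 := mul_le_mul_of_nonneg_left key h4
      have e5 : v.fn x * (Q * c x) ≤ |M| * (Q * c x) :=
        mul_le_mul_of_nonneg_right ((le_abs_self _).trans h5) hqc
      linarith)
    (by
      filter_upwards [h.ae, h.ae_flux, h.ae_lower] with x h1 h2 h3
      refine (tendsto_finsetSum _ fun j _ => ((h2 j).mul (h1.2 j)).mul
        (((hE'.tendsto _).comp h1.1).const_mul _)).add
        (h3.mul (((hEc.tendsto _).comp h1.1).const_mul _))) hQn
  have e1 := hsplit a' φ' u' z' (fun j => (h.memLp_flux j).2) h.int_lower' hzf hzd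
  unfold defect
  linarith

end W0

end AnisoElliptic

end

/-! ### Passage to the limit: removal of the weight and of the sign restriction -/

noncomputable section

set_option linter.unusedSectionVars false

namespace AnisoElliptic

namespace W0

variable {N : ℕ} {Ω : Set (Eu N)} {p : Fin N → ℝ} [hp : Fact (∀ j, 1 < p j)]
  [hN : Fact (2 ≤ N)] [hpN : Fact (hmean p < N)] [NeZero N]
  [hfin : IsFiniteMeasure (leb Ω)]

variable {ν₀ : ℝ} {ζ : ℝ → ℝ} {c : Eu N → ℝ} {u : ℕ → W0 Ω p} {u' : W0 Ω p}
    {a : ℕ → Fin N → Eu N → ℝ} {a' : Fin N → Eu N → ℝ} {φ : ℕ → Eu N → ℝ} {φ' : Eu N → ℝ}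
    {ℓ : ℕ → StrongDual ℝ (W0 Ω p)} {ℓ' : StrongDual ℝ (W0 Ω p)}
    {f : ℕ → Eu N → ℝ} {f' : Eu N → ℝ}

/-- Bounded sequences converging a.e. under a common bound converge weakly. -/
lemma weakConv_of_ae {w : ℕ → W0 Ω p} {w' : W0 Ω p} {R M : ℝ} (hR : ∀ n, ‖w n‖ ≤ R)
    (hM : ∀ n, ∀ᵐ x ∂(leb Ω), |(w n).fn x| ≤ M)
    (hae : ∀ᵐ x ∂(leb Ω), Tendsto (fun n => (w n).fn x) atTop (𝓝 (w'.fn x))) :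
    WeakConv w w' := by
  refine weakConv_of_tendsto_fn hR ?_
  rw [Lp.tendsto_Lp_iff_tendsto_eLpNorm']
  refine (tendsto_eLpNorm_sub_of_dominated le_rfl ENNReal.one_ne_top
    (fun n => Lp.aestronglyMeasurable _) (memLp_const M) (fun n => ?_) hae).2
  filter_upwards [hM n] with x hx
  exact hx.trans (le_abs_self _)

lemma tendsto_integral_mul_fn {g : Eu N → ℝ} (hg : Integrable g (leb Ω)) {w : ℕ → W0 Ω p}
    {w' : W0 Ω p} {M : ℝ} (hM : ∀ n, ∀ᵐ x ∂(leb Ω), |(w n).fn x| ≤ M)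
    (hae : ∀ᵐ x ∂(leb Ω), Tendsto (fun n => (w n).fn x) atTop (𝓝 (w'.fn x))) :
    Tendsto (fun n => ∫ x in Ω, g x * (w n).fn x) atTop (𝓝 (∫ x in Ω, g x * w'.fn x)) := by
  have := tendsto_integral_bdd_mul (fun n => Lp.aestronglyMeasurable (w n).fn) hM hae
    (b := fun _ => g) (fun _ => hg) hg (by simp)
  simpa only [mul_comm] using this

/-- The continuity by which cutoffs in `u'` and in `v` are removed: the norm bound together with the
uniform bound gives weak convergence, and the uniform bound handles the integrable terms. -/
lemma tendsto_defect (h : LimitData ν₀ ζ c u u' a a' φ φ' ℓ ℓ' f f') {w : ℕ → W0 Ω p}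
    {w' : W0 Ω p} {R M : ℝ} (hR : ∀ n, ‖w n‖ ≤ R) (hM : ∀ n, ∀ᵐ x ∂(leb Ω), |(w n).fn x| ≤ M)
    (hae : ∀ᵐ x ∂(leb Ω), Tendsto (fun n => (w n).fn x) atTop (𝓝 (w'.fn x))) :
    Tendsto (fun n => defect a' φ' ℓ' f' (w n)) atTop (𝓝 (defect a' φ' ℓ' f' w')) := by
  have hw := weakConv_of_ae hR hM hae
  exact (((tendsto_finsetSum _ fun j _ => tendsto_integral_mul_der hw j (h.memLp_flux j).2).add
    (tendsto_integral_mul_fn h.int_lower' hM hae)).sub (hw ℓ')).sub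
    (tendsto_integral_mul_fn h.int_f' hM hae)

lemma integrable_mul_fn_of_abs_le {g : Eu N → ℝ} (hg : Integrable g (leb Ω)) {v : W0 Ω p} {M : ℝ}
    (hv : ∀ᵐ x ∂(leb Ω), |v.fn x| ≤ M) : Integrable (fun x => g x * v.fn x) (leb Ω) :=
  hg.mul_bdd (Lp.aestronglyMeasurable _) hv

lemma LimitData.defect_add (h : LimitData ν₀ ζ c u u' a a' φ φ' ℓ ℓ' f f') {v w : W0 Ω p} {M : ℝ}
    (hv : ∀ᵐ x ∂(leb Ω), |v.fn x| ≤ M) (hw : ∀ᵐ x ∂(leb Ω), |w.fn x| ≤ M) :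
    defect a' φ' ℓ' f' (v + w) = defect a' φ' ℓ' f' v + defect a' φ' ℓ' f' w := by
  have e1 : ∀ j, ∫ x in Ω, a' j x * (v + w).der j x =
      (∫ x in Ω, a' j x * v.der j x) + ∫ x in Ω, a' j x * w.der j x := fun j => by
    rw [← integral_add (integrable_mul_of_conj (conj p j) (h.memLp_flux j).2 (Lp.memLp _))
      (integrable_mul_of_conj (conj p j) (h.memLp_flux j).2 (Lp.memLp _))]
    refine integral_congr_ae ?_
    filter_upwards [der_add_ae v w j] with x hx
    rw [hx, mul_add]
  have e2 : ∀ g : Eu N → ℝ, Integrable g (leb Ω) → ∫ x in Ω, g x * (v + w).fn x =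
      (∫ x in Ω, g x * v.fn x) + ∫ x in Ω, g x * w.fn x := fun g hg => by
    rw [← integral_add (integrable_mul_fn_of_abs_le hg hv) (integrable_mul_fn_of_abs_le hg hw)]
    refine integral_congr_ae ?_
    filter_upwards [fn_add_ae v w] with x hx
    rw [hx, mul_add]
  unfold defect
  rw [e2 _ h.int_lower', e2 _ h.int_f', map_add]
  simp only [e1, Finset.sum_add_distrib]
  ring

lemma defect_neg_data (v : W0 Ω p) :
    defect (fun j x => - a' j x) (fun x => - φ' x) (-ℓ') (fun x => - f' x) v =
      - defect a' φ' ℓ' f' v := by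
  simp only [defect, neg_mul, integral_neg, Finset.sum_neg_distrib, neg_apply]
  ring

/-- The weighted inequality is applied to `v P(u')` in place of `v`. As `P E = H`, the exponential
weight disappears and leaves a test function `v H(u')` with a mere cutoff from above, which is then
let tend to `v`. -/
lemma LimitData.defect_nonneg (h : LimitData ν₀ ζ c u u' a a' φ φ' ℓ ℓ' f f') {v : W0 Ω p} {M : ℝ}
    (hv0 : ∀ᵐ x ∂(leb Ω), 0 ≤ v.fn x) (hvM : ∀ᵐ x ∂(leb Ω), |v.fn x| ≤ M) :
    0 ≤ defect a' φ' ℓ' f' v := by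
  obtain ⟨K, K', L, hK, hK', hL, hKneg, hK01, hK1, hK0, hK'0⟩ := exists_descent
  have hL0 : 0 ≤ L := (abs_nonneg _).trans (hL 0)
  have hvM' : ∀ᵐ x ∂(leb Ω), |v.fn x| ≤ |M| := hvM.mono fun x hx => hx.trans (le_abs_self M)
  -- The cutoff is one for `t ≤ k + 1` and zero for `t ≥ 2 (k + 1)`, and the derivatives are bounded
  -- independently of `k`.
  have hH : ∀ (k : ℕ) (t : ℝ), HasDerivAt (fun t => K (t / (k + 1) - 1))
      (K' (t / (k + 1) - 1) * (1 / (k + 1))) t := fun k t => by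
    have h1 : HasDerivAt (fun t : ℝ => t / ((k : ℝ) + 1) - 1) (1 / ((k : ℝ) + 1)) t :=
      ((hasDerivAt_id t).div_const _).sub_const 1
    exact (hK _).comp t h1
  have hH' : ∀ k : ℕ, Continuous fun t : ℝ => K' (t / ((k : ℝ) + 1) - 1) * (1 / ((k : ℝ) + 1)) :=
    fun k => by fun_prop
  have hHL : ∀ (k : ℕ) (t : ℝ), |K' (t / ((k : ℝ) + 1) - 1) * (1 / ((k : ℝ) + 1))| ≤ L :=
    fun k t => by
      have h1 : 1 / ((k : ℝ) + 1) ≤ 1 := by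
        rw [div_le_one (by positivity)]
        linarith [Nat.cast_nonneg (α := ℝ) k]
      rw [abs_mul, abs_of_nonneg (show 0 ≤ 1 / ((k : ℝ) + 1) by positivity)]
      calc _ ≤ L * 1 := mul_le_mul (hL _) h1 (by positivity) hL0
        _ = L := mul_one L
  have hH1 : ∀ (k : ℕ) (t : ℝ), |K (t / ((k : ℝ) + 1) - 1)| ≤ 1 := fun k t => by
    rw [abs_of_nonneg (hK01 _).1]
    exact (hK01 _).2
  choose z hz hzd using fun k : ℕ => exists_mul_comp v u' hvM' (hH k) (hH' k) (hHL k) (hH1 k)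
  have hpos : ∀ k, 0 ≤ defect a' φ' ℓ' f' (z k) := by
    intro k
    obtain ⟨s, hs⟩ : ∃ s : ℝ, s = 2 * ((k : ℝ) + 1) := ⟨_, rfl⟩
    have hk : 0 < (k : ℝ) + 1 := by positivity
    have hvan : ∀ t, s < t → K (t / ((k : ℝ) + 1) - 1) = 0 ∧
        K' (t / ((k : ℝ) + 1) - 1) * (1 / ((k : ℝ) + 1)) = 0 := fun t ht => by
      have : 2 < t / ((k : ℝ) + 1) := by
        rw [lt_div_iff₀ hk]
        linarith
      rw [hK0 _ (by linarith), hK'0 _ (by linarith), zero_mul]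
      exact ⟨rfl, rfl⟩
    -- The weight vanishes from `s + 1` on, and before that `ζ t ≤ ζ (s + 1)` by monotonicity, so
    -- this one constant yields `ζ E ≤ -ν₀ E'` on the whole half-line.
    have hZ : 0 ≤ ζ (s + 1) / ν₀ := div_nonneg (h.nonneg _) h.pos.le
    obtain ⟨E, E', P, P', C, hE, hE', hEC, hEneg, hE0, hEZ, hEs, hP, hP', hPC, hP0, hPE⟩ :=
      exists_weight (hH k) (hH' k) (hHL k) (fun t => hK01 _) hvan hZ
    have hζ : ∀ t, 0 ≤ t → ζ t * E t ≤ ζ (s + 1) * E t := fun t _ => by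
      rcases le_or_gt (s + 1) t with ht | ht
      · rw [hEs t ht, mul_zero, mul_zero]
      · exact mul_le_mul_of_nonneg_right (h.mono ht.le) (hE0 t).1
    obtain ⟨y, hy, -⟩ := exists_mul_comp v u' hvM' hP hP' hPC (K := C) fun t => by
      rw [abs_of_nonneg (hP0 t).1]
      exact (hP0 t).2
    refine h.defect_nonneg_of_weight (v := y) (M := |M| * C) (Q := ζ (s + 1) * C) ?_ ?_ hE hE' hEC
      hEneg hE0 (fun t ht => ?_) (fun t ht => ?_) ?_
    · filter_upwards [hy, hv0] with x hx hx0
      rw [hx]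
      exact mul_nonneg hx0 (hP0 _).1
    · filter_upwards [hy, hvM'] with x hx hx0
      rw [hx, abs_mul, abs_of_nonneg (hP0 _).1]
      exact mul_le_mul hx0 (hP0 _).2 (hP0 _).1 (abs_nonneg M)
    · have e1 := mul_le_mul_of_nonneg_left (hEZ t ht) h.pos.le
      have e2 : ν₀ * (ζ (s + 1) / ν₀ * E t) = ζ (s + 1) * E t := by
        rw [← mul_assoc, mul_div_cancel₀ _ h.pos.ne']
      linarith [hζ t ht]
    · exact (hζ t ht).trans (mul_le_mul_of_nonneg_left (hE0 t).2 (h.nonneg _))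
    · filter_upwards [hz k, hy] with x hx hx'
      rw [hx, hx', mul_assoc, hPE]
  refine ge_of_tendsto' (tendsto_defect h (w := z) (w' := v) (R := 1 * ‖v‖ + |M| * L * ‖u'‖)
    (M := |M|) (fun k => ?_) (fun k => ?_) ?_) hpos
  · refine norm_le_of_der_le zero_le_one (by positivity) fun j => ?_
    filter_upwards [hzd k j, hvM'] with x hx hxM
    rw [hx]
    refine (abs_add_le _ _).trans ?_
    rw [abs_mul, abs_mul, abs_mul (K' _ * _), mul_assoc]
    gcongr
    · exact hH1 k _
    · exact hHL k _
  · filter_upwards [hz k, hvM'] with x hx hxM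
    rw [hx, abs_mul]
    exact (mul_le_of_le_one_right (abs_nonneg _) (hH1 k _)).trans hxM
  · filter_upwards [ae_all_iff.2 hz] with x hx
    simp only [hx]
    refine tendsto_const_nhds.congr' ?_
    filter_upwards [eventually_ge_atTop ⌈u'.fn x⌉₊] with k hk
    have h1 : u'.fn x ≤ k := (Nat.le_ceil _).trans (Nat.cast_le.2 hk)
    rw [hK1, mul_one]
    rw [sub_nonpos, div_le_one (by positivity)]
    linarith

/-- Reversing the signs of the data, but not of `v`, turns the lower bound on the defect into an
upper bound. -/
lemma LimitData.defect_eq_zero_of_nonneg (h : LimitData ν₀ ζ c u u' a a' φ φ' ℓ ℓ' f f')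
    {v : W0 Ω p} {M : ℝ} (hv0 : ∀ᵐ x ∂(leb Ω), 0 ≤ v.fn x) (hvM : ∀ᵐ x ∂(leb Ω), |v.fn x| ≤ M) :
    defect a' φ' ℓ' f' v = 0 := by
  have h1 := h.defect_nonneg hv0 hvM
  have h2 := h.neg.defect_nonneg hv0 hvM
  rw [defect_neg_data] at h2
  linarith

/-- Constants are not in the space, so `v + |M|` is not available, and positive parts are not `C^1`
functions of `v`. Instead `v F_k(v)` with `F_k(t) = t^2 / (t^2 + 1/(k+1))` is the difference of the
nonnegative functions `(v + |M|) F_k(v)` and `|M| F_k(v)`, and it tends to `v`. -/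
lemma LimitData.defect_eq_zero (h : LimitData ν₀ ζ c u u' a a' φ φ' ℓ ℓ' f f')
    {v : W0 Ω p} {M : ℝ} (hvM : ∀ᵐ x ∂(leb Ω), |v.fn x| ≤ M) :
    defect a' φ' ℓ' f' v = 0 := by
  have hvM' : ∀ᵐ x ∂(leb Ω), |v.fn x| ≤ |M| := hvM.mono fun x hx => hx.trans (le_abs_self M)
  obtain ⟨F, hF⟩ : ∃ F : ℕ → ℝ → ℝ, F = fun (k : ℕ) t => t ^ 2 / (t ^ 2 + 1 / ((k : ℝ) + 1)) := ⟨_, rfl⟩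
  obtain ⟨F', hF'⟩ : ∃ F' : ℕ → ℝ → ℝ, F' = fun (k : ℕ) t =>
    2 * t * (1 / ((k : ℝ) + 1)) / (t ^ 2 + 1 / ((k : ℝ) + 1)) ^ 2 := ⟨_, rfl⟩
  have hden : ∀ (k : ℕ) (t : ℝ), 0 < t ^ 2 + 1 / ((k : ℝ) + 1) := fun k t => by positivity
  have hd : ∀ k t, HasDerivAt (F k) (F' k t) t := fun k t => by
    have h1 := (hasDerivAt_pow 2 t).div ((hasDerivAt_pow 2 t).add_const (1 / ((k : ℝ) + 1)))
      (hden k t).ne'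
    rw [hF, hF']
    refine h1.congr_deriv ?_
    have := hden k t
    field_simp
    push_cast
    ring
  have hc' : ∀ k, Continuous (F' k) := fun k => by
    rw [hF']
    exact Continuous.div (by fun_prop) (by fun_prop) fun t => (pow_pos (hden k t) 2).ne'
  have h01 : ∀ k t, 0 ≤ F k t ∧ F k t ≤ 1 := fun k t => by
    rw [hF]
    have : 0 ≤ 1 / ((k : ℝ) + 1) := by positivity
    exact ⟨div_nonneg (sq_nonneg t) (hden k t).le, (div_le_one (hden k t)).2 (by linarith)⟩
  have hFabs : ∀ k t, |F k t| ≤ 1 := fun k t => by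
    rw [abs_of_nonneg (h01 k t).1]
    exact (h01 k t).2
  -- The bound on `t F_k'(t)` is uniform in `k`, and it keeps `v F_k(v)` bounded in the space. The
  -- bound on `F_k'` itself grows with `k` and serves only to apply the chain rule.
  have htF : ∀ k t, |t * F' k t| ≤ 1 := fun k t => by
    rw [hF']
    obtain ⟨e, he⟩ : ∃ e : ℝ, e = 1 / ((k : ℝ) + 1) := ⟨_, rfl⟩
    have he0 : 0 < e := by rw [he]; positivity
    beta_reduce
    rw [← he, show t * (2 * t * e / (t ^ 2 + e) ^ 2) = 2 * t ^ 2 * e / (t ^ 2 + e) ^ 2 by ring,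
      abs_of_nonneg (by positivity), div_le_one (by positivity)]
    nlinarith [sq_nonneg (t ^ 2), sq_nonneg e]
  have hL : ∀ k t, |F' k t| ≤ (k : ℝ) + 2 := fun k t => by
    rw [hF']
    obtain ⟨e, he⟩ : ∃ e : ℝ, e = 1 / ((k : ℝ) + 1) := ⟨_, rfl⟩
    have he0 : 0 < e := by rw [he]; positivity
    have hek : ((k : ℝ) + 1) * e = 1 := by rw [he]; field_simp
    have hk : 0 ≤ (k : ℝ) := Nat.cast_nonneg k
    beta_reduce
    rw [← he, abs_div, abs_of_nonneg (show 0 ≤ (t ^ 2 + e) ^ 2 by positivity),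
      div_le_iff₀ (by positivity), abs_mul, abs_mul, abs_of_pos he0, abs_two]
    have h1 : 2 * |t| ≤ t ^ 2 + 1 := by
      nlinarith [sq_nonneg (|t| - 1), sq_abs t]
    have h2 : (t ^ 2 + 1) * e ≤ (k + 2) * (2 * (t ^ 2 * e) + e ^ 2) := by
      have e1 : ((k : ℝ) + 1) * e * e = e := by rw [hek, one_mul]
      have e2 : 0 ≤ t ^ 2 * e := by positivity
      nlinarith [mul_nonneg hk e2, sq_nonneg e]
    have h3 : (k + 2) * (2 * (t ^ 2 * e) + e ^ 2) ≤ (k + 2) * (t ^ 2 + e) ^ 2 := by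
      refine mul_le_mul_of_nonneg_left ?_ (by linarith)
      nlinarith [sq_nonneg (t ^ 2)]
    nlinarith [mul_le_mul_of_nonneg_right h1 he0.le]
  have hF0 : ∀ k, F k 0 = 0 := fun k => by rw [hF]; simp
  choose w₁ hw₁ hw₁d using fun k => exists_mul_comp v v hvM' (hd k) (hc' k) (hL k) (hFabs k)
  choose w₂ hw₂ hw₂d using fun k => exists_comp v (hd k) (hc' k) (hL k) (hF0 k)
  have hzero : ∀ k, defect a' φ' ℓ' f' (w₁ k) = 0 := by
    intro k
    have b1 : ∀ᵐ x ∂(leb Ω), |(w₁ k).fn x| ≤ |M| := by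
      filter_upwards [hw₁ k, hvM'] with x hx hxM
      rw [hx, abs_mul]
      exact (mul_le_of_le_one_right (abs_nonneg _) (hFabs k _)).trans hxM
    have b2 : ∀ᵐ x ∂(leb Ω), (|M| • w₂ k).fn x = |M| * F k (v.fn x) := by
      filter_upwards [hw₂ k, fn_smul_ae |M| (w₂ k)] with x hx hx'
      rw [hx', hx]
    have b3 : ∀ᵐ x ∂(leb Ω), |(|M| • w₂ k).fn x| ≤ |M| := by
      filter_upwards [b2] with x hx
      rw [hx, abs_mul, abs_abs]
      exact mul_le_of_le_one_right (abs_nonneg _) (hFabs k _)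
    have z2 := h.defect_eq_zero_of_nonneg (v := |M| • w₂ k) (by
      filter_upwards [b2] with x hx
      rw [hx]
      exact mul_nonneg (abs_nonneg _) (h01 k _).1) b3
    have z1 := h.defect_eq_zero_of_nonneg (v := w₁ k + |M| • w₂ k) (M := |M| + |M|) (by
      filter_upwards [hw₁ k, b2, fn_add_ae (w₁ k) (|M| • w₂ k), hvM'] with x h1 h2 h3 h4
      rw [h3, h1, h2, ← add_mul]
      exact mul_nonneg (by linarith [neg_abs_le (v.fn x)]) (h01 k _).1) (by
      filter_upwards [b1, b3, fn_add_ae (w₁ k) (|M| • w₂ k)] with x h1 h2 h3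
      rw [h3]
      exact (abs_add_le _ _).trans (add_le_add h1 h2))
    rw [h.defect_add b1 b3, z2, add_zero] at z1
    exact z1
  have hlim := tendsto_defect h (w := w₁) (w' := v) (R := 1 * ‖v‖ + 1 * ‖v‖) (M := |M|)
    (fun k => ?_) (fun k => ?_) ?_
  · simp only [hzero] at hlim
    exact (tendsto_nhds_unique tendsto_const_nhds hlim).symm
  · refine norm_le_of_der_le zero_le_one zero_le_one fun j => ?_
    filter_upwards [hw₁d k j] with x hx
    rw [hx, ← mul_assoc (v.fn x)]
    refine (abs_add_le _ _).trans ?_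
    rw [abs_mul, abs_mul (v.fn x * _)]
    gcongr
    · exact hFabs k _
    · exact htF k _
  · filter_upwards [hw₁ k, hvM'] with x hx hxM
    rw [hx, abs_mul]
    exact (mul_le_of_le_one_right (abs_nonneg _) (hFabs k _)).trans hxM
  · filter_upwards [ae_all_iff.2 hw₁] with x hx
    simp only [hx]
    obtain ⟨t, ht⟩ : ∃ t, t = v.fn x := ⟨_, rfl⟩
    rw [← ht, hF]
    rcases eq_or_ne t 0 with rfl | h0
    · simp
    · have h1 : Tendsto (fun k : ℕ => t * (t ^ 2 / (t ^ 2 + 1 / ((k : ℝ) + 1)))) atTop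
          (𝓝 (t * (t ^ 2 / (t ^ 2 + 0)))) :=
        (tendsto_const_nhds.div (tendsto_one_div_add_atTop_nhds_zero_nat.const_add _)
          (by simpa using h0)).const_mul _
      rwa [add_zero, div_self (by simpa using h0), mul_one] at h1

/-- The limit of approximate solutions solves the limit equation. -/
theorem LimitData.limit_eq (h : LimitData ν₀ ζ c u u' a a' φ φ' ℓ ℓ' f f')
    {v : W0 Ω p} (hv : MemLp v.fn ⊤ (leb Ω)) :
    (∑ j, ∫ x in Ω, a' j x * v.der j x) + ∫ x in Ω, φ' x * v.fn x =
      ℓ' v + ∫ x in Ω, f' x * v.fn x := by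
  obtain ⟨M, -, hM⟩ := abs_le_of_memLp_top hv
  have := h.defect_eq_zero hM
  unfold defect at this
  linarith

end W0

end AnisoElliptic

end

/-! ### Stability of weak solutions -/

noncomputable section

set_option linter.unusedSectionVars false

namespace AnisoElliptic

/-- A bounded primitive of the cutoff function. -/
lemma exists_primitive_cutoff : ∃ S : ℝ → ℝ, (∀ t, HasDerivAt S (cutoff t) t) ∧ S 0 = 0 ∧
    ∀ t, |S t| ≤ 2 := by
  have hd : ∀ t, HasDerivAt (fun t => ∫ s in (0 : ℝ)..t, cutoff s) (cutoff t) t :=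
    hasDerivAt_primitive continuous_cutoff
  have hle : ∀ t, |cutoff t| ≤ 1 := fun t => by
    rw [abs_of_nonneg (cutoff_mem t).1]
    exact (cutoff_mem t).2
  refine ⟨_, hd, intervalIntegral.integral_same, fun t => ?_⟩
  have hsmall : ∀ t, |t| ≤ 2 → |∫ s in (0 : ℝ)..t, cutoff s| ≤ 2 := fun t ht => by
    have := abs_sub_le_of_hasDerivAt hd hle t 0
    simp only [intervalIntegral.integral_same, sub_zero, one_mul] at this
    exact this.trans ht
  have hfar : ∀ a t : ℝ, |a| = 2 → (∀ s ∈ Set.uIcc a t, 2 ≤ |s|) →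
      |∫ s in (0 : ℝ)..t, cutoff s| ≤ 2 := fun a t ha hs => by
    rw [← intervalIntegral.integral_add_adjacent_intervals
      (continuous_cutoff.intervalIntegrable 0 a) (continuous_cutoff.intervalIntegrable a t),
      intervalIntegral.integral_congr (g := fun _ => 0) fun s h => cutoff_eq_zero (hs s h)]
    simpa using hsmall a ha.le
  rcases le_or_gt (|t|) 2 with h | h
  · exact hsmall t h
  rcases lt_abs.1 h with h | h
  · refine hfar 2 t abs_two fun s hs => ?_
    rw [Set.uIcc_of_le h.le] at hs
    exact hs.1.trans (le_abs_self s)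
  · refine hfar (-2) t (by rw [abs_neg, abs_two]) fun s hs => ?_
    rw [Set.uIcc_of_ge (by linarith)] at hs
    exact le_trans (by linarith [hs.2]) (neg_le_abs s)

namespace W0

variable {N : ℕ} {Ω : Set (Eu N)} {p : Fin N → ℝ} [hp : Fact (∀ j, 1 < p j)]
  [hN : Fact (2 ≤ N)] [hpN : Fact (hmean p < N)] [NeZero N]
  [hfin : IsFiniteMeasure (leb Ω)]
  {A : Fin N → Eu N → ℝ → (Fin N → ℝ) → ℝ} {ν₀ ν : ℝ} {η : Fin N → Eu N → ℝ}
  {B : W0 Ω p → StrongDual ℝ (W0 Ω p)}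

lemma tendsto_apply_zero (hB2 : CondP2 B) {u w : ℕ → W0 Ω p} {u' : W0 Ω p} (hu : WeakConv u u')
    (hw : WeakConv w 0) : Tendsto (fun n => B (u n) (w n)) atTop (𝓝 0) := by
  simpa using hB2 u w u' 0 hu hw

/-- By contradiction: sequences violating every bound have weakly convergent subsequences, along
which `(P_2)` makes the values converge. -/
lemma exists_abs_apply_le (hB2 : CondP2 B) (R : ℝ) :
    ∃ K, ∀ u v : W0 Ω p, ‖u‖ ≤ R → ‖v‖ ≤ R → |B u v| ≤ K := by
  by_contra! hcon
  choose u v hu hv huv using fun n : ℕ => hcon n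
  obtain ⟨u', σ, hσ, hu'⟩ := exists_weakConv_subseq hu
  obtain ⟨v', τ, hτ, hv'⟩ := exists_weakConv_subseq fun n => hv (σ n)
  have h1 := (hB2 _ _ _ _ (WeakConv.comp hu' hτ) hv').abs
  have h2 : Tendsto (fun n => ((σ (τ n) : ℕ) : ℝ)) atTop atTop :=
    tendsto_natCast_atTop_atTop.comp (hσ.comp hτ).tendsto_atTop
  exact not_tendsto_nhds_of_tendsto_atTop
    (tendsto_atTop_mono (fun n => (huv _).le) h2) _ h1

lemma fn_zero_ae : ∀ᵐ x ∂(leb Ω), (0 : W0 Ω p).fn x = 0 := Lp.coeFn_zero ℝ 1 (leb Ω)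

/-- Approximate solutions whose lower order terms are bounded in `L^1` satisfy the criterion for
the a.e. convergence of the gradients. -/
lemma exists_cutoff_integral_le (hB2 : CondP2 B) {φ : ℕ → Eu N → ℝ} {f : ℕ → Eu N → ℝ}
    {f' : Eu N → ℝ} {u : ℕ → W0 Ω p} {u' : W0 Ω p} {R M : ℝ} (hR : ∀ n, ‖u n‖ ≤ R)
    (hweak : WeakConv u u')
    (hae : ∀ᵐ x ∂(leb Ω), Tendsto (fun n => (u n).fn x) atTop (𝓝 (u'.fn x)))
    (hA : FluxCond Ω p A ν₀ ν η) (hφ : ∀ n, Integrable (φ n) (leb Ω))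
    (hM : ∀ n, ∫ x in Ω, |φ n x| ≤ M) (hf : ∀ n, Integrable (f n) (leb Ω))
    (hf' : Integrable f' (leb Ω)) (hlim : Tendsto (fun n => eLpNorm (f n - f') 1 (leb Ω)) atTop (𝓝 0))
    (heq : ∀ n (v : W0 Ω p), MemLp v.fn ⊤ (leb Ω) →
      (∑ j, ∫ x in Ω, A j x ((u n).fn x) ((u n).grad x) * v.der j x) + ∫ x in Ω, φ n x * v.fn x =
        B (u n) v + ∫ x in Ω, f n x * v.fn x) {δ : ℝ} (hδ : 0 < δ) :
    ∃ r > 0, ∀ᶠ n in atTop, ∫ x in Ω, ∑ j, A j x ((u n).fn x) ((u n).grad x) *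
      ((u n).der j x - u'.der j x) * cutoff (((u n).fn x - u'.fn x) / r) ≤ δ := by
  obtain ⟨S, hS, hS0, hS2⟩ := exists_primitive_cutoff
  have hSc : Continuous S := continuous_iff_continuousAt.2 fun t => (hS t).continuousAt
  have hM0 : 0 ≤ M := (integral_nonneg fun x => abs_nonneg _).trans (hM 0)
  -- The test function is `r S((u_n - u') / r)`, whose gradient is that of `u_n - u'` times the
  -- cutoff and whose size is at most `2 r`. With this `r` the lower order term contributes at most
  -- `δ / 2`; the terms with `B` and `f` tend to zero and supply the other half.
  obtain ⟨r, hr⟩ : ∃ r, r = δ / (4 * (M + 1)) := ⟨_, rfl⟩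
  have hr0 : 0 < r := by rw [hr]; positivity
  have hrM : 2 * r * M ≤ δ / 2 := by
    have : r * (4 * (M + 1)) = δ := by rw [hr]; field_simp
    nlinarith
  have hcut : ∀ s, |cutoff (s / r)| ≤ 1 := fun s => by
    rw [abs_of_nonneg (cutoff_mem _).1]
    exact (cutoff_mem _).2
  have hG : ∀ t, HasDerivAt (fun t => r * S (t / r)) (cutoff (t / r)) t := fun t => by
    have h1 := ((hS (t / r)).comp t ((hasDerivAt_id t).div_const r)).const_mul r
    refine h1.congr_deriv ?_
    field_simp
  choose w hwf hwd using fun n => exists_comp (u n - u') hG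
    (continuous_cutoff.comp (by fun_prop)) hcut (by simp [hS0])
  have hwM : ∀ n, ∀ᵐ x ∂(leb Ω), |(w n).fn x| ≤ 2 * r := fun n => by
    filter_upwards [hwf n] with x hx
    rw [hx, abs_mul, abs_of_pos hr0, mul_comm]
    exact mul_le_mul_of_nonneg_right (hS2 _) hr0.le
  have hwR : ∀ n, ‖w n‖ ≤ 1 * R + 1 * ‖u'‖ := fun n => by
    refine (norm_le_of_der_le (u := u n) (v := u') zero_le_one zero_le_one fun j => ?_).trans
      (by gcongr; exact hR n)
    filter_upwards [hwd n j, der_sub_ae (u n) u' j] with x h1 h2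
    rw [h1, abs_mul, one_mul, one_mul, h2]
    exact (mul_le_of_le_one_left (abs_nonneg _) (hcut _)).trans (abs_sub _ _)
  have hwae : ∀ᵐ x ∂(leb Ω), Tendsto (fun n => (w n).fn x) atTop (𝓝 0) := by
    filter_upwards [ae_all_iff.2 hwf, ae_all_iff.2 fun n => fn_sub_ae (u n) u', hae] with x h1 h2 h3
    simp only [h1, h2]
    have h4 : Continuous fun t => r * S (t / r) := by fun_prop
    have h5 := (h4.tendsto 0).comp (tendsto_sub_nhds_zero_iff.2 h3)
    simp only [zero_div, hS0, mul_zero] at h5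
    exact h5
  have hweak0 : WeakConv w 0 := by
    refine weakConv_of_ae hwR hwM ?_
    filter_upwards [hwae, fn_zero_ae (Ω := Ω) (p := p)] with x h1 h2
    rwa [h2]
  have hB := tendsto_apply_zero hB2 hweak hweak0
  have hfw := tendsto_integral_bdd_mul (fun n => Lp.aestronglyMeasurable (w n).fn) hwM hwae hf hf'
    hlim
  simp only [zero_mul, integral_zero] at hfw
  have hsum := hB.add hfw
  rw [add_zero] at hsum
  refine ⟨r, hr0, ?_⟩
  filter_upwards [hsum.eventually (gt_mem_nhds (half_pos hδ))] with n hn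
  have e1 := heq n (w n) (memLp_top_of_abs_le (hwM n))
  have e2 : ∫ x in Ω, ∑ j, A j x ((u n).fn x) ((u n).grad x) *
      ((u n).der j x - u'.der j x) * cutoff (((u n).fn x - u'.fn x) / r) =
      ∑ j, ∫ x in Ω, A j x ((u n).fn x) ((u n).grad x) * (w n).der j x := by
    rw [← integral_finsetSum _ fun j _ => integrable_flux_mul_der hA (u n) (u n) (w n) j]
    refine integral_congr_ae ?_
    filter_upwards [ae_all_iff.2 (hwd n), ae_all_iff.2 fun j => der_sub_ae (u n) u' j,
      fn_sub_ae (u n) u'] with x h1 h2 h3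
    refine Finset.sum_congr rfl fun j _ => ?_
    rw [h1, h2, h3]
    ring
  have e3 : |∫ x in Ω, φ n x * (w n).fn x| ≤ 2 * r * M := by
    have h1 : |∫ x in Ω, φ n x * (w n).fn x| ≤ ∫ x in Ω, 2 * r * |φ n x| := by
      refine norm_integral_le_of_norm_le (f := fun x => φ n x * (w n).fn x)
        (g := fun x => 2 * r * |φ n x|) ((hφ n).abs.const_mul _) ?_
      filter_upwards [hwM n] with x hx
      rw [norm_mul, mul_comm]
      exact mul_le_mul_of_nonneg_right hx (norm_nonneg _)
    rw [integral_const_mul] at h1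
    exact h1.trans (mul_le_mul_of_nonneg_left (hM n) (by positivity))
  have e4 : ∫ x in Ω, f n x * (w n).fn x = ∫ x in Ω, (w n).fn x * f n x := by
    simp only [mul_comm]
  rw [e2]
  linarith [(abs_le.1 e3).1]

lemma eLpNorm_one_le_ofReal {α : Type*} [MeasurableSpace α] {μ : Measure α} {g : α → ℝ} {M : ℝ}
    (hg : Integrable g μ) (hM : ∫ x, |g x| ∂μ ≤ M) : eLpNorm g 1 μ ≤ ENNReal.ofReal M := by
  rw [eLpNorm_one_eq_lintegral_enorm, ← ofReal_integral_norm_eq_lintegral_enorm hg]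
  exact ENNReal.ofReal_le_ofReal hM

/-- Stability of weak solutions under perturbations of the lower order term and of the right hand
side, provided that the solutions stay bounded and the lower order terms stay bounded in `L^1`. -/
theorem exists_isWeakSolution_of_approx (hA : FluxCond Ω p A ν₀ ν η) {ζ : ℝ → ℝ} (hζm : Monotone ζ)
    (hζ0 : ∀ t, 0 ≤ ζ t) {c : Eu N → ℝ} (hc : Integrable c (leb Ω)) (hc0 : ∀ᵐ x ∂(leb Ω), 0 ≤ c x)
    (hB2 : CondP2 B) {Φ : Eu N → ℝ → (Fin N → ℝ) → ℝ} {Ψ : ℕ → Eu N → ℝ → (Fin N → ℝ) → ℝ}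
    (hsign : ∀ n, ∀ᵐ x ∂(leb Ω), ∀ t ξ, 0 ≤ Ψ n x t ξ * t)
    (hgrowth : ∀ n, ∀ᵐ x ∂(leb Ω), ∀ t ξ, |Ψ n x t ξ| ≤ ζ |t| * (∑ j, |ξ j| ^ p j + c x))
    (hΨ : ∀ᵐ x ∂(leb Ω), ∀ t ξ, Tendsto (fun z : ℕ × ℝ × (Fin N → ℝ) => Ψ z.1 x z.2.1 z.2.2)
      (atTop ×ˢ 𝓝 (t, ξ)) (𝓝 (Φ x t ξ)))
    {f : ℕ → Eu N → ℝ} {f' : Eu N → ℝ} (hf : ∀ n, Integrable (f n) (leb Ω))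
    (hf' : Integrable f' (leb Ω)) (hlim : Tendsto (fun n => eLpNorm (f n - f') 1 (leb Ω)) atTop (𝓝 0))
    {u : ℕ → W0 Ω p} {R M : ℝ} (hR : ∀ n, ‖u n‖ ≤ R)
    (hsol : ∀ n, IsWeakSolution A (Ψ n) B (f n) (u n))
    (hM : ∀ n, ∫ x in Ω, |Ψ n x ((u n).fn x) ((u n).grad x)| ≤ M) :
    ∃ u', IsWeakSolution A Φ B f' u' := by
  obtain ⟨u', σ₁, hσ₁, hw₁⟩ := exists_weakConv_subseq hR
  obtain ⟨σ₂, hσ₂, hae₂⟩ := exists_subseq_ae_fn (fun n => hR (σ₁ n)) hw₁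
  have hτ := hσ₁.comp hσ₂
  -- Three successive extractions: weak convergence, then convergence of the functions almost
  -- everywhere, and here that of the gradients.
  obtain ⟨σ₃, hσ₃, hae⟩ := exists_subseq_ae_grad hA (fun n => hR ((σ₁ ∘ σ₂) n))
    (WeakConv.comp hw₁ hσ₂) fun δ hδ => exists_cutoff_integral_le hB2
      (fun n => hR ((σ₁ ∘ σ₂) n)) (WeakConv.comp hw₁ hσ₂) hae₂ hA
      (φ := fun n x => Ψ ((σ₁ ∘ σ₂) n) x ((u ((σ₁ ∘ σ₂) n)).fn x) ((u ((σ₁ ∘ σ₂) n)).grad x))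
      (fun n => (hsol _).integrable_lower) (fun n => hM _) (fun n => hf ((σ₁ ∘ σ₂) n)) hf'
      (hlim.comp hτ.tendsto_atTop) (fun n => (hsol _).weak_form) hδ
  obtain ⟨σ, hσeq⟩ : ∃ σ, σ = fun n => σ₁ (σ₂ (σ₃ n)) := ⟨_, rfl⟩
  have hσ : StrictMono σ := by
    rw [hσeq]
    exact hτ.comp hσ₃
  have hweak : WeakConv (fun n => u (σ n)) u' := by
    rw [hσeq]
    exact WeakConv.comp (WeakConv.comp hw₁ hσ₂) hσ₃
  have hae' : ∀ᵐ x ∂(leb Ω), Tendsto (fun n => (u (σ n)).fn x) atTop (𝓝 (u'.fn x)) ∧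
      Tendsto (fun n => (u (σ n)).grad x) atTop (𝓝 (u'.grad x)) := by
    rw [hσeq]
    exact hae
  have hlow : ∀ᵐ x ∂(leb Ω), Tendsto (fun n => Ψ (σ n) x ((u (σ n)).fn x) ((u (σ n)).grad x)) atTop
      (𝓝 (Φ x (u'.fn x) (u'.grad x))) := by
    filter_upwards [hae', hΨ] with x h1 h2
    exact (h2 _ _).comp (hσ.tendsto_atTop.prodMk (h1.1.prodMk_nhds h1.2))
  -- Fatou's lemma: the limit lower order term is integrable, although convergence in `L^1` is not
  -- claimed.
  have hint : Integrable (fun x => Φ x (u'.fn x) (u'.grad x)) (leb Ω) :=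
    memLp_one_iff_integrable.1 (memLp_of_ae_tendsto (ENNReal.ofReal_ne_top (r := M))
      (fun n => (hsol (σ n)).integrable_lower.1)
      (fun n => eLpNorm_one_le_ofReal (hsol (σ n)).integrable_lower (hM (σ n))) hlow).1
  have hdata : LimitData ν₀ ζ c (fun n => u (σ n)) u'
      (fun n j x => A j x ((u (σ n)).fn x) ((u (σ n)).grad x))
      (fun j x => A j x (u'.fn x) (u'.grad x))
      (fun n x => Ψ (σ n) x ((u (σ n)).fn x) ((u (σ n)).grad x))
      (fun x => Φ x (u'.fn x) (u'.grad x)) (fun n => B (u (σ n))) (B u') (fun n => f (σ n)) f' :=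
    { pos := hA.pos
      mono := hζm
      nonneg := hζ0
      int_c := hc
      nonneg_c := hc0
      norm_le := ⟨R, fun n => hR _⟩
      ae := hae'.mono fun x hx => ⟨hx.1, fun j => tendsto_pi_nhds.1 hx.2 j⟩
      aesm := fun n j => (memLp_flux hA _ _ j).1
      bdd := fun j => by
        obtain ⟨K, hK, hle⟩ := exists_eLpNorm_flux_le hA R j
        exact ⟨K, hK, fun n => hle _ _ (hR _) (hR _)⟩
      ae_flux := by
        filter_upwards [hae', ae_all_iff.2 fun j => (hA.cara j).2] with x h1 h2 j
        exact ((h2 j).tendsto (u'.fn x, u'.grad x)).comp (h1.1.prodMk_nhds h1.2)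
      coer := fun n => hA.coer.mono fun x hx => hx _ _
      int_lower := fun n => (hsol (σ n)).integrable_lower
      int_lower' := hint
      ae_lower := hlow
      sign := fun n => (hsign (σ n)).mono fun x hx => hx _ _
      growth := fun n => (hgrowth (σ n)).mono fun x hx => hx _ _
      lim := fun w w' hw => hB2 _ _ _ _ hweak hw
      int_f := fun n => hf _
      int_f' := hf'
      lim_f := hlim.comp hσ.tendsto_atTop
      eq := fun n => (hsol (σ n)).weak_form }
  exact ⟨u', hint, fun v j _ => integrable_flux_mul_der hA u' u' v j, fun v hv => hdata.limit_eq hv⟩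

end W0

end AnisoElliptic

end

/-! ### Existence for bounded data, then for integrable data -/

noncomputable section

set_option linter.unusedSectionVars false

namespace AnisoElliptic

lemma mul_arctan_nonneg {a t : ℝ} (h : 0 ≤ a * t) : 0 ≤ a * Real.arctan t := by
  rcases lt_trichotomy t 0 with ht | rfl | ht
  · exact mul_nonneg_of_nonpos_of_nonpos (nonpos_of_mul_nonneg_left h ht)
      (Real.arctan_lt_zero.2 ht).le
  · simp
  · exact mul_nonneg (nonneg_of_mul_nonneg_left h ht) (Real.arctan_pos.2 ht).le

lemma arctan_le_abs_arctan {s t : ℝ} (h : s ≤ |t|) : Real.arctan s ≤ |Real.arctan t| := by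
  rcases le_abs.1 h with h | h
  · exact (Real.arctan_strictMono.monotone h).trans (le_abs_self _)
  · refine (Real.arctan_strictMono.monotone h).trans ?_
    rw [Real.arctan_neg]
    exact neg_le_abs _

lemma abs_arctan_le_two (t : ℝ) : |Real.arctan t| ≤ 2 := by
  have := Real.pi_le_four
  exact abs_le.2 ⟨by linarith [Real.neg_pi_div_two_lt_arctan t],
    by linarith [Real.arctan_lt_pi_div_two t]⟩

/-- Bounded approximation of the lower order term. -/
def tame {N : ℕ} (Φ : Eu N → ℝ → (Fin N → ℝ) → ℝ) (m : ℕ) (x : Eu N) (t : ℝ) (ξ : Fin N → ℝ) : ℝ :=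
  Φ x t ξ / (1 + |Φ x t ξ| / (m + 1))

section Tame

variable {N : ℕ} {Ω : Set (Eu N)} {Φ : Eu N → ℝ → (Fin N → ℝ) → ℝ}

lemma tame_denom (Φ : Eu N → ℝ → (Fin N → ℝ) → ℝ) (m : ℕ) (x : Eu N) (t : ℝ) (ξ : Fin N → ℝ) :
    1 ≤ 1 + |Φ x t ξ| / ((m : ℝ) + 1) :=
  le_add_of_nonneg_right (by positivity)

lemma abs_tame_le (m : ℕ) (x : Eu N) (t : ℝ) (ξ : Fin N → ℝ) : |tame Φ m x t ξ| ≤ |Φ x t ξ| := by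
  have h := tame_denom Φ m x t ξ
  rw [tame, abs_div, abs_of_pos (zero_lt_one.trans_le h)]
  exact div_le_self (abs_nonneg _) h

lemma abs_tame_le_nat (m : ℕ) (x : Eu N) (t : ℝ) (ξ : Fin N → ℝ) : |tame Φ m x t ξ| ≤ m + 1 := by
  have h := zero_lt_one.trans_le (tame_denom Φ m x t ξ)
  have hm : (0 : ℝ) < m + 1 := by positivity
  rw [tame, abs_div, abs_of_pos h, div_le_iff₀ h, mul_add, mul_div_cancel₀ _ hm.ne']
  linarith

lemma tame_mul_nonneg {m : ℕ} {x : Eu N} {t : ℝ} {ξ : Fin N → ℝ} (h : 0 ≤ Φ x t ξ * t) :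
    0 ≤ tame Φ m x t ξ * t := by
  rw [tame, div_mul_eq_mul_div]
  exact div_nonneg h (zero_le_one.trans (tame_denom Φ m x t ξ))

lemma IsCaratheodory.tame (hΦ : IsCaratheodory Ω Φ) (m : ℕ) : IsCaratheodory Ω (tame Φ m) := by
  refine ⟨fun t ξ => ?_, ?_⟩
  · have h := (hΦ.1 t ξ).norm
    exact (hΦ.1 t ξ).div ((h.div_const _).const_add 1)
  · filter_upwards [hΦ.2] with x hx
    exact hx.div (continuous_const.add (hx.abs.div_const _)) fun z =>
      (zero_lt_one.trans_le (tame_denom Φ m x z.1 z.2)).ne'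

lemma IsCaratheodory.sub_fun (hΦ : IsCaratheodory Ω Φ) {f : Eu N → ℝ}
    (hf : AEMeasurable f (leb Ω)) : IsCaratheodory Ω fun x t ξ => Φ x t ξ - f x :=
  ⟨fun t ξ => (hΦ.1 t ξ).sub hf, hΦ.2.mono fun _ hx => hx.sub continuous_const⟩

lemma IsCaratheodory.tendsto_tame (hΦ : IsCaratheodory Ω Φ) : ∀ᵐ x ∂(leb Ω), ∀ t ξ,
    Tendsto (fun z : ℕ × ℝ × (Fin N → ℝ) => AnisoElliptic.tame Φ z.1 x z.2.1 z.2.2)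
      (atTop ×ˢ 𝓝 (t, ξ)) (𝓝 (Φ x t ξ)) := by
  filter_upwards [hΦ.2] with x hx t ξ
  have h1 : Tendsto (fun z : ℕ × ℝ × (Fin N → ℝ) => Φ x z.2.1 z.2.2) (atTop ×ˢ 𝓝 (t, ξ))
      (𝓝 (Φ x t ξ)) := (hx.tendsto (t, ξ)).comp tendsto_snd
  have h2 : Tendsto (fun z : ℕ × ℝ × (Fin N → ℝ) => 1 / ((z.1 : ℝ) + 1)) (atTop ×ˢ 𝓝 (t, ξ))
      (𝓝 0) := tendsto_one_div_add_atTop_nhds_zero_nat.comp tendsto_fst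
  have h3 := h1.div ((h1.abs.mul h2).const_add 1) (by simp)
  rw [mul_zero, add_zero, div_one] at h3
  refine h3.congr fun z => ?_
  simp only [AnisoElliptic.tame, Pi.div_apply, mul_one_div]

end Tame

namespace W0

variable {N : ℕ} {Ω : Set (Eu N)} {p : Fin N → ℝ} [hp : Fact (∀ j, 1 < p j)]
  [hN : Fact (2 ≤ N)] [hpN : Fact (hmean p < N)] [NeZero N]
  [hfin : IsFiniteMeasure (leb Ω)]
  {A : Fin N → Eu N → ℝ → (Fin N → ℝ) → ℝ} {ν₀ ν : ℝ} {η : Fin N → Eu N → ℝ}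
  {B : W0 Ω p → StrongDual ℝ (W0 Ω p)} {Φ : Eu N → ℝ → (Fin N → ℝ) → ℝ} {ζ : ℝ → ℝ} {c : Eu N → ℝ}

lemma energy_le_of_der_le {u w : W0 Ω p} (h : ∀ j, ∀ᵐ x ∂(leb Ω), |w.der j x| ≤ |u.der j x|) :
    w.energy ≤ u.energy := by
  refine Finset.sum_le_sum fun j _ => ?_
  refine integral_mono_ae (integrable_abs_rpow (p_pos p j) (Lp.memLp _))
    (integrable_abs_rpow (p_pos p j) (Lp.memLp _)) ?_
  filter_upwards [h j] with x hx
  exact Real.rpow_le_rpow (abs_nonneg _) hx (p_pos p j).le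

/-- Control of the lower order term in `L^1` by its pairing with a test function. -/
lemma integral_abs_lower_le (hζm : Monotone ζ) (hζ0 : ∀ t, 0 ≤ ζ t) (hc : Integrable c (leb Ω))
    (hc0 : ∀ᵐ x ∂(leb Ω), 0 ≤ c x) {φ : Eu N → ℝ} {u w : W0 Ω p} (hφ : Integrable φ (leb Ω))
    (hφw : Integrable (fun x => φ x * w.fn x) (leb Ω))
    (hgrowth : ∀ᵐ x ∂(leb Ω), |φ x| ≤ ζ |u.fn x| * (∑ j, |u.grad x j| ^ p j + c x))
    (hsign : ∀ᵐ x ∂(leb Ω), 0 ≤ φ x * w.fn x)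
    (hw : ∀ᵐ x ∂(leb Ω), 1 ≤ |u.fn x| → 1 / 2 ≤ |w.fn x|) :
    ∫ x in Ω, |φ x| ≤
      ζ 1 * (u.energy + ∫ x in Ω, c x) + 2 * ∫ x in Ω, φ x * w.fn x := by
  have hX := integrable_sum_der u
  have h1 : Integrable (fun x => ζ 1 * (∑ j, |u.grad x j| ^ p j + c x)) (leb Ω) :=
    (hX.add hc).const_mul _
  have h2 : Integrable (fun x => 2 * (φ x * w.fn x)) (leb Ω) := hφw.const_mul 2
  rw [← integral_sum_der, ← integral_add hX hc, ← integral_const_mul, ← integral_const_mul,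
    ← integral_add h1 h2]
  refine integral_mono_ae hφ.abs (h1.add h2) ?_
  filter_upwards [hgrowth, hsign, hw, hc0] with x h1 h2 h3 h4
  have hX0 := sum_abs_rpow_nonneg p (u.grad x)
  show |φ x| ≤ ζ 1 * (∑ j, |u.grad x j| ^ p j + c x) + 2 * (φ x * w.fn x)
  -- Where `|u| ≥ 1` the pairing with `w` controls `|φ| / 2`; elsewhere the growth condition bounds
  -- `|φ|` by `ζ 1` times the energy density plus `c`.
  rcases le_or_gt 1 |u.fn x| with h | h
  · have h5 : φ x * w.fn x = |φ x| * |w.fn x| := by rw [← abs_mul, abs_of_nonneg h2]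
    have h6 := mul_le_mul_of_nonneg_left (h3 h) (abs_nonneg (φ x))
    have h7 := mul_nonneg (hζ0 1) (add_nonneg hX0 h4)
    linarith
  · have := mul_le_mul_of_nonneg_right (hζm h.le) (add_nonneg hX0 h4)
    linarith

/-- Existence of weak solutions for bounded right hand sides. -/
theorem exists_isWeakSolution_of_bounded (hA : FluxCond Ω p A ν₀ ν η) (hmono : Monotone p)
    (hΦ : IsCaratheodory Ω Φ) (hζm : Monotone ζ) (hζ0 : ∀ t, 0 ≤ ζ t) (hc : Integrable c (leb Ω))
    (hc0 : ∀ᵐ x ∂(leb Ω), 0 ≤ c x) (hsign : ∀ᵐ x ∂(leb Ω), ∀ t ξ, 0 ≤ Φ x t ξ * t)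
    (hgrowth : ∀ᵐ x ∂(leb Ω), ∀ t ξ, |Φ x t ξ| ≤ ζ |t| * (∑ j, |ξ j| ^ p j + c x))
    (hB1 : CondP1 B) (hB2 : CondP2 B) {f : Eu N → ℝ} {K : ℝ} (hf : Integrable f (leb Ω))
    (hK : ∀ᵐ x ∂(leb Ω), |f x| ≤ K) : ∃ u, IsWeakSolution A Φ B f u := by
  obtain ⟨C, hC, hCle⟩ := poincare Ω p
  obtain ⟨R, hR0, hR⟩ := exists_bound_of_condP1 hB1 hmono hA.pos (M := |K| * C) (by positivity)
  obtain ⟨Q, hQ⟩ := exists_abs_apply_le hB2 R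
  -- The datum `f` is moved into the bounded lower order term. At this level no sign condition is
  -- required, and the bound may depend on `m`.
  choose u hu using fun m : ℕ => exists_form_eq_zero hA hmono
    ((hΦ.tame m).sub_fun hf.1.aemeasurable) (K := m + 1 + K) (by
      filter_upwards [hK] with x hx t ξ
      exact (abs_sub _ _).trans (add_le_add (abs_tame_le_nat m x t ξ) hx)) hB1 hB2
  have hfv : ∀ v : W0 Ω p, Integrable (fun x => f x * v.fn x) (leb Ω) := fun v =>
    (L1.integrable_coeFn v.fn).bdd_mul hf.1 hK
  have hmeas : ∀ m, AEStronglyMeasurable (fun x => tame Φ m x ((u m).fn x) ((u m).grad x)) (leb Ω) :=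
    fun m => aestronglyMeasurable_comp (hΦ.tame m) (Lp.aestronglyMeasurable _) _
  have hΨv : ∀ m (v : W0 Ω p),
      Integrable (fun x => tame Φ m x ((u m).fn x) ((u m).grad x) * v.fn x) (leb Ω) := fun m v =>
    (L1.integrable_coeFn v.fn).bdd_mul (hmeas m)
      (Eventually.of_forall fun x => abs_tame_le_nat m x _ _)
  have hΨ : ∀ m, Integrable (fun x => tame Φ m x ((u m).fn x) ((u m).grad x)) (leb Ω) := fun m =>
    Integrable.of_bound (hmeas m) ((m : ℝ) + 1)
      (Eventually.of_forall fun x => abs_tame_le_nat m x _ _)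
  have heq : ∀ m (v : W0 Ω p),
      (∑ j, ∫ x in Ω, A j x ((u m).fn x) ((u m).grad x) * v.der j x) +
        ∫ x in Ω, tame Φ m x ((u m).fn x) ((u m).grad x) * v.fn x =
      B (u m) v + ∫ x in Ω, f x * v.fn x := fun m v => by
    have h1 := hu m v
    unfold form at h1
    simp only [sub_mul] at h1
    rw [integral_sub (hΨv m v) (hfv v)] at h1
    linarith
  -- With `f` separated again, the sign condition makes the pairing of the tamed term with `u m`
  -- nonnegative, so the energy estimate does not depend on `m`.
  have hpair : ∀ m, 0 ≤ ∫ x in Ω, tame Φ m x ((u m).fn x) ((u m).grad x) * (u m).fn x := fun m =>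
    integral_nonneg_of_ae (hsign.mono fun x hx => tame_mul_nonneg (hx _ _))
  have hfu : ∀ m, |∫ x in Ω, f x * (u m).fn x| ≤ |K| * C * ‖u m‖ := fun m => by
    refine (abs_integral_mul_fn_le (hK.mono fun x hx => hx.trans (le_abs_self K)) _).trans ?_
    rw [mul_assoc]
    exact mul_le_mul_of_nonneg_left (hCle _) (abs_nonneg _)
  have huR : ∀ m, ‖u m‖ ≤ R := fun m => by
    refine hR (u m) (u m) le_rfl ?_
    have h1 := energy_le_integral_flux hA (u m)
    have h2 := (abs_le.1 (hfu m)).2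
    have h3 : 0 ≤ |K| * C := by positivity
    linarith [heq m (u m), hpair m]
  refine exists_isWeakSolution_of_approx hA hζm hζ0 hc hc0 hB2 (Ψ := tame Φ) (f := fun _ => f)
    (M := ζ 1 * (∑ j, R ^ p j + ∫ x in Ω, c x) + 2 * (Q + |K| * C * R))
    (fun m => hsign.mono fun x hx t ξ => tame_mul_nonneg (hx t ξ))
    (fun m => hgrowth.mono fun x hx t ξ => (abs_tame_le m x t ξ).trans (hx t ξ))
    hΦ.tendsto_tame (fun _ => hf) hf (by simp) huR
    (fun m => ⟨hΨ m, fun v j _ => integrable_flux_mul_der hA _ _ v j, fun v _ => heq m v⟩)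
    fun m => ?_
  -- The equation tested with `u m` bounds its pairing with the tamed term, because the flux
  -- contribution is nonnegative; this is the `L^1` bound required for the limit.
  refine (integral_abs_lower_le (w := u m) hζm hζ0 hc hc0 (hΨ m) (hΨv m (u m))
    (hgrowth.mono fun x hx => (abs_tame_le m x _ _).trans (hx _ _))
    (hsign.mono fun x hx => tame_mul_nonneg (hx _ _))
    (Eventually.of_forall fun x hx => by linarith)).trans ?_
  have h1 := energy_le (huR m)
  have h2 := energy_le_integral_flux hA (u m)
  have h3 := mul_nonneg hA.pos.le (energy_nonneg (u m))
  have h4 := (abs_le.1 (hfu m)).2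
  have h5 := (abs_le.1 (hQ (u m) (u m) (huR m) (huR m))).2
  have h6 : |K| * C * ‖u m‖ ≤ |K| * C * R := mul_le_mul_of_nonneg_left (huR m) (by positivity)
  have h7 := mul_le_mul_of_nonneg_left (add_le_add_left h1 (∫ x in Ω, c x)) (hζ0 1)
  linarith [heq m (u m)]

/-- The arctangent of a weak solution as a test function. -/
lemma exists_arctan (u : W0 Ω p) : ∃ w : W0 Ω p,
    (w.fn =ᵐ[leb Ω] fun x => Real.arctan (u.fn x)) ∧
    (∀ j, w.der j =ᵐ[leb Ω] fun x => 1 / (1 + u.fn x ^ 2) * u.der j x) ∧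
    (∀ᵐ x ∂(leb Ω), |w.fn x| ≤ 2) ∧ w.energy ≤ u.energy ∧ ‖w‖ ≤ ‖u‖ := by
  have hL : ∀ t : ℝ, |1 / (1 + t ^ 2)| ≤ 1 := fun t => by
    rw [abs_of_nonneg (by positivity), div_le_one (by positivity)]
    linarith [sq_nonneg t]
  obtain ⟨w, hw, hwd⟩ := exists_comp u Real.hasDerivAt_arctan
    (continuous_const.div (by fun_prop) fun t => (by positivity : (1 + t ^ 2 : ℝ) ≠ 0)) hL
    Real.arctan_zero
  have hle : ∀ j, ∀ᵐ x ∂(leb Ω), |w.der j x| ≤ |u.der j x| := fun j => by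
    filter_upwards [hwd j] with x hx
    rw [hx, abs_mul]
    exact mul_le_of_le_one_left (abs_nonneg _) (hL _)
  refine ⟨w, hw, hwd, hw.mono fun x hx => hx ▸ abs_arctan_le_two _, energy_le_of_der_le hle, ?_⟩
  have := norm_le_of_der_le (w := w) (u := u) (v := u) zero_le_one le_rfl fun j =>
    (hle j).mono fun x hx => by linarith
  linarith

/-- Existence of weak solutions for integrable right hand sides. -/
theorem exists_isWeakSolution (hA : FluxCond Ω p A ν₀ ν η) (hmono : Monotone p)
    (hΦ : IsCaratheodory Ω Φ) (hζm : Monotone ζ) (hζ0 : ∀ t, 0 ≤ ζ t) (hc : Integrable c (leb Ω))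
    (hc0 : ∀ᵐ x ∂(leb Ω), 0 ≤ c x) (hsign : ∀ᵐ x ∂(leb Ω), ∀ t ξ, 0 ≤ Φ x t ξ * t)
    (hgrowth : ∀ᵐ x ∂(leb Ω), ∀ t ξ, |Φ x t ξ| ≤ ζ |t| * (∑ j, |ξ j| ^ p j + c x))
    {τ γ : ℝ} (hτ : 0 < τ) (hγ : 0 < γ)
    (hlower : ∀ᵐ x ∂(leb Ω), ∀ (ξ : Fin N → ℝ) (t : ℝ), τ ≤ |t| →
      γ * ∑ j, |ξ j| ^ p j ≤ |Φ x t ξ|)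
    (hB1 : CondP1 B) (hB2 : CondP2 B) {f : Eu N → ℝ} (hf : Integrable f (leb Ω)) :
    ∃ u, IsWeakSolution A Φ B f u := by
  obtain ⟨g, hg⟩ : ∃ g : ℕ → Eu N → ℝ, g = fun (n : ℕ) x => max (-(n : ℝ)) (min (n : ℝ) (f x)) := ⟨_, rfl⟩
  have hgn : ∀ n x, |g n x| ≤ n := fun n x => by
    rw [hg]
    exact abs_le.2 ⟨le_max_left _ _, max_le (by linarith [Nat.cast_nonneg (α := ℝ) n])
      (min_le_left _ _)⟩
  have hgf : ∀ n x, |g n x| ≤ |f x| := fun n x => by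
    have hn : (0 : ℝ) ≤ n := Nat.cast_nonneg n
    rw [hg]
    refine abs_le.2 ⟨le_max_of_le_right (le_min ?_ (neg_abs_le _)), max_le ?_
      ((min_le_right _ _).trans (le_abs_self _))⟩
    · linarith [abs_nonneg (f x)]
    · linarith [abs_nonneg (f x)]
  have hgm : ∀ n, AEStronglyMeasurable (g n) (leb Ω) := fun n => by
    rw [hg]
    have : Continuous fun t : ℝ => max (-(n : ℝ)) (min n t) := by fun_prop
    exact this.comp_aestronglyMeasurable hf.1
  have hgi : ∀ n, Integrable (g n) (leb Ω) := fun n =>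
    hf.mono (hgm n) (Eventually.of_forall (hgf n))
  have hglim : Tendsto (fun n => eLpNorm (g n - f) 1 (leb Ω)) atTop (𝓝 0) := by
    refine (tendsto_eLpNorm_sub_of_dominated le_rfl ENNReal.one_ne_top hgm
      (memLp_one_iff_integrable.2 hf) (fun n => Eventually.of_forall (hgf n))
      (Eventually.of_forall fun x => ?_)).2
    refine tendsto_const_nhds.congr' ?_
    filter_upwards [eventually_ge_atTop ⌈|f x|⌉₊] with n hn
    have h1 : |f x| ≤ n := (Nat.le_ceil _).trans (Nat.cast_le.2 hn)
    rw [hg]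
    beta_reduce
    rw [min_eq_right ((le_abs_self _).trans h1), max_eq_right (by linarith [neg_abs_le (f x)])]
  choose u hu using fun n => exists_isWeakSolution_of_bounded hA hmono hΦ hζm hζ0 hc hc0 hsign
    hgrowth hB1 hB2 (hgi n) (Eventually.of_forall (hgn n))
  -- The solutions `u n` may be unbounded, and `f` is only integrable, so an estimate uniform in `n`
  -- must use bounded test functions. The arctangent is bounded, keeps the sign of `u n`, and does
  -- not increase the energy.
  choose w hw hwd hw2 hwE hwn using fun n => exists_arctan (u n)
  have hwtop : ∀ n, MemLp (w n).fn ⊤ (leb Ω) := fun n => memLp_top_of_abs_le (hw2 n)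
  have hF0 : 0 ≤ ∫ x in Ω, |f x| := integral_nonneg fun x => abs_nonneg _
  have hgw : ∀ n, |∫ x in Ω, g n x * (w n).fn x| ≤ 2 * ∫ x in Ω, |f x| := fun n => by
    rw [← integral_const_mul]
    refine norm_integral_le_of_norm_le (f := fun x => g n x * (w n).fn x)
      (g := fun x => 2 * |f x|) (hf.abs.const_mul 2) ?_
    filter_upwards [hw2 n] with x hx
    rw [norm_mul, mul_comm]
    exact mul_le_mul hx (hgf n x) (abs_nonneg _) zero_le_two
  have hΦw : ∀ n, Integrable (fun x => Φ x ((u n).fn x) ((u n).grad x) * (w n).fn x) (leb Ω) :=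
    fun n => integrable_mul_fn_of_abs_le (hu n).integrable_lower (hw2 n)
  have hsign' : ∀ n, ∀ᵐ x ∂(leb Ω), 0 ≤ Φ x ((u n).fn x) ((u n).grad x) * (w n).fn x := fun n => by
    filter_upwards [hsign, hw n] with x h1 h2
    rw [h2]
    exact mul_arctan_nonneg (h1 _ _)
  -- Where `|u| < τ`, the derivative of the arctangent is at least `1 / (1 + τ^2)` and the flux
  -- controls the energy density. Where `|u| ≥ τ`, the lower bound on `Φ` does, with the factor
  -- `arctan τ`.
  obtain ⟨κ, hκ⟩ : ∃ κ, κ = min (ν₀ / (1 + τ ^ 2)) (γ * Real.arctan τ) := ⟨_, rfl⟩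
  have hκ0 : 0 < κ := by
    rw [hκ]
    exact lt_min (div_pos hA.pos (by positivity)) (mul_pos hγ (Real.arctan_pos.2 hτ))
  have hflux0 : ∀ n, ∀ᵐ x ∂(leb Ω), ν₀ * (∑ j, |(u n).grad x j| ^ p j) / (1 + (u n).fn x ^ 2) ≤
      ∑ j, A j x ((u n).fn x) ((u n).grad x) * (w n).der j x := fun n => by
    filter_upwards [hA.coer, ae_all_iff.2 (hwd n)] with x h1 h2
    have h3 : ∑ j, A j x ((u n).fn x) ((u n).grad x) * (w n).der j x =
        (∑ j, A j x ((u n).fn x) ((u n).grad x) * (u n).grad x j) / (1 + (u n).fn x ^ 2) := by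
      rw [Finset.sum_div]
      refine Finset.sum_congr rfl fun j _ => ?_
      rw [h2 j]
      show _ * (1 / _ * (u n).der j x) = _ * (u n).der j x / _
      ring
    rw [h3]
    exact div_le_div_of_nonneg_right (h1 _ _) (by positivity)
  have hfluxi : ∀ n, Integrable (fun x =>
      ∑ j, A j x ((u n).fn x) ((u n).grad x) * (w n).der j x) (leb Ω) := fun n =>
    integrable_finsetSum _ fun j _ => integrable_flux_mul_der hA _ _ (w n) j
  have hfluxsum : ∀ n, ∑ j, ∫ x in Ω, A j x ((u n).fn x) ((u n).grad x) * (w n).der j x =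
      ∫ x in Ω, ∑ j, A j x ((u n).fn x) ((u n).grad x) * (w n).der j x := fun n =>
    (integral_finsetSum _ fun j _ => integrable_flux_mul_der hA _ _ (w n) j).symm
  have hcoer : ∀ n, κ * (u n).energy ≤
      (∑ j, ∫ x in Ω, A j x ((u n).fn x) ((u n).grad x) * (w n).der j x) +
      ∫ x in Ω, Φ x ((u n).fn x) ((u n).grad x) * (w n).fn x := fun n => by
    rw [hfluxsum, ← integral_add (hfluxi n) (hΦw n), ← integral_sum_der, ← integral_const_mul]
    refine integral_mono_ae ((integrable_sum_der (u n)).const_mul κ) ((hfluxi n).add (hΦw n)) ?_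
    filter_upwards [hflux0 n, hsign' n, hlower, hw n] with x h1 h2 h3 h4
    have hX0 := sum_abs_rpow_nonneg p ((u n).grad x)
    obtain ⟨X, hX⟩ : ∃ X, X = ∑ j, |(u n).grad x j| ^ p j := ⟨_, rfl⟩
    have h3' := h3 ((u n).grad x) ((u n).fn x)
    rw [← hX] at h1 hX0 h3'
    show κ * ∑ j, |(u n).grad x j| ^ p j ≤
      (∑ j, A j x ((u n).fn x) ((u n).grad x) * (w n).der j x) +
        Φ x ((u n).fn x) ((u n).grad x) * (w n).fn x
    rw [← hX]
    rcases le_or_gt τ |(u n).fn x| with h | h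
    · have e1 : 0 ≤ ν₀ * X / (1 + (u n).fn x ^ 2) :=
        div_nonneg (mul_nonneg hA.pos.le hX0) (by positivity)
      have e2 : γ * X * Real.arctan τ ≤ Φ x ((u n).fn x) ((u n).grad x) * (w n).fn x := by
        rw [← abs_of_nonneg h2, abs_mul, h4]
        exact mul_le_mul (h3' h) (arctan_le_abs_arctan h) (Real.arctan_pos.2 hτ).le (abs_nonneg _)
      have e3 : κ * X ≤ γ * Real.arctan τ * X :=
        mul_le_mul_of_nonneg_right (hκ ▸ min_le_right _ _) hX0
      linarith
    · have e1 : (u n).fn x ^ 2 ≤ τ ^ 2 := by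
        rw [← sq_abs]
        exact pow_le_pow_left₀ (abs_nonneg _) h.le 2
      have e2 : ν₀ * X / (1 + τ ^ 2) ≤ ν₀ * X / (1 + (u n).fn x ^ 2) :=
        div_le_div_of_nonneg_left (mul_nonneg hA.pos.le hX0) (by positivity) (by linarith)
      have e3 : κ * X ≤ ν₀ / (1 + τ ^ 2) * X :=
        mul_le_mul_of_nonneg_right (hκ ▸ min_le_left _ _) hX0
      rw [div_mul_eq_mul_div] at e3
      linarith
  -- The a priori estimate is used with two different arguments, `u n` and its arctangent; the `L^1`
  -- datum contributes only the constant `2 ∫ |f|`.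
  obtain ⟨R, hR0, hR⟩ := exists_bound_of_condP1 hB1 hmono hκ0 (M := 2 * ∫ x in Ω, |f x|)
    (by positivity)
  obtain ⟨Q, hQ⟩ := exists_abs_apply_le hB2 R
  have huR : ∀ n, ‖u n‖ ≤ R := fun n => by
    refine hR (u n) (w n) (hwE n) ?_
    have h1 := (hu n).weak_form (w n) (hwtop n)
    have h2 := (abs_le.1 (hgw n)).2
    have h3 := mul_nonneg (mul_nonneg zero_le_two hF0) (norm_nonneg (w n))
    linarith [hcoer n]
  refine exists_isWeakSolution_of_approx hA hζm hζ0 hc hc0 hB2 (Ψ := fun _ => Φ) (f := g)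
    (M := ζ 1 * (∑ j, R ^ p j + ∫ x in Ω, c x) + 2 * (Q + 2 * ∫ x in Ω, |f x|))
    (fun _ => hsign) (fun _ => hgrowth) ?_ hgi hf hglim huR hu fun n => ?_
  · filter_upwards [hΦ.2] with x hx t ξ
    exact (hx.tendsto (t, ξ)).comp tendsto_snd
  refine (integral_abs_lower_le (w := w n) hζm hζ0 hc hc0 (hu n).integrable_lower (hΦw n)
    (hgrowth.mono fun x hx => hx _ _) (hsign' n) ?_).trans ?_
  -- Where `|u| ≥ 1` the test function has absolute value at least `arctan 1 = π / 4 > 1 / 2`.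
  · filter_upwards [hw n] with x hx h1
    rw [hx]
    refine le_trans ?_ (arctan_le_abs_arctan h1)
    rw [Real.arctan_one]
    linarith [Real.pi_gt_three]
  have h1 := energy_le (huR n)
  have h2 : 0 ≤ ∑ j, ∫ x in Ω, A j x ((u n).fn x) ((u n).grad x) * (w n).der j x := by
    rw [hfluxsum]
    refine integral_nonneg_of_ae ?_
    filter_upwards [hflux0 n] with x hx
    exact (div_nonneg (mul_nonneg hA.pos.le (sum_abs_rpow_nonneg p _)) (by positivity)).trans hx
  have h4 := (abs_le.1 (hgw n)).2
  have h5 := (abs_le.1 (hQ (u n) (w n) (huR n) ((hwn n).trans (huR n)))).2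
  have h7 := mul_le_mul_of_nonneg_left (add_le_add_left h1 (∫ x in Ω, c x)) (hζ0 1)
  linarith [(hu n).weak_form (w n) (hwtop n)]

end W0

end AnisoElliptic

end

open AnisoElliptic in
theorem theorem1p2 {N : ℕ} [NeZero N] (hN : 2 ≤ N)
    (Ω : Set (EuclideanSpace ℝ (Fin N))) (hΩo : IsOpen Ω) (hΩb : Bornology.IsBounded Ω)
    -- the exponents: `1 < p_1 ≤ … ≤ p_N`, with harmonic mean less than `N`
    (p : Fin N → ℝ) [hp : Fact (∀ j, 1 < p j)] (hmono : Monotone p) (hpN : hmean p < N)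
    (A : Fin N → EuclideanSpace ℝ (Fin N) → ℝ → (Fin N → ℝ) → ℝ)
    (Φ : EuclideanSpace ℝ (Fin N) → ℝ → (Fin N → ℝ) → ℝ)
    (hA : ∀ j, IsCaratheodory Ω (A j)) (hΦ : IsCaratheodory Ω Φ)
    -- coercivity, monotonicity and sign condition
    (ν₀ : ℝ) (hν₀ : 0 < ν₀)
    (hcoer : ∀ᵐ x ∂(volume.restrict Ω), ∀ (t : ℝ) (ξ : Fin N → ℝ),
      ν₀ * ∑ j, |ξ j| ^ p j ≤ ∑ j, A j x t ξ * ξ j)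
    (hmonot : ∀ᵐ x ∂(volume.restrict Ω), ∀ (t : ℝ) (ξ ξ' : Fin N → ℝ), ξ ≠ ξ' →
      0 < ∑ j, (A j x t ξ - A j x t ξ') * (ξ j - ξ' j))
    (hsign : ∀ᵐ x ∂(volume.restrict Ω), ∀ (t : ℝ) (ξ : Fin N → ℝ), 0 ≤ Φ x t ξ * t)
    -- growth conditions
    (ν : ℝ) (hν : 0 < ν)
    (η : Fin N → EuclideanSpace ℝ (Fin N) → ℝ)
    (hη : ∀ j, MemLp (η j) (ENNReal.ofReal (p j).conjExponent) (volume.restrict Ω))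
    (hη0 : ∀ j, ∀ᵐ x ∂(volume.restrict Ω), 0 ≤ η j x)
    (hAgrowth : ∀ᵐ x ∂(volume.restrict Ω), ∀ (t : ℝ) (ξ : Fin N → ℝ) (j : Fin N),
      |A j x t ξ| ≤ ν * (η j x + |t| ^ (sobExp p / (p j).conjExponent)
        + (∑ l, |ξ l| ^ p l) ^ (1 / (p j).conjExponent)))
    (ζ : ℝ → ℝ) (hζc : Continuous ζ) (hζm : Monotone ζ) (hζ0 : ∀ t, 0 ≤ ζ t)
    (c : EuclideanSpace ℝ (Fin N) → ℝ) (hc : IntegrableOn c Ω)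
    (hc0 : ∀ᵐ x ∂(volume.restrict Ω), 0 ≤ c x)
    (hΦgrowth : ∀ᵐ x ∂(volume.restrict Ω), ∀ (t : ℝ) (ξ : Fin N → ℝ),
      |Φ x t ξ| ≤ ζ |t| * (∑ j, |ξ j| ^ p j + c x))
    -- lower bound on `Φ` for large `|t|`
    (τ γ : ℝ) (hτ : 0 < τ) (hγ : 0 < γ)
    (hΦlower : ∀ᵐ x ∂(volume.restrict Ω), ∀ (ξ : Fin N → ℝ) (t : ℝ), τ ≤ |t| →
      γ * ∑ j, |ξ j| ^ p j ≤ |Φ x t ξ|)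
    -- the operator `B : W_0^{1,p}(Ω) → W^{-1,p'}(Ω)`
    (B : W0 Ω p → StrongDual ℝ (W0 Ω p)) (hB1 : CondP1 B) (hB2 : CondP2 B)
    (f : EuclideanSpace ℝ (Fin N) → ℝ) (hf : IntegrableOn f Ω) :
    ∃ u : W0 Ω p, IsWeakSolution A Φ B f u := by
  have : Fact (2 ≤ N) := ⟨hN⟩
  have : Fact (hmean p < N) := ⟨hpN⟩
  -- The existence argument uses the boundedness of `Ω` only through the finiteness of its measure.
  have : IsFiniteMeasure (leb Ω) := ⟨by
    rw [leb, Measure.restrict_apply_univ]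
    exact hΩb.measure_lt_top⟩
  exact W0.exists_isWeakSolution ⟨hA, hν₀, hν, hcoer, hmonot, hη, hAgrowth⟩ hmono hΦ hζm hζ0 hc hc0
    hsign hΦgrowth hτ hγ hΦlower hB1 hB2 hf
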